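/- **Setting.** Let $0<\tau$, $N\ge 1$, and let $\sigma_1,\dots,\sigma_N\in[\tau,\tau^{-1}]$ with $\frac1N\sum_i\sigma_i=1$ (the eigenvalues of $\Sigma=TT^\dagger$, where $T$ is an $N\times M$ matrix with $N\le M$); let $s_1>\dots>s_n$ be the distinct values of the $\sigma_i$ and $l_i$ their multiplicities. Let $z\in\mathbb C$ with $\tau\le\big||z|^2-1\big|\le\tau^{-1}$. For $w=E+i\eta\in\mathbb C_+$ let $m_{1c}=m_{1c}(w)$ be the analytic function $\mathbb C_+\to\mathbb C_+$ with $w\,m_{1c}(w)\in\mathbb C_+$ that solves $$m_1=\frac1N\sum_{i=1}^n l_is_i\Big[-w(1+s_im_2)+\frac{|z|^2}{1+m_1}\Big]^{-1},\qquad \frac1{m_2}=-w(1+m_1)+\frac{|z|^2}{1+m_1},$$ and let $m_{2c}$ be the corresponding $m_2$. Put $\rho_{1,2c}(x)=\frac1\pi\lim_{\eta\downarrow0}\operatorname{Im}m_{1,2c}(x+i\eta)$. The support of $\rho_{1c}$ is a finite union of disjoint intervals $[e_{2k},e_{2k-1}]$, $1\le k\le L$; their endpoints $e_1>e_2>\dots>e_{2L}\ge0$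 (the boundary points of the support) are the edges, and $\kappa(E)=\min_{e_k>0}|E-e_k|$. Let $\sqrt w$ be the branch with positive imaginary part (the positive root for $w>0$), $m_c(w)=\sqrt w(1+m_{1c}(w))$, extended to real $w$ by the limit $\eta\downarrow0$, and $$p_i(\sqrt w,m)=\sqrt w\,m^3-(s_i+|z|^2)m^2-\sqrt w|z|^2m+|z|^4,\qquad f(\sqrt w,m)=-\sqrt w+m+\frac1N\sum_{i=1}^n l_is_i\frac{m(m^2-|z|^2)}{p_i(\sqrt w,m)}.$$ *Regularity.* An edge $e_k\ne0$ is regular with constant $\epsilon>0$ if $|m_c(e_k)-r|\ge\epsilon$ for every $i$ and every root $r$ of $p_i(\sqrt{e_k},\cdot)$, and $|\partial_m^2f(\sqrt{e_k},m_c(e_k))|\ge\epsilon$. A component $[e_{2k},e_{2k-1}]$ is regular with lower bounds $g:(0,\infty)\to(0,\infty)$ if, for every $\delta>0$, $\rho_{1c}\ge g(\delta)$ on $[e_{2k}+\delta,e_{2k-1}-\delta]$. *Domains.* For $\zeta,\tau'>0$ let $$\mathbf D=\{w\in\mathbb C_+:0\le E\le\zeta^{-1},\ N^{-1+\zeta}|m_{2c}(w)|^{-1}\le\eta\le\zeta^{-1}\},\qquad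 \mathbf D_L=\{w\in\mathbb C_+:0\le E\le\zeta^{-1},\ \eta\ge\zeta^{-1}\},$$ $\mathbf D^e_k=\{w\in\mathbf D:|E-e_k|\le\tau'\}$, $\mathbf D^b_k=\{w\in\mathbf D:E\in[e_{2k}+\tau',e_{2k-1}-\tau']\}$ and $\mathbf D^o=\{w\in\mathbf D:\operatorname{dist}(E,\operatorname{supp}\rho_{1c})\ge\tau'\}$. *Constants.* $A\sim B$ means $C^{-1}B\le A\le CB$, and $A=O(1)$ means $|A|\le C$. The constants $C,c>0$ below do not depend on $N$, the $\sigma_i$, $z$, $k$ or $w$. $C$ may depend on $\tau,\tau',\zeta$ and, in Cases 1 and 3, on the regularity data $g$ or $\epsilon$; $c$ may depend on the same quantities except $\zeta$. **Lemma.** 1. (Bulk.) Let $\tau'>0$. If the component $[e_{2k},e_{2k-1}]$ is regular with lower bounds $g$, then for $w\in\mathbf D^b_k$: $|1+m_{1c}|\sim\operatorname{Im}m_{1c}\sim1$ and $|m_{2c}|\sim\operatorname{Im}m_{2c}\sim1$. 2. (Outside the support.) Let $\tau'>0$. For $w\in\mathbf D^o$: $\operatorname{Im}m_{1c}\sim\operatorname{Im}m_{2c}\sim\eta$,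 $|1+m_{1c}|\sim1$ and $|m_{2c}|\sim1$. 3. (Regular edge.) Let $e_k\ne0$ be a regular edge with constant $\epsilon$, and let $0<\tau'\le\tau_0$, where $\tau_0>0$ depends only on $\tau$ and $\epsilon$. For $w\in\mathbf D^e_k$: $|1+m_{1c}|\sim1$, $|m_{2c}|\sim1$, and for $j=1,2$, $\operatorname{Im}m_{jc}\sim\sqrt{\kappa+\eta}$ if $E\in\operatorname{supp}\rho_{jc}$ and $\operatorname{Im}m_{jc}\sim\eta/\sqrt{\kappa+\eta}$ if $E\notin\operatorname{supp}\rho_{jc}$. 4. (Edge at $0$.) Let $|z|^2\le1-\tau$, so that $e_{2L}=0$, and let $0<\tau'\le\tau_0$, where $\tau_0>0$ depends only on $\tau$. For $w\in\mathbf D^e_{2L}$: if $\eta\ge\tau'$, then $|1+m_{1c}|\sim\operatorname{Im}m_{1c}\sim1$ and $|m_{2c}|\sim\operatorname{Im}m_{2c}\sim1$; if $|w|\le2\tau'$, then $$m_{1c}=\frac{i\sqrt t}{\sqrt w}+O(1),\qquad m_{2c}=\frac{i\sqrt t}{\sqrt w\,(t+|z|^2)}+O(1),\qquad \operatorname{Im}m_{1c}\sim\operatorname{Im}m_{2c}\sim|w|^{-1/2},$$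 for some $t>0$ with $t\sim1$ that does not depend on $w$. 5. (Large $\eta$.) For $w\in\mathbf D_L$: $|m_{1c}|\sim\operatorname{Im}m_{1c}\sim1/\eta$ and $|m_{2c}|\sim\operatorname{Im}m_{2c}\sim1/\eta$. Moreover, in Cases 1–4, $\big|w(1+s_im_{2c})(1+m_{1c})-|z|^2\big|\ge c$ for all $i$; and in Case 5, if $\zeta\le\zeta_0$, where $\zeta_0>0$ depends only on $\tau$, then $\big|w(1+s_im_{2c})(1+m_{1c})-|z|^2\big|\ge\eta$ for all $i$. -/

import Mathlib

open Set Filter Topology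

namespace CircularLaw

noncomputable section

/-- Standing assumptions on the parameters: the eigenvalues `σ 0, …, σ (N-1)` of `Σ = T T†` lie in
`[τ, τ⁻¹]` and have mean one, and `z` stays away from the unit circle. -/
structure Admissible (τ : ℝ) {N : ℕ} (σ : Fin N → ℝ) (z : ℂ) : Prop where
  lower : ∀ i, τ ≤ σ i
  upper : ∀ i, σ i ≤ τ⁻¹
  mean_one : (∑ i, σ i) / (N : ℝ) = 1
  z_lower : τ ≤ |‖z‖ ^ 2 - 1|
  z_upper : |‖z‖ ^ 2 - 1| ≤ τ⁻¹

/-- The value of `m₂` determined by `m₁` through `1 / m₂ = -w (1 + m₁) + |z|² / (1 + m₁)`. -/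
def m2of (z w m₁ : ℂ) : ℂ := (-w * (1 + m₁) + (‖z‖ : ℂ) ^ 2 / (1 + m₁))⁻¹

/-- `m` is an analytic solution `ℂ₊ → ℂ₊` of the self-consistent equation for `m₁`, with
`w m(w) ∈ ℂ₊`. The sum over all eigenvalues `σ i` is the sum over the distinct ones counted with
their multiplicities. -/
structure IsSelfConsistent {N : ℕ} (σ : Fin N → ℝ) (z : ℂ) (m : ℂ → ℂ) : Prop where
  analytic : DifferentiableOn ℂ m {w : ℂ | 0 < w.im}
  im_pos : ∀ w : ℂ, 0 < w.im → 0 < (m w).im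
  mul_im_pos : ∀ w : ℂ, 0 < w.im → 0 < (w * m w).im
  equation : ∀ w : ℂ, 0 < w.im →
    m w = (1 / (N : ℂ)) * ∑ i, (σ i : ℂ) *
      (-w * (1 + (σ i : ℂ) * m2of z w (m w)) + (‖z‖ : ℂ) ^ 2 / (1 + m w))⁻¹

/-- `m_{1c}`, the analytic solution of the self-consistent equation (only its values on `ℂ₊` are
used, where it is unique). -/
def m1c {N : ℕ} (σ : Fin N → ℝ) (z : ℂ) : ℂ → ℂ :=
  Classical.epsilon (IsSelfConsistent σ z)

/-- `m_{2c}`. -/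
def m2c {N : ℕ} (σ : Fin N → ℝ) (z : ℂ) (w : ℂ) : ℂ := m2of z w (m1c σ z w)

/-- The density `ρ(x) = π⁻¹ lim_{η ↓ 0} Im m(x + iη)`. -/
def density (m : ℂ → ℂ) (x : ℝ) : ℝ :=
  Real.pi⁻¹ * limUnder (𝓝[>] (0 : ℝ)) (fun η : ℝ => (m ((x : ℂ) + (η : ℂ) * Complex.I)).im)

def rho1c {N : ℕ} (σ : Fin N → ℝ) (z : ℂ) : ℝ → ℝ := density (m1c σ z)

def rho2c {N : ℕ} (σ : Fin N → ℝ) (z : ℂ) : ℝ → ℝ := density (m2c σ z)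

/-- The (closed) support of `ρ_{1c}`. -/
def supp1 {N : ℕ} (σ : Fin N → ℝ) (z : ℂ) : Set ℝ := tsupport (rho1c σ z)

/-- The (closed) support of `ρ_{2c}`. -/
def supp2 {N : ℕ} (σ : Fin N → ℝ) (z : ℂ) : Set ℝ := tsupport (rho2c σ z)

/-- The edges `e_k`: the support is a finite union of disjoint intervals `[e_{2k}, e_{2k-1}]`, and
the edges are their endpoints, that is, the boundary points of the support. -/
def edges {N : ℕ} (σ : Fin N → ℝ) (z : ℂ) : Set ℝ := frontier (supp1 σ z)

/-- `[a, b]` is one of the components `[e_{2k}, e_{2k-1}]` of the support. -/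
def IsBulkComponent {N : ℕ} (σ : Fin N → ℝ) (z : ℂ) (a b : ℝ) : Prop :=
  a ∈ supp1 σ z ∧ a < b ∧ connectedComponentIn (supp1 σ z) a = Icc a b

/-- The square root on the closed upper half plane with nonnegative imaginary part (the principal
branch). -/
def csqrt (w : ℂ) : ℂ := w ^ (1 / 2 : ℂ)

/-- The cubic `√w m³ - (s + |z|²) m² - √w |z|² m + |z|⁴` as a function of `r = √w` and `m`; for
`r > 0` and `z ≠ 0` its roots are `a_i > 0`, `b_i > 0`, `-c_i < 0` when `s = s_i`. -/
def cubic (s : ℝ) (z r m : ℂ) : ℂ :=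
  r * m ^ 3 - ((s : ℂ) + (‖z‖ : ℂ) ^ 2) * m ^ 2 - r * (‖z‖ : ℂ) ^ 2 * m + (‖z‖ : ℂ) ^ 4

/-- The function `f(r, m)`, `r = √w`, for which the self-consistent equation reads
`f(√w, √w (1 + m₁)) = 0`. -/
def fFun {N : ℕ} (σ : Fin N → ℝ) (z r m : ℂ) : ℂ :=
  -r + m + (1 / (N : ℂ)) * ∑ i, (σ i : ℂ) * (m * (m ^ 2 - (‖z‖ : ℂ) ^ 2) / cubic (σ i) z r m)

/-- `m_c(x) = lim_{η ↓ 0} √w (1 + m_{1c}(w))`, `w = x + iη`, the boundary value at a real `x`. -/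
def mcReal {N : ℕ} (σ : Fin N → ℝ) (z : ℂ) (x : ℝ) : ℂ :=
  limUnder (𝓝[>] (0 : ℝ)) (fun η : ℝ =>
    csqrt ((x : ℂ) + (η : ℂ) * Complex.I) * (1 + m1c σ z ((x : ℂ) + (η : ℂ) * Complex.I)))

/-- A nonzero edge `e` is regular with constant `ε`: `m_c(e)` has distance at least `ε` from all the
roots `a_i(e)`, `b_i(e)`, `-c_i(e)`, and `|∂_m² f(√e, m_c(e))| ≥ ε`. -/
structure IsRegularEdge (ε : ℝ) {N : ℕ} (σ : Fin N → ℝ) (z : ℂ) (e : ℝ) : Prop where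
  edge : e ∈ edges σ z
  ne_zero : e ≠ 0
  roots : ∀ i, ∀ r : ℂ, cubic (σ i) z (Real.sqrt e : ℂ) r = 0 → ε ≤ ‖mcReal σ z e - r‖
  second_deriv : ε ≤ ‖iteratedDeriv 2 (fFun σ z (Real.sqrt e : ℂ)) (mcReal σ z e)‖

/-- The component `[a, b]` is regular, with lower bounds `g`: for every `δ > 0` the density of
`ρ_{1c}` on `[a + δ, b - δ]` is at least `g δ`. -/
def IsRegularBulk (g : ℝ → ℝ) {N : ℕ} (σ : Fin N → ℝ) (z : ℂ) (a b : ℝ) : Prop :=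
  ∀ δ > 0, ∀ x ∈ Icc (a + δ) (b - δ), g δ ≤ rho1c σ z x

/-- The fundamental domain `𝐃(ζ, N)`. -/
def domD (ζ : ℝ) {N : ℕ} (σ : Fin N → ℝ) (z : ℂ) : Set ℂ :=
  {w | 0 < w.im ∧ 0 ≤ w.re ∧ w.re ≤ ζ⁻¹ ∧
    (N : ℝ) ^ (-1 + ζ) * ‖m2c σ z w‖⁻¹ ≤ w.im ∧ w.im ≤ ζ⁻¹}

/-- The domain `𝐃^e` around the edge `e`. -/
def domEdge (ζ τ' : ℝ) {N : ℕ} (σ : Fin N → ℝ) (z : ℂ) (e : ℝ) : Set ℂ :=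
  {w | w ∈ domD ζ σ z ∧ |w.re - e| ≤ τ'}

/-- The domain `𝐃^b` in the component `[a, b]`. -/
def domBulk (ζ τ' : ℝ) {N : ℕ} (σ : Fin N → ℝ) (z : ℂ) (a b : ℝ) : Set ℂ :=
  {w | w ∈ domD ζ σ z ∧ w.re ∈ Icc (a + τ') (b - τ')}

/-- The domain `𝐃^o` outside the support. -/
def domOut (ζ τ' : ℝ) {N : ℕ} (σ : Fin N → ℝ) (z : ℂ) : Set ℂ :=
  {w | w ∈ domD ζ σ z ∧ τ' ≤ Metric.infDist w.re (supp1 σ z)}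

/-- The domain `𝐃_L(ζ)` of large `η`. -/
def domLarge (ζ : ℝ) : Set ℂ :=
  {w | 0 ≤ w.re ∧ w.re ≤ ζ⁻¹ ∧ ζ⁻¹ ≤ w.im}

/-- The distance `κ(E)` of `E` to the set of positive edges. -/
def kappa {N : ℕ} (σ : Fin N → ℝ) (z : ℂ) (E : ℝ) : ℝ :=
  Metric.infDist E {e : ℝ | e ∈ edges σ z ∧ 0 < e}

/-- `w (1 + s m_{2c}) (1 + m_{1c}) - |z|²`. -/
def denom {N : ℕ} (σ : Fin N → ℝ) (z : ℂ) (s : ℝ) (w : ℂ) : ℂ :=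
  w * (1 + (s : ℂ) * m2c σ z w) * (1 + m1c σ z w) - (‖z‖ : ℂ) ^ 2

/-- `a ∼ b` with constant `C`. -/
def Comparable (C a b : ℝ) : Prop := C⁻¹ * b ≤ a ∧ a ≤ C * b

end

end CircularLaw

open CircularLaw

/-! ### Notation and strategy -/

namespace CircularLaw

/-! ### Averages over the eigenvalues -/

/-! With r = √w, A = √w (1 + m₁), G = √w m₂ and Z = |z|², the system becomes A - r = avg (σ A / q)
and G (Z - A²) = A, where q i = Z - A (r + σ i G), and the denominators of the last claim are -q i.
All constants must be uniform in N, so compactness in the parameters is not available. The uniform a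
priori control comes from one inequality, `IsSol.avg_stab`: avg (σ (Z + |A (r + σ G)|) / |q|²) ≤ 1.
It follows by taking imaginary parts of the equations for A and G and applying the
arithmetic-geometric mean inequality. It yields avg (σ / |q|) ≤ 1, |1 + m₁| ≥ 1/2, |Z - A²| ≥ τ, a
bound on |A| by a multiple of 1 + |r|, and, when r / A and r A are small, that -A G is almost a
nonnegative real number.

Since `m1c` is chosen by `Classical.epsilon`, an analytic solution has to be produced first. The
fixed point map for √w m₁ contracts the pseudo-hyperbolic distance, and its iterates converge
locally uniformly (`exists_fixed_point`). Everything afterwards uses only the defining properties of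
a solution, so its uniqueness is not needed.

Near w = 0 with |z| < 1, the quantity X = Z - A² is compared with a real solution X₀ of the limiting
equation: X₀ exists by the intermediate value theorem, and X - X₀ = O(r) because the stability
factor has real part bounded below (`near_zero`). With |z| > 1, the part of Im m₁ fed back by the
equation has coefficient below 1 near w = 0, so Im m₁ = O(Im w).

Boundary values at x > 0 exist since f(r, m) = 0 is a polynomial equation once denominators are
cleared: cluster values form a finite set and half balls are connected (`exists_tendsto_rootA`).

Outside the support and in the bulk, maximum principles on half discs carry qualitative boundary
information into the upper half plane at a quantitative rate. Outside, `im_le_of_vanish` is applied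
to each summand separately, which also bounds the denominators; in the bulk, `le_im_of_boundary` is
applied to m₁ itself.

At a regular edge f is analytic near the real point (√e, m_c(e)) and ∂_r f ≤ -1 there. A nonzero ∂_m
f would make the density vanish near e, so ∂_m f = 0, while |∂_m² f| ≥ ε. Hence (A - m_c(e))² ≈ β (w
- e) with β real, and a second relation, from comparing f at A and at its conjugate, controls Im A
where the square root is nearly real (`sqrt_dichotomy`). A continuity argument makes the
neighbourhood uniform (`edge_expansion`); the sign of β (E - e) tells on which side the support
lies. -/

/-- The average of a finite family. -/
noncomputable def avg {N : ℕ} {E : Type*} [AddCommGroup E] [Module ℝ E] (F : Fin N → E) : E :=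
  (N : ℝ)⁻¹ • ∑ i, F i

section avg

variable {N : ℕ}

lemma avg_add {E : Type*} [AddCommGroup E] [Module ℝ E] (F G : Fin N → E) :
    avg (fun i => F i + G i) = avg F + avg G := by
  simp [avg, Finset.sum_add_distrib]

lemma avg_sub {E : Type*} [AddCommGroup E] [Module ℝ E] (F G : Fin N → E) :
    avg (fun i => F i - G i) = avg F - avg G := by
  simp [avg, Finset.sum_sub_distrib, smul_sub]

lemma avg_mul_left {E : Type*} [Ring E] [Algebra ℝ E] (c : E) (F : Fin N → E) :
    avg (fun i => c * F i) = c * avg F := by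
  simp [avg, ← Finset.mul_sum]

lemma avg_mul_right {E : Type*} [Ring E] [Algebra ℝ E] (c : E) (F : Fin N → E) :
    avg (fun i => F i * c) = avg F * c := by
  simp [avg, ← Finset.sum_mul]

lemma avg_const {E : Type*} [AddCommGroup E] [Module ℝ E] (hN : 0 < N) (c : E) :
    avg (fun _ : Fin N => c) = c := by
  have : (N : ℝ) ≠ 0 := by positivity
  rw [avg, Finset.sum_const, Finset.card_univ, Fintype.card_fin, ← Nat.cast_smul_eq_nsmul ℝ,
    smul_smul, inv_mul_cancel₀ this, one_smul]

lemma avg_mono {F G : Fin N → ℝ} (h : ∀ i, F i ≤ G i) : avg F ≤ avg G := by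
  unfold avg
  exact smul_le_smul_of_nonneg_left (Finset.sum_le_sum fun i _ => h i) (by positivity)

lemma avg_nonneg {F : Fin N → ℝ} (h : ∀ i, 0 ≤ F i) : 0 ≤ avg F := by
  unfold avg
  exact smul_nonneg (by positivity) (Finset.sum_nonneg fun i _ => h i)

lemma avg_le_of_le (hN : 0 < N) {F : Fin N → ℝ} {c : ℝ} (h : ∀ i, F i ≤ c) : avg F ≤ c :=
  (avg_mono h).trans_eq (avg_const hN c)

lemma le_avg_of_le (hN : 0 < N) {F : Fin N → ℝ} {c : ℝ} (h : ∀ i, c ≤ F i) : c ≤ avg F :=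
  (avg_const hN c).symm.trans_le (avg_mono h)

lemma norm_avg_le (F : Fin N → ℂ) : ‖avg F‖ ≤ avg (fun i => ‖F i‖) := by
  unfold avg
  rw [norm_smul, Real.norm_of_nonneg (by positivity), smul_eq_mul]
  gcongr
  exact norm_sum_le _ _

lemma re_avg (F : Fin N → ℂ) : (avg F).re = avg (fun i => (F i).re) := by
  simp [avg]

lemma im_avg (F : Fin N → ℂ) : (avg F).im = avg (fun i => (F i).im) := by
  simp [avg]

lemma ofReal_avg (F : Fin N → ℝ) : ((avg F : ℝ) : ℂ) = avg (fun i => (F i : ℂ)) := by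
  simp [avg]

lemma conj_avg (F : Fin N → ℂ) :
    (starRingEnd ℂ) (avg F) = avg (fun i => (starRingEnd ℂ) (F i)) := by
  simp [avg, Complex.real_smul]

/-- One term of an average of nonnegative numbers. -/
lemma le_card_mul_avg {F : Fin N → ℝ} (h : ∀ i, 0 ≤ F i) (j : Fin N) : F j ≤ N * avg F := by
  have hN : (N : ℝ) ≠ 0 := by
    have := j.pos
    positivity
  rw [avg, smul_eq_mul, mul_inv_cancel_left₀ hN]
  exact Finset.single_le_sum (fun i _ => h i) (Finset.mem_univ j)

end avg

/-! ### Pointwise solutions of the self-consistent equation -/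

/-- The assumptions on the parameters, in terms of `Z = |z|²`. -/
structure Params (τ : ℝ) {N : ℕ} (σ : Fin N → ℝ) (Z : ℝ) : Prop where
  pos : 0 < τ
  lower : ∀ i, τ ≤ σ i
  upper : ∀ i, σ i ≤ τ⁻¹
  mean : avg σ = 1
  Z_nonneg : 0 ≤ Z
  Z_upper : |Z - 1| ≤ τ⁻¹

namespace Params

variable {τ : ℝ} {N : ℕ} {σ : Fin N → ℝ} {Z : ℝ}

lemma card_pos (h : Params τ σ Z) : 0 < N := by
  rcases Nat.eq_zero_or_pos N with rfl | h'
  · have := h.mean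
    simp [avg] at this
  · exact h'

lemma sigma_pos (h : Params τ σ Z) (i : Fin N) : 0 < σ i := h.pos.trans_le (h.lower i)

lemma tau_le_one (h : Params τ σ Z) : τ ≤ 1 := by
  have := le_avg_of_le h.card_pos h.lower
  rwa [h.mean] at this

lemma one_le_inv (h : Params τ σ Z) : 1 ≤ τ⁻¹ := (one_le_inv₀ h.pos).2 h.tau_le_one

lemma Z_le (h : Params τ σ Z) : Z ≤ 2 / τ := by
  have h1 := (abs_le.1 h.Z_upper).2
  have h2 := h.one_le_inv
  rw [div_eq_mul_inv]
  linarith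

end Params

/-- The quantity `Z - A (r + s G)`. -/
def quo (s Z : ℝ) (r A G : ℂ) : ℂ := (Z : ℂ) - A * (r + (s : ℂ) * G)

/-- The self-consistent equation at one point, in terms of `r = √w`, `A = √w (1 + m₁)` and
`G = √w m₂`. -/
structure IsSol {N : ℕ} (σ : Fin N → ℝ) (Z : ℝ) (r A G : ℂ) : Prop where
  re_pos : 0 < r.re
  im_pos : 0 < r.im
  A_im : r.im < A.im
  G_im : 0 < G.im
  quo_ne : ∀ i, quo (σ i) Z r A G ≠ 0
  eq_A : A - r = avg (fun i => (σ i : ℂ) * A / quo (σ i) Z r A G)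
  eq_G : G * ((Z : ℂ) - A ^ 2) = A

namespace IsSol

variable {τ : ℝ} {N : ℕ} {σ : Fin N → ℝ} {Z : ℝ} {r A G : ℂ}

lemma A_ne (h : IsSol σ Z r A G) : A ≠ 0 := by
  intro h0
  have := h.A_im
  have := h.im_pos
  rw [h0] at *
  simp at *
  linarith

lemma r_ne (h : IsSol σ Z r A G) : r ≠ 0 := by
  intro h0
  have := h.im_pos
  rw [h0] at this
  simp at this

lemma X_ne (h : IsSol σ Z r A G) : (Z : ℂ) - A ^ 2 ≠ 0 := by
  intro h0
  have := h.eq_G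
  rw [h0, mul_zero] at this
  exact h.A_ne this.symm

lemma G_eq (h : IsSol σ Z r A G) : G = A / ((Z : ℂ) - A ^ 2) :=
  eq_div_of_mul_eq h.X_ne h.eq_G

lemma avg_sigma_div (h : IsSol σ Z r A G) :
    avg (fun i => (σ i : ℂ) / quo (σ i) Z r A G) = 1 - r / A := by
  have h1 := h.eq_A
  have h2 : avg (fun i => (σ i : ℂ) * A / quo (σ i) Z r A G)
      = avg (fun i => (σ i : ℂ) / quo (σ i) Z r A G) * A := by
    rw [← avg_mul_right]
    congr 1
    ext i
    ring
  rw [h2] at h1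
  have := h.A_ne
  field_simp
  linear_combination -h1

/-- Averaging the trivial identity q / q = 1, with q affine in σ, produces from the equation for A a
second identity without σ in the numerator. -/
lemma avg_one_div (p : Params τ σ Z) (h : IsSol σ Z r A G) :
    avg (fun i => 1 / quo (σ i) Z r A G) = 1 / ((Z : ℂ) - A ^ 2) := by
  have h1 := h.avg_sigma_div
  have h2 : avg (fun i => quo (σ i) Z r A G / quo (σ i) Z r A G) = 1 := by
    rw [← avg_const p.card_pos (1 : ℂ)]
    congr 1
    ext i
    exact div_self (h.quo_ne i)
  have h3 : avg (fun i => quo (σ i) Z r A G / quo (σ i) Z r A G)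
      = ((Z : ℂ) - A * r) * avg (fun i => 1 / quo (σ i) Z r A G)
        - A * G * avg (fun i => (σ i : ℂ) / quo (σ i) Z r A G) := by
    rw [← avg_mul_left, ← avg_mul_left, ← avg_sub]
    congr 1
    ext i
    rw [quo]
    ring
  rw [h2, h1] at h3
  have hA := h.A_ne
  have hX := h.X_ne
  have hG := h.eq_G
  have h4 : ((Z : ℂ) - A * r) * avg (fun i => 1 / quo (σ i) Z r A G) = 1 + G * (A - r) := by
    field_simp at h3
    linear_combination -h3
  have h5 : ((Z : ℂ) - A * r) ≠ 0 ∨ (Z : ℂ) - A * r = 0 := (em _).symm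
  have hW : (1 + G * (A - r)) * ((Z : ℂ) - A ^ 2) = (Z : ℂ) - A * r := by
    linear_combination (A - r) * hG
  -- The identity is divided by Z - A r. Were this zero, r = Z / A would have nonpositive imaginary
  -- part because Im A > 0.
  rcases h5 with h5 | h5
  · rw [eq_div_iff hX]
    apply mul_left_cancel₀ h5
    linear_combination ((Z : ℂ) - A ^ 2) * h4 + hW
  · exfalso
    have h6 : r = (Z : ℂ) / A := by
      field_simp
      linear_combination -h5
    have : r.im ≤ 0 := by
      rw [h6, Complex.div_im]
      simp only [Complex.ofReal_im, Complex.ofReal_re, zero_mul, zero_div, zero_sub]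
      have := h.A_im
      have := h.im_pos
      have := p.Z_nonneg
      rw [neg_nonpos]
      apply div_nonneg (mul_nonneg this (by linarith)) (Complex.normSq_nonneg _)
    linarith [h.im_pos]

/-- The companion of `eq_A`: with B = r + σ G, the quantity G is an average of B / q just as A - r
is an average of σ A / q. The two imaginary parts therefore form a system with positive
coefficients. -/
lemma avg_B_div (p : Params τ σ Z) (h : IsSol σ Z r A G) :
    avg (fun i => (r + (σ i : ℂ) * G) / quo (σ i) Z r A G) = G := by
  have h1 : avg (fun i => (r + (σ i : ℂ) * G) / quo (σ i) Z r A G)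
      = r * avg (fun i => 1 / quo (σ i) Z r A G)
        + G * avg (fun i => (σ i : ℂ) / quo (σ i) Z r A G) := by
    rw [← avg_mul_left, ← avg_mul_left, ← avg_add]
    congr 1
    ext i
    ring
  rw [h1, h.avg_one_div p, h.avg_sigma_div, h.G_eq]
  have := h.A_ne
  have := h.X_ne
  field_simp
  ring

/-- With q = Z - A B one has A conj(q) = Z A - |A|² conj(B), so the imaginary part is a positive
combination of Im A and Im B. -/
lemma im_div_quo_A (s : ℝ) :
    (A / quo s Z r A G).im
      = (‖A‖ ^ 2 * (r.im + s * G.im) + Z * A.im) / ‖quo s Z r A G‖ ^ 2 := by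
  rw [Complex.div_im, Complex.sq_norm, Complex.sq_norm, ← sub_div]
  congr 1
  simp [quo, Complex.normSq_apply]
  ring

lemma im_div_quo_B (s : ℝ) :
    ((r + (s : ℂ) * G) / quo s Z r A G).im
      = (‖r + (s : ℂ) * G‖ ^ 2 * A.im + Z * (r.im + s * G.im)) / ‖quo s Z r A G‖ ^ 2 := by
  rw [Complex.div_im, Complex.sq_norm, Complex.sq_norm, ← sub_div]
  congr 1
  simp [quo, Complex.normSq_apply]
  ring

lemma im_A_eq (h : IsSol σ Z r A G) :
    A.im - r.im = avg (fun i => σ i * ((‖A‖ ^ 2 * (r.im + σ i * G.im) + Z * A.im)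
      / ‖quo (σ i) Z r A G‖ ^ 2)) := by
  have := congrArg Complex.im h.eq_A
  rw [im_avg] at this
  rw [← Complex.sub_im, this]
  congr 1
  ext i
  rw [← im_div_quo_A, mul_div_assoc, Complex.im_ofReal_mul]

lemma im_G_eq (p : Params τ σ Z) (h : IsSol σ Z r A G) :
    G.im = avg (fun i => (‖r + (σ i : ℂ) * G‖ ^ 2 * A.im + Z * (r.im + σ i * G.im))
      / ‖quo (σ i) Z r A G‖ ^ 2) := by
  have := congrArg Complex.im (h.avg_B_div p)
  rw [im_avg] at this
  refine this.symm.trans ?_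
  congr 1
  ext i
  rw [← im_div_quo_B]

/-- The basic inequality of the stability analysis. -/
lemma avg_stab (p : Params τ σ Z) (h : IsSol σ Z r A G) :
    avg (fun i => σ i * (Z + ‖A * (r + (σ i : ℂ) * G)‖) / ‖quo (σ i) Z r A G‖ ^ 2) ≤ 1 := by
  set y₁ := A.im - r.im with hy₁
  set y₂ := G.im with hy₂
  have h1 : 0 < y₁ := sub_pos.2 h.A_im
  have h2 : 0 < y₂ := h.G_im
  have hA := h.im_A_eq
  have hG := h.im_G_eq p
  rw [← hy₁] at hA
  rw [← hy₂] at hG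
  -- The identities for Im A - Im r and Im G are weighted by 1/(2 y₁) and 1/(2 y₂), so that they sum
  -- to 1. The terms in |A|² and |B|² dominate σ |A| |B| because the difference is the square of σ
  -- |A| y₂ - |B| y₁; the terms with Im r are nonnegative.
  have key : avg (fun i => σ i * (Z + ‖A * (r + (σ i : ℂ) * G)‖) / ‖quo (σ i) Z r A G‖ ^ 2)
      ≤ avg (fun i => (2 * y₁)⁻¹ * (σ i * ((‖A‖ ^ 2 * (r.im + σ i * y₂) + Z * A.im)
      / ‖quo (σ i) Z r A G‖ ^ 2)) + (2 * y₂)⁻¹ * ((‖r + (σ i : ℂ) * G‖ ^ 2 * A.im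
        + Z * (r.im + σ i * y₂)) / ‖quo (σ i) Z r A G‖ ^ 2)) := by
    apply avg_mono
    intro i
    have hs := p.sigma_pos i
    have hq : 0 < ‖quo (σ i) Z r A G‖ ^ 2 := by
      have := h.quo_ne i
      positivity
    rw [norm_mul]
    set a := ‖A‖
    set b := ‖r + (σ i : ℂ) * G‖
    set q := ‖quo (σ i) Z r A G‖ ^ 2
    rw [← mul_div_assoc, mul_div_assoc', mul_div_assoc', ← add_div]
    gcongr
    have hv := h.im_pos
    have hZ := p.Z_nonneg
    have e1 : A.im = y₁ + r.im := by rw [hy₁]; ring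
    rw [e1]
    have e2 : (2 * y₁)⁻¹ * (σ i * (a ^ 2 * (r.im + σ i * y₂) + Z * (y₁ + r.im)))
        + (2 * y₂)⁻¹ * (b ^ 2 * (y₁ + r.im) + Z * (r.im + σ i * y₂))
        - σ i * (Z + a * b) = (2 * y₁ * y₂)⁻¹ * ((σ i * a * y₂ - b * y₁) ^ 2
          + r.im * (y₂ * σ i * a ^ 2 + y₂ * σ i * Z + y₁ * b ^ 2 + y₁ * Z)) := by
      field_simp
      ring
    have e3 : 0 ≤ (2 * y₁ * y₂)⁻¹ * ((σ i * a * y₂ - b * y₁) ^ 2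
          + r.im * (y₂ * σ i * a ^ 2 + y₂ * σ i * Z + y₁ * b ^ 2 + y₁ * Z)) := by
      positivity
    linarith
  refine key.trans ?_
  rw [avg_add, avg_mul_left, avg_mul_left, ← hA, ← hG]
  apply le_of_eq
  field_simp
  norm_num

/-- One factor |q| ≤ Z + |A (r + σ G)| is cancelled in `avg_stab`. -/
lemma avg_sigma_div_norm (p : Params τ σ Z) (h : IsSol σ Z r A G) :
    avg (fun i => σ i / ‖quo (σ i) Z r A G‖) ≤ 1 := by
  refine le_trans (avg_mono fun i => ?_) (h.avg_stab p)
  have hs := p.sigma_pos i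
  have hq : 0 < ‖quo (σ i) Z r A G‖ := norm_pos_iff.2 (h.quo_ne i)
  rw [div_le_div_iff₀ hq (by positivity), mul_assoc, sq]
  gcongr
  rw [quo]
  refine (norm_sub_le _ _).trans ?_
  rw [Complex.norm_real, Real.norm_of_nonneg p.Z_nonneg]

lemma norm_sub_le_norm (p : Params τ σ Z) (h : IsSol σ Z r A G) : ‖A - r‖ ≤ ‖A‖ := by
  have h1 : A - r = A * avg (fun i => (σ i : ℂ) / quo (σ i) Z r A G) := by
    rw [h.avg_sigma_div]
    have := h.A_ne
    field_simp
  rw [h1, norm_mul]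
  apply mul_le_of_le_one_right (norm_nonneg _)
  refine (norm_avg_le _).trans ((avg_mono fun i => ?_).trans (h.avg_sigma_div_norm p))
  rw [norm_div, Complex.norm_real, Real.norm_of_nonneg (p.sigma_pos i).le]

/-- In the original variables this is |1 + m₁| ≥ 1/2. -/
lemma norm_r_le (p : Params τ σ Z) (h : IsSol σ Z r A G) : ‖r‖ ≤ 2 * ‖A‖ := by
  have h1 := h.norm_sub_le_norm p
  have h2 : ‖r‖ ≤ ‖A‖ + ‖A - r‖ := by
    calc ‖r‖ = ‖A - (A - r)‖ := by ring_nf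
      _ ≤ _ := norm_sub_le _ _
  linarith

/-- 1 / (Z - A²) is the average of 1 / q, and 1 ≤ σ / τ turns `avg_sigma_div_norm` into a bound for
it. -/
lemma tau_le_norm_X (p : Params τ σ Z) (h : IsSol σ Z r A G) : τ ≤ ‖(Z : ℂ) - A ^ 2‖ := by
  have h1 := h.avg_one_div p
  have h2 : ‖1 / ((Z : ℂ) - A ^ 2)‖ ≤ τ⁻¹ := by
    rw [← h1]
    refine (norm_avg_le _).trans ?_
    calc avg (fun i => ‖1 / quo (σ i) Z r A G‖)
        ≤ avg (fun i => τ⁻¹ * (σ i / ‖quo (σ i) Z r A G‖)) := by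
          apply avg_mono
          intro i
          rw [norm_div, norm_one, ← mul_div_assoc]
          gcongr
          rw [← div_eq_inv_mul, le_div_iff₀ p.pos, one_mul]
          exact p.lower i
      _ ≤ τ⁻¹ := by
          rw [avg_mul_left]
          exact mul_le_of_le_one_right (inv_nonneg.2 p.pos.le) (h.avg_sigma_div_norm p)
  rw [norm_div, norm_one, one_div] at h2
  exact (inv_le_inv₀ (norm_pos_iff.2 h.X_ne) p.pos).1 h2

/-- For small r / A the average of σ / q is close to 1 although the average of σ / |q| is at most 1.
So the values 1 / q concentrate along the positive axis, and their unweighted average cannot have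
small real part. -/
lemma re_inv_X (p : Params τ σ Z) (h : IsSol σ Z r A G) (hd : ‖r‖ ≤ τ ^ 2 / 4 * ‖A‖) :
    τ / 2 ≤ (1 / ((Z : ℂ) - A ^ 2)).re := by
  have hA : 0 < ‖A‖ := norm_pos_iff.2 h.A_ne
  have hd' : ‖r / A‖ ≤ τ ^ 2 / 4 := by
    rw [norm_div, div_le_iff₀ hA]
    exact hd
  have h1 := congrArg Complex.re h.avg_sigma_div
  have h2 := h.avg_sigma_div_norm p
  have h3 := congrArg Complex.re (h.avg_one_div p)
  rw [re_avg] at h1 h3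
  rw [← h3]
  have h4 : (1 - r / A).re ≥ 1 - τ ^ 2 / 4 := by
    have := Complex.re_le_norm (r / A)
    simp only [Complex.sub_re, Complex.one_re]
    linarith
  have hτ := p.pos
  -- The unweighted real part is compared linearly with the two weighted averages that are known.
  -- The coefficients work because τ σ ≤ 1 ≤ σ / τ and |Re (1/q)| ≤ |1/q|.
  have h5 : avg (fun i => ((τ + τ⁻¹) * ((σ i : ℂ) / quo (σ i) Z r A G).re
      - τ⁻¹ * (σ i / ‖quo (σ i) Z r A G‖)))
      ≤ avg (fun i => (1 / quo (σ i) Z r A G).re) := by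
    apply avg_mono
    intro i
    have e1 : ((σ i : ℂ) / quo (σ i) Z r A G) = (σ i : ℂ) * (1 / quo (σ i) Z r A G) := by ring
    have e2 : ‖1 / quo (σ i) Z r A G‖ = 1 / ‖quo (σ i) Z r A G‖ := by rw [norm_div, norm_one]
    rw [e1, Complex.re_ofReal_mul, div_eq_mul_one_div (σ i), ← e2]
    have e3 := Complex.re_le_norm (1 / quo (σ i) Z r A G)
    have e4 := norm_nonneg (1 / quo (σ i) Z r A G)
    set u := (1 / quo (σ i) Z r A G).re
    set n := ‖1 / quo (σ i) Z r A G‖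
    have h6 := p.lower i
    have h7 := p.upper i
    have h8 : -n ≤ u := (abs_le.1 (Complex.abs_re_le_norm _)).1
    have h9 : 1 ≤ τ⁻¹ * σ i := by
      rw [← div_eq_inv_mul, le_div_iff₀ hτ]
      linarith
    have h10 : τ * σ i ≤ 1 := by
      calc τ * σ i ≤ τ * τ⁻¹ := by gcongr
        _ = 1 := mul_inv_cancel₀ hτ.ne'
    nlinarith [mul_nonneg (sub_nonneg.2 e3) (sub_nonneg.2 h9), mul_nonneg
      (sub_nonneg.2 e3) (sub_nonneg.2 h10), mul_nonneg e4 (sub_nonneg.2 h10)]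
  refine le_trans ?_ h5
  rw [avg_sub, avg_mul_left, avg_mul_left, h1]
  have h11 : τ⁻¹ * avg (fun i => σ i / ‖quo (σ i) Z r A G‖) ≤ τ⁻¹ * 1 := by gcongr
  have h12 : (τ + τ⁻¹) * (1 - τ ^ 2 / 4) ≤ (τ + τ⁻¹) * (1 - r / A).re := by gcongr
  have h13 : (τ + τ⁻¹) * (1 - τ ^ 2 / 4) = τ + τ⁻¹ - τ ^ 3 / 4 - τ / 4 := by
    field_simp
    ring
  have h14 : τ ^ 3 ≤ τ := by
    have := p.tau_le_one
    nlinarith [mul_nonneg hτ.le (sub_nonneg.2 this)]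
  linarith

end IsSol

end CircularLaw

/-! ### Size estimates for a pointwise solution -/

namespace CircularLaw

namespace IsSol

variable {τ : ℝ} {N : ℕ} {σ : Fin N → ℝ} {Z : ℝ} {r A G : ℂ}

lemma norm_X_le (p : Params τ σ Z) (h : IsSol σ Z r A G) (hd : ‖r‖ ≤ τ ^ 2 / 4 * ‖A‖) :
    ‖(Z : ℂ) - A ^ 2‖ ≤ 2 / τ := by
  have h1 := (h.re_inv_X p hd).trans (Complex.re_le_norm _)
  rw [norm_div, norm_one] at h1
  have h2 := norm_pos_iff.2 h.X_ne
  have hτ := p.pos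
  rw [le_div_iff₀ h2] at h1
  rw [le_div_iff₀ hτ]
  linarith

/-- If r is small relative to A, then A² = Z - X with both Z and X bounded by 2 / τ; otherwise A is
bounded by a multiple of r. -/
lemma norm_A_bound (p : Params τ σ Z) (h : IsSol σ Z r A G) :
    ‖A‖ ^ 2 ≤ 4 / τ ∨ ‖A‖ ≤ 4 / τ ^ 2 * ‖r‖ := by
  have hτ := p.pos
  by_cases hd : ‖r‖ ≤ τ ^ 2 / 4 * ‖A‖
  · left
    have h1 := h.norm_X_le p hd
    have h2 := p.Z_le
    have h3 : ‖A ^ 2‖ ≤ ‖(Z : ℂ)‖ + ‖(Z : ℂ) - A ^ 2‖ := by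
      calc ‖A ^ 2‖ = ‖(Z : ℂ) - (Z - A ^ 2)‖ := by ring_nf
        _ ≤ _ := norm_sub_le _ _
    rw [norm_pow, Complex.norm_real, Real.norm_of_nonneg p.Z_nonneg] at h3
    have h4 : 4 / τ = 2 / τ + 2 / τ := by ring
    linarith
  · right
    push Not at hd
    rw [div_mul_eq_mul_div, le_div_iff₀ (by positivity)]
    linarith

lemma norm_A_le (p : Params τ σ Z) (h : IsSol σ Z r A G) : ‖A‖ ≤ 4 / τ ^ 2 * (1 + ‖r‖) := by
  have hτ := p.pos
  have h1 := p.tau_le_one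
  rcases h.norm_A_bound p with h2 | h2
  · have h3 : ‖A‖ ≤ 4 / τ ^ 2 := by
      apply le_of_sq_le_sq _ (by positivity)
      refine h2.trans ?_
      rw [div_pow, div_le_div_iff₀ hτ (by positivity)]
      nlinarith [pow_le_one₀ hτ.le h1 (n := 3), pow_pos hτ 4]
    have : 0 ≤ 4 / τ ^ 2 * ‖r‖ := by positivity
    linarith
  · have : 0 ≤ 4 / τ ^ 2 := by positivity
    linarith

lemma norm_G_le (p : Params τ σ Z) (h : IsSol σ Z r A G) : ‖G‖ ≤ ‖A‖ / τ := by
  rw [h.G_eq, norm_div]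
  exact div_le_div_of_nonneg_left (norm_nonneg _) p.pos (h.tau_le_norm_X p)

lemma norm_AG_le (p : Params τ σ Z) (h : IsSol σ Z r A G) (i : Fin N) :
    ‖(σ i : ℂ) * (A * G)‖ ≤ ‖A‖ ^ 2 / τ ^ 2 := by
  rw [norm_mul, norm_mul, Complex.norm_real, Real.norm_of_nonneg (p.sigma_pos i).le]
  calc σ i * (‖A‖ * ‖G‖) ≤ τ⁻¹ * (‖A‖ * (‖A‖ / τ)) := by
        have := h.norm_G_le p
        have := p.upper i
        have := p.pos
        gcongr
    _ = ‖A‖ ^ 2 / τ ^ 2 := by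
        have := p.pos
        field_simp

lemma norm_quo_sub_le (p : Params τ σ Z) (h : IsSol σ Z r A G) (i : Fin N) :
    ‖quo (σ i) Z r A G - Z‖ ≤ ‖r‖ * ‖A‖ + ‖A‖ ^ 2 / τ ^ 2 := by
  have e : quo (σ i) Z r A G - Z = -(r * A) - (σ i : ℂ) * (A * G) := by
    rw [quo]
    ring
  rw [e]
  refine (norm_sub_le _ _).trans ?_
  rw [norm_neg, norm_mul]
  gcongr
  exact h.norm_AG_le p i

lemma norm_quo_le (p : Params τ σ Z) (h : IsSol σ Z r A G) (i : Fin N) :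
    ‖quo (σ i) Z r A G‖ ≤ Z + (‖r‖ * ‖A‖ + ‖A‖ ^ 2 / τ ^ 2) := by
  have h1 := h.norm_quo_sub_le p i
  have h2 : ‖quo (σ i) Z r A G‖ ≤ ‖(Z : ℂ)‖ + ‖quo (σ i) Z r A G - Z‖ := by
    calc _ = ‖(Z : ℂ) + (quo (σ i) Z r A G - Z)‖ := by ring_nf
      _ ≤ _ := norm_add_le _ _
  rw [Complex.norm_real, Real.norm_of_nonneg p.Z_nonneg] at h2
  linarith

/-- Since σ has mean one, avg (σ / |q|) ≤ 1 rules out a common upper bound for the |q i| below 1. As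
q differs from Z ≤ 1 - τ by O(|A|²), A cannot be small. -/
lemma norm_A_sq_ge (p : Params τ σ Z) (hZ : Z ≤ 1 - τ) (h : IsSol σ Z r A G) :
    τ ^ 3 / 3 ≤ ‖A‖ ^ 2 := by
  have hτ := p.pos
  set b := Z + (‖r‖ * ‖A‖ + ‖A‖ ^ 2 / τ ^ 2) with hb
  have hA : 0 < ‖A‖ := norm_pos_iff.2 h.A_ne
  have hb0 : 0 < b := by
    have := p.Z_nonneg
    positivity
  have h1 : 1 ≤ b := by
    have h2 : avg (fun i => b⁻¹ * σ i) ≤ avg (fun i => σ i / ‖quo (σ i) Z r A G‖) := by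
      apply avg_mono
      intro i
      have hq : 0 < ‖quo (σ i) Z r A G‖ := norm_pos_iff.2 (h.quo_ne i)
      rw [← div_eq_inv_mul]
      exact div_le_div_of_nonneg_left (p.sigma_pos i).le hq (h.norm_quo_le p i)
    have h3 := h2.trans (h.avg_sigma_div_norm p)
    rw [avg_mul_left, p.mean, mul_one] at h3
    exact (inv_le_one₀ hb0).1 h3
  have h2 : ‖r‖ * ‖A‖ ≤ 2 * ‖A‖ ^ 2 := by
    have := h.norm_r_le p
    nlinarith
  have h3 : τ ≤ 2 * ‖A‖ ^ 2 + ‖A‖ ^ 2 / τ ^ 2 := by linarith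
  have h4 : 2 * ‖A‖ ^ 2 ≤ 2 * (‖A‖ ^ 2 / τ ^ 2) := by
    gcongr
    rw [le_div_iff₀ (by positivity)]
    apply mul_le_of_le_one_right (by positivity)
    exact pow_le_one₀ hτ.le p.tau_le_one
  have h5 : τ ≤ 3 * ‖A‖ ^ 2 / τ ^ 2 := by
    rw [mul_div_assoc]
    linarith
  rw [le_div_iff₀ (by positivity)] at h5
  linarith

/-- Subtracting the real part of avg (σ / q) = 1 - r / A from `avg_stab` cancels Z and leaves the
nonnegative defect |c| + Re c of c = A (r + σ G). When r / A is small, c is forced close to the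
negative real axis. -/
lemma avg_stab_sub (p : Params τ σ Z) (h : IsSol σ Z r A G) :
    avg (fun i => σ i * (‖A * (r + (σ i : ℂ) * G)‖ + (A * (r + (σ i : ℂ) * G)).re)
      / ‖quo (σ i) Z r A G‖ ^ 2) ≤ (r / A).re := by
  have h1 := h.avg_stab p
  have h2 := congrArg Complex.re h.avg_sigma_div
  rw [re_avg, Complex.sub_re, Complex.one_re] at h2
  have h3 : avg (fun i => σ i * (‖A * (r + (σ i : ℂ) * G)‖ + (A * (r + (σ i : ℂ) * G)).re)
      / ‖quo (σ i) Z r A G‖ ^ 2)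
      = avg (fun i => σ i * (Z + ‖A * (r + (σ i : ℂ) * G)‖) / ‖quo (σ i) Z r A G‖ ^ 2)
        - avg (fun i => ((σ i : ℂ) / quo (σ i) Z r A G).re) := by
    rw [← avg_sub]
    congr 1
    ext i
    have e : ((σ i : ℂ) / quo (σ i) Z r A G).re
        = σ i * (Z - (A * (r + (σ i : ℂ) * G)).re) / ‖quo (σ i) Z r A G‖ ^ 2 := by
      rw [Complex.div_re, Complex.sq_norm]
      simp only [Complex.ofReal_re, Complex.ofReal_im, zero_mul, zero_div, add_zero]
      simp [quo]
    rw [e]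
    ring
  rw [h3, h2]
  linarith

/-- `-A G` is almost a nonnegative real number if `r / A` and `r A` are small. -/
lemma norm_AG_add_re_le (p : Params τ σ Z) (h : IsSol σ Z r A G) {M : ℝ}
    (hM : ∀ i, ‖quo (σ i) Z r A G‖ ≤ M) :
    ‖A * G‖ + (A * G).re ≤ M ^ 2 / τ * (‖r‖ / ‖A‖) + 2 * (‖r‖ * ‖A‖) := by
  have hτ := p.pos
  have h1 := (h.avg_stab_sub p).trans (Complex.re_le_norm _)
  rw [norm_div] at h1
  have hM0 : 0 < M := (norm_pos_iff.2 (h.quo_ne ⟨0, p.card_pos⟩)).trans_le (hM _)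
  have h2 : avg (fun i => τ / M ^ 2 * (σ i * (‖A * G‖ + (A * G).re) - 2 * (‖r‖ * ‖A‖)))
      ≤ ‖r‖ / ‖A‖ := by
    refine le_trans (avg_mono fun i => ?_) h1
    have hq : 0 < ‖quo (σ i) Z r A G‖ := norm_pos_iff.2 (h.quo_ne i)
    have hs := p.sigma_pos i
    set c := A * (r + (σ i : ℂ) * G) with hc
    have e1 : (σ i : ℂ) * (A * G) = c - r * A := by rw [hc]; ring
    have e2 : σ i * ‖A * G‖ ≤ ‖c‖ + ‖r‖ * ‖A‖ := by
      have := norm_sub_le c (r * A)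
      rw [← e1, norm_mul, Complex.norm_real, Real.norm_of_nonneg hs.le, norm_mul r A] at this
      exact this
    have e3 : σ i * (A * G).re ≤ c.re + ‖r‖ * ‖A‖ := by
      have := congrArg Complex.re e1
      rw [Complex.re_ofReal_mul, Complex.sub_re] at this
      rw [this]
      have := Complex.abs_re_le_norm (r * A)
      rw [norm_mul] at this
      linarith [(abs_le.1 this).1]
    have e4 : 0 ≤ ‖c‖ + c.re := by
      linarith [(abs_le.1 (Complex.abs_re_le_norm c)).1]
    calc τ / M ^ 2 * (σ i * (‖A * G‖ + (A * G).re) - 2 * (‖r‖ * ‖A‖))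
        ≤ τ / M ^ 2 * (‖c‖ + c.re) := by
          gcongr
          linarith
      _ ≤ σ i / ‖quo (σ i) Z r A G‖ ^ 2 * (‖c‖ + c.re) := by
          gcongr
          · exact p.lower i
          · exact hM i
      _ = _ := by ring
  rw [avg_mul_left, avg_sub, avg_mul_right, p.mean, avg_const p.card_pos, one_mul] at h2
  have h3 : τ / M ^ 2 * (‖A * G‖ + (A * G).re) ≤ ‖r‖ / ‖A‖ + τ / M ^ 2 * (2 * (‖r‖ * ‖A‖)) := by
    linarith
  have h4 : ‖A * G‖ + (A * G).re = M ^ 2 / τ * (τ / M ^ 2 * (‖A * G‖ + (A * G).re)) := by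
    field_simp
  rw [h4]
  refine (mul_le_mul_of_nonneg_left h3 (by positivity)).trans_eq ?_
  field_simp

end IsSol

end CircularLaw

namespace CircularLaw

/-! ### Existence of the analytic solution -/

/-- The pseudo-hyperbolic bound `|x - y|² ≤ d Im x Im y` on the closed upper half plane. -/
def HypLe (d : ℝ) (x y : ℂ) : Prop := 0 ≤ x.im ∧ 0 ≤ y.im ∧ ‖x - y‖ ^ 2 ≤ d * (x.im * y.im)

namespace HypLe

variable {d : ℝ} {x y x' y' r : ℂ}

lemma refl (hd : 0 ≤ d) (hx : 0 ≤ x.im) : HypLe d x x :=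
  ⟨hx, hx, by
    rw [sub_self, norm_zero, zero_pow two_ne_zero]
    positivity⟩

/-- The cross term 2 |x - y| |x' - y'| is absorbed by the mixed products of imaginary parts, by the
arithmetic-geometric mean inequality. -/
lemma add (hd : 0 ≤ d) (h : HypLe d x y) (h' : HypLe d x' y') : HypLe d (x + x') (y + y') := by
  obtain ⟨a, b, c⟩ := h
  obtain ⟨a', b', c'⟩ := h'
  refine ⟨by simpa using add_nonneg a a', by simpa using add_nonneg b b', ?_⟩
  have e : x + x' - (y + y') = (x - y) + (x' - y') := by ring
  rw [e]
  have h1 : ‖(x - y) + (x' - y')‖ ^ 2 ≤ (‖x - y‖ + ‖x' - y'‖) ^ 2 := by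
    gcongr
    exact norm_add_le _ _
  refine h1.trans ?_
  simp only [Complex.add_im]
  set p := ‖x - y‖
  set q := ‖x' - y'‖
  have hp : 0 ≤ p := norm_nonneg _
  have hq : 0 ≤ q := norm_nonneg _
  have h2 : 2 * (p * q) ≤ d * (x.im * y'.im + x'.im * y.im) := by
    apply le_of_sq_le_sq _ (by positivity)
    have h3 : p ^ 2 * q ^ 2 ≤ (d * (x.im * y.im)) * (d * (x'.im * y'.im)) := by
      gcongr
    nlinarith [sq_nonneg (d * (x.im * y'.im - x'.im * y.im))]
  nlinarith

lemma smul {t : ℝ} (ht : 0 ≤ t) (h : HypLe d x y) : HypLe d ((t : ℂ) * x) ((t : ℂ) * y) := by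
  obtain ⟨a, b, c⟩ := h
  refine ⟨by rw [Complex.im_ofReal_mul]; positivity, by rw [Complex.im_ofReal_mul]; positivity, ?_⟩
  rw [← mul_sub, norm_mul, Complex.norm_real, Real.norm_of_nonneg ht, Complex.im_ofReal_mul,
    Complex.im_ofReal_mul]
  nlinarith [mul_le_mul_of_nonneg_left c (sq_nonneg t)]

/-- Inversion is an isometry: |x - y|² and Im x Im y are both divided by |x y|². -/
lemma neg_inv (h : HypLe d x y) (hx : 0 < x.im) (hy : 0 < y.im) : HypLe d (-x⁻¹) (-y⁻¹) := by
  obtain ⟨-, -, c⟩ := h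
  have hx0 : x ≠ 0 := by rintro rfl; simp at hx
  have hy0 : y ≠ 0 := by rintro rfl; simp at hy
  have ex : (-x⁻¹).im = x.im / ‖x‖ ^ 2 := by
    rw [Complex.neg_im, Complex.inv_im, Complex.sq_norm]; ring
  have ey : (-y⁻¹).im = y.im / ‖y‖ ^ 2 := by
    rw [Complex.neg_im, Complex.inv_im, Complex.sq_norm]; ring
  refine ⟨by rw [ex]; positivity, by rw [ey]; positivity, ?_⟩
  have e : -x⁻¹ - -y⁻¹ = (x - y) / (x * y) := by
    field_simp
    ring
  rw [e, ex, ey, norm_div, norm_mul, div_pow, mul_pow, div_mul_div_comm, ← mul_div_assoc]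
  gcongr

/-- The difference is unchanged while each imaginary part, being at most L, grows at least by the
factor (Im r + L) / L. This is the only source of strict contraction. -/
lemma shift (h : HypLe d x y) (hd : 0 ≤ d) {L : ℝ} (hL : 0 < L) (hx : x.im ≤ L) (hy : y.im ≤ L)
    (hr : 0 < r.im) : HypLe ((L / (r.im + L)) ^ 2 * d) (r + x) (r + y) := by
  obtain ⟨a, b, c⟩ := h
  refine ⟨by rw [Complex.add_im]; positivity, by rw [Complex.add_im]; positivity, ?_⟩
  rw [add_sub_add_left_eq_sub, Complex.add_im, Complex.add_im]
  have h1 : ∀ t, 0 ≤ t → t ≤ L → t ≤ L / (r.im + L) * (r.im + t) := by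
    intro t h0 h1
    rw [div_mul_eq_mul_div, le_div_iff₀ (by positivity)]
    nlinarith
  calc ‖x - y‖ ^ 2 ≤ d * (x.im * y.im) := c
    _ ≤ d * ((L / (r.im + L) * (r.im + x.im)) * (L / (r.im + L) * (r.im + y.im))) := by
        gcongr
        · exact h1 _ a hx
        · exact h1 _ b hy
    _ = _ := by ring

lemma avg {N : ℕ} {F F' : Fin N → ℂ} (hd : 0 ≤ d) (h : ∀ i, HypLe d (F i) (F' i)) :
    HypLe d (avg F) (avg F') := by
  have hs : ∀ s : Finset (Fin N), HypLe d (∑ i ∈ s, F i) (∑ i ∈ s, F' i) := by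
    intro s
    induction s using Finset.cons_induction with
    | empty => simpa using HypLe.refl (x := 0) hd (by simp)
    | cons a s ha ih =>
      rw [Finset.sum_cons, Finset.sum_cons]
      exact (h a).add hd ih
  have := (hs Finset.univ).smul (t := (N : ℝ)⁻¹) (by positivity)
  simpa only [CircularLaw.avg, Complex.real_smul] using this

lemma norm_sub_le (h : HypLe d x y) (hd : 0 ≤ d) {L : ℝ} (hx : x.im ≤ L) (hy : y.im ≤ L) :
    ‖x - y‖ ≤ √d * L := by
  obtain ⟨a, b, c⟩ := h
  have hL : 0 ≤ L := a.trans hx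
  apply le_of_sq_le_sq _ (by positivity)
  rw [mul_pow, Real.sq_sqrt hd, sq L]
  exact c.trans (by gcongr)

end HypLe

lemma avg_pos {N : ℕ} (hN : 0 < N) {F : Fin N → ℝ} (h : ∀ i, 0 < F i) : 0 < avg F := by
  have : Nonempty (Fin N) := ⟨⟨0, hN⟩⟩
  unfold avg
  exact smul_pos (by positivity) (Finset.sum_pos (fun i _ => h i) Finset.univ_nonempty)

/-- The open sector of all `g` with `g / r` and `r g` in the upper half plane. -/
def sector (r : ℂ) : Set ℂ := {g | 0 < (g * (starRingEnd ℂ) r).im ∧ 0 < (g * r).im}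

/-- The open first quadrant. -/
def quadrant : Set ℂ := {r | 0 < r.re ∧ 0 < r.im}

lemma isOpen_quadrant : IsOpen quadrant :=
  (isOpen_lt continuous_const Complex.continuous_re).inter
    (isOpen_lt continuous_const Complex.continuous_im)

lemma im_pos_of_mem_sector {r g : ℂ} (hr : r ∈ quadrant) (hg : g ∈ sector r) : 0 < g.im := by
  obtain ⟨h1, h2⟩ := hg
  simp only [Complex.mul_im, Complex.conj_re, Complex.conj_im] at h1 h2
  have := hr.1
  by_contra h
  push Not at h
  nlinarith

lemma im_nonneg_of_sector {r g : ℂ} (hr : r ∈ quadrant) (h1 : 0 ≤ (g * (starRingEnd ℂ) r).im)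
    (h2 : 0 ≤ (g * r).im) : 0 ≤ g.im := by
  simp only [Complex.mul_im, Complex.conj_re, Complex.conj_im] at h1 h2
  have := hr.1
  by_contra h
  push Not at h
  nlinarith

lemma smul_mem_sector {r g : ℂ} {t : ℝ} (ht : 0 < t) (hg : g ∈ sector r) :
    (t : ℂ) * g ∈ sector r := by
  refine ⟨?_, ?_⟩
  · rw [mul_assoc, Complex.im_ofReal_mul]
    exact mul_pos ht hg.1
  · rw [mul_assoc, Complex.im_ofReal_mul]
    exact mul_pos ht hg.2

lemma avg_mem_sector {N : ℕ} (hN : 0 < N) {F : Fin N → ℂ} {r : ℂ} (h : ∀ i, F i ∈ sector r) :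
    avg F ∈ sector r := by
  refine ⟨?_, ?_⟩
  · rw [← avg_mul_right, im_avg]
    exact avg_pos hN fun i => (h i).1
  · rw [← avg_mul_right, im_avg]
    exact avg_pos hN fun i => (h i).2

/-- `√w m₂` as a function of `A = √w (1 + m₁)`. -/
noncomputable def stepG (Z : ℝ) (A : ℂ) : ℂ := -(A + (Z : ℂ) * -A⁻¹)⁻¹

/-- The fixed point map for `g = √w m₁`. -/
noncomputable def step {N : ℕ} (σ : Fin N → ℝ) (Z : ℝ) (r g : ℂ) : ℂ :=
  avg (fun i => (σ i : ℂ) * -(r + (σ i : ℂ) * stepG Z (r + g) + (Z : ℂ) * -(r + g)⁻¹)⁻¹)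

section step

variable {N : ℕ} {σ : Fin N → ℝ} {Z : ℝ} {r g g' : ℂ}

lemma neg_inv_im_nonneg {x : ℂ} (h : 0 ≤ x.im) : 0 ≤ (-x⁻¹).im := by
  rw [Complex.neg_im, Complex.inv_im, neg_div, neg_neg]
  exact div_nonneg h (Complex.normSq_nonneg _)

lemma stepG_den_im (hZ : 0 ≤ Z) {A : ℂ} (hA : 0 < A.im) : 0 < (A + (Z : ℂ) * -A⁻¹).im := by
  rw [Complex.add_im, Complex.im_ofReal_mul]
  have := neg_inv_im_nonneg hA.le
  positivity

lemma stepG_im (hZ : 0 ≤ Z) {A : ℂ} (hA : 0 < A.im) : 0 ≤ (stepG Z A).im :=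
  neg_inv_im_nonneg (stepG_den_im hZ hA).le

lemma step_den_im (hZ : 0 ≤ Z) (hs : ∀ i, 0 < σ i) (hr : 0 < r.im) (hg : 0 ≤ g.im) (i : Fin N) :
    r.im ≤ (r + (σ i : ℂ) * stepG Z (r + g) + (Z : ℂ) * -(r + g)⁻¹).im := by
  have hA : 0 < (r + g).im := by rw [Complex.add_im]; linarith
  rw [Complex.add_im, Complex.add_im, Complex.im_ofReal_mul, Complex.im_ofReal_mul]
  have h1 := neg_inv_im_nonneg hA.le
  have h2 := stepG_im hZ hA
  have h3 := hs i
  have : 0 ≤ σ i * (stepG Z (r + g)).im := by positivity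
  have : 0 ≤ Z * (-(r + g)⁻¹).im := by positivity
  linarith

lemma norm_step_le (hZ : 0 ≤ Z) (hs : ∀ i, 0 < σ i) (hm : avg σ = 1) (hr : 0 < r.im)
    (hg : 0 ≤ g.im) : ‖step σ Z r g‖ ≤ r.im⁻¹ := by
  have : avg (fun i => σ i * r.im⁻¹) = r.im⁻¹ := by rw [avg_mul_right, hm, one_mul]
  rw [← this]
  refine (norm_avg_le _).trans (avg_mono fun i => ?_)
  rw [norm_mul, norm_neg, norm_inv, Complex.norm_real, Real.norm_of_nonneg (hs i).le]
  have := hs i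
  gcongr
  exact (step_den_im hZ hs hr hg i).trans (Complex.im_le_norm _)

/-- The map is built from the shift by r, nonnegative combinations and x ↦ -1/x. Only the first
shift is used for contraction, with L = 1 / Im r, the a priori bound of `norm_step_le`. -/
lemma step_hyp (hZ : 0 ≤ Z) (hs : ∀ i, 0 < σ i) (hr : 0 < r.im) {d : ℝ} (hd : 0 ≤ d)
    (h : HypLe d g g') (hg : g.im ≤ r.im⁻¹) (hg' : g'.im ≤ r.im⁻¹) :
    HypLe ((r.im⁻¹ / (r.im + r.im⁻¹)) ^ 2 * d) (step σ Z r g) (step σ Z r g') := by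
  have h1 := h.shift hd (inv_pos.2 hr) hg hg' hr
  set q := (r.im⁻¹ / (r.im + r.im⁻¹)) ^ 2 * d
  have hq : 0 ≤ q := by positivity
  have hA : 0 < (r + g).im := by rw [Complex.add_im]; linarith [h.1]
  have hA' : 0 < (r + g').im := by rw [Complex.add_im]; linarith [h.2.1]
  have h2 := (h1.neg_inv hA hA').smul hZ
  have h3 : HypLe q (stepG Z (r + g)) (stepG Z (r + g')) :=
    (h1.add hq h2).neg_inv (stepG_den_im hZ hA) (stepG_den_im hZ hA')
  apply HypLe.avg hq
  intro i
  refine HypLe.smul (hs i).le (HypLe.neg_inv ?_ ?_ ?_)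
  · exact ((HypLe.refl hq hr.le).add hq (h3.smul (hs i).le)).add hq h2
  · exact hr.trans_le (step_den_im hZ hs hr h.1 i)
  · exact hr.trans_le (step_den_im hZ hs hr h.2.1 i)

lemma neg_inv_mul_conj_im (r K : ℂ) :
    (-K⁻¹ * (starRingEnd ℂ) r).im = (r * K).im / Complex.normSq K := by
  simp [Complex.mul_im, Complex.inv_re, Complex.inv_im]
  ring

lemma neg_inv_mul_im (r K : ℂ) :
    (-K⁻¹ * r).im = ((starRingEnd ℂ) r * K).im / Complex.normSq K := by
  simp [Complex.mul_im, Complex.inv_re, Complex.inv_im]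
  ring

/-- Inversion interchanges the roles of r and its conjugate in the two sector conditions, so each of
them can be checked on the denominator. -/
lemma neg_mem_sector_of {r K : ℂ} (h1 : 0 < (r * K).im) (h2 : 0 < ((starRingEnd ℂ) r * K).im) :
    -K⁻¹ ∈ sector r := by
  have hK : K ≠ 0 := by rintro rfl; simp at h1
  have hK' : 0 < Complex.normSq K := Complex.normSq_pos.2 hK
  refine ⟨?_, ?_⟩
  · rw [neg_inv_mul_conj_im]
    exact div_pos h1 hK'
  · rw [neg_inv_mul_im]
    exact div_pos h2 hK'

lemma mul_neg_inv_im (h1 : 0 ≤ (g * (starRingEnd ℂ) r).im) :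
    0 ≤ (r * -(r + g)⁻¹).im := by
  have : (r * -(r + g)⁻¹).im = (g * (starRingEnd ℂ) r).im / Complex.normSq (r + g) := by
    simp [Complex.mul_im, Complex.inv_re, Complex.inv_im]
    ring
  rw [this]
  exact div_nonneg h1 (Complex.normSq_nonneg _)

lemma im_mul_self_pos (hr : r ∈ quadrant) : 0 < (r * r).im := by
  have h1 := hr.1
  have h2 := hr.2
  rw [Complex.mul_im]
  positivity

lemma conj_mul_neg_inv_im (hr : r ∈ quadrant) (h2 : 0 ≤ (g * r).im) :
    0 ≤ ((starRingEnd ℂ) r * -(r + g)⁻¹).im := by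
  have : ((starRingEnd ℂ) r * -(r + g)⁻¹).im
      = ((r * r).im + (g * r).im) / Complex.normSq (r + g) := by
    simp [Complex.mul_im, Complex.inv_re, Complex.inv_im]
    ring
  rw [this]
  have := im_mul_self_pos hr
  exact div_nonneg (by linarith) (Complex.normSq_nonneg _)

lemma im_conj_mul_self (r : ℂ) : ((starRingEnd ℂ) r * r).im = 0 := by
  simp [Complex.mul_im]
  ring

lemma stepG_sector_left (hZ : 0 ≤ Z) (hr : r ∈ quadrant) (h1 : 0 ≤ (g * (starRingEnd ℂ) r).im)
    (h2 : 0 ≤ (g * r).im) : 0 < (stepG Z (r + g) * (starRingEnd ℂ) r).im := by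
  have e : r * ((r + g) + (Z : ℂ) * -(r + g)⁻¹) = r * r + g * r + (Z : ℂ) * (r * -(r + g)⁻¹) := by
    ring
  have h : 0 < (r * ((r + g) + (Z : ℂ) * -(r + g)⁻¹)).im := by
    rw [e, Complex.add_im, Complex.add_im, Complex.im_ofReal_mul]
    have h3 := mul_neg_inv_im h1
    have h4 := im_mul_self_pos hr
    positivity
  rw [stepG, neg_inv_mul_conj_im]
  refine div_pos h (Complex.normSq_pos.2 fun h0 => ?_)
  rw [h0] at h
  simp at h

lemma stepG_sector_right (hZ : 0 ≤ Z) (hr : r ∈ quadrant)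
    (h1 : 0 ≤ (g * (starRingEnd ℂ) r).im) (h2 : 0 ≤ (g * r).im) :
    0 ≤ (stepG Z (r + g) * r).im := by
  have e : (starRingEnd ℂ) r * ((r + g) + (Z : ℂ) * -(r + g)⁻¹)
      = (starRingEnd ℂ) r * r + g * (starRingEnd ℂ) r
        + (Z : ℂ) * ((starRingEnd ℂ) r * -(r + g)⁻¹) := by
    ring
  have h : 0 ≤ ((starRingEnd ℂ) r * ((r + g) + (Z : ℂ) * -(r + g)⁻¹)).im := by
    rw [e, Complex.add_im, Complex.add_im, Complex.im_ofReal_mul, im_conj_mul_self]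
    have h3 := conj_mul_neg_inv_im hr h2
    positivity
  rw [stepG, neg_inv_mul_im]
  exact div_nonneg h (Complex.normSq_nonneg _)

/-- The fixed point map sends the closed sector into the open one. -/
lemma step_mem_sector (hN : 0 < N) (hZ : 0 ≤ Z) (hs : ∀ i, 0 < σ i) (hr : r ∈ quadrant)
    (h1 : 0 ≤ (g * (starRingEnd ℂ) r).im) (h2 : 0 ≤ (g * r).im) : step σ Z r g ∈ sector r := by
  apply avg_mem_sector hN
  intro i
  apply smul_mem_sector (hs i)
  have hsi := hs i
  apply neg_mem_sector_of
  · have e : r * (r + (σ i : ℂ) * stepG Z (r + g) + (Z : ℂ) * -(r + g)⁻¹)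
        = r * r + (σ i : ℂ) * (stepG Z (r + g) * r) + (Z : ℂ) * (r * -(r + g)⁻¹) := by ring
    rw [e, Complex.add_im, Complex.add_im, Complex.im_ofReal_mul, Complex.im_ofReal_mul]
    have h3 := mul_neg_inv_im h1
    have h4 := im_mul_self_pos hr
    have h5 := stepG_sector_right hZ hr h1 h2
    positivity
  · have e : (starRingEnd ℂ) r * (r + (σ i : ℂ) * stepG Z (r + g) + (Z : ℂ) * -(r + g)⁻¹)
        = (starRingEnd ℂ) r * r + (σ i : ℂ) * (stepG Z (r + g) * (starRingEnd ℂ) r)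
          + (Z : ℂ) * ((starRingEnd ℂ) r * -(r + g)⁻¹) := by ring
    rw [e, Complex.add_im, Complex.add_im, Complex.im_ofReal_mul, Complex.im_ofReal_mul,
      im_conj_mul_self]
    have h3 := conj_mul_neg_inv_im hr h2
    have h5 := stepG_sector_left hZ hr h1 h2
    positivity

end step

end CircularLaw

/-! ### Convergence of the iteration -/

namespace CircularLaw

section iterates

variable {N : ℕ} {σ : Fin N → ℝ} {Z : ℝ} {r g : ℂ}

/-- The iterates of the fixed point map. -/
noncomputable def stepIter {N : ℕ} (σ : Fin N → ℝ) (Z : ℝ) (n : ℕ) (r : ℂ) : ℂ :=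
  (step σ Z r)^[n] Complex.I

lemma stepIter_succ (n : ℕ) (r : ℂ) :
    stepIter σ Z (n + 1) r = step σ Z r (stepIter σ Z n r) :=
  Function.iterate_succ_apply' _ _ _

lemma stepIter_mem_sector (hN : 0 < N) (hZ : 0 ≤ Z) (hs : ∀ i, 0 < σ i) (hr : r ∈ quadrant)
    (n : ℕ) : stepIter σ Z n r ∈ sector r := by
  induction n with
  | zero =>
    have := hr.1
    constructor <;> simpa [stepIter, Complex.mul_im] using this
  | succ n ih =>
    rw [stepIter_succ]
    exact step_mem_sector hN hZ hs hr ih.1.le ih.2.le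

lemma step_differentiableOn (hZ : 0 ≤ Z) (hs : ∀ i, 0 < σ i) {φ : ℂ → ℂ}
    (hφ : DifferentiableOn ℂ φ quadrant) (hφ' : ∀ r ∈ quadrant, 0 ≤ (φ r).im) :
    DifferentiableOn ℂ (fun r => step σ Z r (φ r)) quadrant := by
  have hne : ∀ x : ℂ, 0 < x.im → x ≠ 0 := by
    rintro x hx rfl
    simp at hx
  have hA : ∀ r ∈ quadrant, 0 < (r + φ r).im := fun r hr => by
    rw [Complex.add_im]
    linarith [hr.2, hφ' r hr]
  have h1 : DifferentiableOn ℂ (fun r => r + φ r) quadrant := differentiableOn_id.add hφ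
  have h2 : DifferentiableOn ℂ (fun r => (Z : ℂ) * -(r + φ r)⁻¹) quadrant :=
    (h1.inv fun r hr => hne _ (hA r hr)).neg.const_mul _
  have h3 : DifferentiableOn ℂ (fun r => stepG Z (r + φ r)) quadrant :=
    ((h1.add h2).inv fun r hr => hne _ (stepG_den_im hZ (hA r hr))).neg
  have h4 : ∀ i, DifferentiableOn ℂ (fun r =>
      (σ i : ℂ) * -(r + (σ i : ℂ) * stepG Z (r + φ r) + (Z : ℂ) * -(r + φ r)⁻¹)⁻¹) quadrant := by
    intro i
    refine DifferentiableOn.const_mul (DifferentiableOn.neg (DifferentiableOn.inv ?_ ?_)) _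
    · exact (differentiableOn_id.add (h3.const_mul _)).add h2
    · intro r hr
      exact hne _ (hr.2.trans_le (step_den_im hZ hs hr.2 (hφ' r hr) i))
  exact (DifferentiableOn.fun_sum fun i _ => h4 i).const_smul _

lemma stepIter_differentiableOn (hN : 0 < N) (hZ : 0 ≤ Z) (hs : ∀ i, 0 < σ i) (n : ℕ) :
    DifferentiableOn ℂ (stepIter σ Z n) quadrant := by
  induction n with
  | zero => exact differentiableOn_const _
  | succ n ih =>
    refine (step_differentiableOn hZ hs ih fun r hr => ?_).congr fun r _ => stepIter_succ n r
    exact (im_pos_of_mem_sector hr (stepIter_mem_sector hN hZ hs hr n)).le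

/-- The pseudo-hyperbolic distance of the first two iterates. -/
noncomputable def iterDist {N : ℕ} (σ : Fin N → ℝ) (Z : ℝ) (r : ℂ) : ℝ :=
  ‖stepIter σ Z 2 r - stepIter σ Z 1 r‖ ^ 2 / ((stepIter σ Z 2 r).im * (stepIter σ Z 1 r).im)

/-- The contraction factor of the fixed point map. -/
noncomputable def iterFactor (r : ℂ) : ℝ := r.im⁻¹ / (r.im + r.im⁻¹)

lemma iterDist_nonneg (hN : 0 < N) (hZ : 0 ≤ Z) (hs : ∀ i, 0 < σ i) (hr : r ∈ quadrant) :
    0 ≤ iterDist σ Z r := by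
  have h1 := im_pos_of_mem_sector hr (stepIter_mem_sector hN hZ hs hr 1)
  have h2 := im_pos_of_mem_sector hr (stepIter_mem_sector hN hZ hs hr 2)
  unfold iterDist
  positivity

lemma iterFactor_nonneg (hr : r ∈ quadrant) : 0 ≤ iterFactor r := by
  have := hr.2
  unfold iterFactor
  positivity

lemma iterFactor_lt_one (hr : r ∈ quadrant) : iterFactor r < 1 := by
  have := hr.2
  unfold iterFactor
  rw [div_lt_one (by positivity)]
  linarith

lemma stepIter_im_le (hN : 0 < N) (hZ : 0 ≤ Z) (hs : ∀ i, 0 < σ i) (hm : avg σ = 1)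
    (hr : r ∈ quadrant) (n : ℕ) : (stepIter σ Z (n + 1) r).im ≤ r.im⁻¹ := by
  rw [stepIter_succ]
  refine (Complex.im_le_norm _).trans (norm_step_le hZ hs hm hr.2 ?_)
  exact (im_pos_of_mem_sector hr (stepIter_mem_sector hN hZ hs hr n)).le

/-- The starting point `I` need not satisfy Im ≤ 1 / Im r, which the contraction requires. All later
iterates do, hence the comparison starts with the first and second iterates. -/
lemma norm_stepIter_sub_le (hN : 0 < N) (hZ : 0 ≤ Z) (hs : ∀ i, 0 < σ i) (hm : avg σ = 1)
    (hr : r ∈ quadrant) (n : ℕ) :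
    ‖stepIter σ Z (n + 2) r - stepIter σ Z (n + 1) r‖
      ≤ iterFactor r ^ n * (√(iterDist σ Z r) * r.im⁻¹) := by
  have hd := iterDist_nonneg hN hZ hs hr
  have hf := iterFactor_nonneg hr
  have key : HypLe ((iterFactor r ^ n) ^ 2 * iterDist σ Z r) (stepIter σ Z (n + 2) r)
      (stepIter σ Z (n + 1) r) := by
    induction n with
    | zero =>
      have h1 := im_pos_of_mem_sector hr (stepIter_mem_sector hN hZ hs hr 1)
      have h2 := im_pos_of_mem_sector hr (stepIter_mem_sector hN hZ hs hr 2)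
      refine ⟨h2.le, h1.le, ?_⟩
      rw [pow_zero, one_pow, one_mul, iterDist]
      exact (div_mul_cancel₀ _ (by positivity)).ge
    | succ n ih =>
      have := step_hyp hZ hs hr.2 (by positivity) ih (stepIter_im_le hN hZ hs hm hr (n + 1))
        (stepIter_im_le hN hZ hs hm hr n)
      rw [← stepIter_succ, ← stepIter_succ] at this
      convert this using 1
      rw [iterFactor]
      ring
  have := key.norm_sub_le (by positivity) (stepIter_im_le hN hZ hs hm hr (n + 1))
    (stepIter_im_le hN hZ hs hm hr n)
  rwa [Real.sqrt_mul (by positivity), Real.sqrt_sq (by positivity), mul_assoc] at this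

/-- The initial distance and the contraction factor are continuous in r, so on a compact set they
attain their maxima and the geometric rate is uniform. This gives analyticity of the limit. -/
lemma exists_stepIter_bound (hN : 0 < N) (hZ : 0 ≤ Z) (hs : ∀ i, 0 < σ i) (hm : avg σ = 1)
    {K : Set ℂ} (hK : IsCompact K) (hKq : K ⊆ quadrant) :
    ∃ C q : ℝ, 0 ≤ q ∧ q < 1 ∧ ∀ r ∈ K, ∀ n,
      dist (stepIter σ Z (n + 1) r) (stepIter σ Z (n + 2) r) ≤ C * q ^ n := by
  rcases K.eq_empty_or_nonempty with rfl | hne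
  · exact ⟨0, 0, le_rfl, by norm_num, by simp⟩
  have him : ContinuousOn (fun r : ℂ => r.im⁻¹) K :=
    Complex.continuous_im.continuousOn.inv₀ fun r hr => (hKq hr).2.ne'
  have hc : ∀ n, ContinuousOn (stepIter σ Z n) K := fun n =>
    (stepIter_differentiableOn hN hZ hs n).continuousOn.mono hKq
  have hpos : ∀ n, ∀ r ∈ K, 0 < (stepIter σ Z n r).im := fun n r hr =>
    im_pos_of_mem_sector (hKq hr) (stepIter_mem_sector hN hZ hs (hKq hr) n)
  have h1 : ContinuousOn (fun r => √(iterDist σ Z r) * r.im⁻¹) K := by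
    refine ContinuousOn.mul (ContinuousOn.sqrt (ContinuousOn.div ?_ ?_ ?_)) him
    · exact (((hc 2).sub (hc 1)).norm).pow 2
    · exact (Complex.continuous_im.comp_continuousOn (hc 2)).mul
        (Complex.continuous_im.comp_continuousOn (hc 1))
    · intro r hr
      exact (mul_pos (hpos 2 r hr) (hpos 1 r hr)).ne'
  have h2 : ContinuousOn iterFactor K := by
    refine ContinuousOn.div him (Complex.continuous_im.continuousOn.add him) ?_
    intro r hr
    have := (hKq hr).2
    positivity
  obtain ⟨r₁, hr₁, hmax₁⟩ := hK.exists_isMaxOn hne h1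
  obtain ⟨r₂, hr₂, hmax₂⟩ := hK.exists_isMaxOn hne h2
  refine ⟨√(iterDist σ Z r₁) * r₁.im⁻¹, iterFactor r₂, iterFactor_nonneg (hKq hr₂),
    iterFactor_lt_one (hKq hr₂), fun r hr n => ?_⟩
  · rw [dist_comm, dist_eq_norm]
    refine (norm_stepIter_sub_le hN hZ hs hm (hKq hr) n).trans ?_
    rw [mul_comm]
    have h3 := hmax₁ hr
    have h4 := hmax₂ hr
    have h5 := iterFactor_nonneg (hKq hr)
    have h6 : 0 ≤ √(iterDist σ Z r₁) * r₁.im⁻¹ := by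
      have := (hKq hr₁).2
      positivity
    simp only [mem_ofPred_eq] at h3 h4
    gcongr

lemma step_continuousAt (hZ : 0 ≤ Z) (hs : ∀ i, 0 < σ i) (hr : 0 < r.im) (hg : 0 ≤ g.im) :
    ContinuousAt (step σ Z r) g := by
  have hne : ∀ x : ℂ, 0 < x.im → x ≠ 0 := by
    rintro x hx rfl
    simp at hx
  have hA : 0 < (r + g).im := by
    rw [Complex.add_im]
    linarith
  have h1 : ContinuousAt (fun g => r + g) g := by fun_prop
  have h2 : ContinuousAt (fun g => (Z : ℂ) * -(r + g)⁻¹) g :=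
    continuousAt_const.mul (h1.inv₀ (hne _ hA)).neg
  have h3 : ContinuousAt (fun g => stepG Z (r + g)) g :=
    ((h1.add h2).inv₀ (hne _ (stepG_den_im hZ hA))).neg
  have h4 : ∀ i, ContinuousAt (fun g =>
      (σ i : ℂ) * -(r + (σ i : ℂ) * stepG Z (r + g) + (Z : ℂ) * -(r + g)⁻¹)⁻¹) g := by
    intro i
    refine continuousAt_const.mul (ContinuousAt.neg (ContinuousAt.inv₀ ?_ ?_))
    · exact (continuousAt_const.add (continuousAt_const.mul h3)).add h2
    · exact hne _ (hr.trans_le (step_den_im hZ hs hr hg i))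
  exact (tendsto_finsetSum _ fun i _ => h4 i).const_smul _

/-- The solution of the fixed point equation, analytic in `r = √w`. -/
lemma exists_fixed_point (hN : 0 < N) (hZ : 0 ≤ Z) (hs : ∀ i, 0 < σ i) (hm : avg σ = 1) :
    ∃ γ : ℂ → ℂ, DifferentiableOn ℂ γ quadrant ∧
      ∀ r ∈ quadrant, γ r ∈ sector r ∧ step σ Z r (γ r) = γ r := by
  have hlim : ∀ r ∈ quadrant, ∃ γ, Tendsto (fun n => stepIter σ Z (n + 1) r) atTop (𝓝 γ) := by
    intro r hr
    obtain ⟨C, q, -, hq, h⟩ := exists_stepIter_bound hN hZ hs hm (K := {r}) isCompact_singleton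
      (by simpa using hr)
    exact cauchySeq_tendsto_of_complete (cauchySeq_of_le_geometric q C hq (h r rfl))
  choose! γ hγ using hlim
  refine ⟨γ, ?_, fun r hr => ?_⟩
  · have hu : TendstoLocallyUniformlyOn (fun n => stepIter σ Z (n + 1)) γ atTop quadrant := by
      rw [tendstoLocallyUniformlyOn_iff_forall_isCompact isOpen_quadrant]
      intro K hKq hK
      obtain ⟨C, q, hq0, hq, h⟩ := exists_stepIter_bound hN hZ hs hm hK hKq
      rw [Metric.tendstoUniformlyOn_iff]
      intro ε hε
      have h1 : Tendsto (fun n : ℕ => C * q ^ n / (1 - q)) atTop (𝓝 (C * 0 / (1 - q))) :=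
        ((tendsto_pow_atTop_nhds_zero_of_lt_one hq0 hq).const_mul C).div_const _
      rw [mul_zero, zero_div] at h1
      filter_upwards [h1.eventually_lt_const hε] with n hn r hr
      rw [dist_comm]
      exact (dist_le_of_le_geometric_of_tendsto q C hq (h r hr) (hγ r (hKq hr)) n).trans_lt hn
    exact hu.differentiableOn (Eventually.of_forall fun n =>
      stepIter_differentiableOn hN hZ hs (n + 1)) isOpen_quadrant
  · have h1 : 0 ≤ (γ r * (starRingEnd ℂ) r).im :=
      ge_of_tendsto ((Complex.continuous_im.tendsto _).comp ((hγ r hr).mul_const _))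
        (Eventually.of_forall fun n => (stepIter_mem_sector hN hZ hs hr (n + 1)).1.le)
    have h2 : 0 ≤ (γ r * r).im :=
      ge_of_tendsto ((Complex.continuous_im.tendsto _).comp ((hγ r hr).mul_const _))
        (Eventually.of_forall fun n => (stepIter_mem_sector hN hZ hs hr (n + 1)).2.le)
    have h3 : step σ Z r (γ r) = γ r := by
      have h4 := (step_continuousAt hZ hs hr.2 (im_nonneg_of_sector hr h1 h2)).tendsto.comp
        (hγ r hr)
      have h5 := (hγ r hr).comp (tendsto_add_atTop_nat 1)
      refine tendsto_nhds_unique h4 (h5.congr fun n => ?_)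
      simp only [Function.comp_apply]
      exact stepIter_succ (n + 1) r
    -- The limit is a priori only in the closed sector; being its own image under the map, it lies
    -- in the open one.
    refine ⟨?_, h3⟩
    rw [← h3]
    exact step_mem_sector hN hZ hs hr h1 h2

end iterates

/-! ### The square root on the upper half plane -/

lemma csqrt_sq (w : ℂ) : csqrt w ^ 2 = w := by
  rw [csqrt, one_div]
  exact Complex.cpow_nat_inv_pow w two_ne_zero

lemma csqrt_mem_quadrant {w : ℂ} (hw : 0 < w.im) : csqrt w ∈ quadrant := by
  have hw0 : w ≠ 0 := by
    rintro rfl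
    simp at hw
  have h1 : 0 < (csqrt w).re := by
    rw [csqrt, Complex.cpow_def_of_ne_zero hw0, Complex.exp_re]
    apply mul_pos (Real.exp_pos _)
    apply Real.cos_pos_of_mem_Ioo
    have h2 : (Complex.log w * (1 / 2)).im = w.arg / 2 := by
      simp [Complex.mul_im, Complex.log_im]
      ring
    rw [h2]
    have h3 := Complex.neg_pi_lt_arg w
    have h4 := Complex.arg_lt_pi_iff.2 (Or.inr hw.ne')
    constructor <;> linarith
  refine ⟨h1, ?_⟩
  have h2 := congrArg Complex.im (csqrt_sq w)
  rw [sq, Complex.mul_im] at h2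
  by_contra h
  push Not at h
  nlinarith

lemma csqrt_differentiableOn : DifferentiableOn ℂ csqrt {w : ℂ | 0 < w.im} := by
  intro w hw
  apply DifferentiableAt.differentiableWithinAt
  exact differentiableAt_id.cpow_const (Or.inr (ne_of_gt hw))

/-! ### The solution on the upper half plane -/

lemma isSol_of_fixed_point {N : ℕ} {σ : Fin N → ℝ} {Z : ℝ} {r g : ℂ} (hZ : 0 ≤ Z)
    (hs : ∀ i, 0 < σ i) (hr : r ∈ quadrant) (hg : g ∈ sector r) (h : step σ Z r g = g) :
    IsSol σ Z r (r + g) (stepG Z (r + g)) := by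
  have hgim := im_pos_of_mem_sector hr hg
  have hA : 0 < (r + g).im := by
    rw [Complex.add_im]
    linarith [hr.2]
  have hne : ∀ x : ℂ, 0 < x.im → x ≠ 0 := by
    rintro x hx rfl
    simp at hx
  have hA0 := hne _ hA
  have hD0 := hne _ (stepG_den_im hZ hA)
  have hG : stepG Z (r + g) * ((Z : ℂ) - (r + g) ^ 2) = r + g := by
    have e : ((Z : ℂ) - (r + g) ^ 2) = -(r + g) * (r + g + (Z : ℂ) * -(r + g)⁻¹) := by
      field_simp
      ring
    rw [e, stepG]
    generalize r + g + (Z : ℂ) * -(r + g)⁻¹ = D at hD0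
    field_simp
  have hq : ∀ i, quo (σ i) Z r (r + g) (stepG Z (r + g)) = -(r + g) *
      (r + (σ i : ℂ) * stepG Z (r + g) + (Z : ℂ) * -(r + g)⁻¹) := by
    intro i
    rw [quo]
    field_simp
    ring
  have hK : ∀ i, r + (σ i : ℂ) * stepG Z (r + g) + (Z : ℂ) * -(r + g)⁻¹ ≠ 0 := fun i =>
    hne _ (hr.2.trans_le (step_den_im hZ hs hr.2 hgim.le i))
  refine ⟨hr.1, hr.2, by rw [Complex.add_im]; linarith, ?_, fun i => ?_, ?_, hG⟩
  · refine lt_of_le_of_ne (stepG_im hZ hA) fun h0 => ?_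
    have := stepG_den_im hZ hA
    rw [stepG, Complex.neg_im, Complex.inv_im, neg_div, neg_neg] at h0
    have h1 := div_pos this (Complex.normSq_pos.2 hD0)
    linarith
  · rw [hq]
    exact mul_ne_zero (neg_ne_zero.2 hA0) (hK i)
  · rw [add_sub_cancel_left]
    conv_lhs => rw [← h]
    rw [step]
    congr 1
    ext i
    rw [hq]
    have := hK i
    generalize r + (σ i : ℂ) * stepG Z (r + g) + (Z : ℂ) * -(r + g)⁻¹ = K at this ⊢
    field_simp

end CircularLaw

namespace CircularLaw

lemma avg_eq_complex {N : ℕ} (F : Fin N → ℂ) : avg F = (1 / (N : ℂ)) * ∑ i, F i := by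
  simp [avg, Complex.real_smul]

lemma Admissible.params {τ : ℝ} (hτ : 0 < τ) {N : ℕ} {σ : Fin N → ℝ} {z : ℂ}
    (h : Admissible τ σ z) : Params τ σ (‖z‖ ^ 2) where
  pos := hτ
  lower := h.lower
  upper := h.upper
  mean := by
    rw [avg, smul_eq_mul, inv_mul_eq_div]
    exact h.mean_one
  Z_nonneg := by positivity
  Z_upper := h.z_upper

lemma quo_eq {Z : ℝ} {r a m₂ : ℂ} (s : ℝ) (ha : a ≠ 0) :
    quo s Z r (r * a) (r * m₂) = a * (-r ^ 2 * (1 + (s : ℂ) * m₂) + (Z : ℂ) / a) := by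
  rw [quo]
  field_simp
  ring

lemma m2of_eq {z w m r : ℂ} (hr : r ^ 2 = w) :
    m2of z w m = (-r ^ 2 * (1 + m) + ((‖z‖ ^ 2 : ℝ) : ℂ) / (1 + m))⁻¹ := by
  rw [m2of, hr]
  push_cast
  rfl

/-- The solution is m₁ = γ(√w) / √w with γ the fixed point. The two conditions defining the sector
are exactly Im m₁ > 0 and Im (w m₁) > 0. -/
theorem exists_isSelfConsistent {τ : ℝ} (hτ : 0 < τ) {N : ℕ} {σ : Fin N → ℝ} {z : ℂ}
    (h : Admissible τ σ z) : ∃ m, IsSelfConsistent σ z m := by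
  have p := h.params hτ
  obtain ⟨γ, hγd, hγ⟩ := exists_fixed_point p.card_pos p.Z_nonneg p.sigma_pos p.mean
  refine ⟨fun w => γ (csqrt w) / csqrt w, ?_, fun w hw => ?_, fun w hw => ?_, fun w hw => ?_⟩
  · refine (hγd.comp csqrt_differentiableOn fun w hw => csqrt_mem_quadrant hw).div
      csqrt_differentiableOn fun w hw h0 => ?_
    have := (csqrt_mem_quadrant hw).1
    rw [h0] at this
    simp at this
  all_goals
    have hr := csqrt_mem_quadrant hw
    have hr2 := csqrt_sq w
    obtain ⟨hg, hfix⟩ := hγ _ hr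
    set r := csqrt w
    set g := γ r
    have hr0 : r ≠ 0 := by
      intro h0
      have := hr.1
      rw [h0] at this
      simp at this
  · have e : (g / r).im = (g * (starRingEnd ℂ) r).im / Complex.normSq r := by
      simp [Complex.div_im, Complex.mul_im]
      ring
    rw [e]
    exact div_pos hg.1 (Complex.normSq_pos.2 hr0)
  · have e : w * (g / r) = g * r := by
      rw [← hr2]
      field_simp
    rw [e]
    exact hg.2
  · have hS := isSol_of_fixed_point p.Z_nonneg p.sigma_pos hr hg hfix
    set A := r + g with hA
    set G := stepG (‖z‖ ^ 2) A
    have hA0 := hS.A_ne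
    have ha : 1 + g / r = A / r := by
      rw [hA]
      field_simp
    have hX := hS.X_ne
    have hm2 : m2of z w (g / r) = G / r := by
      rw [m2of_eq hr2, ha, hS.G_eq]
      have e : -r ^ 2 * (A / r) + ((‖z‖ ^ 2 : ℝ) : ℂ) / (A / r)
          = r * (((‖z‖ ^ 2 : ℝ) : ℂ) - A ^ 2) / A := by
        field_simp
        ring
      rw [e]
      field_simp
    rw [← avg_eq_complex, hm2, ha]
    have h1 := hS.eq_A
    have h2 : g = A - r := by rw [hA]; ring
    have h3 : g / r = avg (fun i => ((σ i : ℂ) * A / quo (σ i) (‖z‖ ^ 2) r A G) * r⁻¹) := by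
      rw [avg_mul_right, ← h1, h2, div_eq_mul_inv]
    refine h3.trans ?_
    congr 1
    ext i
    have hq := quo_eq (Z := ‖z‖ ^ 2) (r := r) (a := A / r) (m₂ := G / r) (σ i)
      (div_ne_zero hA0 hr0)
    rw [mul_div_cancel₀ _ hr0, mul_div_cancel₀ _ hr0] at hq
    have hq0 := hS.quo_ne i
    rw [hq] at hq0 ⊢
    have e : -w * (1 + (σ i : ℂ) * (G / r)) + (‖z‖ : ℂ) ^ 2 / (A / r)
      = -r ^ 2 * (1 + (σ i : ℂ) * (G / r)) + ((‖z‖ ^ 2 : ℝ) : ℂ) / (A / r) := by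
      rw [hr2]
      push_cast
      rfl
    rw [e]
    have := right_ne_zero_of_mul hq0
    generalize -r ^ 2 * (1 + (σ i : ℂ) * (G / r)) + ((‖z‖ ^ 2 : ℝ) : ℂ) / (A / r) = K at this ⊢
    field_simp

lemma m1c_spec {τ : ℝ} (hτ : 0 < τ) {N : ℕ} {σ : Fin N → ℝ} {z : ℂ}
    (h : Admissible τ σ z) : IsSelfConsistent σ z (m1c σ z) :=
  Classical.epsilon_spec (exists_isSelfConsistent hτ h)

/-- `A = √w (1 + m₁)`. -/
noncomputable def rootA {N : ℕ} (σ : Fin N → ℝ) (z w : ℂ) : ℂ := csqrt w * (1 + m1c σ z w)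

/-- `G = √w m₂`. -/
noncomputable def rootG {N : ℕ} (σ : Fin N → ℝ) (z w : ℂ) : ℂ := csqrt w * m2c σ z w

section

variable {τ : ℝ} {N : ℕ} {σ : Fin N → ℝ} {z w : ℂ}

lemma csqrt_ne_zero (hw : 0 < w.im) : csqrt w ≠ 0 := by
  intro h0
  have := (csqrt_mem_quadrant hw).1
  rw [h0] at this
  simp at this

lemma mul_mem_sector {m : ℂ} (hw : 0 < w.im) (h1 : 0 < m.im) (h2 : 0 < (w * m).im) :
    csqrt w * m ∈ sector (csqrt w) := by
  have hr0 := csqrt_ne_zero hw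
  refine ⟨?_, ?_⟩
  · have e : csqrt w * m * (starRingEnd ℂ) (csqrt w) = (Complex.normSq (csqrt w) : ℂ) * m := by
      rw [← Complex.mul_conj]
      ring
    rw [e, Complex.im_ofReal_mul]
    exact mul_pos (Complex.normSq_pos.2 hr0) h1
  · have e : csqrt w * m * csqrt w = w * m := by
      conv_rhs => rw [← csqrt_sq w]
      ring
    rwa [e]

lemma one_add_m1c_im (hτ : 0 < τ) (h : Admissible τ σ z) (hw : 0 < w.im) :
    0 < (1 + m1c σ z w).im := by
  simpa using (m1c_spec hτ h).im_pos w hw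

lemma one_add_m1c_ne (hτ : 0 < τ) (h : Admissible τ σ z) (hw : 0 < w.im) :
    1 + m1c σ z w ≠ 0 := by
  intro h0
  have := one_add_m1c_im hτ h hw
  rw [h0] at this
  simp at this

lemma im_inv_m2c_neg :
    (m2c σ z w)⁻¹.im ≤ -(w.im + (w * m1c σ z w).im + ‖z‖ ^ 2 * (m1c σ z w).im
      / ‖1 + m1c σ z w‖ ^ 2) := by
  apply le_of_eq
  have e : (m2c σ z w)⁻¹ = -(w + w * m1c σ z w) + ((‖z‖ ^ 2 : ℝ) : ℂ) * (1 + m1c σ z w)⁻¹ := by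
    rw [m2c, m2of, inv_inv]
    push_cast
    ring
  rw [e, Complex.add_im, Complex.neg_im, Complex.add_im, Complex.im_ofReal_mul, Complex.inv_im,
    Complex.sq_norm (1 + _)]
  simp only [Complex.add_im, Complex.one_im, zero_add]
  ring

lemma neg_inv_im (x : ℂ) : x.im = -x⁻¹.im * ‖x‖ ^ 2 := by
  by_cases hx : x = 0
  · simp [hx]
  · rw [Complex.inv_im, Complex.sq_norm]
    have := Complex.normSq_pos.2 hx
    field_simp

/-- -1 / m₂ has imaginary part at least Im w, and Im m₂ = |m₂|² Im (-1 / m₂). -/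
lemma m2c_im_ge (hτ : 0 < τ) (h : Admissible τ σ z) (hw : 0 < w.im) :
    w.im * ‖m2c σ z w‖ ^ 2 ≤ (m2c σ z w).im := by
  rw [neg_inv_im (m2c σ z w)]
  have h1 := im_inv_m2c_neg (σ := σ) (z := z) (w := w)
  have h2 := (m1c_spec hτ h).im_pos w hw
  have h3 := (m1c_spec hτ h).mul_im_pos w hw
  gcongr
  have : 0 ≤ ‖z‖ ^ 2 * (m1c σ z w).im / ‖1 + m1c σ z w‖ ^ 2 := by positivity
  linarith

lemma m2c_ne (hτ : 0 < τ) (h : Admissible τ σ z) (hw : 0 < w.im) : m2c σ z w ≠ 0 := by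
  intro h0
  have h1 := im_inv_m2c_neg (σ := σ) (z := z) (w := w)
  rw [h0, inv_zero, Complex.zero_im] at h1
  have h2 := (m1c_spec hτ h).im_pos w hw
  have h3 := (m1c_spec hτ h).mul_im_pos w hw
  have : 0 ≤ ‖z‖ ^ 2 * (m1c σ z w).im / ‖1 + m1c σ z w‖ ^ 2 := by positivity
  linarith

lemma m2c_im_pos (hτ : 0 < τ) (h : Admissible τ σ z) (hw : 0 < w.im) : 0 < (m2c σ z w).im := by
  refine lt_of_lt_of_le ?_ (m2c_im_ge hτ h hw)
  have := m2c_ne hτ h hw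
  positivity

/-- -1 / (w m₂) = (1 + m₁) - Z / (w (1 + m₁)), where both terms contribute nonnegatively to the
imaginary part and the first one strictly. -/
lemma mul_m2c_im_pos (hτ : 0 < τ) (h : Admissible τ σ z) (hw : 0 < w.im) :
    0 < (w * m2c σ z w).im := by
  have hw0 : w ≠ 0 := by
    rintro rfl
    simp at hw
  have h2 := (m1c_spec hτ h).im_pos w hw
  have h3 := (m1c_spec hτ h).mul_im_pos w hw
  have hx : w * m2c σ z w ≠ 0 := mul_ne_zero hw0 (m2c_ne hτ h hw)
  have e : (w * m2c σ z w)⁻¹ = -(1 + m1c σ z w)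
      + ((‖z‖ ^ 2 : ℝ) : ℂ) * (w * (1 + m1c σ z w))⁻¹ := by
    rw [mul_inv, m2c, m2of, inv_inv, mul_inv]
    push_cast
    field_simp
  have e2 : (w * m2c σ z w)⁻¹.im < 0 := by
    rw [e, Complex.add_im, Complex.neg_im, Complex.im_ofReal_mul, Complex.inv_im]
    have h4 := one_add_m1c_im hτ h hw
    have h5 : 0 < (w * (1 + m1c σ z w)).im := by
      rw [mul_add, mul_one, Complex.add_im]
      linarith
    have : 0 ≤ ‖z‖ ^ 2 * ((w * (1 + m1c σ z w)).im / Complex.normSq (w * (1 + m1c σ z w))) := by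
      have := Complex.normSq_nonneg (w * (1 + m1c σ z w))
      positivity
    rw [neg_div]
    linarith
  rw [neg_inv_im]
  have : 0 < -(w * m2c σ z w)⁻¹.im := by linarith
  positivity

lemma rootG_mem_sector (hτ : 0 < τ) (h : Admissible τ σ z) (hw : 0 < w.im) :
    rootG σ z w ∈ sector (csqrt w) :=
  mul_mem_sector hw (m2c_im_pos hτ h hw) (mul_m2c_im_pos hτ h hw)

lemma rootA_sub_mem_sector (hτ : 0 < τ) (h : Admissible τ σ z) (hw : 0 < w.im) :
    rootA σ z w - csqrt w ∈ sector (csqrt w) := by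
  have e : rootA σ z w - csqrt w = csqrt w * m1c σ z w := by
    rw [rootA]
    ring
  rw [e]
  exact mul_mem_sector hw ((m1c_spec hτ h).im_pos w hw) ((m1c_spec hτ h).mul_im_pos w hw)

lemma den_im (i : Fin N) :
    (-w * (1 + (σ i : ℂ) * m2c σ z w) + (‖z‖ : ℂ) ^ 2 / (1 + m1c σ z w)).im
      = -(w.im + σ i * (w * m2c σ z w).im + ‖z‖ ^ 2 * (m1c σ z w).im
        / ‖1 + m1c σ z w‖ ^ 2) := by
  have e : -w * (1 + (σ i : ℂ) * m2c σ z w) + (‖z‖ : ℂ) ^ 2 / (1 + m1c σ z w)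
      = -(w + (σ i : ℂ) * (w * m2c σ z w))
        + ((‖z‖ ^ 2 : ℝ) : ℂ) * (1 + m1c σ z w)⁻¹ := by
    push_cast
    ring
  rw [e, Complex.add_im, Complex.neg_im, Complex.add_im, Complex.im_ofReal_mul,
    Complex.im_ofReal_mul, Complex.inv_im, Complex.sq_norm (1 + _)]
  simp only [Complex.add_im, Complex.one_im, zero_add]
  ring

lemma den_im_le (hτ : 0 < τ) (h : Admissible τ σ z) (hw : 0 < w.im) (i : Fin N) :
    (-w * (1 + (σ i : ℂ) * m2c σ z w) + (‖z‖ : ℂ) ^ 2 / (1 + m1c σ z w)).im ≤ -w.im := by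
  rw [den_im i]
  have h2 := (m1c_spec hτ h).im_pos w hw
  have h4 := mul_m2c_im_pos hτ h hw
  have h5 := (h.params hτ).sigma_pos i
  have : 0 ≤ ‖z‖ ^ 2 * (m1c σ z w).im / ‖1 + m1c σ z w‖ ^ 2 := by positivity
  have : 0 ≤ σ i * (w * m2c σ z w).im := by positivity
  linarith

lemma quo_root (hτ : 0 < τ) (h : Admissible τ σ z) (hw : 0 < w.im) (s : ℝ) :
    quo s (‖z‖ ^ 2) (csqrt w) (rootA σ z w) (rootG σ z w) = (1 + m1c σ z w) *
      (-w * (1 + (s : ℂ) * m2c σ z w) + (‖z‖ : ℂ) ^ 2 / (1 + m1c σ z w)) := by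
  rw [rootA, rootG, quo_eq _ (one_add_m1c_ne hτ h hw), csqrt_sq]
  push_cast
  rfl

lemma denom_eq (w : ℂ) (s : ℝ) :
    denom σ z s w = -quo s (‖z‖ ^ 2) (csqrt w) (rootA σ z w) (rootG σ z w) := by
  rw [denom, rootA, rootG, quo]
  push_cast
  linear_combination -(1 + m1c σ z w) * (1 + s * m2c σ z w) * csqrt_sq w

lemma norm_denom (w : ℂ) (s : ℝ) :
    ‖denom σ z s w‖ = ‖quo s (‖z‖ ^ 2) (csqrt w) (rootA σ z w) (rootG σ z w)‖ := by
  rw [denom_eq, norm_neg]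

/-- The defining equation in terms of `r = √w`. -/
lemma isSol (hτ : 0 < τ) (h : Admissible τ σ z) (hw : 0 < w.im) :
    IsSol σ (‖z‖ ^ 2) (csqrt w) (rootA σ z w) (rootG σ z w) := by
  have hr := csqrt_mem_quadrant hw
  have hr0 := csqrt_ne_zero hw
  have hA := im_pos_of_mem_sector hr (rootA_sub_mem_sector hτ h hw)
  have ha := one_add_m1c_ne hτ h hw
  have hK : ∀ i, -w * (1 + (σ i : ℂ) * m2c σ z w) + (‖z‖ : ℂ) ^ 2 / (1 + m1c σ z w) ≠ 0 := by
    intro i h0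
    have := den_im_le hτ h hw i
    rw [h0, Complex.zero_im] at this
    linarith
  refine ⟨hr.1, hr.2, ?_, im_pos_of_mem_sector hr (rootG_mem_sector hτ h hw), fun i => ?_, ?_, ?_⟩
  · rw [Complex.sub_im] at hA
    linarith
  · rw [quo_root hτ h hw]
    exact mul_ne_zero ha (hK i)
  · have h1 := (m1c_spec hτ h).equation w hw
    rw [← avg_eq_complex] at h1
    have e : rootA σ z w - csqrt w = csqrt w * m1c σ z w := by
      rw [rootA]
      ring
    rw [e]
    conv_lhs => rw [h1]
    rw [← avg_mul_left]
    congr 1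
    ext i
    rw [quo_root hτ h hw, rootA]
    have hKi := hK i
    rw [m2c] at hKi ⊢
    generalize -w * (1 + (σ i : ℂ) * m2of z w (m1c σ z w))
      + (‖z‖ : ℂ) ^ 2 / (1 + m1c σ z w) = K at hKi ⊢
    field_simp
  · have h1 := m2c_ne hτ h hw
    have h2 : (m2c σ z w)⁻¹ = -w * (1 + m1c σ z w) + (‖z‖ : ℂ) ^ 2 / (1 + m1c σ z w) := by
      rw [m2c, m2of, inv_inv]
    have h3 : m2c σ z w * (-w * (1 + m1c σ z w) + (‖z‖ : ℂ) ^ 2 / (1 + m1c σ z w)) = 1 := by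
      rw [← h2]
      exact mul_inv_cancel₀ h1
    have h4 : (-w * (1 + m1c σ z w) + (‖z‖ : ℂ) ^ 2 / (1 + m1c σ z w)) * (1 + m1c σ z w)
        = (‖z‖ : ℂ) ^ 2 - w * (1 + m1c σ z w) ^ 2 := by
      field_simp
      ring
    rw [rootA, rootG]
    push_cast
    have h5 := csqrt_sq w
    linear_combination csqrt w * (1 + m1c σ z w) * h3 - csqrt w * m2c σ z w * h4
      - csqrt w * m2c σ z w * (1 + m1c σ z w) ^ 2 * h5

end

end CircularLaw

/-! ### A priori bounds on the upper half plane -/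

namespace CircularLaw

section

variable {τ : ℝ} {N : ℕ} {σ : Fin N → ℝ} {z w : ℂ}

/-- The reciprocal of the `i`-th summand of the self-consistent equation, up to the factor `σ i`. -/
noncomputable def den {N : ℕ} (σ : Fin N → ℝ) (z w : ℂ) (i : Fin N) : ℂ :=
  -w * (1 + (σ i : ℂ) * m2c σ z w) + (‖z‖ : ℂ) ^ 2 / (1 + m1c σ z w)

lemma im_le_norm_den (hτ : 0 < τ) (h : Admissible τ σ z) (hw : 0 < w.im) (i : Fin N) :
    w.im ≤ ‖den σ z w i‖ := by
  have h1 := den_im_le hτ h hw i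
  have h2 := (abs_le.1 (Complex.abs_im_le_norm (den σ z w i))).1
  rw [den] at *
  linarith

lemma den_ne (hτ : 0 < τ) (h : Admissible τ σ z) (hw : 0 < w.im) (i : Fin N) :
    den σ z w i ≠ 0 :=
  norm_pos_iff.1 (hw.trans_le (im_le_norm_den hτ h hw i))

lemma norm_denom_eq (hτ : 0 < τ) (h : Admissible τ σ z) (hw : 0 < w.im) (i : Fin N) :
    ‖denom σ z (σ i) w‖ = ‖1 + m1c σ z w‖ * ‖den σ z w i‖ := by
  rw [norm_denom, quo_root hτ h hw, norm_mul, den]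

lemma m1c_eq_avg (hτ : 0 < τ) (h : Admissible τ σ z) (hw : 0 < w.im) :
    m1c σ z w = avg (fun i => (σ i : ℂ) * (den σ z w i)⁻¹) := by
  rw [avg_eq_complex]
  exact (m1c_spec hτ h).equation w hw

lemma den_inv_im_ge (hτ : 0 < τ) (h : Admissible τ σ z) (hw : 0 < w.im) (i : Fin N) :
    w.im / ‖den σ z w i‖ ^ 2 ≤ (den σ z w i)⁻¹.im := by
  rw [Complex.inv_im, Complex.sq_norm]
  have h1 := den_im_le hτ h hw i
  have := Complex.normSq_nonneg (den σ z w i)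
  gcongr
  rw [den]
  linarith

lemma den_inv_im_pos (hτ : 0 < τ) (h : Admissible τ σ z) (hw : 0 < w.im) (i : Fin N) :
    0 < (den σ z w i)⁻¹.im := by
  refine lt_of_lt_of_le ?_ (den_inv_im_ge hτ h hw i)
  have := den_ne hτ h hw i
  positivity

lemma m1c_im_eq (hτ : 0 < τ) (h : Admissible τ σ z) (hw : 0 < w.im) :
    (m1c σ z w).im = avg (fun i => σ i * (den σ z w i)⁻¹.im) := by
  conv_lhs => rw [m1c_eq_avg hτ h hw]
  rw [im_avg]
  simp only [Complex.im_ofReal_mul]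

lemma m1c_im_ge_of_den_le (hτ : 0 < τ) (h : Admissible τ σ z) (hw : 0 < w.im) {M : ℝ}
    (hM : ∀ i, ‖den σ z w i‖ ≤ M) : w.im / M ^ 2 ≤ (m1c σ z w).im := by
  have p := h.params hτ
  rw [m1c_im_eq hτ h hw]
  have : w.im / M ^ 2 = avg (fun i => σ i * (w.im / M ^ 2)) := by
    rw [avg_mul_right, p.mean, one_mul]
  rw [this]
  apply avg_mono
  intro i
  have hs := p.sigma_pos i
  have h1 : 0 < ‖den σ z w i‖ := norm_pos_iff.2 (den_ne hτ h hw i)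
  gcongr
  refine le_trans ?_ (den_inv_im_ge hτ h hw i)
  gcongr
  exact hM i

lemma norm_sq_csqrt (w : ℂ) : ‖csqrt w‖ ^ 2 = ‖w‖ := by
  rw [← norm_pow, csqrt_sq]

lemma half_le_norm_one_add (hτ : 0 < τ) (h : Admissible τ σ z) (hw : 0 < w.im) :
    1 / 2 ≤ ‖1 + m1c σ z w‖ := by
  have h1 := (isSol hτ h hw).norm_r_le (h.params hτ)
  have h2 : 0 < ‖csqrt w‖ := norm_pos_iff.2 (csqrt_ne_zero hw)
  rw [rootA, norm_mul] at h1
  by_contra h3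
  push Not at h3
  nlinarith

/-- Settles the lower bound on the denominators wherever Im w is bounded below, so that only small
Im w needs a separate argument. -/
lemma half_im_le_norm_denom (hτ : 0 < τ) (h : Admissible τ σ z) (hw : 0 < w.im) (i : Fin N) :
    w.im / 2 ≤ ‖denom σ z (σ i) w‖ := by
  rw [norm_denom_eq hτ h hw]
  have h1 := half_le_norm_one_add hτ h hw
  have h2 := im_le_norm_den hτ h hw i
  nlinarith

lemma X_root_eq (w : ℂ) : (((‖z‖ ^ 2 : ℝ) : ℂ) - rootA σ z w ^ 2)
    = (‖z‖ : ℂ) ^ 2 - w * (1 + m1c σ z w) ^ 2 := by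
  rw [rootA, mul_pow, csqrt_sq]
  push_cast
  rfl

lemma m2c_eq_div (hτ : 0 < τ) (h : Admissible τ σ z) (hw : 0 < w.im) :
    m2c σ z w = (1 + m1c σ z w) / ((‖z‖ : ℂ) ^ 2 - w * (1 + m1c σ z w) ^ 2) := by
  have h1 := (isSol hτ h hw).G_eq
  rw [X_root_eq, rootG, rootA] at h1
  have h0 := csqrt_ne_zero hw
  rw [mul_div_assoc] at h1
  exact mul_left_cancel₀ h0 h1

lemma tau_le_norm_X_root (hτ : 0 < τ) (h : Admissible τ σ z) (hw : 0 < w.im) :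
    τ ≤ ‖(‖z‖ : ℂ) ^ 2 - w * (1 + m1c σ z w) ^ 2‖ := by
  rw [← X_root_eq]
  exact (isSol hτ h hw).tau_le_norm_X (h.params hτ)

lemma norm_Z (z : ℂ) : ‖(‖z‖ : ℂ) ^ 2‖ = ‖z‖ ^ 2 := by simp

/-- Bounds on `w` and `1 + m₁`, with one common constant. -/
structure Bounded (τ : ℝ) {N : ℕ} (σ : Fin N → ℝ) (z w : ℂ) (K : ℝ) : Prop where
  one_le : 1 ≤ K
  inv_le : τ⁻¹ ≤ K
  norm_le : ‖w‖ ≤ K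
  norm_one_add_le : ‖1 + m1c σ z w‖ ≤ K

namespace Bounded

variable {K : ℝ}

lemma Z_le (b : Bounded τ σ z w K) (hτ : 0 < τ) (h : Admissible τ σ z) : ‖z‖ ^ 2 ≤ 2 * K := by
  have := (h.params hτ).Z_le
  have := b.inv_le
  rw [div_eq_mul_inv] at *
  linarith

lemma norm_m2c_le (b : Bounded τ σ z w K) (hτ : 0 < τ) (h : Admissible τ σ z) (hw : 0 < w.im) :
    ‖m2c σ z w‖ ≤ K ^ 2 := by
  rw [m2c_eq_div hτ h hw, norm_div, div_eq_mul_inv, sq K]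
  have h1 := b.norm_one_add_le
  have h2 := b.inv_le
  have h3 := tau_le_norm_X_root hτ h hw
  have h4 := b.one_le
  refine mul_le_mul h1 (le_trans ?_ h2) (by positivity) (by linarith)
  exact (inv_le_inv₀ (hτ.trans_le h3) hτ).2 h3

lemma norm_m2c_ge (b : Bounded τ σ z w K) (hτ : 0 < τ) (h : Admissible τ σ z) (hw : 0 < w.im) :
    (6 * K ^ 3)⁻¹ ≤ ‖m2c σ z w‖ := by
  rw [m2c_eq_div hτ h hw, norm_div]
  have h1 := half_le_norm_one_add hτ h hw
  have h3 := tau_le_norm_X_root hτ h hw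
  have h4 := b.one_le
  have h5 : ‖(‖z‖ : ℂ) ^ 2 - w * (1 + m1c σ z w) ^ 2‖ ≤ 3 * K ^ 3 := by
    refine (norm_sub_le _ _).trans ?_
    rw [norm_Z, norm_mul, norm_pow]
    have h6 := b.Z_le hτ h
    have h7 : ‖w‖ * ‖1 + m1c σ z w‖ ^ 2 ≤ K * K ^ 2 := by
      gcongr
      · exact b.norm_le
      · exact b.norm_one_add_le
    have h8 : K ≤ K ^ 3 := le_self_pow₀ h4 (by norm_num)
    linarith [show K * K ^ 2 = K ^ 3 by ring]
  calc (6 * K ^ 3)⁻¹ = 1 / 2 / (3 * K ^ 3) := by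
        field_simp
        norm_num
    _ ≤ _ := by
        have : 0 < ‖(‖z‖ : ℂ) ^ 2 - w * (1 + m1c σ z w) ^ 2‖ := hτ.trans_le h3
        gcongr

lemma norm_den_le (b : Bounded τ σ z w K) (hτ : 0 < τ) (h : Admissible τ σ z) (hw : 0 < w.im)
    (i : Fin N) : ‖den σ z w i‖ ≤ 6 * K ^ 4 := by
  have h4 := b.one_le
  have h1 : ‖-w * (1 + (σ i : ℂ) * m2c σ z w)‖ ≤ K * (1 + K * K ^ 2) := by
    rw [norm_mul, norm_neg]
    gcongr
    · exact b.norm_le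
    · refine (norm_add_le _ _).trans ?_
      rw [norm_one, norm_mul, Complex.norm_real,
        Real.norm_of_nonneg ((h.params hτ).sigma_pos i).le]
      gcongr
      · exact (h.upper i).trans b.inv_le
      · exact b.norm_m2c_le hτ h hw
  have h2 : ‖(‖z‖ : ℂ) ^ 2 / (1 + m1c σ z w)‖ ≤ 2 * K / (1 / 2) := by
    rw [norm_div, norm_Z]
    have := half_le_norm_one_add hτ h hw
    have := b.Z_le hτ h
    gcongr
  refine (norm_add_le _ _).trans ((add_le_add h1 h2).trans ?_)
  have h8 : K ≤ K ^ 4 := le_self_pow₀ h4 (by norm_num)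
  calc K * (1 + K * K ^ 2) + 2 * K / (1 / 2) = K ^ 4 + 5 * K := by ring
    _ ≤ _ := by linarith

lemma m1c_im_ge (b : Bounded τ σ z w K) (hτ : 0 < τ) (h : Admissible τ σ z) (hw : 0 < w.im) :
    w.im / (6 * K ^ 4) ^ 2 ≤ (m1c σ z w).im :=
  m1c_im_ge_of_den_le hτ h hw fun i => b.norm_den_le hτ h hw i

lemma m2c_im_ge (b : Bounded τ σ z w K) (hτ : 0 < τ) (h : Admissible τ σ z) (hw : 0 < w.im) :
    w.im / (6 * K ^ 3) ^ 2 ≤ (m2c σ z w).im := by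
  refine le_trans ?_ (CircularLaw.m2c_im_ge hτ h hw)
  have := b.norm_m2c_ge hτ h hw
  have := b.one_le
  rw [div_eq_mul_inv, ← inv_pow]
  gcongr

lemma norm_m1c_le (b : Bounded τ σ z w K) : ‖m1c σ z w‖ ≤ 2 * K := by
  have e : m1c σ z w = (1 + m1c σ z w) - 1 := by ring
  rw [e]
  refine (norm_sub_le _ _).trans ?_
  rw [norm_one]
  linarith [b.norm_one_add_le, b.one_le]

lemma m1c_im_le (b : Bounded τ σ z w K) : (m1c σ z w).im ≤ 2 * K :=
  (Complex.im_le_norm _).trans b.norm_m1c_le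

lemma m2c_im_le' (b : Bounded τ σ z w K) (hτ : 0 < τ) (h : Admissible τ σ z) (hw : 0 < w.im) :
    (m2c σ z w).im ≤ K ^ 2 :=
  (Complex.im_le_norm _).trans (b.norm_m2c_le hτ h hw)

lemma m2c_im_le (b : Bounded τ σ z w K) (hτ : 0 < τ) (h : Admissible τ σ z) (hw : 0 < w.im) :
    (m2c σ z w).im ≤ K ^ 4 * (3 * K * w.im + 9 * K * (m1c σ z w).im) := by
  have h4 := b.one_le
  have hm := (m1c_spec hτ h).im_pos w hw
  have e : (m2c σ z w)⁻¹.im = -(w.im + (w * m1c σ z w).im + ‖z‖ ^ 2 * (m1c σ z w).im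
      / ‖1 + m1c σ z w‖ ^ 2) := by
    have e : (m2c σ z w)⁻¹
        = -(w + w * m1c σ z w) + ((‖z‖ ^ 2 : ℝ) : ℂ) * (1 + m1c σ z w)⁻¹ := by
      rw [m2c, m2of, inv_inv]
      push_cast
      ring
    rw [e, Complex.add_im, Complex.neg_im, Complex.add_im, Complex.im_ofReal_mul, Complex.inv_im,
      Complex.sq_norm (1 + _)]
    simp only [Complex.add_im, Complex.one_im, zero_add]
    ring
  rw [neg_inv_im (m2c σ z w), e, neg_neg, mul_comm]
  have h1 : (w * m1c σ z w).im ≤ K * (m1c σ z w).im + w.im * (2 * K) := by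
    rw [Complex.mul_im]
    gcongr
    · exact (Complex.re_le_norm _).trans b.norm_le
    · exact (Complex.re_le_norm _).trans b.norm_m1c_le
  have h2 : ‖z‖ ^ 2 * (m1c σ z w).im / ‖1 + m1c σ z w‖ ^ 2
      ≤ 2 * K * (m1c σ z w).im / (1 / 2) ^ 2 := by
    have := half_le_norm_one_add hτ h hw
    have := b.Z_le hτ h
    gcongr
  have h3 : ‖m2c σ z w‖ ^ 2 ≤ K ^ 4 := by
    calc ‖m2c σ z w‖ ^ 2 ≤ (K ^ 2) ^ 2 := by
          gcongr
          exact b.norm_m2c_le hτ h hw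
      _ = K ^ 4 := by ring
  have h5 : 0 ≤ (w * m1c σ z w).im := ((m1c_spec hτ h).mul_im_pos w hw).le
  have : w.im ≤ K * w.im := le_mul_of_one_le_left hw.le h4
  refine mul_le_mul h3 ?_ (by positivity) (by positivity)
  calc _ ≤ K * w.im + (K * (m1c σ z w).im + w.im * (2 * K))
        + 2 * K * (m1c σ z w).im / (1 / 2) ^ 2 := by linarith
    _ = _ := by ring

/-- Im (-1 / m₂) contains Im (w m₁), which is Re w Im m₁ up to O(Im w), and Im w is itself O(Im m₂).
Together with `m2c_im_le` this makes Im m₁ and Im m₂ comparable when Re w is bounded below. -/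
lemma re_mul_m1c_im_le (b : Bounded τ σ z w K) (hτ : 0 < τ) (h : Admissible τ σ z)
    (hw : 0 < w.im) :
    w.re * (m1c σ z w).im ≤ 3 * K * (6 * K ^ 3) ^ 2 * (m2c σ z w).im := by
  have h4 := b.one_le
  have h1 := im_inv_m2c_neg (σ := σ) (z := z) (w := w)
  have hm := (m1c_spec hτ h).im_pos w hw
  have h2 : 0 ≤ ‖z‖ ^ 2 * (m1c σ z w).im / ‖1 + m1c σ z w‖ ^ 2 := by positivity
  have h3 := neg_inv_im (m2c σ z w)
  have hn := b.norm_m2c_ge hτ h hw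
  have hn0 : 0 < ‖m2c σ z w‖ := norm_pos_iff.2 (m2c_ne hτ h hw)
  have h5 : (w * m1c σ z w).im ≥ w.re * (m1c σ z w).im - w.im * (2 * K) := by
    rw [Complex.mul_im]
    have := (abs_le.1 ((Complex.abs_re_le_norm (m1c σ z w)).trans b.norm_m1c_le)).1
    nlinarith
  have h6 := b.m2c_im_ge hτ h hw
  have h7 : -(m2c σ z w)⁻¹.im ≤ (6 * K ^ 3) ^ 2 * (m2c σ z w).im := by
    have e : -(m2c σ z w)⁻¹.im = (m2c σ z w).im / ‖m2c σ z w‖ ^ 2 := by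
      rw [h3]
      field_simp
    rw [e, div_eq_inv_mul]
    have := m2c_im_pos hτ h hw
    gcongr
    rw [← inv_pow]
    gcongr
    rwa [inv_le_comm₀ hn0 (by positivity)]
  rw [div_le_iff₀ (by positivity)] at h6
  set M := (6 * K ^ 3) ^ 2 with hM
  have h8 : (m2c σ z w).im * M * (2 * K) ≥ w.im * (2 * K) := by gcongr
  have h9 : M * (m2c σ z w).im ≤ K * (M * (m2c σ z w).im) := by
    apply le_mul_of_one_le_left _ h4
    have := m2c_im_pos hτ h hw
    positivity
  calc w.re * (m1c σ z w).im ≤ M * (m2c σ z w).im + w.im * (2 * K) := by linarith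
    _ ≤ _ := by linarith [show 3 * K * M * (m2c σ z w).im
        = K * (M * (m2c σ z w).im) + (m2c σ z w).im * M * (2 * K) by ring]

end Bounded

/-- Away from `w = 0` the quantity `1 + m₁` is bounded. -/
lemma bounded_of_le (hτ : 0 < τ) (h : Admissible τ σ z) (hw : 0 < w.im) {c M : ℝ} (hc : 0 < c)
    (hcw : c ≤ ‖w‖) (hM : ‖w‖ ≤ M) :
    Bounded τ σ z w (1 + τ⁻¹ + M + 4 / τ ^ 2 * (1 + (√c)⁻¹)) := by
  have h0 : 0 ≤ M := (norm_nonneg _).trans hM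
  have h1 : 0 ≤ 4 / τ ^ 2 * (1 + (√c)⁻¹) := by positivity
  have h2 : 0 < τ⁻¹ := by positivity
  refine ⟨by linarith, by linarith, by linarith, ?_⟩
  have h3 := (isSol hτ h hw).norm_A_le (h.params hτ)
  have h4 : 0 < ‖csqrt w‖ := norm_pos_iff.2 (csqrt_ne_zero hw)
  have h5 : √c ≤ ‖csqrt w‖ := by
    apply Real.sqrt_le_iff.2 ⟨h4.le, ?_⟩
    rwa [norm_sq_csqrt]
  rw [rootA, norm_mul] at h3
  have h6 : ‖1 + m1c σ z w‖ ≤ 4 / τ ^ 2 * (1 + (√c)⁻¹) := by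
    have h7 : ‖1 + m1c σ z w‖ ≤ 4 / τ ^ 2 * (1 + ‖csqrt w‖⁻¹) := by
      have e : 4 / τ ^ 2 * (1 + ‖csqrt w‖⁻¹) = (4 / τ ^ 2 * (1 + ‖csqrt w‖)) / ‖csqrt w‖ := by
        field_simp
        ring
      rw [e, le_div_iff₀ h4]
      linarith
    refine h7.trans ?_
    have := Real.sqrt_pos.2 hc
    gcongr
  linarith

/-- The behaviour of the solution for large `w`. -/
lemma large_bounds (hτ : 0 < τ) (h : Admissible τ σ z) (hw : 0 < w.im) (hW : 16 / τ ≤ ‖w‖) :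
    ‖m1c σ z w‖ ≤ 2 / ‖w‖ ∧ ∀ i, ‖w‖ / 4 ≤ ‖denom σ z (σ i) w‖ ∧ ‖den σ z w i‖ ≤ 3 * ‖w‖ := by
  have p := h.params hτ
  have S := isSol hτ h hw
  have hr := norm_sq_csqrt w
  have hr0 : 0 < ‖csqrt w‖ := norm_pos_iff.2 S.r_ne
  have hA0 : 0 < ‖rootA σ z w‖ := norm_pos_iff.2 S.A_ne
  have h1 := S.norm_r_le p
  have hAeq : ‖rootA σ z w‖ = ‖csqrt w‖ * ‖1 + m1c σ z w‖ := by rw [rootA, norm_mul]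
  have hZ := p.Z_le
  have hτ1 := p.tau_le_one
  set A := rootA σ z w
  set G := rootG σ z w
  set r := csqrt w
  -- |r| ≤ 2 |A| gives |A|² ≥ |w| / 4. The threshold 16 / τ for |w| makes A² at least twice as large
  -- as Z ≤ 2 / τ.
  have hA2 : 4 / τ ≤ ‖A‖ ^ 2 := by
    have : ‖r‖ ^ 2 ≤ (2 * ‖A‖) ^ 2 := by gcongr
    rw [hr] at this
    have e : 16 / τ = 4 * (4 / τ) := by ring
    nlinarith
  have hAG : ‖A * G‖ ≤ 2 := by
    rw [S.G_eq, mul_div_assoc', norm_div, ← sq, norm_pow]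
    have h2 : ‖A‖ ^ 2 / 2 ≤ ‖((‖z‖ ^ 2 : ℝ) : ℂ) - A ^ 2‖ := by
      have h3 := norm_sub_norm_le (A ^ 2) ((‖z‖ ^ 2 : ℝ) : ℂ)
      rw [norm_sub_rev, norm_pow, Complex.norm_real, Real.norm_of_nonneg p.Z_nonneg] at h3
      have : 4 / τ = 2 * (2 / τ) := by ring
      linarith
    rw [div_le_iff₀ (norm_pos_iff.2 S.X_ne)]
    linarith
  -- For large w the denominators are -r A up to the bounded terms Z and σ A G.
  have hq : ∀ i, ‖quo (σ i) (‖z‖ ^ 2) r A G + r * A‖ ≤ 4 / τ := by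
    intro i
    have e : quo (σ i) (‖z‖ ^ 2) r A G + r * A = ((‖z‖ ^ 2 : ℝ) : ℂ) - (σ i : ℂ) * (A * G) := by
      rw [quo]
      ring
    rw [e]
    refine (norm_sub_le _ _).trans ?_
    rw [norm_mul, Complex.norm_real, Complex.norm_real, Real.norm_of_nonneg p.Z_nonneg,
      Real.norm_of_nonneg (p.sigma_pos i).le]
    have h2 : σ i * ‖A * G‖ ≤ τ⁻¹ * 2 := by
      have := p.upper i
      gcongr
    have : 4 / τ = 2 / τ + τ⁻¹ * 2 := by ring
    linarith
  have hrA : ‖w‖ / 2 ≤ ‖r‖ * ‖A‖ := by nlinarith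
  have hq1 : ∀ i, ‖r‖ * ‖A‖ / 2 ≤ ‖quo (σ i) (‖z‖ ^ 2) r A G‖ := by
    intro i
    have h2 := norm_sub_norm_le (r * A) (-quo (σ i) (‖z‖ ^ 2) r A G)
    rw [norm_neg, sub_neg_eq_add, norm_mul] at h2
    have h3 := hq i
    have : 16 / τ = 4 * (4 / τ) := by ring
    rw [add_comm (r * A)] at h2
    linarith
  have hm1 : ‖m1c σ z w‖ ≤ 2 / ‖w‖ := by
    have h2 : ‖A - r‖ ≤ 2 / ‖r‖ := by
      have e : 2 / ‖r‖ = avg (fun i => σ i * (2 / ‖r‖)) := by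
        rw [avg_mul_right, p.mean, one_mul]
      rw [S.eq_A, e]
      refine (norm_avg_le _).trans (avg_mono fun i => ?_)
      have hs := p.sigma_pos i
      rw [norm_div, norm_mul, Complex.norm_real, Real.norm_of_nonneg hs.le, mul_div_assoc]
      refine mul_le_mul_of_nonneg_left ?_ hs.le
      have hq0 : 0 < ‖quo (σ i) (‖z‖ ^ 2) r A G‖ := norm_pos_iff.2 (S.quo_ne i)
      rw [div_le_div_iff₀ hq0 hr0]
      linarith [hq1 i]
    have e : A - r = r * m1c σ z w := by
      simp only [A, r, rootA]
      ring
    rw [e, norm_mul, le_div_iff₀ hr0] at h2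
    rw [le_div_iff₀ (by rw [← hr]; positivity), ← hr]
    linarith [show ‖m1c σ z w‖ * ‖r‖ ^ 2 = ‖r‖ * ‖m1c σ z w‖ * ‖r‖ by ring]
  refine ⟨hm1, fun i => ⟨?_, ?_⟩⟩
  · rw [norm_denom]
    linarith [hq1 i]
  · have ha := half_le_norm_one_add hτ h hw
    have h2 : ‖quo (σ i) (‖z‖ ^ 2) r A G‖ ≤ 4 / τ + ‖r‖ * ‖A‖ := by
      have h3 := norm_sub_le (quo (σ i) (‖z‖ ^ 2) r A G + r * A) (r * A)
      rw [add_sub_cancel_right, norm_mul r A] at h3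
      linarith [hq i]
    have h3 : ‖quo (σ i) (‖z‖ ^ 2) r A G‖ = ‖1 + m1c σ z w‖ * ‖den σ z w i‖ := by
      rw [← norm_denom, norm_denom_eq hτ h hw]
    rw [h3, hAeq] at h2
    have h4 : 4 / τ ≤ ‖w‖ / 4 := by linarith [show 16 / τ = 4 * (4 / τ) by ring]
    have h5 : ‖r‖ * (‖r‖ * ‖1 + m1c σ z w‖) = ‖w‖ * ‖1 + m1c σ z w‖ := by
      rw [← hr]
      ring
    rw [h5] at h2
    have h6 : 0 ≤ ‖w‖ := norm_nonneg _
    by_contra h7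
    push Not at h7
    nlinarith

end

end CircularLaw

namespace CircularLaw

/-! ### The solution near `w = 0` -/

namespace IsSol

variable {τ : ℝ} {N : ℕ} {σ : Fin N → ℝ} {Z : ℝ} {r A G : ℂ}

lemma norm_A_sq_le (p : Params τ σ Z) (h : IsSol σ Z r A G) (hd : ‖r‖ ≤ τ ^ 2 / 4 * ‖A‖) :
    ‖A‖ ^ 2 ≤ 4 / τ := by
  have hτ := p.pos
  have h1 := h.norm_X_le p hd
  have h2 := p.Z_le
  have h3 : ‖A ^ 2‖ ≤ ‖(Z : ℂ)‖ + ‖(Z : ℂ) - A ^ 2‖ := by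
    calc ‖A ^ 2‖ = ‖(Z : ℂ) - (Z - A ^ 2)‖ := by ring_nf
      _ ≤ _ := norm_sub_le _ _
  rw [norm_pow, Complex.norm_real, Real.norm_of_nonneg p.Z_nonneg] at h3
  have h4 : 4 / τ = 2 / τ + 2 / τ := by ring
  linarith

lemma norm_r_mul_A_le (p : Params τ σ Z) (h : IsSol σ Z r A G) {κ : ℝ} (hκ : κ ≤ τ ^ 2 / 4)
    (hd : ‖r‖ ≤ κ * ‖A‖) : ‖r‖ * ‖A‖ ≤ κ * (4 / τ) := by
  have h0 : 0 < ‖A‖ := norm_pos_iff.2 h.A_ne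
  have hκ0 : 0 ≤ κ := by
    by_contra h1
    push Not at h1
    nlinarith [norm_nonneg r]
  have h1 := h.norm_A_sq_le p (hd.trans (by gcongr))
  calc ‖r‖ * ‖A‖ ≤ κ * ‖A‖ * ‖A‖ := by gcongr
    _ = κ * ‖A‖ ^ 2 := by ring
    _ ≤ _ := by gcongr

lemma norm_quo_le_of_small (p : Params τ σ Z) (h : IsSol σ Z r A G)
    (hd : ‖r‖ ≤ τ ^ 2 / 4 * ‖A‖) (i : Fin N) : ‖quo (σ i) Z r A G‖ ≤ 7 / τ ^ 3 := by
  have hτ := p.pos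
  have hτ1 := p.tau_le_one
  have h1 := h.norm_quo_le p i
  have h2 := h.norm_A_sq_le p hd
  have h3 := h.norm_r_mul_A_le p le_rfl hd
  have h4 := p.Z_le
  have h5 : ‖A‖ ^ 2 / τ ^ 2 ≤ 4 / τ / τ ^ 2 := by gcongr
  have h6 : 2 / τ ≤ 2 / τ ^ 3 := by
    gcongr
    exact pow_le_of_le_one hτ.le hτ1 (by norm_num)
  have h7 : τ ^ 2 / 4 * (4 / τ) ≤ 1 / τ ^ 3 := by
    have : τ ^ 2 / 4 * (4 / τ) = τ := by
      field_simp
    rw [this, le_div_iff₀ (by positivity), ← pow_succ']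
    exact pow_le_one₀ hτ.le hτ1
  have h8 : 4 / τ / τ ^ 2 = 4 / τ ^ 3 := by
    field_simp
  have h9 : 7 / τ ^ 3 = 2 / τ ^ 3 + (1 / τ ^ 3 + 4 / τ ^ 3) := by ring
  linarith

lemma AG_add_re_le_of_small (p : Params τ σ Z) (h : IsSol σ Z r A G) {κ : ℝ}
    (hκ : κ ≤ τ ^ 2 / 4) (hd : ‖r‖ ≤ κ * ‖A‖) :
    ‖A * G‖ + (A * G).re ≤ 57 / τ ^ 7 * κ := by
  have hτ := p.pos
  have hτ1 := p.tau_le_one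
  have h0 : 0 < ‖A‖ := norm_pos_iff.2 h.A_ne
  have hd' : ‖r‖ ≤ τ ^ 2 / 4 * ‖A‖ := hd.trans (by gcongr)
  have hκ0 : 0 ≤ κ := by
    by_contra h1
    push Not at h1
    nlinarith [norm_nonneg r]
  refine (h.norm_AG_add_re_le p (h.norm_quo_le_of_small p hd')).trans ?_
  have h1 : ‖r‖ / ‖A‖ ≤ κ := by rwa [div_le_iff₀ h0]
  have h2 := h.norm_r_mul_A_le p hκ hd
  have h3 : (7 / τ ^ 3) ^ 2 / τ * (‖r‖ / ‖A‖) ≤ (7 / τ ^ 3) ^ 2 / τ * κ := by gcongr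
  have h4 : (7 / τ ^ 3) ^ 2 / τ = 49 / τ ^ 7 := by
    field_simp
    norm_num
  have h5 : 1 / τ ≤ 1 / τ ^ 7 := by
    gcongr
    exact pow_le_of_le_one hτ.le hτ1 (by norm_num)
  have h6 : κ * (1 / τ) ≤ κ * (1 / τ ^ 7) := by gcongr
  rw [h4] at h3 ⊢
  have h7 : κ * (4 / τ) = 4 * (κ * (1 / τ)) := by ring
  calc _ ≤ 49 / τ ^ 7 * κ + 8 * (κ * (1 / τ)) := by linarith
    _ ≤ 49 / τ ^ 7 * κ + 8 * (κ * (1 / τ ^ 7)) := by linarith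
    _ = _ := by ring

/-- For `|z| > 1` the quantity `1 + m₁ = A / r` is bounded. -/
lemma norm_A_le_of_gt (p : Params τ σ Z) (hZ : 1 + τ ≤ Z) (h : IsSol σ Z r A G) :
    ‖A‖ ≤ 256 / τ ^ 9 * ‖r‖ := by
  have hτ := p.pos
  have hτ1 := p.tau_le_one
  by_contra hcon
  push Not at hcon
  have h0 : 0 < ‖A‖ := norm_pos_iff.2 h.A_ne
  -- With this κ the defect 57 κ / τ⁷ of -A G from being a nonnegative real stays below τ² / 4,
  -- hence below τ / 4 after multiplication by σ ≤ 1 / τ.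
  set κ := τ ^ 9 / 256 with hκ
  have hτ8 : τ ^ 8 ≤ 1 := pow_le_one₀ hτ.le hτ1
  have hκ2 : κ ≤ τ ^ 2 / 4 := by
    have : τ ^ 9 ≤ τ ^ 2 := pow_le_pow_of_le_one hτ.le hτ1 (by norm_num)
    rw [hκ]
    linarith [sq_nonneg τ]
  have hκ3 : κ ≤ τ / 256 := by
    rw [hκ]
    have : τ ^ 9 ≤ τ := pow_le_of_le_one hτ.le hτ1 (by norm_num)
    linarith
  have hd : ‖r‖ ≤ κ * ‖A‖ := by
    have : 256 / τ ^ 9 * ‖r‖ = ‖r‖ / κ := by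
      rw [hκ]
      field_simp
    rw [this, div_lt_iff₀ (by positivity)] at hcon
    linarith
  have h1 := h.AG_add_re_le_of_small p hκ2 hd
  have h2 := h.norm_r_mul_A_le p hκ2 hd
  have h3 : 57 / τ ^ 7 * κ = 57 / 256 * τ ^ 2 := by
    rw [hκ]
    field_simp
  have h4 : κ * (4 / τ) ≤ τ / 64 := by
    have : κ * (4 / τ) = τ ^ 8 / 64 := by
      rw [hκ]
      field_simp
      norm_num
    rw [this]
    have : τ ^ 8 ≤ τ := pow_le_of_le_one hτ.le hτ1 (by norm_num)
    linarith
  rw [h3] at h1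
  -- Re (A G) is almost nonpositive and r A is small, so Re q is almost at least Z ≥ 1 + τ. Then
  -- |avg (σ / q)| is at most 1 / (1 + τ/2), which contradicts its value 1 - r / A ≈ 1.
  have h5 : ∀ i, 1 + τ / 2 ≤ ‖quo (σ i) Z r A G‖ := by
    intro i
    refine le_trans ?_ (Complex.re_le_norm _)
    have e : quo (σ i) Z r A G = (Z : ℂ) - r * A - (σ i : ℂ) * (A * G) := by
      rw [quo]
      ring
    rw [e, Complex.sub_re, Complex.sub_re, Complex.ofReal_re, Complex.re_ofReal_mul]
    have h6 := Complex.re_le_norm (r * A)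
    rw [norm_mul] at h6
    have h7 : σ i * (A * G).re ≤ τ⁻¹ * (57 / 256 * τ ^ 2) := by
      have h8 : (A * G).re ≤ 57 / 256 * τ ^ 2 := by linarith [norm_nonneg (A * G)]
      have := p.sigma_pos i
      have := p.upper i
      calc σ i * (A * G).re ≤ σ i * (57 / 256 * τ ^ 2) := by gcongr
        _ ≤ _ := by gcongr
    have h9 : τ⁻¹ * (57 / 256 * τ ^ 2) = 57 / 256 * τ := by
      field_simp
    linarith
  have h6 : ‖avg (fun i => (σ i : ℂ) / quo (σ i) Z r A G)‖ ≤ (1 + τ / 2)⁻¹ := by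
    have e : (1 + τ / 2)⁻¹ = avg (fun i => σ i * (1 + τ / 2)⁻¹) := by
      rw [avg_mul_right, p.mean, one_mul]
    rw [e]
    refine (norm_avg_le _).trans (avg_mono fun i => ?_)
    have hs := p.sigma_pos i
    rw [norm_div, Complex.norm_real, Real.norm_of_nonneg hs.le, div_eq_mul_inv]
    gcongr
    exact h5 i
  rw [h.avg_sigma_div] at h6
  have h7 : 1 - κ ≤ ‖1 - r / A‖ := by
    have := norm_sub_norm_le 1 (r / A)
    rw [norm_one, norm_div] at this
    have h8 : ‖r‖ / ‖A‖ ≤ κ := by rwa [div_le_iff₀ h0]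
    linarith
  have h8 : (1 - κ) * (1 + τ / 2) ≤ 1 := by
    have := h7.trans h6
    rwa [le_inv_comm₀ (by linarith) (by positivity), ← one_div, le_div_iff₀ (by linarith),
      mul_comm] at this
  nlinarith

end IsSol

section

variable {τ : ℝ} {N : ℕ} {σ : Fin N → ℝ} {z w : ℂ}

lemma norm_one_add_le_of_gt (hτ : 0 < τ) (h : Admissible τ σ z) (hz : 1 + τ ≤ ‖z‖ ^ 2)
    (hw : 0 < w.im) : ‖1 + m1c σ z w‖ ≤ 256 / τ ^ 9 := by
  have h1 := (isSol hτ h hw).norm_A_le_of_gt (h.params hτ) hz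
  have h2 : 0 < ‖csqrt w‖ := norm_pos_iff.2 (csqrt_ne_zero hw)
  rw [rootA, norm_mul, mul_comm] at h1
  exact le_of_mul_le_mul_right h1 h2

/-- Im (w m₂) enters the denominators of the equation for m₁. The factor |w| in front of Im m₁ is
what allows this feedback to be absorbed near w = 0. -/
lemma Bounded.mul_m2c_im_le {K : ℝ} (b : Bounded τ σ z w K) (hτ : 0 < τ)
    (h : Admissible τ σ z) (hw : 0 < w.im) (hw1 : ‖w‖ ≤ 1) :
    (w * m2c σ z w).im ≤ 3 * K ^ 4 * (‖w‖ * (m1c σ z w).im) + 6 * K ^ 4 * w.im := by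
  have hK1 := b.one_le
  have hy := (m1c_spec hτ h).im_pos w hw
  have ha2 := half_le_norm_one_add hτ h hw
  have e : (w * m2c σ z w)⁻¹ = -(1 + m1c σ z w)
      + ((‖z‖ ^ 2 : ℝ) : ℂ) * (w * (1 + m1c σ z w))⁻¹ := by
    have hw0 : w ≠ 0 := by
      rintro rfl
      simp at hw
    rw [mul_inv, m2c, m2of, inv_inv, mul_inv]
    push_cast
    field_simp
  have hwa : (w * (1 + m1c σ z w)).im ≤ 3 * K * w.im + ‖w‖ * (m1c σ z w).im := by
    have h1 : w.re * (m1c σ z w).im ≤ ‖w‖ * (m1c σ z w).im := by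
      gcongr
      exact Complex.re_le_norm _
    have h2 : w.im * (m1c σ z w).re ≤ w.im * (2 * K) := by
      gcongr
      exact (Complex.re_le_norm _).trans b.norm_m1c_le
    have h3 : w.im ≤ K * w.im := le_mul_of_one_le_left hw.le hK1
    rw [mul_add, mul_one, Complex.add_im, Complex.mul_im]
    linarith
  have e2 : (w * m2c σ z w).im = ‖w * m2c σ z w‖ ^ 2 * (m1c σ z w).im
      + ‖z‖ ^ 2 * (‖m2c σ z w‖ / ‖1 + m1c σ z w‖) ^ 2 * (w * (1 + m1c σ z w)).im := by
    rw [neg_inv_im (w * m2c σ z w), e, Complex.add_im, Complex.neg_im, Complex.im_ofReal_mul,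
      Complex.inv_im, ← Complex.sq_norm, norm_mul w (1 + _), norm_mul w, Complex.add_im,
      Complex.one_im, zero_add]
    have : ‖w‖ ≠ 0 := by
      rw [norm_ne_zero_iff]
      rintro rfl
      simp at hw
    have : ‖1 + m1c σ z w‖ ≠ 0 := by linarith
    field_simp
    ring
  have h3 : ‖m2c σ z w‖ / ‖1 + m1c σ z w‖ ≤ K := by
    rw [m2c_eq_div hτ h hw, norm_div, div_div_cancel_left' (by linarith)]
    refine le_trans ?_ b.inv_le
    exact (inv_le_inv₀ (hτ.trans_le (tau_le_norm_X_root hτ h hw)) hτ).2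
      (tau_le_norm_X_root hτ h hw)
  have h4 : ‖w * m2c σ z w‖ ^ 2 ≤ ‖w‖ * K ^ 4 := by
    rw [norm_mul, mul_pow, sq ‖w‖]
    calc ‖w‖ * ‖w‖ * ‖m2c σ z w‖ ^ 2 ≤ ‖w‖ * 1 * (K ^ 2) ^ 2 := by
          gcongr
          exact b.norm_m2c_le hτ h hw
      _ = _ := by ring
  have h5 : ‖z‖ ^ 2 * (‖m2c σ z w‖ / ‖1 + m1c σ z w‖) ^ 2 ≤ 2 * K ^ 3 := by
    calc _ ≤ 2 * K * K ^ 2 := by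
          gcongr
          exact b.Z_le hτ h
      _ = _ := by ring
  generalize (m1c σ z w).im = y at *
  have hwa0 : 0 ≤ 3 * K * w.im + ‖w‖ * y := by positivity
  rw [e2]
  calc _ ≤ ‖w‖ * K ^ 4 * y + 2 * K ^ 3 * (3 * K * w.im + ‖w‖ * y) := by
        refine add_le_add (by gcongr) ?_
        refine (mul_le_mul_of_nonneg_left hwa (by positivity)).trans ?_
        gcongr
    _ = K ^ 4 * (‖w‖ * y) + 2 * K ^ 3 * (‖w‖ * y) + 6 * K ^ 4 * w.im := by ring
    _ ≤ K ^ 4 * (‖w‖ * y) + 2 * K ^ 4 * (‖w‖ * y) + 6 * K ^ 4 * w.im := by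
        have := pow_le_pow_right₀ hK1 (show 3 ≤ 4 by norm_num)
        gcongr
    _ = _ := by ring

lemma Bounded.norm_denom_ge {K : ℝ} (b : Bounded τ σ z w K) (hτ : 0 < τ)
    (h : Admissible τ σ z) (hw : 0 < w.im) (i : Fin N) :
    ‖z‖ ^ 2 - 2 * (‖w‖ * K ^ 4) ≤ ‖denom σ z (σ i) w‖ := by
  have p := h.params hτ
  have hK1 := b.one_le
  have h1 := (isSol hτ h hw).norm_quo_sub_le p i
  have h2 : ‖csqrt w‖ * ‖rootA σ z w‖ = ‖w‖ * ‖1 + m1c σ z w‖ := by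
    rw [rootA, norm_mul, ← norm_sq_csqrt w]
    ring
  have h3 : ‖rootA σ z w‖ ^ 2 = ‖w‖ * ‖1 + m1c σ z w‖ ^ 2 := by
    rw [rootA, norm_mul, mul_pow, norm_sq_csqrt]
  rw [h2, h3] at h1
  have h5 : ‖w‖ * ‖1 + m1c σ z w‖ ^ 2 / τ ^ 2 ≤ ‖w‖ * K ^ 4 := by
    calc ‖w‖ * ‖1 + m1c σ z w‖ ^ 2 / τ ^ 2 = ‖w‖ * (‖1 + m1c σ z w‖ ^ 2 * τ⁻¹ ^ 2) := by
          rw [inv_pow]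
          ring
      _ ≤ ‖w‖ * (K ^ 2 * K ^ 2) := by
          gcongr
          · exact b.norm_one_add_le
          · exact b.inv_le
      _ = _ := by ring
  have h6 : ‖w‖ * ‖1 + m1c σ z w‖ ≤ ‖w‖ * K ^ 4 := by
    gcongr
    exact b.norm_one_add_le.trans (le_self_pow₀ hK1 (by norm_num))
  rw [norm_denom]
  have h5 := norm_sub_norm_le (((‖z‖ ^ 2 : ℝ) : ℂ))
    (quo (σ i) (‖z‖ ^ 2) (csqrt w) (rootA σ z w) (rootG σ z w))
  rw [norm_sub_rev, Complex.norm_real, Real.norm_of_nonneg p.Z_nonneg] at h5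
  linarith

/-- The part of each summand fed back by Im m₁ has coefficient Z / |denom|². Where 1 + m₁ stays
bounded as w → 0 the denominators tend to -Z, so the coefficient tends to 1 / Z, which is below 1
for |z| > 1. -/
lemma den_inv_im_eq (hτ : 0 < τ) (h : Admissible τ σ z) (hw : 0 < w.im) (i : Fin N) :
    (den σ z w i)⁻¹.im = ‖1 + m1c σ z w‖ ^ 2 * (w.im + σ i * (w * m2c σ z w).im)
      * (‖denom σ z (σ i) w‖ ^ 2)⁻¹ + ‖z‖ ^ 2 / ‖denom σ z (σ i) w‖ ^ 2 * (m1c σ z w).im := by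
  have hden : (den σ z w i).im = _ := den_im i
  have hq := norm_denom_eq hτ h hw i
  have ha2 := half_le_norm_one_add hτ h hw
  have hd0 : 0 < ‖den σ z w i‖ := norm_pos_iff.2 (den_ne hτ h hw i)
  rw [Complex.inv_im, ← Complex.sq_norm, hden, neg_neg, hq]
  have ha0 : ‖1 + m1c σ z w‖ ≠ 0 := by linarith
  field_simp

/-- For `|z| > 1` there is no mass near `0`. -/
lemma m1c_im_le_of_gt (hτ : 0 < τ) :
    ∃ c C : ℝ, 0 < c ∧ 0 < C ∧ ∀ (N : ℕ) (σ : Fin N → ℝ) (z w : ℂ), Admissible τ σ z →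
      1 + τ ≤ ‖z‖ ^ 2 → 0 < w.im → ‖w‖ ≤ c → (m1c σ z w).im ≤ C * w.im := by
  set K := 256 / τ ^ 9 + τ⁻¹ + 1 with hK
  have hK1 : 1 ≤ K := by
    have : 0 < 256 / τ ^ 9 + τ⁻¹ := by positivity
    linarith
  have hτK : τ⁻¹ ≤ K := by
    have : 0 < 256 / τ ^ 9 := by positivity
    linarith
  -- The radius makes the coefficient 12 K⁸ |w| of Im m₁ at most 1/2; absorbing it leaves twice 28
  -- K⁸ Im w.
  refine ⟨(24 * K ^ 8)⁻¹, 70 * K ^ 8, by positivity, by positivity, ?_⟩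
  intro N σ z w h hz hw hwc
  have p := h.params hτ
  have hτ1 := p.tau_le_one
  have ha : ‖1 + m1c σ z w‖ ≤ K := by
    have := norm_one_add_le_of_gt hτ h hz hw
    have : 0 < τ⁻¹ := by positivity
    linarith
  have hwD : ‖w‖ * (24 * K ^ 8) ≤ 1 := by
    calc ‖w‖ * (24 * K ^ 8) ≤ (24 * K ^ 8)⁻¹ * (24 * K ^ 8) := by gcongr
      _ = 1 := inv_mul_cancel₀ (by positivity)
  have hK8 : 1 ≤ K ^ 8 := one_le_pow₀ hK1
  have hw1 : ‖w‖ ≤ 1 := le_trans (le_mul_of_one_le_right (norm_nonneg _) (by linarith)) hwD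
  have b : Bounded τ σ z w K := ⟨hK1, hτK, hw1.trans hK1, ha⟩
  have hE1 := b.mul_m2c_im_le hτ h hw hw1
  have hE0 := mul_m2c_im_pos hτ h hw
  have hy := (m1c_spec hτ h).im_pos w hw
  have hsmall : 2 * (‖w‖ * K ^ 4) ≤ τ / 4 := by
    have h8 : 8 * (‖w‖ * K ^ 4) * K ≤ 1 := by
      refine le_trans ?_ hwD
      have := pow_le_pow_right₀ hK1 (show 5 ≤ 8 by norm_num)
      calc 8 * (‖w‖ * K ^ 4) * K = ‖w‖ * (8 * K ^ 5) := by ring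
        _ ≤ ‖w‖ * (24 * K ^ 8) := by
          gcongr
          norm_num
    have h9 : 1 ≤ τ * K := by
      rw [← mul_inv_cancel₀ hτ.ne']
      gcongr
    have : 8 * (‖w‖ * K ^ 4) ≤ τ := le_of_mul_le_mul_right (h8.trans h9) (by linarith)
    linarith
  have hterm : ∀ i, σ i * (den σ z w i)⁻¹.im
      ≤ σ i * (K ^ 2 * (w.im + K * (w * m2c σ z w).im) + (1 - τ / 4) * (m1c σ z w).im) := by
    intro i
    have hs := p.sigma_pos i
    refine mul_le_mul_of_nonneg_left ?_ hs.le
    have hQi : ‖z‖ ^ 2 - τ / 4 ≤ ‖denom σ z (σ i) w‖ := by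
      have := b.norm_denom_ge hτ h hw i
      linarith
    rw [den_inv_im_eq hτ h hw i]
    generalize ‖denom σ z (σ i) w‖ = q at hQi ⊢
    have hq0 : 0 < q := by linarith
    -- The feedback coefficient is strictly below 1, because q ≥ Z - τ/4 and Z ≥ 1 + τ.
    have h1 : ‖z‖ ^ 2 / q ^ 2 ≤ 1 - τ / 4 := by
      rw [div_le_iff₀ (by positivity)]
      have h2 : (‖z‖ ^ 2 - τ / 4) ^ 2 ≤ q ^ 2 := by
        have : 0 ≤ ‖z‖ ^ 2 - τ / 4 := by linarith
        gcongr
      have h3 : 0 ≤ 1 - τ / 4 := by linarith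
      refine le_trans ?_ (mul_le_mul_of_nonneg_left h2 h3)
      generalize ‖z‖ ^ 2 = Z at hz
      have h4 : Z * (1 + τ / 2) ≤ (Z - τ / 4) ^ 2 := by nlinarith
      refine le_trans ?_ (mul_le_mul_of_nonneg_left h4 h3)
      nlinarith [mul_nonneg hτ.le (sub_nonneg.2 hτ1)]
    have h2 : (q ^ 2)⁻¹ ≤ 1 := by
      apply inv_le_one_of_one_le₀
      apply one_le_pow₀
      linarith
    have h3 : ‖1 + m1c σ z w‖ ^ 2 * (w.im + σ i * (w * m2c σ z w).im) * (q ^ 2)⁻¹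
        ≤ K ^ 2 * (w.im + K * (w * m2c σ z w).im) * 1 := by
      have := (p.upper i).trans hτK
      gcongr
    have h4 : ‖z‖ ^ 2 / q ^ 2 * (m1c σ z w).im ≤ (1 - τ / 4) * (m1c σ z w).im := by gcongr
    linarith
  have hsum : (m1c σ z w).im
      ≤ K ^ 2 * (w.im + K * (w * m2c σ z w).im) + (1 - τ / 4) * (m1c σ z w).im := by
    conv_lhs => rw [m1c_im_eq hτ h hw]
    refine (avg_mono hterm).trans_eq ?_
    rw [avg_mul_right, p.mean, one_mul]
  generalize (m1c σ z w).im = y at *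
  generalize (w * m2c σ z w).im = E at *
  have h1 : y ≤ 4 * K ^ 4 * (w.im + E) := by
    have h2 : τ * y ≤ 4 * (K ^ 2 * (w.im + K * E)) := by linarith
    have h3 : y = τ⁻¹ * (τ * y) := by
      field_simp
    have h4 : w.im ≤ K * w.im := le_mul_of_one_le_left hw.le hK1
    rw [h3]
    calc τ⁻¹ * (τ * y) ≤ K * (4 * (K ^ 2 * (K * w.im + K * E))) := by
          have : 0 ≤ τ * y := by positivity
          refine mul_le_mul hτK (h2.trans ?_) this (by positivity)
          gcongr
      _ = _ := by ring
  have h2 : 4 * K ^ 4 * (w.im + E) ≤ 12 * K ^ 8 * (‖w‖ * y) + 28 * K ^ 8 * w.im := by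
    calc 4 * K ^ 4 * (w.im + E)
        ≤ 4 * K ^ 4 * (w.im + (3 * K ^ 4 * (‖w‖ * y) + 6 * K ^ 4 * w.im)) := by gcongr
      _ = 12 * K ^ 8 * (‖w‖ * y) + 24 * K ^ 8 * w.im + 4 * K ^ 4 * w.im := by ring
      _ ≤ 12 * K ^ 8 * (‖w‖ * y) + 24 * K ^ 8 * w.im + 4 * K ^ 8 * w.im := by
          have := pow_le_pow_right₀ hK1 (show 4 ≤ 8 by norm_num)
          gcongr
      _ = _ := by ring
  have h3 : 12 * K ^ 8 * (‖w‖ * y) ≤ 1 / 2 * y := by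
    calc 12 * K ^ 8 * (‖w‖ * y) = 1 / 2 * (‖w‖ * (24 * K ^ 8)) * y := by ring
      _ ≤ 1 / 2 * 1 * y := by gcongr
      _ = _ := by ring
  have h4 : 0 < K ^ 8 * w.im := by positivity
  linarith

end

end CircularLaw

/-! ### The limiting equation at w = 0 -/

namespace CircularLaw

variable {τ : ℝ} {N : ℕ} {σ : Fin N → ℝ} {Z : ℝ} {r A G : ℂ}

/-- The denominators of the limiting equation at `w = 0`, where `X = Z - A²`. -/
noncomputable def zeroDen (s Z X : ℝ) : ℝ := Z * X + s * (X - Z)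

lemma zeroDen_ge (p : Params τ σ Z) {c X : ℝ} (hc : 0 ≤ c) (hX : Z + c ≤ X) (i : Fin N) :
    Z ^ 2 + τ * c ≤ zeroDen (σ i) Z X := by
  have h0 := p.Z_nonneg
  have h1 := p.lower i
  have h2 : Z * Z ≤ Z * X := by
    gcongr
    linarith
  have h3 : τ * c ≤ σ i * (X - Z) := by
    have := p.sigma_pos i
    gcongr
    linarith
  rw [zeroDen]
  linarith [sq Z]

/-- The value `X = t + Z` of `Z - A²` at `w = 0`. -/
lemma exists_zero_solution (p : Params τ σ Z) (hZ : Z ≤ 1 - τ) :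
    ∃ X : ℝ, Z + τ ^ 5 / 16 ≤ X ∧ X ≤ Z + τ⁻¹ ∧
      avg (fun i => (X - σ i) / zeroDen (σ i) Z X) = 0 := by
  have hτ := p.pos
  have hτ1 := p.tau_le_one
  have hZ0 := p.Z_nonneg
  have hinv := p.one_le_inv
  -- The value for which the error 8 c / τ⁴ arising at the left endpoint is exactly τ / 2.
  set c := τ ^ 5 / 16 with hc
  have hc0 : 0 < c := by positivity
  have hcτ : c ≤ τ / 16 := by
    have : τ ^ 5 ≤ τ := pow_le_of_le_one hτ.le hτ1 (by norm_num)
    linarith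
  have hpos : ∀ X, Z + c ≤ X → ∀ i, 0 < zeroDen (σ i) Z X := fun X hX i => by
    have := zeroDen_ge p hc0.le hX i
    have : 0 < Z ^ 2 + τ * c := by positivity
    linarith
  have hcont : ContinuousOn (fun X => avg (fun i => (X - σ i) / zeroDen (σ i) Z X))
      (Icc (Z + c) (Z + τ⁻¹)) := by
    simp only [avg, smul_eq_mul]
    refine continuousOn_const.mul (continuousOn_finsetSum _ ?_)
    intro i _
    refine ContinuousOn.div (by fun_prop) ?_ fun X hX => (hpos X hX.1 i).ne'
    unfold zeroDen
    fun_prop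
  have hle : Z + c ≤ Z + τ⁻¹ := by linarith
  -- At the right endpoint every numerator is nonnegative because σ ≤ 1 / τ.
  have hhigh : 0 ≤ avg (fun i => (Z + τ⁻¹ - σ i) / zeroDen (σ i) Z (Z + τ⁻¹)) := by
    apply avg_nonneg
    intro i
    apply div_nonneg _ (hpos _ hle i).le
    linarith [p.upper i]
  have hlow : avg (fun i => (Z + c - σ i) / zeroDen (σ i) Z (Z + c)) ≤ 0 := by
    by_cases hcase : Z + c ≤ τ
    · rw [← avg_const p.card_pos (0 : ℝ)]
      apply avg_mono
      intro i
      apply div_nonpos_of_nonpos_of_nonneg _ (hpos _ le_rfl i).le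
      linarith [p.lower i]
    -- Here Z is bounded below, so the denominators vary with i only by O(c). Replacing them by the
    -- common value M leaves the average of X - σ, namely Z + c - 1, which is below -τ/2 and
    -- outweighs the error.
    · push Not at hcase
      set m := Z * (Z + c) with hm
      set M := Z * (Z + c) + τ⁻¹ * c with hM
      have hZτ : τ / 2 ≤ Z := by linarith
      have hm0 : τ ^ 2 / 4 ≤ m := by nlinarith
      have hm1 : 0 < m := by
        have : 0 < τ ^ 2 / 4 := by positivity
        linarith
      have hM0 : 0 < M := by positivity
      have hden : ∀ i, m ≤ zeroDen (σ i) Z (Z + c) ∧ zeroDen (σ i) Z (Z + c) ≤ M := by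
        intro i
        have h1 := p.sigma_pos i
        have h2 := p.upper i
        rw [zeroDen, add_sub_cancel_left]
        constructor
        · have : 0 ≤ σ i * c := by positivity
          linarith
        · have : σ i * c ≤ τ⁻¹ * c := by gcongr
          linarith
      have hterm : ∀ i, (Z + c - σ i) / zeroDen (σ i) Z (Z + c)
          ≤ M⁻¹ * (Z + c - σ i) + 2 / τ * (τ⁻¹ * c / (m * M)) := by
        intro i
        obtain ⟨h1, h2⟩ := hden i
        have h3 := p.lower i
        have h4 := p.upper i
        set d := zeroDen (σ i) Z (Z + c)
        have hd0 : 0 < d := by linarith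
        have h5 : |Z + c - σ i| ≤ 2 / τ := by
          rw [div_eq_mul_inv, abs_le]
          constructor <;> linarith
        have h6 : d⁻¹ - M⁻¹ ≤ τ⁻¹ * c / (m * M) := by
          have e : d⁻¹ - M⁻¹ = (M - d) / (d * M) := by
            field_simp
          rw [e]
          have : 0 ≤ M - d := by linarith
          gcongr
          linarith
        have h7 : 0 ≤ d⁻¹ - M⁻¹ := by
          rw [sub_nonneg]
          gcongr
        calc (Z + c - σ i) / d = M⁻¹ * (Z + c - σ i) + (Z + c - σ i) * (d⁻¹ - M⁻¹) := by
              field_simp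
              ring
          _ ≤ M⁻¹ * (Z + c - σ i) + |Z + c - σ i| * (d⁻¹ - M⁻¹) := by
              gcongr
              exact le_abs_self _
          _ ≤ _ := by gcongr
      refine (avg_mono hterm).trans ?_
      rw [avg_add, avg_mul_left, avg_sub, avg_const p.card_pos, avg_const p.card_pos, p.mean]
      have h8 : 2 / τ * (τ⁻¹ * c / (m * M)) ≤ M⁻¹ * (τ / 2) := by
        calc 2 / τ * (τ⁻¹ * c / (m * M)) ≤ 2 / τ * (τ⁻¹ * c / (τ ^ 2 / 4 * M)) := by gcongr
          _ = M⁻¹ * (τ / 2) := by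
            rw [hc]
            field_simp
            norm_num
      have h9 : M⁻¹ * (Z + c - 1) ≤ M⁻¹ * (-(τ / 2)) := by
        gcongr
        linarith
      linarith
  obtain ⟨X, hX, hX0⟩ := intermediate_value_Icc hle hcont ⟨hlow, hhigh⟩
  exact ⟨X, hX.1, hX.2, hX0⟩

namespace IsSol

/-- Writing X = Z - A², this identifies Z + σ (-A G) with `zeroDen` divided by X. Setting r = 0 in
avg (1/q) = 1/X and avg (σ/q) = 1 - r/A then gives the limiting equation avg ((X - σ) / `zeroDen`) =
0. -/
lemma neg_AG_eq (h : IsSol σ Z r A G) :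
    ((Z : ℂ) - A ^ 2) * (-(A * G)) = ((Z : ℂ) - A ^ 2) - Z := by
  linear_combination (-A) * h.eq_G

/-- Near `w = 0` and for `|z| < 1`, `-A G` has a real part bounded from below. -/
lemma re_neg_AG_ge (p : Params τ σ Z) (hZ : Z ≤ 1 - τ) (h : IsSol σ Z r A G)
    (hr : ‖r‖ ≤ τ ^ 14 / 4096) :
    ‖r‖ ≤ τ ^ 2 / 4 * ‖A‖ ∧ τ ^ 4 / 12 ≤ (-(A * G)).re := by
  have hτ := p.pos
  have hτ1 := p.tau_le_one
  have hA2 := h.norm_A_sq_ge p hZ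
  have hA : τ ^ 2 / 3 ≤ ‖A‖ := by
    apply le_of_sq_le_sq _ (norm_nonneg _)
    refine le_trans ?_ hA2
    have : τ ^ 4 ≤ τ ^ 3 := pow_le_pow_of_le_one hτ.le hτ1 (by norm_num)
    nlinarith [pow_pos hτ 3]
  set κ := τ ^ 12 / 1024 with hκ
  have hd : ‖r‖ ≤ κ * ‖A‖ := by
    refine hr.trans ?_
    calc τ ^ 14 / 4096 ≤ τ ^ 12 / 1024 * (τ ^ 2 / 3) := by
          have : 0 < τ ^ 14 := by positivity
          have e : τ ^ 12 / 1024 * (τ ^ 2 / 3) = τ ^ 14 / 3072 := by ring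
          rw [e]
          gcongr
          norm_num
      _ ≤ _ := by gcongr
  have hκ2 : κ ≤ τ ^ 2 / 4 := by
    have : τ ^ 12 ≤ τ ^ 2 := pow_le_pow_of_le_one hτ.le hτ1 (by norm_num)
    rw [hκ]
    linarith [sq_nonneg τ]
  have hd' : ‖r‖ ≤ τ ^ 2 / 4 * ‖A‖ := hd.trans (by gcongr)
  refine ⟨hd', ?_⟩
  have h1 := h.AG_add_re_le_of_small p hκ2 hd
  have h2 := h.norm_X_le p hd'
  have h3 : τ ^ 4 / 6 ≤ ‖A * G‖ := by
    rw [h.G_eq, mul_div_assoc', norm_div, ← sq, norm_pow]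
    calc τ ^ 4 / 6 = τ ^ 3 / 3 / (2 / τ) := by
          field_simp
          norm_num
      _ ≤ _ := by
          have := norm_pos_iff.2 h.X_ne
          gcongr
  have h4 : 57 / τ ^ 7 * κ ≤ τ ^ 4 / 12 := by
    have e : 57 / τ ^ 7 * κ = 57 / 1024 * τ ^ 5 := by
      rw [hκ]
      field_simp
    rw [e]
    have : τ ^ 5 ≤ τ ^ 4 := pow_le_pow_of_le_one hτ.le hτ1 (by norm_num)
    linarith [pow_pos hτ 4]
  rw [Complex.neg_re]
  linarith

end IsSol

lemma zeroDen_le (p : Params τ σ Z) {X : ℝ} (hX : Z ≤ X) (hX' : X ≤ Z + τ⁻¹) (i : Fin N) :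
    zeroDen (σ i) Z X ≤ 7 / τ ^ 2 := by
  have hτ := p.pos
  have h0 := p.Z_nonneg
  have h1 := p.Z_le
  have h5 : X ≤ 3 / τ := by
    have : 3 / τ = 2 / τ + τ⁻¹ := by ring
    linarith
  have h6 : 0 ≤ X := h0.trans hX
  have h2 : Z * X ≤ 2 / τ * (3 / τ) := by gcongr
  have h3 : σ i * (X - Z) ≤ τ⁻¹ * τ⁻¹ := by
    have := p.upper i
    have := p.sigma_pos i
    gcongr
    linarith
  have h4 : 7 / τ ^ 2 = 2 / τ * (3 / τ) + τ⁻¹ * τ⁻¹ := by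
    field_simp
    norm_num
  rw [zeroDen]
  linarith

/-- The error term in the comparison of `Z - A²` with its limit at `w = 0`. -/
lemma IsSol.norm_X_sub_le (p : Params τ σ Z) (h : IsSol σ Z r A G) {X₀ q M C a : ℝ}
    (hq : 0 < q) (hM : 0 < M) (ha : 0 < a) (hX : ∀ i, 0 < zeroDen (σ i) Z X₀)
    (hX0 : avg (fun i => (X₀ - σ i) / zeroDen (σ i) Z X₀) = 0)
    (hXM : ∀ i, zeroDen (σ i) Z X₀ ≤ M)
    (hP : ∀ i, q ≤ ((Z : ℂ) + (σ i : ℂ) * -(A * G)).re)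
    (hPM : ∀ i, ‖(Z : ℂ) + (σ i : ℂ) * -(A * G)‖ ≤ M)
    (hQ : ∀ i, q ≤ ‖quo (σ i) Z r A G‖) (hC : ‖(Z : ℂ) - A ^ 2‖ ≤ C)
    (hA : a ≤ ‖A‖) (hAC : ‖A‖ ≤ C) (hτC : τ⁻¹ ≤ C) :
    ‖(Z : ℂ) - A ^ 2 - X₀‖
      ≤ (C * M / a + (C + C) * C) / (q * q) / (τ ^ 2 * q / (M ^ 2 * M)) * ‖r‖ := by
  have hτ := p.pos
  have hA0 := h.A_ne
  have hX1 := h.X_ne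
  have hx := h.neg_AG_eq
  have hC0 : 0 < C := ha.trans_le (hA.trans hAC)
  set X := (Z : ℂ) - A ^ 2 with hXdef
  have hPne : ∀ i, (Z : ℂ) + (σ i : ℂ) * -(A * G) ≠ 0 := by
    intro i h0
    have := hP i
    rw [h0, Complex.zero_re] at this
    linarith
  have hPnorm : ∀ i, q ≤ ‖(Z : ℂ) + (σ i : ℂ) * -(A * G)‖ := fun i =>
    (hP i).trans (Complex.re_le_norm _)
  set P : Fin N → ℂ := fun i => (Z : ℂ) + (σ i : ℂ) * -(A * G) with hPdef
  have hQP : ∀ i, quo (σ i) Z r A G = P i - r * A := by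
    intro i
    simp only [hPdef, quo]
    ring
  have hXP : ∀ i, X * P i = Z * X + (σ i : ℂ) * (X - Z) := by
    intro i
    simp only [hPdef]
    linear_combination (σ i : ℂ) * hx
  -- the equation for `X`
  have e1 : avg (fun i => (X * (1 - r / A) - σ i) / quo (σ i) Z r A G) = 0 := by
    have e : ∀ i, (X * (1 - r / A) - σ i) / quo (σ i) Z r A G
        = X * (1 - r / A) * (1 / quo (σ i) Z r A G) - (σ i : ℂ) / quo (σ i) Z r A G := by
      intro i
      ring
    simp only [e]
    rw [avg_sub, avg_mul_left, h.avg_one_div p, h.avg_sigma_div, ← hXdef]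
    field_simp
    ring
  have e2 : avg (fun i => ((X₀ : ℂ) - σ i) / (zeroDen (σ i) Z X₀ : ℂ)) = 0 := by
    have := congrArg (fun x : ℝ => (x : ℂ)) hX0
    simp only [ofReal_avg] at this
    push_cast at this
    exact this
  -- Subtracting X times the equation for X₀ from the exact equation isolates X - X₀. The remainder
  -- is proportional to r: it comes from q = P - r A and from the term r / A.
  have e3 : (X - X₀) * avg (fun i => (σ i : ℂ) ^ 2 / (P i * (zeroDen (σ i) Z X₀ : ℂ)))
      = avg (fun i => r * (X * P i / A - (X - σ i) * A) / (P i * quo (σ i) Z r A G)) := by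
    rw [← avg_mul_left]
    have e4 : avg (fun i => (X - X₀) * ((σ i : ℂ) ^ 2 / (P i * (zeroDen (σ i) Z X₀ : ℂ))))
        = avg (fun i => r * (X * P i / A - (X - σ i) * A) / (P i * quo (σ i) Z r A G)
          + ((X * (1 - r / A) - σ i) / quo (σ i) Z r A G
            - X * (((X₀ : ℂ) - σ i) / (zeroDen (σ i) Z X₀ : ℂ)))) := by
      congr 1
      ext i
      have hD : (zeroDen (σ i) Z X₀ : ℂ) ≠ 0 := Complex.ofReal_ne_zero.2 (hX i).ne'
      have hDe : (zeroDen (σ i) Z X₀ : ℂ) = Z * X₀ + (σ i : ℂ) * (X₀ - Z) := by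
        rw [zeroDen]
        push_cast
        ring
      have hQne := h.quo_ne i
      have hPi := hPne i
      have hXPi := hXP i
      have hQPi := hQP i
      change P i ≠ 0 at hPi
      have t1 : r * (X * P i / A - (X - σ i) * A) / (P i * quo (σ i) Z r A G)
          + (X * (1 - r / A) - σ i) / quo (σ i) Z r A G = (X - σ i) / P i := by
        have t2 : P i = quo (σ i) Z r A G + r * A := by
          rw [hQPi]
          ring
        field_simp
        rw [t2]
        ring
      have t3 : (X - X₀) * ((σ i : ℂ) ^ 2 / (P i * (zeroDen (σ i) Z X₀ : ℂ)))
          = (X - σ i) / P i - X * (((X₀ : ℂ) - σ i) / (zeroDen (σ i) Z X₀ : ℂ)) := by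
        field_simp
        rw [hDe]
        linear_combination (X₀ - (σ i : ℂ)) * hXPi
      rw [t3, ← t1]
      ring
    rw [e4, avg_add, avg_sub, avg_mul_left, e1, e2]
    ring
  have hR : ‖avg (fun i => r * (X * P i / A - (X - σ i) * A) / (P i * quo (σ i) Z r A G))‖
      ≤ (C * M / a + (C + C) * C) / (q * q) * ‖r‖ := by
    refine (norm_avg_le _).trans (avg_le_of_le p.card_pos fun i => ?_)
    rw [norm_div, norm_mul, norm_mul]
    have t1 : ‖X * P i / A - (X - σ i) * A‖ ≤ C * M / a + (C + C) * C := by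
      refine (norm_sub_le _ _).trans ?_
      rw [norm_div, norm_mul, norm_mul]
      gcongr
      · exact hPM i
      · refine (norm_sub_le _ _).trans ?_
        rw [Complex.norm_real, Real.norm_of_nonneg (p.sigma_pos i).le]
        gcongr
        exact (p.upper i).trans hτC
    have t2 : q * q ≤ ‖P i‖ * ‖quo (σ i) Z r A G‖ := by
      have := hPnorm i
      have := hQ i
      gcongr
    calc _ ≤ ‖r‖ * (C * M / a + (C + C) * C) / (q * q) := by gcongr
      _ = _ := by ring
  -- Stability: since Re P is bounded below, all summands have positive real part and cannot cancel.
  have hS : τ ^ 2 * q / (M ^ 2 * M)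
      ≤ ‖avg (fun i => (σ i : ℂ) ^ 2 / (P i * (zeroDen (σ i) Z X₀ : ℂ)))‖ := by
    refine le_trans ?_ (Complex.re_le_norm _)
    rw [re_avg]
    apply le_avg_of_le p.card_pos
    intro i
    have t1 : ((σ i : ℂ) ^ 2 / (P i * (zeroDen (σ i) Z X₀ : ℂ))).re
        = σ i ^ 2 * (P i).re / (‖P i‖ ^ 2 * zeroDen (σ i) Z X₀) := by
      have e : (σ i : ℂ) ^ 2 / (P i * (zeroDen (σ i) Z X₀ : ℂ))
          = ((σ i ^ 2 / zeroDen (σ i) Z X₀ : ℝ) : ℂ) * (P i)⁻¹ := by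
        push_cast
        rw [div_mul_eq_div_div_swap]
        rfl
      rw [e, Complex.re_ofReal_mul, Complex.inv_re, Complex.sq_norm]
      have := hX i
      field_simp
    rw [t1]
    have := hX i
    have := hP i
    have := p.lower i
    have h6 : 0 < ‖P i‖ := hq.trans_le (hPnorm i)
    have := hPM i
    have := hXM i
    have : 0 ≤ (P i).re := hq.le.trans (hP i)
    change q ≤ (P i).re at *
    gcongr
  have hS0 : 0 < τ ^ 2 * q / (M ^ 2 * M) := by positivity
  have h7 := congrArg norm e3
  rw [norm_mul] at h7
  rw [div_mul_eq_mul_div, le_div_iff₀ hS0]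
  calc ‖X - X₀‖ * (τ ^ 2 * q / (M ^ 2 * M)) ≤ ‖X - X₀‖ * _ := by gcongr
    _ = _ := h7
    _ ≤ _ := hR

/-- The solution near `w = 0` for `|z| < 1`. -/
lemma near_zero (hτ : 0 < τ) :
    ∃ c C : ℝ, 0 < c ∧ 0 < C ∧ ∀ (N : ℕ) (σ : Fin N → ℝ) (Z : ℝ), Params τ σ Z → Z ≤ 1 - τ →
      ∃ t : ℝ, c ≤ t ∧ t ≤ τ⁻¹ ∧ ∀ r A G : ℂ, IsSol σ Z r A G → ‖r‖ ≤ c →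
        ‖A - Complex.I * (√t : ℝ)‖ ≤ C * ‖r‖ ∧
        ‖G - Complex.I * (√t : ℝ) / ((t : ℂ) + Z)‖ ≤ C * ‖r‖ ∧
        ∀ i, c ≤ ‖quo (σ i) Z r A G‖ := by
  set q := τ ^ 5 / 24 with hqdef
  have hq : 0 < q := by positivity
  set M := 7 / τ ^ 3 with hMdef
  have hM : 0 < M := by positivity
  set a := τ ^ 2 / 3 with hadef
  have ha : 0 < a := by positivity
  set C := 2 / τ with hCdef
  have hC : 0 < C := by positivity
  set C₁ := (C * M / a + (C + C) * C) / (q * q) / (τ ^ 2 * q / (M ^ 2 * M)) with hC₁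
  have hC₁0 : 0 < C₁ := by positivity
  set c := min (τ ^ 14 / 4096) (τ ^ 5 / 24) with hcdef
  set d := √(τ ^ 5 / 16) with hd
  have hd0 : 0 < d := Real.sqrt_pos.2 (by positivity)
  refine ⟨c, C₁ / d + (C₁ / d / τ + √τ⁻¹ * C₁ / (τ * (τ ^ 5 / 16))), by positivity,
    by positivity, ?_⟩
  intro N σ Z p hZ
  have hτ1 := p.tau_le_one
  obtain ⟨X₀, hX1, hX2, hX3⟩ := exists_zero_solution p hZ
  have hZ0 := p.Z_nonneg
  have ht0 : τ ^ 5 / 16 ≤ X₀ - Z := by linarith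
  refine ⟨X₀ - Z, ?_, by linarith, fun r A G h hr => ?_⟩
  · refine (min_le_right _ _).trans (le_trans ?_ ht0)
    gcongr
    norm_num
  obtain ⟨hsmall, hre⟩ := h.re_neg_AG_ge p hZ (hr.trans (min_le_left _ _))
  have hA2 := h.norm_A_sq_le p hsmall
  have hXn := h.norm_X_le p hsmall
  have hAC : ‖A‖ ≤ C := by
    apply le_of_sq_le_sq _ hC.le
    refine hA2.trans ?_
    rw [hCdef, div_pow, div_le_div_iff₀ hτ (by positivity)]
    nlinarith
  have hAa : a ≤ ‖A‖ := by
    apply le_of_sq_le_sq _ (norm_nonneg _)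
    refine le_trans ?_ (h.norm_A_sq_ge p hZ)
    have : τ ^ 4 ≤ τ ^ 3 := pow_le_pow_of_le_one hτ.le hτ1 (by norm_num)
    rw [hadef]
    nlinarith [pow_pos hτ 3]
  have hP : ∀ i, τ ^ 5 / 12 ≤ ((Z : ℂ) + (σ i : ℂ) * -(A * G)).re := by
    intro i
    rw [Complex.add_re, Complex.ofReal_re, Complex.re_ofReal_mul]
    have : τ * (τ ^ 4 / 12) ≤ σ i * (-(A * G)).re := by
      have := p.lower i
      have := (p.sigma_pos i).le
      gcongr
    linarith [show τ * (τ ^ 4 / 12) = τ ^ 5 / 12 by ring]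
  have hQP : ∀ i, quo (σ i) Z r A G = (Z : ℂ) + (σ i : ℂ) * -(A * G) - r * A := by
    intro i
    rw [quo]
    ring
  have hrA : ‖r * A‖ ≤ τ ^ 5 / 24 := by
    rw [norm_mul]
    calc ‖r‖ * ‖A‖ ≤ τ ^ 14 / 4096 * (2 / τ) := by
          gcongr
          exact hr.trans (min_le_left _ _)
      _ = τ ^ 13 / 2048 := by
          field_simp
          norm_num
      _ ≤ τ ^ 5 / 24 := by
          have : τ ^ 13 ≤ τ ^ 5 := pow_le_pow_of_le_one hτ.le hτ1 (by norm_num)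
          linarith [pow_pos hτ 5]
  have hQ : ∀ i, q ≤ ‖quo (σ i) Z r A G‖ := by
    intro i
    refine le_trans ?_ (Complex.re_le_norm _)
    rw [hQP, Complex.sub_re]
    have := hP i
    have := (Complex.re_le_norm (r * A)).trans hrA
    linarith
  have hPM : ∀ i, ‖(Z : ℂ) + (σ i : ℂ) * -(A * G)‖ ≤ M := by
    intro i
    refine (norm_add_le _ _).trans ?_
    rw [mul_neg, norm_neg, Complex.norm_real, Real.norm_of_nonneg hZ0]
    have t1 := h.norm_AG_le p i
    have t2 : ‖A‖ ^ 2 / τ ^ 2 ≤ 4 / τ / τ ^ 2 := by gcongr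
    have t3 : 2 / τ ≤ 2 / τ ^ 3 := by
      gcongr
      exact pow_le_of_le_one hτ.le hτ1 (by norm_num)
    have t4 : 4 / τ / τ ^ 2 = 4 / τ ^ 3 := by
      field_simp
    have t5 : M = 2 / τ ^ 3 + 4 / τ ^ 3 + 1 / τ ^ 3 := by
      rw [hMdef]
      ring
    have t6 : 0 < 1 / τ ^ 3 := by positivity
    linarith [p.Z_le]
  have hXM : ∀ i, zeroDen (σ i) Z X₀ ≤ M := by
    intro i
    refine (zeroDen_le p (by linarith [pow_pos hτ 5]) hX2 i).trans ?_
    rw [hMdef]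
    exact div_le_div_of_nonneg_left (by norm_num) (by positivity)
      (pow_le_pow_of_le_one hτ.le hτ1 (by norm_num))
  have hXpos : ∀ i, 0 < zeroDen (σ i) Z X₀ := by
    intro i
    have := zeroDen_ge p (by positivity) hX1 i
    have : 0 < Z ^ 2 + τ * (τ ^ 5 / 16) := by positivity
    linarith
  have hmain := h.norm_X_sub_le p hq hM ha hXpos hX3 hXM
    (fun i => (by linarith [hP i, pow_pos hτ 5] : q ≤ _)) hPM hQ hXn hAa hAC
    (by rw [inv_eq_one_div]; gcongr; norm_num)
  rw [← hC₁] at hmain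
  set s := √(X₀ - Z) with hs
  have hds : d ≤ s := Real.sqrt_le_sqrt ht0
  have hs2 : (s : ℂ) ^ 2 = X₀ - Z := by
    rw [← Complex.ofReal_pow, Real.sq_sqrt (by linarith [pow_pos hτ 5])]
    push_cast
    rfl
  -- A² = Z - X determines A only up to sign. Since A and i s lie in the upper half plane, A + i s
  -- is bounded below, which selects the root.
  have hAI : ‖A - Complex.I * s‖ ≤ C₁ / d * ‖r‖ := by
    have e : (A - Complex.I * s) * (A + Complex.I * s) = -((Z : ℂ) - A ^ 2 - X₀) := by
      linear_combination hs2 - (s : ℂ) ^ 2 * Complex.I_sq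
    have h1 : d ≤ ‖A + Complex.I * s‖ := by
      refine le_trans ?_ (Complex.im_le_norm _)
      have : (A + Complex.I * s).im = A.im + s := by simp
      rw [this]
      linarith [h.A_im, h.im_pos]
    have h2 := congrArg norm e
    rw [norm_mul, norm_neg] at h2
    rw [div_mul_eq_mul_div, le_div_iff₀ hd0]
    calc ‖A - Complex.I * s‖ * d ≤ ‖A - Complex.I * s‖ * ‖A + Complex.I * s‖ := by gcongr
      _ ≤ _ := by
        rw [h2]
        exact hmain
  have hr0 : 0 ≤ ‖r‖ := norm_nonneg r
  have hlast : 0 ≤ C₁ / d / τ + √τ⁻¹ * C₁ / (τ * (τ ^ 5 / 16)) := by positivity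
  refine ⟨hAI.trans ?_, ?_, fun i => (min_le_right _ _).trans (hQ i)⟩
  · exact mul_le_mul_of_nonneg_right (by linarith) hr0
  · have hX0pos : τ ^ 5 / 16 ≤ X₀ := by linarith
    have hX0ne : (X₀ : ℂ) ≠ 0 := by
      rw [Complex.ofReal_ne_zero]
      have : 0 < τ ^ 5 / 16 := by positivity
      linarith
    have e : ((X₀ - Z : ℝ) : ℂ) + Z = X₀ := by
      push_cast
      ring
    have hXne := h.X_ne
    have hXτ := h.tau_le_norm_X p
    rw [e, h.G_eq]
    have e2 : A / ((Z : ℂ) - A ^ 2) - Complex.I * s / X₀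
        = (A - Complex.I * s) / ((Z : ℂ) - A ^ 2)
          - Complex.I * s * ((Z : ℂ) - A ^ 2 - X₀) / (((Z : ℂ) - A ^ 2) * X₀) := by
      field_simp
      ring
    rw [e2]
    refine (norm_sub_le _ _).trans ?_
    have hsτ : ‖(s : ℂ)‖ ≤ √τ⁻¹ := by
      rw [Complex.norm_real, Real.norm_of_nonneg (Real.sqrt_nonneg _)]
      apply Real.sqrt_le_sqrt
      linarith
    have h1 : ‖(A - Complex.I * s) / ((Z : ℂ) - A ^ 2)‖ ≤ C₁ / d * ‖r‖ / τ := by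
      rw [norm_div]
      gcongr
    have h2 : ‖Complex.I * s * ((Z : ℂ) - A ^ 2 - X₀) / (((Z : ℂ) - A ^ 2) * X₀)‖
        ≤ √τ⁻¹ * (C₁ * ‖r‖) / (τ * (τ ^ 5 / 16)) := by
      rw [norm_div, norm_mul, norm_mul, norm_mul, Complex.norm_I, one_mul, Complex.norm_real X₀,
        Real.norm_of_nonneg (by linarith [pow_pos hτ 5])]
      gcongr
    have h3 : 0 ≤ C₁ / d * ‖r‖ := by positivity
    calc _ ≤ C₁ / d * ‖r‖ / τ + √τ⁻¹ * (C₁ * ‖r‖) / (τ * (τ ^ 5 / 16)) := add_le_add h1 h2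
      _ = (C₁ / d / τ + √τ⁻¹ * C₁ / (τ * (τ ^ 5 / 16))) * ‖r‖ := by ring
      _ ≤ _ := by
        have : 0 ≤ C₁ / d := by positivity
        exact mul_le_mul_of_nonneg_right (by linarith) hr0

end CircularLaw

/-! ### Boundary limits and the polynomial equation -/

namespace CircularLaw

/-- A function into a metric space whose cluster values lie in a finite set converges along every
filter that has a basis of preconnected sets. -/
theorem exists_tendsto_of_cluster_finite {X Y : Type*} [TopologicalSpace X] [MetricSpace Y]
    {l : Filter X} [l.NeBot] {f : X → Y} {K S : Set Y} (hK : IsCompact K) (hS : S.Finite)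
    (hb : ∀ t ∈ l, ∃ V ∈ l, V ⊆ t ∧ IsPreconnected V ∧ ContinuousOn f V)
    (hfK : ∀ᶠ x in l, f x ∈ K) (hcl : ∀ a, MapClusterPt a l f → a ∈ S) :
    ∃ a, Tendsto f l (𝓝 a) := by
  obtain ⟨a, -, ha⟩ := hK.exists_mapClusterPt_of_frequently hfK.frequently
  refine ⟨a, Metric.tendsto_nhds.2 fun ε hε => ?_⟩
  -- A radius whose sphere about the cluster value a misses S. By compactness f eventually avoids
  -- this sphere, and on a connected set it cannot jump across.
  obtain ⟨δ, ⟨hδ0, hδε⟩, hδS⟩ : ∃ δ ∈ Ioo 0 ε, δ ∉ (fun y => dist y a) '' S :=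
    ((Ioo_infinite hε).sdiff (hS.image _)).nonempty
  have hsph : ∀ᶠ x in l, dist (f x) a ≠ δ := by
    by_contra hcon
    have h1 : ∃ᶠ x in l, f x ∈ K ∩ Metric.sphere a δ := by
      refine ((not_eventually.1 hcon).and_eventually hfK).mono ?_
      rintro x ⟨hx, hxK⟩
      exact ⟨hxK, not_not.1 hx⟩
    obtain ⟨b, hbK, hb⟩ :=
      (hK.inter_right Metric.isClosed_sphere).exists_mapClusterPt_of_frequently h1
    exact hδS ⟨b, hcl b hb, hbK.2⟩
  obtain ⟨V, hV, hVs, hVc, hVf⟩ := hb _ hsph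
  have hfr : ∃ᶠ x in l, dist (f x) a < δ := ha.frequently (Metric.ball_mem_nhds a hδ0)
  obtain ⟨x₀, hx₀, hx₀V⟩ := (hfr.and_eventually hV).exists
  filter_upwards [hV] with x hx
  refine lt_trans ?_ hδε
  by_contra hcon
  push Not at hcon
  have hcont : ContinuousOn (fun x => dist (f x) a) V := continuous_dist.comp_continuousOn (ContinuousOn.prodMk hVf continuousOn_const)
  obtain ⟨y, hy, hy2⟩ := hVc.intermediate_value hx₀V hx hcont ⟨hx₀.le, hcon⟩
  exact hVs hy hy2

/-- The upper half plane. -/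
def upperHalf : Set ℂ := {w | 0 < w.im}

lemma convex_upperHalf : Convex ℝ upperHalf := convex_halfSpace_im_gt 0

instance nhdsWithin_upperHalf_neBot (x : ℝ) : (𝓝[upperHalf] (x : ℂ)).NeBot := by
  rw [← mem_closure_iff_nhdsWithin_neBot, Metric.mem_closure_iff]
  intro ε hε
  refine ⟨x + (ε / 2 : ℝ) * Complex.I, ?_, ?_⟩
  · simp only [upperHalf, mem_ofPred_eq]
    simp [hε]
  · rw [Complex.dist_eq, sub_add_cancel_left, norm_neg, norm_mul, Complex.norm_I, mul_one,
      Complex.norm_real, Real.norm_of_nonneg (by positivity)]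
    linarith

lemma tendsto_vertical (x : ℝ) :
    Tendsto (fun η : ℝ => (x : ℂ) + (η : ℂ) * Complex.I) (𝓝[>] (0 : ℝ)) (𝓝[upperHalf] (x : ℂ)) := by
  apply tendsto_nhdsWithin_iff.2
  constructor
  · have : Tendsto (fun η : ℝ => (x : ℂ) + (η : ℂ) * Complex.I) (𝓝 0)
        (𝓝 ((x : ℂ) + ((0 : ℝ) : ℂ) * Complex.I)) := by
      apply Continuous.tendsto
      fun_prop
    simp only [Complex.ofReal_zero, zero_mul, add_zero] at this
    exact this.mono_left nhdsWithin_le_nhds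
  · filter_upwards [self_mem_nhdsWithin] with η hη
    simp only [upperHalf, mem_ofPred_eq]
    simpa using hη

section Polynomial

open Polynomial

variable {N : ℕ} (σ : Fin N → ℝ) (z : ℂ)

/-- The cubics `p_i` as polynomials in `m`. -/
noncomputable def cubicPoly (s : ℝ) (z r : ℂ) : ℂ[X] :=
  C r * X ^ 3 - C ((s : ℂ) + (‖z‖ : ℂ) ^ 2) * X ^ 2 - C (r * (‖z‖ : ℂ) ^ 2) * X + C ((‖z‖ : ℂ) ^ 4)

lemma eval_cubicPoly (s : ℝ) (z r m : ℂ) : (cubicPoly s z r).eval m = cubic s z r m := by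
  simp [cubicPoly, cubic]

/-- The equation `f(r, m) = 0` with the denominators cleared. -/
noncomputable def clearedPoly (r : ℂ) : ℂ[X] :=
  (X - C r) * ∏ i, cubicPoly (σ i) z r + C (1 / (N : ℂ)) * ∑ i, C (σ i : ℂ) *
    (X * (X ^ 2 - C ((‖z‖ : ℂ) ^ 2))) * ∏ j ∈ Finset.univ.erase i, cubicPoly (σ j) z r

lemma eval_clearedPoly (r m : ℂ) : (clearedPoly σ z r).eval m
    = (m - r) * ∏ i, cubic (σ i) z r m + 1 / (N : ℂ) * ∑ i, (σ i : ℂ) *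
      (m * (m ^ 2 - (‖z‖ : ℂ) ^ 2)) * ∏ j ∈ Finset.univ.erase i, cubic (σ j) z r m := by
  simp [clearedPoly, eval_finsetSum, eval_prod, eval_cubicPoly]

lemma eval_clearedPoly_eq {r m : ℂ} (h : ∀ i, cubic (σ i) z r m ≠ 0) :
    (clearedPoly σ z r).eval m = fFun σ z r m * ∏ i, cubic (σ i) z r m := by
  rw [eval_clearedPoly, fFun, add_mul, mul_assoc (1 / (N : ℂ)), Finset.sum_mul]
  congr 1
  · ring
  · congr 1
    refine Finset.sum_congr rfl fun i _ => ?_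
    rw [← Finset.mul_prod_erase _ _ (Finset.mem_univ i)]
    have := h i
    field_simp

lemma continuous_eval_clearedPoly :
    Continuous fun q : ℂ × ℂ => (clearedPoly σ z q.1).eval q.2 := by
  simp only [eval_clearedPoly, cubic]
  fun_prop

end Polynomial

variable {τ : ℝ} {N : ℕ} {σ : Fin N → ℝ} {z : ℂ}

lemma fFun_eq (r m : ℂ) : fFun σ z r m
    = -r + m + avg (fun i => (σ i : ℂ) * (m * (m ^ 2 - (‖z‖ : ℂ) ^ 2) / cubic (σ i) z r m)) := by
  rw [avg_eq_complex]
  rfl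

/-- The polynomial is tested at m = -t for large t > 0: there every cubic is negative, and f is
negative because the averaged term is at most 1 / r < t. -/
lemma clearedPoly_ne_zero (hτ : 0 < τ) (h : Admissible τ σ z) {r : ℝ} (hr : 0 < r) :
    clearedPoly σ z (r : ℂ) ≠ 0 := by
  have p := h.params hτ
  set Z := ‖z‖ ^ 2 with hZ
  have hZ0 : 0 ≤ Z := p.Z_nonneg
  set t := 1 + Z + r⁻¹ with ht
  have hr' : 0 < r⁻¹ := inv_pos.2 hr
  have ht0 : 0 < t := by positivity
  have ht1 : Z < t ^ 2 := by nlinarith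
  set d : Fin N → ℝ := fun i => r * t * (t ^ 2 - Z) + σ i * t ^ 2 + Z * (t ^ 2 - Z) with hd
  have ht2 : 0 < t ^ 2 - Z := by linarith
  have hd0 : ∀ i, r * t * (t ^ 2 - Z) < d i := by
    intro i
    have := p.sigma_pos i
    have h1 : 0 < σ i * t ^ 2 := by positivity
    have h2 : 0 ≤ Z * (t ^ 2 - Z) := by positivity
    simp only [hd]
    linarith
  have hdpos : ∀ i, 0 < d i := fun i => lt_trans (by positivity) (hd0 i)
  have hcub : ∀ i, cubic (σ i) z r (-t : ℝ) = (-d i : ℝ) := by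
    intro i
    simp only [hd, cubic, hZ]
    push_cast
    ring
  have hne : ∀ i, cubic (σ i) z r (-t : ℝ) ≠ 0 := by
    intro i
    rw [hcub, Complex.ofReal_ne_zero]
    linarith [hdpos i]
  have hf : fFun σ z r (-t : ℝ) = ((-r - t + avg (fun i => σ i * (t * (t ^ 2 - Z) / d i)) : ℝ) : ℂ) := by
    rw [fFun_eq]
    rw [Complex.ofReal_add, ofReal_avg]
    congr 1
    · push_cast
      ring
    congr 1
    ext i
    rw [hcub]
    have := Complex.ofReal_ne_zero.2 (hdpos i).ne'
    simp only [hZ]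
    push_cast
    field_simp
  intro h0
  have h1 := eval_clearedPoly_eq σ z hne
  rw [h0, Polynomial.eval_zero, eq_comm, mul_eq_zero] at h1
  rcases h1 with h1 | h1
  · rw [hf, Complex.ofReal_eq_zero] at h1
    have h2 : avg (fun i => σ i * (t * (t ^ 2 - Z) / d i)) ≤ avg (fun i => σ i * r⁻¹) := by
      apply avg_mono
      intro i
      have := (p.sigma_pos i).le
      gcongr
      rw [div_le_iff₀ (hdpos i)]
      calc t * (t ^ 2 - Z) = r⁻¹ * (r * t * (t ^ 2 - Z)) := by field_simp
        _ ≤ _ := by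
          have := hd0 i
          gcongr
    rw [avg_mul_right, p.mean, one_mul] at h2
    linarith
  · rw [Finset.prod_eq_zero_iff] at h1
    obtain ⟨i, -, hi⟩ := h1
    exact hne i hi

/-- `cubic = X Q`. -/
lemma cubic_root_eq {w : ℂ} (hτ : 0 < τ) (h : Admissible τ σ z) (hw : 0 < w.im) (s : ℝ) :
    cubic s z (csqrt w) (rootA σ z w) = (((‖z‖ ^ 2 : ℝ) : ℂ) - rootA σ z w ^ 2)
      * quo s (‖z‖ ^ 2) (csqrt w) (rootA σ z w) (rootG σ z w) := by
  have h1 := (isSol hτ h hw).eq_G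
  rw [cubic, quo]
  push_cast at *
  linear_combination (rootA σ z w * (s : ℂ)) * h1

lemma cubic_root_ne {w : ℂ} (hτ : 0 < τ) (h : Admissible τ σ z) (hw : 0 < w.im) (i : Fin N) :
    cubic (σ i) z (csqrt w) (rootA σ z w) ≠ 0 := by
  rw [cubic_root_eq hτ h hw]
  have S := isSol hτ h hw
  exact mul_ne_zero S.X_ne (S.quo_ne i)

lemma fFun_root {w : ℂ} (hτ : 0 < τ) (h : Admissible τ σ z) (hw : 0 < w.im) :
    fFun σ z (csqrt w) (rootA σ z w) = 0 := by
  have S := isSol hτ h hw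
  have p := h.params hτ
  have hA := S.A_ne
  have hX := S.X_ne
  rw [fFun_eq]
  have e : ∀ i, (σ i : ℂ) * (rootA σ z w * (rootA σ z w ^ 2 - (‖z‖ : ℂ) ^ 2)
      / cubic (σ i) z (csqrt w) (rootA σ z w)) = -rootA σ z w *
      ((σ i : ℂ) / quo (σ i) (‖z‖ ^ 2) (csqrt w) (rootA σ z w) (rootG σ z w)) := by
    intro i
    rw [cubic_root_eq hτ h hw]
    have := S.quo_ne i
    have e1 : rootA σ z w ^ 2 - (‖z‖ : ℂ) ^ 2 = -(((‖z‖ ^ 2 : ℝ) : ℂ) - rootA σ z w ^ 2) := by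
      push_cast
      ring
    rw [e1]
    field_simp
  simp only [e]
  rw [avg_mul_left, S.avg_sigma_div]
  field_simp
  ring

end CircularLaw

/-! ### Boundary values and the density -/

namespace CircularLaw

variable {τ : ℝ} {N : ℕ} {σ : Fin N → ℝ} {z : ℂ}

lemma csqrt_continuousOn : ContinuousOn csqrt upperHalf :=
  csqrt_differentiableOn.continuousOn

lemma m1c_continuousOn (hτ : 0 < τ) (h : Admissible τ σ z) :
    ContinuousOn (m1c σ z) upperHalf :=
  (m1c_spec hτ h).analytic.continuousOn

lemma rootA_continuousOn (hτ : 0 < τ) (h : Admissible τ σ z) :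
    ContinuousOn (rootA σ z) upperHalf :=
  csqrt_continuousOn.mul (continuousOn_const.add (m1c_continuousOn hτ h))

lemma csqrt_ofReal {x : ℝ} (hx : 0 < x) : csqrt (x : ℂ) = (√x : ℝ) := by
  rw [csqrt, Real.sqrt_eq_rpow, Complex.ofReal_cpow hx.le]
  push_cast
  rfl

lemma csqrt_continuousAt {x : ℝ} (hx : 0 < x) : ContinuousAt csqrt (x : ℂ) := by
  unfold csqrt
  apply ContinuousAt.cpow continuousAt_id continuousAt_const
  left
  simpa using hx

lemma tendsto_csqrt {x : ℝ} (hx : 0 < x) :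
    Tendsto csqrt (𝓝[upperHalf] (x : ℂ)) (𝓝 ((√x : ℝ) : ℂ)) := by
  rw [← csqrt_ofReal hx]
  exact (csqrt_continuousAt hx).mono_left nhdsWithin_le_nhds

/-- Near a positive real number all quantities are bounded. -/
lemma eventually_bounded (hτ : 0 < τ) (h : Admissible τ σ z) {x : ℝ} (hx : x ≠ 0) :
    ∃ K, ∀ᶠ w in 𝓝[upperHalf] (x : ℂ), Bounded τ σ z w K := by
  have hx' : 0 < |x| := abs_pos.2 hx
  refine ⟨1 + τ⁻¹ + 2 * |x| + 4 / τ ^ 2 * (1 + (√(|x| / 2))⁻¹), ?_⟩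
  have hcont : Tendsto (fun w : ℂ => ‖w‖) (𝓝[upperHalf] (x : ℂ)) (𝓝 |x|) := by
    have : Tendsto (fun w : ℂ => ‖w‖) (𝓝 (x : ℂ)) (𝓝 ‖(x : ℂ)‖) := continuous_norm.tendsto _
    rw [Complex.norm_real, Real.norm_eq_abs] at this
    exact this.mono_left nhdsWithin_le_nhds
  filter_upwards [self_mem_nhdsWithin, hcont.eventually (eventually_ge_nhds (b := |x| / 2)
    (by linarith)), hcont.eventually (eventually_le_nhds (b := 2 * |x|) (by linarith))]
    with w hw h1 h2
  exact bounded_of_le hτ h hw (by positivity) h1 h2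

/-- The boundary values of `√w (1 + m₁)` on the positive half line exist. -/
theorem exists_tendsto_rootA (hτ : 0 < τ) (h : Admissible τ σ z) {x : ℝ} (hx : 0 < x) :
    ∃ a, Tendsto (rootA σ z) (𝓝[upperHalf] (x : ℂ)) (𝓝 a) := by
  have hx' : 0 < √x := Real.sqrt_pos.2 hx
  have hP := clearedPoly_ne_zero hτ h hx'
  obtain ⟨K, hK⟩ := eventually_bounded hτ h hx.ne'
  refine exists_tendsto_of_cluster_finite (K := Metric.closedBall 0 (K * K))
    (S := {a | (clearedPoly σ z ((√x : ℝ) : ℂ)).eval a = 0}) (isCompact_closedBall _ _) ?_ ?_ ?_ ?_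
  · refine ((clearedPoly σ z ((√x : ℝ) : ℂ)).roots.toFinset.finite_toSet).subset fun a ha => ?_
    simpa [hP] using ha
  · intro t ht
    obtain ⟨ε, hε, hsub⟩ := Metric.mem_nhdsWithin_iff.1 ht
    refine ⟨Metric.ball (x : ℂ) ε ∩ upperHalf, ?_, hsub, ?_, ?_⟩
    · exact inter_mem (mem_nhdsWithin_of_mem_nhds (Metric.ball_mem_nhds _ hε)) self_mem_nhdsWithin
    · exact ((convex_ball _ _).inter convex_upperHalf).isPreconnected
    · exact (rootA_continuousOn hτ h).mono inter_subset_right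
  · filter_upwards [hK] with w hw
    have h1 := norm_sq_csqrt w
    have h2 := hw.one_le
    have h3 := hw.norm_le
    have h4 := hw.norm_one_add_le
    have h5 : ‖csqrt w‖ ≤ K := by
      apply le_of_sq_le_sq _ (by linarith)
      rw [h1]
      nlinarith
    rw [mem_closedBall_zero_iff, rootA, norm_mul]
    gcongr
  -- A cluster value could be a zero of one of the cubics, where f itself has no meaning; the
  -- equation with cleared denominators passes to the limit regardless.
  · intro a ha
    obtain ⟨u, hu, hua⟩ := mapClusterPt_iff_ultrafilter.1 ha
    have h1 : Tendsto (fun w => (clearedPoly σ z (csqrt w)).eval (rootA σ z w)) u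
        (𝓝 ((clearedPoly σ z ((√x : ℝ) : ℂ)).eval a)) :=
      ((continuous_eval_clearedPoly σ z).tendsto (((√x : ℝ) : ℂ), a)).comp
        (((tendsto_csqrt hx).mono_left hu).prodMk_nhds hua)
    have h2 : Tendsto (fun w => (clearedPoly σ z (csqrt w)).eval (rootA σ z w)) u (𝓝 0) := by
      refine tendsto_const_nhds.congr' ?_
      filter_upwards [hu self_mem_nhdsWithin] with w hw
      rw [eval_clearedPoly_eq σ z (cubic_root_ne hτ h hw), fFun_root hτ h hw, zero_mul]
    exact tendsto_nhds_unique h1 h2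

/-- The boundary value of `m₁` at a real point. -/
noncomputable def m1Real {N : ℕ} (σ : Fin N → ℝ) (z : ℂ) (x : ℝ) : ℂ :=
  limUnder (𝓝[upperHalf] (x : ℂ)) (m1c σ z)

lemma tendsto_m1c (hτ : 0 < τ) (h : Admissible τ σ z) {x : ℝ} (hx : 0 < x) :
    Tendsto (m1c σ z) (𝓝[upperHalf] (x : ℂ)) (𝓝 (m1Real σ z x)) := by
  apply tendsto_nhds_limUnder
  obtain ⟨a, ha⟩ := exists_tendsto_rootA hτ h hx
  have hx' : ((√x : ℝ) : ℂ) ≠ 0 := Complex.ofReal_ne_zero.2 (Real.sqrt_pos.2 hx).ne'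
  refine ⟨a / (√x : ℝ) - 1, ((ha.div (tendsto_csqrt hx) hx').sub_const 1).congr' ?_⟩
  filter_upwards [self_mem_nhdsWithin] with w hw
  have := csqrt_ne_zero hw
  change rootA σ z w / csqrt w - 1 = m1c σ z w
  rw [rootA]
  field_simp
  ring

lemma tendsto_rootA (hτ : 0 < τ) (h : Admissible τ σ z) {x : ℝ} (hx : 0 < x) :
    Tendsto (rootA σ z) (𝓝[upperHalf] (x : ℂ)) (𝓝 ((√x : ℝ) * (1 + m1Real σ z x))) :=
  (tendsto_csqrt hx).mul ((tendsto_m1c hτ h hx).const_add 1)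

lemma m1Real_im_nonneg (hτ : 0 < τ) (h : Admissible τ σ z) {x : ℝ} (hx : 0 < x) :
    0 ≤ (m1Real σ z x).im := by
  refine ge_of_tendsto ((Complex.continuous_im.tendsto _).comp (tendsto_m1c hτ h hx)) ?_
  filter_upwards [self_mem_nhdsWithin] with w hw
  exact ((m1c_spec hτ h).im_pos w hw).le

lemma mcReal_eq (hτ : 0 < τ) (h : Admissible τ σ z) {x : ℝ} (hx : 0 < x) :
    mcReal σ z x = (√x : ℝ) * (1 + m1Real σ z x) :=
  ((tendsto_rootA hτ h hx).comp (tendsto_vertical x)).limUnder_eq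

lemma m1Real_continuousOn (hτ : 0 < τ) (h : Admissible τ σ z) :
    ContinuousOn (m1Real σ z) (Ioi 0) := by
  have h1 : ContinuousOn (extendFrom upperHalf (m1c σ z)) ((fun x : ℝ => (x : ℂ)) '' Ioi 0) := by
    apply continuousOn_extendFrom
    · rintro - ⟨x, -, rfl⟩
      exact mem_closure_iff_nhdsWithin_neBot.2 inferInstance
    · rintro - ⟨x, hx, rfl⟩
      exact ⟨_, tendsto_m1c hτ h hx⟩
  exact h1.comp Complex.continuous_ofReal.continuousOn (mapsTo_image _ _)

/-- The density in terms of a limit along the upper half plane. -/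
lemma density_eq {m : ℂ → ℂ} {x y : ℝ}
    (hm : Tendsto (fun w => (m w).im) (𝓝[upperHalf] (x : ℂ)) (𝓝 y)) :
    density m x = Real.pi⁻¹ * y := by
  rw [density]
  congr 1
  exact (hm.comp (tendsto_vertical x)).limUnder_eq

lemma tendsto_m1c_im (hτ : 0 < τ) (h : Admissible τ σ z) {x : ℝ} (hx : 0 < x) :
    Tendsto (fun w => (m1c σ z w).im) (𝓝[upperHalf] (x : ℂ)) (𝓝 (m1Real σ z x).im) :=
  (Complex.continuous_im.tendsto _).comp (tendsto_m1c hτ h hx)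

lemma rho1c_eq (hτ : 0 < τ) (h : Admissible τ σ z) {x : ℝ} (hx : 0 < x) :
    rho1c σ z x = Real.pi⁻¹ * (m1Real σ z x).im :=
  density_eq (tendsto_m1c_im hτ h hx)

/-- On the negative half line the imaginary part of `m₁` tends to zero. -/
lemma tendsto_m1c_im_of_neg (hτ : 0 < τ) (h : Admissible τ σ z) {x : ℝ} (hx : x < 0) :
    Tendsto (fun w => (m1c σ z w).im) (𝓝[upperHalf] (x : ℂ)) (𝓝 0) := by
  obtain ⟨K, hK⟩ := eventually_bounded hτ h hx.ne
  have him : Tendsto (fun w : ℂ => w.im) (𝓝[upperHalf] (x : ℂ)) (𝓝 0) := by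
    have := Complex.continuous_im.tendsto (x : ℂ)
    rw [Complex.ofReal_im] at this
    exact this.mono_left nhdsWithin_le_nhds
  have hre : Tendsto (fun w : ℂ => w.re) (𝓝[upperHalf] (x : ℂ)) (𝓝 x) := by
    have := Complex.continuous_re.tendsto (x : ℂ)
    rw [Complex.ofReal_re] at this
    exact this.mono_left nhdsWithin_le_nhds
  have hup : Tendsto (fun w : ℂ => 2 * (2 * K) / (-x) * w.im) (𝓝[upperHalf] (x : ℂ)) (𝓝 0) := by
    simpa using him.const_mul (2 * (2 * K) / (-x))
  refine squeeze_zero' ?_ ?_ hup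
  · filter_upwards [self_mem_nhdsWithin] with w hw
    exact ((m1c_spec hτ h).im_pos w hw).le
  · filter_upwards [self_mem_nhdsWithin, hK,
      hre.eventually (eventually_le_nhds (b := x / 2) (by linarith))] with w hw hb h1
    -- Im (w m₁) = Re w Im m₁ + Im w Re m₁ is positive, so for negative Re w it bounds Im m₁ by a
    -- multiple of Im w.
    have h2 := (m1c_spec hτ h).mul_im_pos w hw
    have h3 := (m1c_spec hτ h).im_pos w hw
    have h4 := (Complex.re_le_norm _).trans hb.norm_m1c_le
    have hw' : 0 < w.im := hw
    rw [Complex.mul_im] at h2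
    rw [div_mul_eq_mul_div, le_div_iff₀ (by linarith)]
    nlinarith

lemma rho1c_of_neg (hτ : 0 < τ) (h : Admissible τ σ z) {x : ℝ} (hx : x < 0) :
    rho1c σ z x = 0 := by
  rw [rho1c, density_eq (tendsto_m1c_im_of_neg hτ h hx), mul_zero]

lemma supp1_subset (hτ : 0 < τ) (h : Admissible τ σ z) : supp1 σ z ⊆ Ici 0 := by
  apply closure_minimal _ isClosed_Ici
  intro x hx
  by_contra hcon
  exact hx (rho1c_of_neg hτ h (not_le.1 hcon))

lemma Admissible.z_cases (h : Admissible τ σ z) : ‖z‖ ^ 2 ≤ 1 - τ ∨ 1 + τ ≤ ‖z‖ ^ 2 := by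
  rcases le_abs.1 h.z_lower with h1 | h1
  · right
    linarith
  · left
    linarith

/-- For `|z| < 1` the density is positive near zero. -/
lemma rho1c_pos_near_zero (hτ : 0 < τ) :
    ∃ c : ℝ, 0 < c ∧ ∀ (N : ℕ) (σ : Fin N → ℝ) (z : ℂ), Admissible τ σ z → ‖z‖ ^ 2 ≤ 1 - τ →
      ∀ x ∈ Ioo 0 c, 0 < rho1c σ z x := by
  obtain ⟨c, C, hc, hC, H⟩ := near_zero hτ
  -- For |√w| ≤ b the error in `near_zero` is at most √c / 2, half of the lower bound √c for the
  -- leading term √t.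
  set b := min c (√c / (2 * C)) with hb
  have hb0 : 0 < b := lt_min hc (div_pos (Real.sqrt_pos.2 hc) (by positivity))
  refine ⟨b ^ 2, by positivity, fun N σ z h hz x hx => ?_⟩
  have hx0 : 0 < x := hx.1
  have hsx : 0 < √x := Real.sqrt_pos.2 hx0
  have hxb : √x < b := (Real.sqrt_lt' hb0).2 hx.2
  obtain ⟨t, ht, -, Ht⟩ := H N σ _ (h.params hτ) hz
  have hlim := (Complex.continuous_im.tendsto _).comp (tendsto_rootA hτ h hx0)
  have hr : Tendsto (fun w => ‖csqrt w‖) (𝓝[upperHalf] (x : ℂ)) (𝓝 (√x)) := by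
    have := (tendsto_csqrt hx0).norm
    rwa [Complex.norm_real, Real.norm_of_nonneg hsx.le] at this
  have h1 : √c / 2 ≤ ((√x : ℝ) * (1 + m1Real σ z x)).im := by
    refine ge_of_tendsto hlim ?_
    filter_upwards [self_mem_nhdsWithin, hr.eventually (eventually_le_nhds hxb)] with w hw hwb
    have h2 := (Ht _ _ _ (isSol hτ h hw) (hwb.trans (min_le_left _ _))).1
    have h3 := (Complex.abs_im_le_norm _).trans h2
    have e : (rootA σ z w - Complex.I * (√t : ℝ)).im = (rootA σ z w).im - √t := by simp
    rw [e] at h3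
    have h4 := (abs_le.1 h3).1
    have h5 : √c ≤ √t := Real.sqrt_le_sqrt ht
    have h6 : C * ‖csqrt w‖ ≤ √c / 2 := by
      calc C * ‖csqrt w‖ ≤ C * (√c / (2 * C)) := by
            gcongr
            exact hwb.trans (min_le_right _ _)
        _ = √c / 2 := by field_simp
    change √c / 2 ≤ (rootA σ z w).im
    linarith
  rw [Complex.im_ofReal_mul, Complex.add_im, Complex.one_im, zero_add] at h1
  rw [rho1c_eq hτ h hx0]
  have : 0 < √c / 2 := by
    have := Real.sqrt_pos.2 hc
    positivity
  have h4 : 0 < (m1Real σ z x).im := by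
    by_contra hcon
    push Not at hcon
    nlinarith
  have := Real.pi_pos
  positivity

end CircularLaw

/-! ### Location of the support and of the edges -/

namespace CircularLaw

variable {τ : ℝ} {N : ℕ} {σ : Fin N → ℝ} {z : ℂ} {w : ℂ}

/-- Far away from the origin, `Im m₁` is at most of order `Im w`. -/
lemma m1c_im_le_of_large (hτ : 0 < τ) (h : Admissible τ σ z) (hw : 0 < w.im)
    (hW : 200 / τ ≤ ‖w‖) : (m1c σ z w).im ≤ 2 * w.im := by
  have p := h.params hτ
  have hτ1 := p.tau_le_one
  set W := ‖w‖ with hWdef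
  have hW200 : 200 ≤ W := by
    refine le_trans ?_ hW
    rw [le_div_iff₀ hτ]
    linarith
  have hW0 : 0 < W := by linarith
  have hτW : τ⁻¹ ≤ W / 16 := by
    have : 200 / τ = 200 * τ⁻¹ := by ring
    linarith [inv_pos.2 hτ]
  have hZ : ‖z‖ ^ 2 ≤ W / 8 := by
    have := p.Z_le
    rw [div_eq_mul_inv] at this
    linarith
  obtain ⟨h1, h2⟩ := large_bounds hτ h hw (le_trans (by gcongr; norm_num) hW)
  have hm1 : ‖m1c σ z w‖ ≤ 1 / 2 := h1.trans (by rw [div_le_div_iff₀ hW0 (by norm_num)]; linarith)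
  have ha1 := half_le_norm_one_add hτ h hw
  have ha2 : ‖1 + m1c σ z w‖ ≤ 2 := by
    refine (norm_add_le _ _).trans ?_
    rw [norm_one]
    linarith
  set a := 1 + m1c σ z w with ha
  have ha0 : a ≠ 0 := one_add_m1c_ne hτ h hw
  have hw0 : w ≠ 0 := norm_pos_iff.1 hW0
  set y := (m1c σ z w).im with hy
  have hy0 : 0 < y := (m1c_spec hτ h).im_pos w hw
  have hX : W * ‖a‖ ^ 2 / 2 ≤ ‖(‖z‖ : ℂ) ^ 2 - w * a ^ 2‖ := by
    have e : ‖w * a ^ 2‖ = W * ‖a‖ ^ 2 := by rw [norm_mul, norm_pow]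
    have h3 := norm_sub_norm_le (w * a ^ 2) ((‖z‖ : ℂ) ^ 2)
    rw [norm_sub_rev, norm_Z, e] at h3
    have h4 : (1 / 2) ^ 2 ≤ ‖a‖ ^ 2 := by gcongr
    nlinarith
  have hm2 : ‖w * m2c σ z w‖ ≤ 4 := by
    rw [m2c_eq_div hτ h hw, norm_mul, norm_div, ← ha, mul_div_assoc',
      div_le_iff₀ (lt_of_lt_of_le (by positivity) hX)]
    have h5 : 0 ≤ W * ‖a‖ := by positivity
    have h6 : W * ‖a‖ * (1 / 2) ≤ W * ‖a‖ * ‖a‖ := by gcongr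
    linarith [show W * ‖a‖ ^ 2 = W * ‖a‖ * ‖a‖ by ring]
  have hwa : (w * a).im ≤ 2 * w.im + W * y := by
    have e : (w * a).im = w.im + (w.re * y + w.im * (m1c σ z w).re) := by
      simp only [ha, Complex.mul_im, Complex.add_im, Complex.add_re, Complex.one_re,
        Complex.one_im, hy]
      ring
    rw [e]
    have h3 : (m1c σ z w).re ≤ 1 := by linarith [Complex.re_le_norm (m1c σ z w)]
    have h4 : w.re ≤ W := Complex.re_le_norm w
    nlinarith
  have hwm : (w * m2c σ z w).im ≤ 24 * y + w.im := by
    have e : (w * m2c σ z w)⁻¹ = -a + ((‖z‖ ^ 2 : ℝ) : ℂ) * (w * a)⁻¹ := by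
      rw [mul_inv, m2c_eq_div hτ h hw, inv_div, ← ha]
      push_cast
      field_simp
      ring
    have e2 : (w * m2c σ z w).im
        = (y + ‖z‖ ^ 2 * ((w * a).im / ‖w * a‖ ^ 2)) * ‖w * m2c σ z w‖ ^ 2 := by
      have e3 : a.im = y := by simp [ha, hy]
      rw [neg_inv_im, e, Complex.add_im, Complex.im_ofReal_mul, Complex.inv_im,
        Complex.normSq_eq_norm_sq, Complex.neg_im, e3]
      ring
    have h5 : ‖z‖ ^ 2 * ((w * a).im / ‖w * a‖ ^ 2) ≤ W / 8 * ((2 * w.im + W * y) * (4 / W ^ 2)) := by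
      have h6 : (W / 2) ^ 2 ≤ ‖w * a‖ ^ 2 := by
        rw [norm_mul]
        gcongr
        nlinarith
      have h7 : (w * a).im / ‖w * a‖ ^ 2 ≤ (2 * w.im + W * y) * (4 / W ^ 2) := by
        calc (w * a).im / ‖w * a‖ ^ 2 ≤ (2 * w.im + W * y) / (W / 2) ^ 2 := by gcongr
          _ = _ := by
            field_simp
            norm_num
      exact (mul_le_mul_of_nonneg_left h7 (by positivity)).trans (by gcongr)
    have h8 : W / 8 * ((2 * w.im + W * y) * (4 / W ^ 2)) = w.im / W + y / 2 := by
      field_simp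
      ring
    have h9 : w.im / W ≤ w.im / 200 := by gcongr
    have h10 : ‖w * m2c σ z w‖ ^ 2 ≤ 4 ^ 2 := by gcongr
    rw [e2]
    calc _ ≤ (y + (w.im / 200 + y / 2)) * 4 ^ 2 := by
          gcongr
          linarith
      _ ≤ _ := by linarith
  -- The threshold 200 / τ for |w| makes the total coefficient of y = Im m₁ at most 98 / 200, so
  -- that it can be absorbed after averaging.
  have hden : ∀ i, (den σ z w i)⁻¹.im ≤ y / 2 + w.im := by
    intro i
    rw [den_inv_im_eq hτ h hw]
    have hd := (h2 i).1
    have h3 : 0 ≤ (w * m2c σ z w).im := (mul_m2c_im_pos hτ h hw).le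
    have h4 : σ i ≤ W / 16 := (p.upper i).trans hτW
    have h5 := (p.sigma_pos i).le
    have h6 : (W / 4) ^ 2 ≤ ‖denom σ z (σ i) w‖ ^ 2 := by gcongr
    calc _ ≤ 2 ^ 2 * (w.im + W / 16 * (24 * y + w.im)) * ((W / 4) ^ 2)⁻¹
          + W / 8 / (W / 4) ^ 2 * y := by gcongr
      _ = 64 * w.im / W ^ 2 + 98 * y / W + 4 * w.im / W := by
          field_simp
          ring
      _ ≤ 64 * w.im / 200 ^ 2 + 98 * y / 200 + 4 * w.im / 200 := by gcongr
      _ ≤ _ := by linarith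
  have hfin : y ≤ y / 2 + w.im := by
    calc y = avg (fun i => σ i * (den σ z w i)⁻¹.im) := m1c_im_eq hτ h hw
      _ ≤ avg (fun i => σ i * (y / 2 + w.im)) := by
          apply avg_mono
          intro i
          have := (p.sigma_pos i).le
          have := hden i
          gcongr
      _ = _ := by rw [avg_mul_right, p.mean, one_mul]
  linarith

lemma tendsto_im_upperHalf (x : ℝ) :
    Tendsto (fun w : ℂ => w.im) (𝓝[upperHalf] (x : ℂ)) (𝓝 0) := by
  have := Complex.continuous_im.tendsto (x : ℂ)
  rw [Complex.ofReal_im] at this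
  exact this.mono_left nhdsWithin_le_nhds

lemma tendsto_norm_upperHalf (x : ℝ) :
    Tendsto (fun w : ℂ => ‖w‖) (𝓝[upperHalf] (x : ℂ)) (𝓝 |x|) := by
  have : Tendsto (fun w : ℂ => ‖w‖) (𝓝 (x : ℂ)) (𝓝 ‖(x : ℂ)‖) := continuous_norm.tendsto _
  rw [Complex.norm_real, Real.norm_eq_abs] at this
  exact this.mono_left nhdsWithin_le_nhds

lemma tendsto_m1c_im_zero_of_le (hτ : 0 < τ) (h : Admissible τ σ z) {x C : ℝ}
    (hC : ∀ᶠ w in 𝓝[upperHalf] (x : ℂ), (m1c σ z w).im ≤ C * w.im) :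
    Tendsto (fun w => (m1c σ z w).im) (𝓝[upperHalf] (x : ℂ)) (𝓝 0) := by
  have hup : Tendsto (fun w : ℂ => C * w.im) (𝓝[upperHalf] (x : ℂ)) (𝓝 0) := by
    simpa using (tendsto_im_upperHalf x).const_mul C
  refine squeeze_zero' ?_ hC hup
  filter_upwards [self_mem_nhdsWithin] with w hw
  exact ((m1c_spec hτ h).im_pos w hw).le

lemma rho1c_eq_zero_of_large (hτ : 0 < τ) (h : Admissible τ σ z) {x : ℝ} (hx : 200 / τ < x) :
    rho1c σ z x = 0 := by
  have h0 : 0 < 200 / τ := by positivity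
  have h1 := tendsto_norm_upperHalf x
  rw [abs_of_pos (h0.trans hx)] at h1
  rw [rho1c, density_eq (tendsto_m1c_im_zero_of_le hτ h (C := 2) ?_), mul_zero]
  filter_upwards [self_mem_nhdsWithin, h1.eventually (eventually_ge_nhds hx)] with w hw hwx
  exact m1c_im_le_of_large hτ h hw hwx

/-- For `|z| > 1` there is no mass near zero. -/
lemma tendsto_m1c_im_zero_of_gt (hτ : 0 < τ) :
    ∃ c : ℝ, 0 < c ∧ ∀ (N : ℕ) (σ : Fin N → ℝ) (z : ℂ), Admissible τ σ z → 1 + τ ≤ ‖z‖ ^ 2 →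
      ∀ x ∈ Ioo (-c) c, Tendsto (fun w => (m1c σ z w).im) (𝓝[upperHalf] (x : ℂ)) (𝓝 0) := by
  obtain ⟨c, C, hc, -, H⟩ := m1c_im_le_of_gt hτ
  refine ⟨c, hc, fun N σ z h hz x hx => ?_⟩
  refine tendsto_m1c_im_zero_of_le hτ h (C := C) ?_
  filter_upwards [self_mem_nhdsWithin, (tendsto_norm_upperHalf x).eventually
    (eventually_le_nhds (abs_lt.2 hx))] with w hw hwx
  exact H N σ z w h hz hw hwx

lemma zero_mem_supp1 (hτ : 0 < τ) (h : Admissible τ σ z) (hz : ‖z‖ ^ 2 ≤ 1 - τ) :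
    (0 : ℝ) ∈ supp1 σ z := by
  obtain ⟨c, hc, H⟩ := rho1c_pos_near_zero hτ
  apply closure_mono (s := Ioo 0 c)
  · exact fun x hx => (H N σ z h hz x hx).ne'
  · rw [closure_Ioo hc.ne]
    exact ⟨le_rfl, hc.le⟩

/-- Outside the support, the imaginary part of `m₁` tends to zero on the real line. -/
lemma tendsto_m1c_im_of_notMem (hτ : 0 < τ) (h : Admissible τ σ z) {x : ℝ} (hx : x ∉ supp1 σ z) :
    Tendsto (fun w => (m1c σ z w).im) (𝓝[upperHalf] (x : ℂ)) (𝓝 0) := by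
  rcases lt_trichotomy x 0 with h0 | h0 | h0
  · exact tendsto_m1c_im_of_neg hτ h h0
  · subst h0
    rcases h.z_cases with h1 | h1
    · exact absurd (zero_mem_supp1 hτ h h1) hx
    · obtain ⟨c, hc, H⟩ := tendsto_m1c_im_zero_of_gt hτ
      exact H N σ z h h1 0 ⟨by linarith, hc⟩
  · have h1 : rho1c σ z x = 0 := image_eq_zero_of_notMem_tsupport hx
    rw [rho1c_eq hτ h h0, mul_eq_zero, inv_eq_zero] at h1
    have h2 := h1.resolve_left Real.pi_pos.ne'
    have h3 := tendsto_m1c_im hτ h h0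
    rwa [h2] at h3

/-- Points near which the support fills a neighbourhood, or avoids one, are no edges. -/
lemma notMem_edges_of_pos {x : ℝ} (hx : ∀ᶠ y in 𝓝 x, rho1c σ z y ≠ 0) : x ∉ edges σ z := by
  intro hmem
  refine hmem.2 (mem_interior_iff_mem_nhds.2 ?_)
  filter_upwards [hx] with y hy
  exact subset_closure hy

lemma notMem_edges_of_zero {x : ℝ} (hx : ∀ᶠ y in 𝓝 x, rho1c σ z y = 0) : x ∉ edges σ z := by
  intro hmem
  have h1 : x ∈ supp1 σ z := isClosed_closure.frontier_subset hmem
  have h2 := mem_closure_iff_frequently.1 h1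
  exact h2 (hx.mono fun y hy => by simpa using hy)

lemma edges_subset (hτ : 0 < τ) (h : Admissible τ σ z) : edges σ z ⊆ Icc 0 (200 / τ) := by
  intro x hx
  have h1 : x ∈ supp1 σ z := isClosed_closure.frontier_subset hx
  refine ⟨supp1_subset hτ h h1, ?_⟩
  by_contra hcon
  push Not at hcon
  refine notMem_edges_of_zero ?_ hx
  filter_upwards [eventually_gt_nhds hcon] with y hy
  exact rho1c_eq_zero_of_large hτ h hy

/-- Nonzero edges are bounded away from zero. -/
lemma edges_lower_bound (hτ : 0 < τ) :
    ∃ c : ℝ, 0 < c ∧ ∀ (N : ℕ) (σ : Fin N → ℝ) (z : ℂ), Admissible τ σ z →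
      ∀ x ∈ edges σ z, x ≠ 0 → c ≤ x := by
  obtain ⟨c₁, hc₁, H₁⟩ := rho1c_pos_near_zero hτ
  obtain ⟨c₂, hc₂, H₂⟩ := tendsto_m1c_im_zero_of_gt hτ
  refine ⟨min c₁ c₂, lt_min hc₁ hc₂, fun N σ z h x hx hx0 => ?_⟩
  have hxpos : 0 < x := lt_of_le_of_ne (edges_subset hτ h hx).1 hx0.symm
  by_contra hcon
  push Not at hcon
  rcases h.z_cases with h1 | h1
  · refine notMem_edges_of_pos ?_ hx
    filter_upwards [Ioo_mem_nhds hxpos (hcon.trans_le (min_le_left _ _))] with y hy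
    exact (H₁ N σ z h h1 y hy).ne'
  · refine notMem_edges_of_zero ?_ hx
    filter_upwards [Ioo_mem_nhds hxpos (hcon.trans_le (min_le_right _ _))] with y hy
    rw [rho1c, density_eq (H₂ N σ z h h1 y ⟨by linarith [hy.1], hy.2⟩), mul_zero]

/-- Boundary values are continuous on the positive axis, so a nonzero imaginary part would put a
whole neighbourhood into the support. -/
lemma m1Real_im_eq_zero_of_edge (hτ : 0 < τ) (h : Admissible τ σ z) {x : ℝ} (hx0 : 0 < x)
    (hx : x ∈ edges σ z) : (m1Real σ z x).im = 0 := by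
  by_contra hne
  refine notMem_edges_of_pos ?_ hx
  have h1 : ContinuousAt (fun y => (m1Real σ z y).im) x :=
    Complex.continuous_im.continuousAt.comp
      ((m1Real_continuousOn hτ h).continuousAt (Ioi_mem_nhds hx0))
  filter_upwards [h1.eventually_ne hne, Ioi_mem_nhds hx0] with y hy hy0
  rw [rho1c_eq hτ h hy0]
  exact mul_ne_zero (inv_ne_zero Real.pi_pos.ne') hy

lemma exists_tendsto_m2c_im (hτ : 0 < τ) (h : Admissible τ σ z) {x : ℝ} (hx : 0 < x) :
    ∃ y, Tendsto (fun w => (m2c σ z w).im) (𝓝[upperHalf] (x : ℂ)) (𝓝 y) := by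
  have h1 := tendsto_m1c hτ h hx
  have hw : Tendsto (fun w : ℂ => w) (𝓝[upperHalf] (x : ℂ)) (𝓝 x) :=
    tendsto_id.mono_left nhdsWithin_le_nhds
  have h2 : Tendsto (fun w => (‖z‖ : ℂ) ^ 2 - w * (1 + m1c σ z w) ^ 2) (𝓝[upperHalf] (x : ℂ))
      (𝓝 ((‖z‖ : ℂ) ^ 2 - x * (1 + m1Real σ z x) ^ 2)) :=
    tendsto_const_nhds.sub (hw.mul ((h1.const_add 1).pow 2))
  have h3 : τ ≤ ‖(‖z‖ : ℂ) ^ 2 - x * (1 + m1Real σ z x) ^ 2‖ := by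
    refine ge_of_tendsto h2.norm ?_
    filter_upwards [self_mem_nhdsWithin] with w hw
    exact tau_le_norm_X_root hτ h hw
  have h4 := (h1.const_add 1).div h2 (norm_pos_iff.1 (hτ.trans_le h3))
  refine ⟨_, (Complex.continuous_im.tendsto _).comp (h4.congr' ?_)⟩
  filter_upwards [self_mem_nhdsWithin] with w hw
  exact (m2c_eq_div hτ h hw).symm

/-- The densities `ρ₁` and `ρ₂` are positive at the same positive points. -/
lemma rho2c_eq_zero_iff (hτ : 0 < τ) (h : Admissible τ σ z) {x : ℝ} (hx : 0 < x) :
    rho2c σ z x = 0 ↔ rho1c σ z x = 0 := by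
  obtain ⟨y₂, hy₂⟩ := exists_tendsto_m2c_im hτ h hx
  have hy₁ := tendsto_m1c_im hτ h hx
  set y₁ := (m1Real σ z x).im
  obtain ⟨K, hK⟩ := eventually_bounded hτ h hx.ne'
  have him := tendsto_im_upperHalf x
  have hre : Tendsto (fun w : ℂ => w.re) (𝓝[upperHalf] (x : ℂ)) (𝓝 x) := by
    have := Complex.continuous_re.tendsto (x : ℂ)
    rw [Complex.ofReal_re] at this
    exact this.mono_left nhdsWithin_le_nhds
  have h1 : y₂ ≤ K ^ 4 * (3 * K * 0 + 9 * K * y₁) := by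
    refine le_of_tendsto_of_tendsto hy₂
      (((him.const_mul (3 * K)).add (hy₁.const_mul (9 * K))).const_mul (K ^ 4)) ?_
    filter_upwards [self_mem_nhdsWithin, hK] with w hw hb
    exact hb.m2c_im_le hτ h hw
  have h2 : x * y₁ ≤ 3 * K * (6 * K ^ 3) ^ 2 * y₂ := by
    refine le_of_tendsto_of_tendsto (hre.mul hy₁) (hy₂.const_mul _) ?_
    filter_upwards [self_mem_nhdsWithin, hK] with w hw hb
    exact hb.re_mul_m1c_im_le hτ h hw
  have h3 : 0 ≤ y₁ := m1Real_im_nonneg hτ h hx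
  have h4 : 0 ≤ y₂ := by
    refine ge_of_tendsto hy₂ ?_
    filter_upwards [self_mem_nhdsWithin] with w hw
    exact (m2c_im_pos hτ h hw).le
  rw [rho2c, density_eq hy₂, rho1c, density_eq hy₁, mul_eq_zero, mul_eq_zero,
    or_iff_right (inv_ne_zero Real.pi_pos.ne'), or_iff_right (inv_ne_zero Real.pi_pos.ne')]
  constructor
  · intro h0
    rw [h0] at h2
    nlinarith
  · intro h0
    rw [h0] at h1
    linarith

/-- Membership in a closed support is local, so the pointwise equivalence of ρ₁ = 0 and ρ₂ = 0
suffices. One dichotomy at an edge then serves both m₁ and m₂. -/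
lemma mem_supp2_iff (hτ : 0 < τ) (h : Admissible τ σ z) {x : ℝ} (hx : 0 < x) :
    x ∈ supp2 σ z ↔ x ∈ supp1 σ z := by
  rw [supp2, supp1, tsupport, tsupport, mem_closure_iff_frequently, mem_closure_iff_frequently]
  apply frequently_congr
  filter_upwards [Ioi_mem_nhds hx] with y hy
  exact not_congr (rho2c_eq_zero_iff hτ h hy)

end CircularLaw

/-! ### Maximum principles on half discs -/

namespace CircularLaw

/-- A maximum principle for the imaginary part of an analytic function on a half disc, where on the
diameter only boundary values are used. -/
theorem im_nonpos_of_halfDisc {F : ℂ → ℂ} (hF : DifferentiableOn ℂ F upperHalf) {E ρ : ℝ}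
    (harc : ∀ w ∈ upperHalf, ‖w - E‖ = ρ → (F w).im ≤ 0)
    (hseg : ∀ x ∈ Icc (E - ρ) (E + ρ), ∀ ε > 0, ∀ᶠ w in 𝓝[upperHalf] (x : ℂ), (F w).im ≤ ε)
    {w₀ : ℂ} (hw₀ : w₀ ∈ upperHalf) (hw₀ρ : ‖w₀ - E‖ < ρ) : (F w₀).im ≤ 0 := by
  apply le_of_forall_pos_le_add
  intro ε hε
  rw [zero_add]
  -- Compactness makes the boundary condition uniform in x. The half disc can then be truncated at
  -- one height δ > 0, with F analytic on the closure of what remains.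
  have h1 : ∀ᶠ δ : ℝ in 𝓝 0, ∀ x ∈ Icc (E - ρ) (E + ρ),
      0 < δ → (F ((x : ℂ) + (δ : ℂ) * Complex.I)).im ≤ ε := by
    apply isCompact_Icc.eventually_forall_of_forall_eventually
    intro x hx
    have h2 := eventually_nhdsWithin_iff.1 (hseg x hx ε hε)
    have h3 : Tendsto (fun q : ℝ × ℝ => (q.2 : ℂ) + (q.1 : ℂ) * Complex.I) (𝓝 (0, x))
        (𝓝 (x : ℂ)) := by
      have : Continuous (fun q : ℝ × ℝ => (q.2 : ℂ) + (q.1 : ℂ) * Complex.I) := by fun_prop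
      simpa using this.tendsto (0, x)
    filter_upwards [h3.eventually h2] with q hq hq0
    apply hq
    change 0 < Complex.im _
    simpa using hq0
  have hw₀' : 0 < w₀.im := hw₀
  obtain ⟨δ, hδ, hδ0, hδw⟩ := ((h1.filter_mono nhdsWithin_le_nhds).and
    (Ioo_mem_nhdsGT hw₀')).exists
  set Ω : Set ℂ := Metric.ball (E : ℂ) ρ ∩ {w | δ < w.im} with hΩ
  have hopen : IsOpen Ω :=
    Metric.isOpen_ball.inter (isOpen_lt continuous_const Complex.continuous_im)
  have hcl : closure Ω ⊆ Metric.closedBall (E : ℂ) ρ ∩ {w | δ ≤ w.im} := by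
    apply closure_minimal
    · exact inter_subset_inter Metric.ball_subset_closedBall fun w (hw : δ < w.im) => hw.le
    · exact Metric.isClosed_closedBall.inter (isClosed_le continuous_const Complex.continuous_im)
  have hclU : closure Ω ⊆ upperHalf := fun w hw => hδ0.trans_le (hcl hw).2
  -- |exp (-i F)| = exp (Im F), which reduces the claim to the maximum modulus principle.
  have hd : DifferentiableOn ℂ (fun w => Complex.exp (-Complex.I * F w)) upperHalf :=
    (hF.const_mul _).cexp
  have hnorm : ∀ w, ‖Complex.exp (-Complex.I * F w)‖ = Real.exp (F w).im := by
    intro w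
    rw [Complex.norm_exp]
    simp
  have hmax : ‖Complex.exp (-Complex.I * F w₀)‖ ≤ Real.exp ε := by
    refine Complex.norm_le_of_forall_mem_frontier_norm_le (U := Ω)
      (Metric.isBounded_ball.subset inter_subset_left)
      ((hd.mono hclU).diffContOnCl) ?_ (subset_closure ⟨?_, hδw⟩)
    · intro w hw
      rw [hnorm, Real.exp_le_exp]
      have hwc := hcl (frontier_subset_closure hw)
      have hwU := hclU (frontier_subset_closure hw)
      have hwn : w ∉ Ω := by
        rw [hopen.frontier_eq] at hw
        exact hw.2
      have hwρ : ‖w - E‖ ≤ ρ := by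
        rw [← dist_eq_norm]
        exact hwc.1
      rcases hwρ.eq_or_lt with h4 | h4
      · exact (harc w hwU h4).trans hε.le
      · have h5 : w.im = δ := by
          apply le_antisymm _ hwc.2
          by_contra h6
          push Not at h6
          exact hwn ⟨by rwa [Metric.mem_ball, dist_eq_norm], h6⟩
        have h6 : |w.re - E| ≤ ρ := by
          have := Complex.abs_re_le_norm (w - E)
          rw [Complex.sub_re, Complex.ofReal_re] at this
          linarith
        rw [abs_le] at h6
        have h7 := hδ w.re ⟨by linarith, by linarith⟩ hδ0
        rw [← h5, Complex.re_add_im] at h7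
        exact h7
    · rwa [Metric.mem_ball, dist_eq_norm]
  rwa [hnorm, Real.exp_le_exp] at hmax

lemma norm_sub_sq_eq (w : ℂ) (x : ℝ) : ‖w - x‖ ^ 2 = (w.re - x) ^ 2 + w.im ^ 2 := by
  rw [Complex.sq_norm, Complex.normSq_apply]
  simp
  ring

/-- If `Im h ≤ 1 / Im w` and `Im h` vanishes on a real interval, it is of order `Im w` there. -/
theorem im_le_of_vanish {F : ℂ → ℂ} (hF : DifferentiableOn ℂ F upperHalf) {E ρ : ℝ} (hρ : 0 < ρ)
    (hup : ∀ w ∈ upperHalf, (F w).im ≤ 1 / w.im)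
    (hseg : ∀ x ∈ Icc (E - ρ) (E + ρ), ∀ ε > 0, ∀ᶠ w in 𝓝[upperHalf] (x : ℂ), (F w).im ≤ ε)
    {w : ℂ} (hw : w ∈ upperHalf) (hwE : w.re = E) : (F w).im ≤ 2 * w.im / ρ ^ 2 := by
  have hw' : 0 < w.im := hw
  by_cases hcase : ρ ≤ w.im
  · refine (hup w hw).trans ?_
    rw [div_le_div_iff₀ hw' (by positivity)]
    nlinarith
  push Not at hcase
  have him : ∀ (v : ℂ) (x : ℝ), ((v - x)⁻¹).im = -v.im / ‖v - x‖ ^ 2 := by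
    intro v x
    rw [Complex.inv_im, Complex.sq_norm]
    simp
  have hne : ∀ v ∈ upperHalf, ∀ x : ℝ, v - (x : ℂ) ≠ 0 := by
    intro v hv x h0
    have h1 := congrArg Complex.im h0
    have h2 : 0 < v.im := hv
    simp at h1
    linarith
  -- A barrier with poles at the ends of the diameter: on the arc the imaginary parts of the two
  -- fractions sum to exactly -1 / Im v, cancelling the a priori bound. Above the centre each of
  -- them contributes at most Im w / ρ².
  set b : ℂ → ℂ := fun v => F v + ((v - ((E + ρ : ℝ) : ℂ))⁻¹ + (v - ((E - ρ : ℝ) : ℂ))⁻¹) with hb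
  have hbim : ∀ v, (b v).im = (F v).im
      - (v.im / ‖v - ((E + ρ : ℝ) : ℂ)‖ ^ 2 + v.im / ‖v - ((E - ρ : ℝ) : ℂ)‖ ^ 2) := by
    intro v
    simp only [hb, Complex.add_im, him]
    ring
  have hmain : (b w).im ≤ 0 := by
    refine im_nonpos_of_halfDisc (E := E) (ρ := ρ) ?_ ?_ ?_ hw ?_
    · refine hF.add (DifferentiableOn.add ?_ ?_)
      · exact DifferentiableOn.inv (by fun_prop) fun v hv => hne v hv _
      · exact DifferentiableOn.inv (by fun_prop) fun v hv => hne v hv _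
    · intro v hv hvρ
      have hv' : 0 < v.im := hv
      have h1 := hup v hv
      have h2 : (v.re - E) ^ 2 + v.im ^ 2 = ρ ^ 2 := by
        rw [← norm_sub_sq_eq, hvρ]
      have h3 := norm_sub_sq_eq v (E + ρ)
      have h4 := norm_sub_sq_eq v (E - ρ)
      have h5 : 0 < ‖v - ((E + ρ : ℝ) : ℂ)‖ ^ 2 := by
        have := norm_pos_iff.2 (hne v hv (E + ρ))
        positivity
      have h6 : 0 < ‖v - ((E - ρ : ℝ) : ℂ)‖ ^ 2 := by
        have := norm_pos_iff.2 (hne v hv (E - ρ))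
        positivity
      have h7 : v.im / ‖v - ((E + ρ : ℝ) : ℂ)‖ ^ 2 + v.im / ‖v - ((E - ρ : ℝ) : ℂ)‖ ^ 2
          = 1 / v.im := by
        rw [div_add_div _ _ h5.ne' h6.ne', div_eq_div_iff (by positivity) hv'.ne', h3, h4]
        have e1 : (v.re - (E + ρ)) ^ 2 + v.im ^ 2 = 2 * ρ ^ 2 - 2 * ρ * (v.re - E) := by
          linear_combination h2
        have e2 : (v.re - (E - ρ)) ^ 2 + v.im ^ 2 = 2 * ρ ^ 2 + 2 * ρ * (v.re - E) := by
          linear_combination h2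
        rw [e1, e2]
        linear_combination 4 * ρ ^ 2 * h2
      rw [hbim, h7]
      linarith
    · intro x hx ε hε
      filter_upwards [hseg x hx ε hε, self_mem_nhdsWithin] with v hv hvU
      have hv' : 0 < v.im := hvU
      rw [hbim]
      have : 0 ≤ v.im / ‖v - ((E + ρ : ℝ) : ℂ)‖ ^ 2 + v.im / ‖v - ((E - ρ : ℝ) : ℂ)‖ ^ 2 := by
        positivity
      linarith
    · apply lt_of_pow_lt_pow_left₀ 2 hρ.le
      rw [norm_sub_sq_eq, hwE, sub_self]
      nlinarith
  rw [hbim, norm_sub_sq_eq, norm_sub_sq_eq, hwE] at hmain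
  have h8 : ∀ s : ℝ, s ^ 2 = ρ ^ 2 → w.im / (s ^ 2 + w.im ^ 2) ≤ w.im / ρ ^ 2 := by
    intro s hs
    rw [hs]
    gcongr
    nlinarith
  have h9 := h8 (E - (E + ρ)) (by ring)
  have h10 := h8 (E - (E - ρ)) (by ring)
  have h11 : 2 * w.im / ρ ^ 2 = w.im / ρ ^ 2 + w.im / ρ ^ 2 := by ring
  linarith

/-- A nonnegative imaginary part with boundary values at least `c` on a real interval is bounded
from below near the middle of the interval. -/
theorem le_im_of_boundary {F : ℂ → ℂ} (hF : DifferentiableOn ℂ F upperHalf) {E ρ c : ℝ}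
    (hρ : 0 < ρ) (hc : 0 ≤ c) (hpos : ∀ w ∈ upperHalf, 0 ≤ (F w).im)
    (hseg : ∀ x ∈ Icc (E - ρ) (E + ρ), ∀ ε > 0,
      ∀ᶠ w in 𝓝[upperHalf] (x : ℂ), c - ε ≤ (F w).im)
    {w : ℂ} (hw : w ∈ upperHalf) (hwE : w.re = E) (hwρ : w.im ≤ ρ / 2) : c / 4 ≤ (F w).im := by
  have hw' : 0 < w.im := hw
  -- The comparison polynomial has imaginary part at most 1 on the diameter, at most 0 on the arc,
  -- and equal to (1 - Im w / ρ)² above the centre, which is at least 1/4 for Im w ≤ ρ/2.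
  set b : ℂ → ℂ := fun v =>
    (c : ℂ) * (Complex.I - Complex.I * (v - E) ^ 2 / (ρ : ℂ) ^ 2 - 2 * v / ρ) - F v with hb
  have hbim : ∀ v, (b v).im
      = c * (1 - ((v.re - E) ^ 2 - v.im ^ 2) / ρ ^ 2 - 2 * v.im / ρ) - (F v).im := by
    intro v
    have e1 : Complex.I * (v - E) ^ 2 / (ρ : ℂ) ^ 2
        = ((ρ ^ 2)⁻¹ : ℝ) * (Complex.I * (v - E) ^ 2) := by
      push_cast
      ring
    have e2 : 2 * v / (ρ : ℂ) = ((2 / ρ : ℝ) : ℂ) * v := by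
      push_cast
      ring
    simp only [hb, e1, e2]
    rw [Complex.sub_im, Complex.im_ofReal_mul, Complex.sub_im, Complex.sub_im,
      Complex.im_ofReal_mul, Complex.im_ofReal_mul]
    simp [sq]
    left
    ring
  have hmain : (b w).im ≤ 0 := by
    refine im_nonpos_of_halfDisc (E := E) (ρ := ρ) ?_ ?_ ?_ hw ?_
    · refine DifferentiableOn.sub ?_ hF
      fun_prop
    · intro v hv hvρ
      have hv' : 0 < v.im := hv
      have h2 : (v.re - E) ^ 2 + v.im ^ 2 = ρ ^ 2 := by
        rw [← norm_sub_sq_eq, hvρ]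
      have h3 : v.im ≤ ρ := by nlinarith [sq_nonneg (v.re - E)]
      have h4 : 1 - ((v.re - E) ^ 2 - v.im ^ 2) / ρ ^ 2 - 2 * v.im / ρ
          = 2 * v.im * (v.im - ρ) / ρ ^ 2 := by
        have : (v.re - E) ^ 2 = ρ ^ 2 - v.im ^ 2 := by linarith
        rw [this]
        field_simp
        ring
      have h5 : 2 * v.im * (v.im - ρ) / ρ ^ 2 ≤ 0 := by
        apply div_nonpos_of_nonpos_of_nonneg _ (by positivity)
        nlinarith
      rw [hbim, h4]
      have := hpos v hv
      nlinarith
    · intro x hx ε hε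
      have hcont : Tendsto (fun v : ℂ => c * (1 - ((v.re - E) ^ 2 - v.im ^ 2) / ρ ^ 2
          - 2 * v.im / ρ)) (𝓝[upperHalf] (x : ℂ)) (𝓝 (c * (1 - ((x - E) ^ 2) / ρ ^ 2))) := by
        have : Continuous (fun v : ℂ => c * (1 - ((v.re - E) ^ 2 - v.im ^ 2) / ρ ^ 2
          - 2 * v.im / ρ)) := by fun_prop
        have h1 := this.tendsto (x : ℂ)
        simp only [Complex.ofReal_re, Complex.ofReal_im, mul_zero, zero_div, sub_zero, ne_eq,
          OfNat.ofNat_ne_zero, not_false_eq_true, zero_pow] at h1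
        exact h1.mono_left nhdsWithin_le_nhds
      have h1 : c * (1 - ((x - E) ^ 2) / ρ ^ 2) < c + ε / 2 := by
        have : 0 ≤ c * (((x - E) ^ 2) / ρ ^ 2) := by positivity
        linarith
      filter_upwards [hseg x hx (ε / 2) (by positivity), hcont.eventually (eventually_le_nhds h1)]
        with v hv hv2
      rw [hbim]
      linarith
    · apply lt_of_pow_lt_pow_left₀ 2 hρ.le
      rw [norm_sub_sq_eq, hwE, sub_self]
      nlinarith
  rw [hbim, hwE, sub_self] at hmain
  have h1 : (1 : ℝ) / 4 ≤ 1 - (0 ^ 2 - w.im ^ 2) / ρ ^ 2 - 2 * w.im / ρ := by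
    have e : 1 - (0 ^ 2 - w.im ^ 2) / ρ ^ 2 - 2 * w.im / ρ = (1 - w.im / ρ) ^ 2 := by
      field_simp
      ring
    have h2 : w.im / ρ ≤ 1 / 2 := by
      rw [div_le_iff₀ hρ]
      linarith
    rw [e]
    nlinarith
  nlinarith

end CircularLaw

/-! ### Large η and the edge at zero -/

namespace CircularLaw

variable {τ : ℝ} {N : ℕ} {σ : Fin N → ℝ} {z : ℂ} {w : ℂ}

lemma comparable_of {C l u a b : ℝ} (hl : 0 < l) (h1 : l⁻¹ ≤ C) (h2 : u ≤ C) (hb : 0 ≤ b)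
    (hla : l * b ≤ a) (hau : a ≤ u * b) : Comparable C a b := by
  constructor
  · refine le_trans ?_ hla
    gcongr
    rw [inv_le_comm₀ (lt_of_lt_of_le (inv_pos.2 hl) h1) hl]
    exact h1
  · exact hau.trans (by gcongr)

lemma Bounded.mono {K K' : ℝ} (b : Bounded τ σ z w K) (hK : K ≤ K') : Bounded τ σ z w K' :=
  ⟨b.one_le.trans hK, b.inv_le.trans hK, b.norm_le.trans hK, b.norm_one_add_le.trans hK⟩

lemma Bounded.comparable_norm {K C : ℝ} (b : Bounded τ σ z w K) (hτ : 0 < τ)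
    (h : Admissible τ σ z) (hw : 0 < w.im) (hC : 36 * K ^ 8 ≤ C) :
    Comparable C ‖1 + m1c σ z w‖ 1 ∧ Comparable C ‖m2c σ z w‖ 1 := by
  have hK := b.one_le
  have h1 : K ≤ K ^ 8 := le_self_pow₀ hK (by norm_num)
  have h2 : K ^ 2 ≤ K ^ 8 := pow_le_pow_right₀ hK (by norm_num)
  have h3 : K ^ 3 ≤ K ^ 8 := pow_le_pow_right₀ hK (by norm_num)
  constructor
  · refine comparable_of (l := 1 / 2) (u := K) (by norm_num) ?_ (by linarith) zero_le_one ?_ ?_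
    · norm_num
      linarith
    · rw [mul_one]
      exact half_le_norm_one_add hτ h hw
    · rw [mul_one]
      exact b.norm_one_add_le
  · refine comparable_of (l := (6 * K ^ 3)⁻¹) (u := K ^ 2) (by positivity) ?_ (by linarith)
      zero_le_one ?_ ?_
    · rw [inv_inv]
      linarith
    · rw [mul_one]
      exact b.norm_m2c_ge hτ h hw
    · rw [mul_one]
      exact b.norm_m2c_le hτ h hw

lemma Bounded.comparable_im {K C δ : ℝ} (b : Bounded τ σ z w K) (hτ : 0 < τ)
    (h : Admissible τ σ z) (hw : 0 < w.im) (hδ : 0 < δ) (hη : δ ≤ w.im)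
    (hC : 36 * K ^ 8 * (1 + δ⁻¹) ≤ C) :
    Comparable C (m1c σ z w).im 1 ∧ Comparable C (m2c σ z w).im 1 := by
  have hK1 := b.one_le
  have h1 : 0 ≤ 36 * K ^ 8 := by positivity
  have h2 : 0 ≤ 36 * K ^ 8 * δ⁻¹ := by positivity
  have hl : (36 * K ^ 8 * δ⁻¹)⁻¹⁻¹ ≤ C := by
    rw [inv_inv]
    linarith
  have hlow : ∀ n : ℕ, n ≤ 8 → (36 * K ^ 8 * δ⁻¹)⁻¹ * 1 ≤ w.im / (36 * K ^ n) := by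
    intro n hn
    rw [mul_one, mul_inv, inv_inv, mul_comm, ← div_eq_mul_inv]
    gcongr
  have hk1 : K ≤ K ^ 8 := le_self_pow₀ hK1 (by norm_num)
  have hk2 : K ^ 2 ≤ K ^ 8 := pow_le_pow_right₀ hK1 (by norm_num)
  have h3 := b.m1c_im_le
  have h4 := b.m2c_im_le' hτ h hw
  have h5 := hlow 8 le_rfl
  have h6 := hlow 6 (by norm_num)
  have h7 := b.m1c_im_ge hτ h hw
  have h8 := b.m2c_im_ge hτ h hw
  rw [show (6 * K ^ 4) ^ 2 = 36 * K ^ 8 by ring] at h7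
  rw [show (6 * K ^ 3) ^ 2 = 36 * K ^ 6 by ring] at h8
  constructor
  · exact comparable_of (u := 36 * K ^ 8) (by positivity) hl (by linarith) zero_le_one
      (h5.trans h7) (by linarith)
  · exact comparable_of (u := 36 * K ^ 8) (by positivity) hl (by linarith) zero_le_one
      (h6.trans h8) (by linarith)

/-- Here |w| and η are comparable, and the denominators are at most 3 |w|. The constant 324 = 18²
comes from |m₂| ≥ 1 / (18 η) and Im m₂ ≥ η |m₂|². -/
lemma large_eta_of_large (hτ : 0 < τ) (h : Admissible τ σ z) (hw : 0 < w.im)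
    (hW : 16 / τ ≤ ‖w‖) (hwη : ‖w‖ ≤ 2 * w.im) :
    1 / 324 * (1 / w.im) ≤ (m1c σ z w).im ∧ ‖m1c σ z w‖ ≤ 2 * (1 / w.im) ∧
      1 / 324 * (1 / w.im) ≤ (m2c σ z w).im := by
  obtain ⟨h1, h2⟩ := large_bounds hτ h hw hW
  have p := h.params hτ
  have hW0 : 0 < ‖w‖ := lt_of_lt_of_le (by positivity) hW
  have hηw : w.im ≤ ‖w‖ := Complex.im_le_norm w
  have hW16 : 16 ≤ ‖w‖ := by
    refine le_trans ?_ hW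
    rw [le_div_iff₀ hτ]
    linarith [p.tau_le_one]
  refine ⟨?_, ?_, ?_⟩
  · refine le_trans ?_ (m1c_im_ge_of_den_le hτ h hw fun i => (h2 i).2)
    have e : 1 / 324 * (1 / w.im) = 1 / 9 * (w.im / (3 * (2 * w.im)) ^ 2) := by
      field_simp
      norm_num
    have h3 : w.im / (3 * (2 * w.im)) ^ 2 ≤ w.im / (3 * ‖w‖) ^ 2 := by gcongr
    have h4 : 0 ≤ w.im / (3 * ‖w‖) ^ 2 := by positivity
    linarith
  · refine h1.trans ?_
    rw [mul_one_div]
    gcongr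
  · have ha1 := half_le_norm_one_add hτ h hw
    have ha2 : ‖1 + m1c σ z w‖ ≤ 2 := by
      refine (norm_add_le _ _).trans ?_
      rw [norm_one]
      have : 2 / ‖w‖ ≤ 2 / 16 := by gcongr
      linarith
    have hZ : ‖z‖ ^ 2 ≤ ‖w‖ / 8 := by
      have h3 := p.Z_le
      have e1 : 2 / τ = 2 * τ⁻¹ := by ring
      have e2 : 16 / τ = 16 * τ⁻¹ := by ring
      rw [e2] at hW
      linarith
    have hX : ‖(‖z‖ : ℂ) ^ 2 - w * (1 + m1c σ z w) ^ 2‖ ≤ 9 / 2 * ‖w‖ := by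
      refine (norm_sub_le _ _).trans ?_
      rw [norm_Z, norm_mul, norm_pow]
      have : ‖w‖ * ‖1 + m1c σ z w‖ ^ 2 ≤ ‖w‖ * 2 ^ 2 := by gcongr
      linarith
    have hX0 := hτ.trans_le (tau_le_norm_X_root hτ h hw)
    have hm : 1 / (18 * w.im) ≤ ‖m2c σ z w‖ := by
      rw [m2c_eq_div hτ h hw, norm_div]
      calc 1 / (18 * w.im) = (1 / 2) / (9 / 2 * (2 * w.im)) := by
            field_simp
            norm_num
        _ ≤ (1 / 2) / (9 / 2 * ‖w‖) := by gcongr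
        _ ≤ _ := by gcongr
    refine le_trans ?_ (m2c_im_ge hτ h hw)
    calc 1 / 324 * (1 / w.im) = w.im * (1 / (18 * w.im)) ^ 2 := by
          field_simp
          norm_num
      _ ≤ _ := by gcongr

lemma Bounded.large_eta {K δ : ℝ} (b : Bounded τ σ z w K) (hτ : 0 < τ)
    (h : Admissible τ σ z) (hw : 0 < w.im) (hδ : 0 < δ) (hη : δ ≤ w.im) :
    (36 * K ^ 8 * (δ ^ 2)⁻¹)⁻¹ * (1 / w.im) ≤ (m1c σ z w).im ∧
      ‖m1c σ z w‖ ≤ 2 * K ^ 2 * (1 / w.im) ∧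
      (36 * K ^ 8 * (δ ^ 2)⁻¹)⁻¹ * (1 / w.im) ≤ (m2c σ z w).im := by
  have hK1 := b.one_le
  have hηK : w.im ≤ K := (Complex.im_le_norm w).trans b.norm_le
  have hη2 : δ ^ 2 ≤ w.im * w.im := by
    rw [sq]
    gcongr
  have hlow : ∀ n : ℕ, n ≤ 8 →
      (36 * K ^ 8 * (δ ^ 2)⁻¹)⁻¹ * (1 / w.im) ≤ w.im / (36 * K ^ n) := by
    intro n hn
    rw [mul_one_div, div_le_div_iff₀ hw (by positivity), mul_inv, inv_inv]
    calc (36 * K ^ 8)⁻¹ * δ ^ 2 * (36 * K ^ n)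
        ≤ (36 * K ^ 8)⁻¹ * (w.im * w.im) * (36 * K ^ 8) := by
          gcongr
      _ = w.im * w.im := by field_simp
  have h5 := hlow 8 le_rfl
  have h6 := hlow 6 (by norm_num)
  have h7 := b.m1c_im_ge hτ h hw
  have h8 := b.m2c_im_ge hτ h hw
  rw [show (6 * K ^ 4) ^ 2 = 36 * K ^ 8 by ring] at h7
  rw [show (6 * K ^ 3) ^ 2 = 36 * K ^ 6 by ring] at h8
  refine ⟨h5.trans h7, b.norm_m1c_le.trans ?_, h6.trans h8⟩
  rw [mul_one_div, le_div_iff₀ hw]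
  calc 2 * K * w.im ≤ 2 * K * K := by gcongr
    _ = _ := by ring

/-- Large spectral parameter. -/
theorem large_eta (hτ : 0 < τ) (ζ : ℝ) (hζ : 0 < ζ) : ∃ C : ℝ, 0 < C ∧
    ∀ (N : ℕ) (σ : Fin N → ℝ) (z : ℂ), Admissible τ σ z → ∀ w ∈ domLarge ζ,
      Comparable C ‖m1c σ z w‖ (1 / w.im) ∧ Comparable C (m1c σ z w).im (1 / w.im) ∧
      Comparable C ‖m2c σ z w‖ (1 / w.im) ∧ Comparable C (m2c σ z w).im (1 / w.im) := by
  obtain ⟨K, hK⟩ : ∃ K, K = 1 + τ⁻¹ + 16 / τ + 4 / τ ^ 2 * (1 + (√ζ⁻¹)⁻¹) := ⟨_, rfl⟩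
  have hK0 : 0 < K := by
    rw [hK]
    positivity
  obtain ⟨C, hC⟩ : ∃ C, C = 324 + 36 * K ^ 8 * (ζ⁻¹ ^ 2)⁻¹ + 2 * K ^ 2 := ⟨_, rfl⟩
  have hC1 : 0 ≤ 36 * K ^ 8 * (ζ⁻¹ ^ 2)⁻¹ := by positivity
  have hC2 : 0 ≤ 2 * K ^ 2 := by positivity
  refine ⟨C, by linarith, fun N σ z h w hw => ?_⟩
  obtain ⟨hre0, hre, him⟩ := hw
  have hw0 : 0 < w.im := (inv_pos.2 hζ).trans_le him
  have hη : 0 < 1 / w.im := by positivity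
  -- From η |m₂|² ≤ Im m₂ ≤ |m₂|.
  have hm2 : ‖m2c σ z w‖ ≤ 1 * (1 / w.im) := by
    have h1 := (m2c_im_ge hτ h hw0).trans (Complex.im_le_norm _)
    have h2 : 0 < ‖m2c σ z w‖ := norm_pos_iff.2 (m2c_ne hτ h hw0)
    rw [one_mul, le_div_iff₀ hw0]
    nlinarith
  have hwη : ‖w‖ ≤ 2 * w.im := by
    refine (Complex.norm_le_abs_re_add_abs_im w).trans ?_
    rw [abs_of_nonneg hre0, abs_of_pos hw0]
    linarith
  suffices H : ∃ l u, 0 < l ∧ l⁻¹ ≤ C ∧ u ≤ C ∧ l * (1 / w.im) ≤ (m1c σ z w).im ∧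
      ‖m1c σ z w‖ ≤ u * (1 / w.im) ∧ l * (1 / w.im) ≤ (m2c σ z w).im by
    obtain ⟨l, u, hl, hl', hu', h1, h2, h3⟩ := H
    have h4 := Complex.im_le_norm (m1c σ z w)
    have h5 := Complex.im_le_norm (m2c σ z w)
    have h6 : 1 ≤ C := by linarith
    exact ⟨comparable_of hl hl' hu' hη.le (h1.trans h4) h2,
      comparable_of hl hl' hu' hη.le h1 (h4.trans h2),
      comparable_of hl hl' h6 hη.le (h3.trans h5) hm2,
      comparable_of hl hl' h6 hη.le h3 (h5.trans hm2)⟩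
  by_cases hW : 16 / τ ≤ ‖w‖
  · exact ⟨1 / 324, 2, by norm_num, by norm_num; linarith, by linarith,
      large_eta_of_large hτ h hw0 hW hwη⟩
  · push Not at hW
    have b : Bounded τ σ z w K := by
      rw [hK]
      exact bounded_of_le hτ h hw0 (inv_pos.2 hζ) (him.trans (Complex.im_le_norm w)) hW.le
    exact ⟨(36 * K ^ 8 * (ζ⁻¹ ^ 2)⁻¹)⁻¹, 2 * K ^ 2, by positivity, by rw [inv_inv]; linarith,
      by linarith, b.large_eta hτ h hw0 (inv_pos.2 hζ) him⟩

theorem large_eta_denom (hτ : 0 < τ) : ∃ ζ₀ : ℝ, 0 < ζ₀ ∧ ∀ ζ : ℝ, 0 < ζ → ζ ≤ ζ₀ →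
    ∀ (N : ℕ) (σ : Fin N → ℝ) (z : ℂ), Admissible τ σ z →
      ∀ w ∈ domLarge ζ, ∀ i, w.im ≤ ‖denom σ z (σ i) w‖ := by
  refine ⟨τ / 16, by positivity, fun ζ hζ hζ0 N σ z h w hw i => ?_⟩
  obtain ⟨hre0, hre, him⟩ := hw
  have p := h.params hτ
  have hζ1 : 16 / τ ≤ ζ⁻¹ := by
    rw [le_inv_comm₀ (by positivity) hζ, inv_div]
    exact hζ0
  have h16 : 16 ≤ 16 / τ := by
    rw [le_div_iff₀ hτ]
    linarith [p.tau_le_one]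
  have hw16 : 16 ≤ w.im := by linarith
  have hw0 : 0 < w.im := by linarith
  have hηw : w.im ≤ ‖w‖ := Complex.im_le_norm w
  obtain ⟨h1, -⟩ := large_bounds hτ h hw0 (by linarith)
  set m := m1c σ z w with hm
  have hwm : 0 < (w * m).im := (m1c_spec hτ h).mul_im_pos w hw0
  have hX0 := norm_pos_iff.1 (hτ.trans_le (tau_le_norm_X_root hτ h hw0))
  rw [← hm] at hX0
  -- Inserting m₂ = (1 + m) / X with X = Z - w (1 + m)² gives w (1 + m) - σ - Z + σ Z / X. Its
  -- imaginary part is at least Im w as soon as Im X ≤ 0, which holds because w m² is small compared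
  -- with Im w.
  have e : denom σ z (σ i) w = w + w * m - ((σ i : ℝ) : ℂ) - ((‖z‖ ^ 2 : ℝ) : ℂ)
      + ((σ i * ‖z‖ ^ 2 : ℝ) : ℂ) * ((‖z‖ : ℂ) ^ 2 - w * (1 + m) ^ 2)⁻¹ := by
    rw [denom, m2c_eq_div hτ h hw0, ← hm]
    push_cast
    field_simp
    ring
  have h2 : 0 ≤ (w * (1 + m) ^ 2).im := by
    have e2 : w * (1 + m) ^ 2 = w + w * m + w * m + w * m ^ 2 := by ring
    have h3 : ‖w * m ^ 2‖ ≤ 1 := by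
      rw [norm_mul, norm_pow]
      calc ‖w‖ * ‖m‖ ^ 2 ≤ ‖w‖ * (2 / ‖w‖) ^ 2 := by gcongr
        _ = 4 / ‖w‖ := by
          field_simp
          norm_num
        _ ≤ 1 := by
          rw [div_le_one (by linarith)]
          linarith
    have h4 := (abs_le.1 ((Complex.abs_im_le_norm (w * m ^ 2)).trans h3)).1
    rw [e2, Complex.add_im, Complex.add_im, Complex.add_im]
    linarith
  have h5 : 0 ≤ (((‖z‖ : ℂ) ^ 2 - w * (1 + m) ^ 2)⁻¹).im := by
    rw [Complex.inv_im, Complex.sub_im, ← Complex.ofReal_pow, Complex.ofReal_im, zero_sub, neg_neg]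
    exact div_nonneg h2 (Complex.normSq_nonneg _)
  refine le_trans ?_ (Complex.im_le_norm _)
  rw [e, Complex.add_im, Complex.im_ofReal_mul, Complex.sub_im, Complex.sub_im, Complex.add_im,
    Complex.ofReal_im, Complex.ofReal_im]
  have h6 : 0 ≤ σ i * ‖z‖ ^ 2 * (((‖z‖ : ℂ) ^ 2 - w * (1 + m) ^ 2)⁻¹).im := by
    have := (p.sigma_pos i).le
    positivity
  linarith

/-- The expansions of A and G from `near_zero` are divided by √w: errors O(|√w|) become O(1) while
the leading terms have size |w|^(-1/2). The condition |√w| ≤ q / C makes the imaginary part of the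
leading terms win. -/
lemma zero_edge_bounds (hτ : 0 < τ) (h : Admissible τ σ z) (hw0 : 0 < w.im) (hre0 : 0 ≤ w.re)
    (hz : ‖z‖ ^ 2 ≤ 1 - τ)
    {c C q b t : ℝ} (hc : 0 < c) (hC : 0 < C) (hq : q = √c * τ / 8) (htc : c ≤ t) (htτ : t ≤ τ⁻¹)
    (hrb' : ‖csqrt w‖ ≤ b) (hbq : b ≤ q / C)
    (hA : ‖rootA σ z w - Complex.I * (√t : ℝ)‖ ≤ C * ‖csqrt w‖)
    (hG : ‖rootG σ z w - Complex.I * (√t : ℝ) / ((t : ℂ) + ((‖z‖ ^ 2 : ℝ) : ℂ))‖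
      ≤ C * ‖csqrt w‖) :
    ‖m1c σ z w - Complex.I * (√t : ℝ) / csqrt w‖ ≤ C + 1 ∧
    ‖m2c σ z w - Complex.I * (√t : ℝ) / (csqrt w * ((t : ℂ) + (‖z‖ : ℂ) ^ 2))‖ ≤ C ∧
    q * ‖csqrt w‖⁻¹ ≤ (m1c σ z w).im ∧
    (m1c σ z w).im ≤ (√τ⁻¹ + (C + 1) * b) * ‖csqrt w‖⁻¹ ∧
    q * ‖csqrt w‖⁻¹ ≤ (m2c σ z w).im ∧
    (m2c σ z w).im ≤ (√τ⁻¹ * c⁻¹ + (C + 1) * b) * ‖csqrt w‖⁻¹ ∧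
    ‖w‖ ^ (-(1 / 2 : ℝ)) = ‖csqrt w‖⁻¹ := by
  have p := h.params hτ
  have ht0 : 0 < t := hc.trans_le htc
  have hq0 : 0 < q := by
    rw [hq]
    have := Real.sqrt_pos.2 hc
    positivity
  have hrnorm := norm_sq_csqrt w
  set r := csqrt w with hr
  have hr0 : r ≠ 0 := csqrt_ne_zero hw0
  have hrn : 0 < ‖r‖ := norm_pos_iff.2 hr0
  have e1 : m1c σ z w - Complex.I * (√t : ℝ) / r
      = (rootA σ z w - Complex.I * (√t : ℝ)) / r - 1 := by
    rw [rootA, ← hr]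
    field_simp
    ring
  have htZ : (t : ℂ) + (‖z‖ : ℂ) ^ 2 = ((t + ‖z‖ ^ 2 : ℝ) : ℂ) := by push_cast; rfl
  have htZ0 : 0 < t + ‖z‖ ^ 2 := by positivity
  have htZne : ((t + ‖z‖ ^ 2 : ℝ) : ℂ) ≠ 0 := Complex.ofReal_ne_zero.2 htZ0.ne'
  have e2 : m2c σ z w - Complex.I * (√t : ℝ) / (r * ((t : ℂ) + (‖z‖ : ℂ) ^ 2))
      = (rootG σ z w - Complex.I * (√t : ℝ) / ((t : ℂ) + ((‖z‖ ^ 2 : ℝ) : ℂ))) / r := by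
    rw [rootG, ← hr, htZ, ← Complex.ofReal_add]
    field_simp
  have h1 : ‖m1c σ z w - Complex.I * (√t : ℝ) / r + 1‖ ≤ C := by
    rw [e1, sub_add_cancel, norm_div, div_le_iff₀ hrn]
    exact hA
  have h1' : ‖m1c σ z w - Complex.I * (√t : ℝ) / r‖ ≤ C + 1 := by
    rw [e1]
    refine (norm_sub_le _ _).trans ?_
    rw [norm_one, norm_div]
    gcongr
    rw [div_le_iff₀ hrn]
    exact hA
  have h2 : ‖m2c σ z w - Complex.I * (√t : ℝ) / (r * ((t : ℂ) + (‖z‖ : ℂ) ^ 2))‖ ≤ C := by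
    rw [e2, norm_div, div_le_iff₀ hrn]
    exact hG
  have hpow : ‖w‖ ^ (-(1 / 2 : ℝ)) = ‖r‖⁻¹ := by
    rw [← hrnorm, Real.rpow_neg (by positivity), ← Real.sqrt_eq_rpow, Real.sqrt_sq hrn.le]
  -- Re w ≥ 0 keeps the argument of √w within π/4, so i / √w has imaginary part comparable with its
  -- modulus.
  have hrre : ‖r‖ / 2 ≤ r.re := by
    have hr1 := (csqrt_mem_quadrant hw0)
    have h3 : 0 ≤ r.re * r.re - r.im * r.im := by
      have := congrArg Complex.re (csqrt_sq w)
      rw [sq, Complex.mul_re] at this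
      rw [hr, this]
      exact hre0
    apply le_of_sq_le_sq _ (isSol hτ h hw0).re_pos.le
    have h4 : ‖r‖ ^ 2 = r.re * r.re + r.im * r.im := by
      rw [Complex.sq_norm, Complex.normSq_apply]
    nlinarith [sq_nonneg r.re, sq_nonneg r.im]
  have hIim : (Complex.I * (√t : ℝ) / r).im = √t * (r.re / ‖r‖ ^ 2) := by
    have e : Complex.I * (√t : ℝ) / r = ((√t : ℝ) : ℂ) * (Complex.I * r⁻¹) := by
      rw [div_eq_mul_inv]
      ring
    rw [e, Complex.im_ofReal_mul, Complex.sq_norm]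
    simp [Complex.mul_im, Complex.inv_re]
  have hfrac : ‖r‖⁻¹ / 2 ≤ r.re / ‖r‖ ^ 2 := by
    calc ‖r‖⁻¹ / 2 = ‖r‖ / 2 / ‖r‖ ^ 2 := by field_simp
      _ ≤ _ := by gcongr
  have hst : √c ≤ √t := Real.sqrt_le_sqrt htc
  have hst2 : √t ≤ √τ⁻¹ := Real.sqrt_le_sqrt htτ
  have hCr : C ≤ q * ‖r‖⁻¹ := by
    have : ‖r‖ ≤ q / C := hrb'.trans hbq
    rw [le_div_iff₀ hC] at this
    rw [← div_eq_mul_inv, le_div_iff₀ hrn]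
    linarith
  have hτ1 := p.tau_le_one
  have hinv : 0 < ‖r‖⁻¹ := inv_pos.2 hrn
  have hq8 : q ≤ √c / 8 := by
    rw [hq]
    nlinarith
  have hup : ‖Complex.I * (√t : ℝ) / r‖ = √t * ‖r‖⁻¹ := by
    rw [norm_div, norm_mul, Complex.norm_I, one_mul, Complex.norm_real,
      Real.norm_of_nonneg (Real.sqrt_nonneg _), div_eq_mul_inv]
  have hCb : C + 1 ≤ (C + 1) * b * ‖r‖⁻¹ := by
    rw [mul_assoc]
    apply le_mul_of_one_le_right (by linarith)
    rw [← div_eq_mul_inv, le_div_iff₀ hrn]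
    linarith
  have e3 : Complex.I * (√t : ℝ) / (r * ((t : ℂ) + (‖z‖ : ℂ) ^ 2))
      = (((t + ‖z‖ ^ 2)⁻¹ : ℝ) : ℂ) * (Complex.I * (√t : ℝ) / r) := by
    rw [htZ]
    push_cast
    field_simp
  have h2' := h2
  rw [e3] at h2
  have hZ1 : t + ‖z‖ ^ 2 ≤ 2 / τ := by
    have := p.one_le_inv
    have e : 2 / τ = τ⁻¹ + τ⁻¹ := by ring
    linarith
  have hZ2 : τ / 2 ≤ (t + ‖z‖ ^ 2)⁻¹ := by
    rw [le_inv_comm₀ (by positivity) htZ0, inv_div]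
    exact hZ1
  have hZ3 : (t + ‖z‖ ^ 2)⁻¹ ≤ c⁻¹ := by
    gcongr
    have : 0 ≤ ‖z‖ ^ 2 := by positivity
    linarith
  refine ⟨h1', h2', ?_, ?_, ?_, ?_, hpow⟩
  · have h3 := (abs_le.1 ((Complex.abs_im_le_norm _).trans h1)).1
    rw [Complex.add_im, Complex.one_im, add_zero, Complex.sub_im, hIim] at h3
    have h4 : √c * (‖r‖⁻¹ / 2) ≤ √t * (r.re / ‖r‖ ^ 2) := by gcongr
    have h5 : q * ‖r‖⁻¹ ≤ √c / 8 * ‖r‖⁻¹ := by gcongr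
    have h6 : 0 < √c * ‖r‖⁻¹ := by positivity
    linarith
  · have h3 := norm_sub_norm_le (m1c σ z w) (Complex.I * (√t : ℝ) / r)
    rw [hup] at h3
    have h4 := Complex.im_le_norm (m1c σ z w)
    have h5 : √t * ‖r‖⁻¹ ≤ √τ⁻¹ * ‖r‖⁻¹ := by gcongr
    linarith
  · have h3 := (abs_le.1 ((Complex.abs_im_le_norm _).trans h2)).1
    rw [Complex.sub_im, Complex.im_ofReal_mul, hIim] at h3
    have h4 : τ / 2 * (√c * (‖r‖⁻¹ / 2)) ≤ (t + ‖z‖ ^ 2)⁻¹ * (√t * (r.re / ‖r‖ ^ 2)) := by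
      gcongr
    have h5 : τ / 2 * (√c * (‖r‖⁻¹ / 2)) = q * ‖r‖⁻¹ + q * ‖r‖⁻¹ := by
      rw [hq]
      ring
    linarith
  · have h3 := norm_sub_norm_le (m2c σ z w)
      ((((t + ‖z‖ ^ 2)⁻¹ : ℝ) : ℂ) * (Complex.I * (√t : ℝ) / r))
    rw [norm_mul, hup, Complex.norm_real, Real.norm_of_nonneg (by positivity)] at h3
    have h4 := Complex.im_le_norm (m2c σ z w)
    have h5 : (t + ‖z‖ ^ 2)⁻¹ * (√t * ‖r‖⁻¹) ≤ c⁻¹ * (√τ⁻¹ * ‖r‖⁻¹) := by gcongr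
    linarith

/-- The edge at zero. -/
theorem zero_edge (hτ : 0 < τ) : ∃ τ₀ : ℝ, 0 < τ₀ ∧ ∀ τ' : ℝ, 0 < τ' → τ' ≤ τ₀ →
    ∃ c : ℝ, 0 < c ∧ ∀ ζ : ℝ, 0 < ζ → ∃ C : ℝ, 0 < C ∧
      ∀ (N : ℕ) (σ : Fin N → ℝ) (z : ℂ), Admissible τ σ z → ‖z‖ ^ 2 ≤ 1 - τ →
      ∃ t : ℝ, 0 < t ∧ Comparable C t 1 ∧
      ∀ w ∈ domEdge ζ τ' σ z 0,
        (τ' ≤ w.im →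
          Comparable C ‖1 + m1c σ z w‖ 1 ∧ Comparable C (m1c σ z w).im 1 ∧
          Comparable C ‖m2c σ z w‖ 1 ∧ Comparable C (m2c σ z w).im 1) ∧
        (‖w‖ ≤ 2 * τ' →
          ‖m1c σ z w - Complex.I * (Real.sqrt t : ℂ) / csqrt w‖ ≤ C ∧
          ‖m2c σ z w -
            Complex.I * (Real.sqrt t : ℂ) / (csqrt w * ((t : ℂ) + (‖z‖ : ℂ) ^ 2))‖ ≤ C ∧
          Comparable C (m1c σ z w).im (‖w‖ ^ (-(1 / 2 : ℝ))) ∧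
          Comparable C (m2c σ z w).im (‖w‖ ^ (-(1 / 2 : ℝ)))) ∧
        ∀ i, c ≤ ‖denom σ z (σ i) w‖ := by
  obtain ⟨c, C, hc, hC, H⟩ := near_zero hτ
  obtain ⟨q, hq⟩ : ∃ q, q = √c * τ / 8 := ⟨_, rfl⟩
  have hsc : 0 < √c := Real.sqrt_pos.2 hc
  have hq0 : 0 < q := by
    rw [hq]
    positivity
  obtain ⟨b, hb0, hbc, hbq⟩ : ∃ b, 0 < b ∧ b ≤ c ∧ b ≤ q / C :=
    ⟨min c (q / C), lt_min hc (by positivity), min_le_left _ _, min_le_right _ _⟩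
  -- With τ' ≤ b² / 2, the condition |w| ≤ 2 τ' gives |√w| ≤ b, the range of the expansion. Since 0
  -- ≤ Re w ≤ τ' here, the regimes η ≥ τ' and |w| ≤ 2 τ' cover the domain, so the denominators are
  -- controlled everywhere.
  refine ⟨b ^ 2 / 2, by positivity, fun τ' hτ' hτ'0 => ⟨min c (τ' / 2), by positivity,
    fun ζ hζ => ?_⟩⟩
  obtain ⟨K, hK⟩ : ∃ K, K = 1 + τ⁻¹ + 2 * ζ⁻¹ + 4 / τ ^ 2 * (1 + (√τ')⁻¹) := ⟨_, rfl⟩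
  have hK0 : 0 < K := by
    rw [hK]
    positivity
  obtain ⟨D, hD⟩ : ∃ D, D = 36 * K ^ 8 * (1 + τ'⁻¹) + (C + 1) + q⁻¹ + c⁻¹ + τ⁻¹
    + (√τ⁻¹ + √τ⁻¹ * c⁻¹ + (C + 1) * b) := ⟨_, rfl⟩
  have hD1 : 0 ≤ 36 * K ^ 8 * (1 + τ'⁻¹) := by positivity
  have hD2 : 0 ≤ q⁻¹ := by positivity
  have hD3 : 0 ≤ c⁻¹ := by positivity
  have hD4 : 0 ≤ τ⁻¹ := by positivity
  have hD5 : 0 ≤ √τ⁻¹ := by positivity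
  have hD6 : 0 ≤ √τ⁻¹ * c⁻¹ := by positivity
  have hD7 : 0 ≤ (C + 1) * b := by positivity
  refine ⟨D, by linarith, fun N σ z h hz => ?_⟩
  have p := h.params hτ
  obtain ⟨t, htc, htτ, Ht⟩ := H N σ _ p hz
  have ht0 : 0 < t := hc.trans_le htc
  refine ⟨t, ht0, comparable_of hc (by linarith) (by linarith : τ⁻¹ ≤ D) zero_le_one (by linarith)
    (by linarith), fun w hw => ?_⟩
  obtain ⟨⟨hw0, hre0, hre, -, him⟩, hwE⟩ := hw
  rw [sub_zero, abs_of_nonneg hre0] at hwE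
  have hsplit : ‖w‖ ≤ w.re + w.im := by
    refine (Complex.norm_le_abs_re_add_abs_im w).trans ?_
    rw [abs_of_nonneg hre0, abs_of_pos hw0]
  have hrnorm := norm_sq_csqrt w
  have hrb : ‖w‖ ≤ 2 * τ' → ‖csqrt w‖ ≤ b := by
    intro hw2
    apply le_of_sq_le_sq _ hb0.le
    linarith
  refine ⟨fun hη => ?_, fun hw2 => ?_, fun i => ?_⟩
  · have B : Bounded τ σ z w K := by
      rw [hK]
      refine bounded_of_le hτ h hw0 hτ' (hη.trans (Complex.im_le_norm w)) ?_
      linarith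
    have hKD : 36 * K ^ 8 ≤ D := by
      have : 0 ≤ 36 * K ^ 8 * τ'⁻¹ := by positivity
      linarith
    obtain ⟨h1, h2⟩ := B.comparable_norm hτ h hw0 hKD
    obtain ⟨h3, h4⟩ := B.comparable_im hτ h hw0 hτ' hη (by linarith : _ ≤ D)
    exact ⟨h1, h3, h2, h4⟩
  · have hrb' := hrb hw2
    obtain ⟨hA, hG, -⟩ := Ht _ _ _ (isSol hτ h hw0) (hrb'.trans hbc)
    have h1 := zero_edge_bounds hτ h hw0 hre0 hz hc hC hq htc htτ hrb' hbq hA hG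
    obtain ⟨h1, h2, h3, h4, h5, h6, hpow⟩ := h1
    have hinv : 0 ≤ ‖w‖ ^ (-(1 / 2 : ℝ)) := by positivity
    rw [← hpow] at h3 h4 h5 h6
    refine ⟨h1.trans (by linarith), h2.trans (by linarith),
      comparable_of hq0 (by linarith) (by linarith : √τ⁻¹ + (C + 1) * b ≤ D) hinv h3 h4,
      comparable_of hq0 (by linarith) (by linarith : √τ⁻¹ * c⁻¹ + (C + 1) * b ≤ D) hinv h5 h6⟩
  · by_cases hη : τ' ≤ w.im
    · refine (min_le_right _ _).trans (le_trans ?_ (half_im_le_norm_denom hτ h hw0 i))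
      linarith
    · push Not at hη
      rw [norm_denom]
      exact (min_le_left _ _).trans ((Ht _ _ _ (isSol hτ h hw0)
        ((hrb (by linarith)).trans hbc)).2.2 i)

end CircularLaw

/-! ### Outside the support and regular bulk components -/

namespace CircularLaw

variable {τ : ℝ} {N : ℕ} {σ : Fin N → ℝ} {z : ℂ} {w : ℂ}

lemma m1c_differentiableOn (hτ : 0 < τ) (h : Admissible τ σ z) :
    DifferentiableOn ℂ (m1c σ z) upperHalf :=
  (m1c_spec hτ h).analytic

lemma m2c_differentiableOn (hτ : 0 < τ) (h : Admissible τ σ z) :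
    DifferentiableOn ℂ (m2c σ z) upperHalf := by
  have h1 := m1c_differentiableOn hτ h
  have h2 : DifferentiableOn ℂ
      (fun w => (1 + m1c σ z w) / ((‖z‖ : ℂ) ^ 2 - w * (1 + m1c σ z w) ^ 2)) upperHalf := by
    refine (h1.const_add 1).div
      (DifferentiableOn.const_sub (differentiableOn_id.mul ((h1.const_add 1).pow 2)) _) ?_
    exact fun w hw => norm_pos_iff.1 (hτ.trans_le (tau_le_norm_X_root hτ h hw))
  exact h2.congr fun w hw => m2c_eq_div hτ h hw

lemma den_inv_differentiableOn (hτ : 0 < τ) (h : Admissible τ σ z) (i : Fin N) :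
    DifferentiableOn ℂ (fun w => (den σ z w i)⁻¹) upperHalf := by
  have h1 := m1c_differentiableOn hτ h
  have h2 := m2c_differentiableOn hτ h
  refine DifferentiableOn.inv ?_ fun w hw => den_ne hτ h hw i
  unfold den
  refine (differentiableOn_id.neg.mul ((h2.const_mul _).const_add 1)).add
    ((differentiableOn_const _).div (h1.const_add 1) fun w hw => one_add_m1c_ne hτ h hw)

/-- If the density vanishes on an interval of half length `ρ`, the denominators are bounded from
below above its midpoint. -/
lemma den_inv_im_le (hτ : 0 < τ) (h : Admissible τ σ z) (hw : 0 < w.im) {ρ : ℝ} (hρ : 0 < ρ)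
    (hx : ∀ x ∈ Icc (w.re - ρ) (w.re + ρ), x ∉ supp1 σ z) (i : Fin N) :
    (den σ z w i)⁻¹.im ≤ 2 * w.im / ρ ^ 2 := by
  have p := h.params hτ
  have hN : (0 : ℝ) < N := by exact_mod_cast p.card_pos
  have hs := p.sigma_pos i
  -- Each summand is treated on its own. Its imaginary part vanishes on the segment because σ i Im
  -- (1 / den i) ≤ N Im m₁; the factor N enters only this qualitative limit, whereas the rate comes
  -- from |1 / den i| ≤ 1 / Im w.
  refine im_le_of_vanish (den_inv_differentiableOn hτ h i) hρ ?_ ?_ hw rfl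
  · intro v hv
    have hv' : 0 < v.im := hv
    refine (Complex.im_le_norm _).trans ?_
    rw [norm_inv, one_div]
    have := im_le_norm_den hτ h hv i
    gcongr
  · intro x hxm ε hε
    have h1 := tendsto_m1c_im_of_notMem hτ h (hx x hxm)
    have h2 : 0 < σ i * ε / N := by positivity
    filter_upwards [h1.eventually (eventually_le_nhds h2), self_mem_nhdsWithin] with v hv hvU
    rw [m1c_im_eq hτ h hvU] at hv
    have h3 := le_card_mul_avg (F := fun i => σ i * (den σ z v i)⁻¹.im)
      (fun j => (mul_pos (p.sigma_pos j) (den_inv_im_pos hτ h hvU j)).le) i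
    have h4 : σ i * (den σ z v i)⁻¹.im ≤ σ i * ε := by
      refine h3.trans ?_
      calc (N : ℝ) * _ ≤ N * (σ i * ε / N) := by gcongr
        _ = _ := by field_simp
    exact le_of_mul_le_mul_left h4 hs

/-- Outside the support. -/
theorem outside (hτ : 0 < τ) (τ' : ℝ) (hτ' : 0 < τ') :
    ∃ c : ℝ, 0 < c ∧ ∀ ζ : ℝ, 0 < ζ → ∃ C : ℝ, 0 < C ∧
      ∀ (N : ℕ) (σ : Fin N → ℝ) (z : ℂ), Admissible τ σ z →
      ∀ w ∈ domOut ζ τ' σ z,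
        Comparable C (m1c σ z w).im w.im ∧ Comparable C (m2c σ z w).im w.im ∧
        Comparable C ‖1 + m1c σ z w‖ 1 ∧ Comparable C ‖m2c σ z w‖ 1 ∧
        ∀ i, c ≤ ‖denom σ z (σ i) w‖ := by
  refine ⟨τ' / 8, by positivity, fun ζ hζ => ?_⟩
  obtain ⟨ρ, hρ⟩ : ∃ ρ, ρ = τ' / 2 := ⟨_, rfl⟩
  have hρ0 : 0 < ρ := by
    rw [hρ]
    positivity
  obtain ⟨K, hK⟩ : ∃ K, K = 1 + τ⁻¹ + 2 * ζ⁻¹ + 4 / τ ^ 2 * (1 + (√τ')⁻¹) + 256 / τ ^ 9 :=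
    ⟨_, rfl⟩
  have hk1 : 0 ≤ τ⁻¹ := by positivity
  have hk2 : 0 ≤ 2 * ζ⁻¹ := by positivity
  have hk3 : 0 ≤ 4 / τ ^ 2 * (1 + (√τ')⁻¹) := by positivity
  have hk4 : 0 ≤ 256 / τ ^ 9 := by positivity
  have hK0 : 0 < K := by linarith
  obtain ⟨U, hU⟩ : ∃ U, U = K ^ 4 * (3 * K + 9 * K * (2 / ρ ^ 2)) := ⟨_, rfl⟩
  have hU0 : 0 < U := by
    rw [hU]
    positivity
  obtain ⟨C, hC⟩ : ∃ C, C = 36 * K ^ 8 + 2 / ρ ^ 2 + U := ⟨_, rfl⟩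
  have hc1 : 0 < 36 * K ^ 8 := by positivity
  have hc2 : 0 ≤ 2 / ρ ^ 2 := by positivity
  refine ⟨C, by linarith, fun N σ z h w hw => ?_⟩
  obtain ⟨⟨hw0, hre0, hre, -, him⟩, hdist⟩ := hw
  have p := h.params hτ
  have hwM : ‖w‖ ≤ 2 * ζ⁻¹ := by
    refine (Complex.norm_le_abs_re_add_abs_im w).trans ?_
    rw [abs_of_nonneg hre0, abs_of_pos hw0]
    linarith
  -- For |z| < 1 the point 0 belongs to the support, so |w| ≥ τ'. For |z| > 1, w may approach 0, but
  -- 1 + m₁ is bounded there as well.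
  have B : Bounded τ σ z w K := by
    rcases h.z_cases with hz | hz
    · have h1 : τ' ≤ ‖w‖ := by
        have h2 := Metric.infDist_le_dist_of_mem (x := w.re) (zero_mem_supp1 hτ h hz)
        rw [Real.dist_eq, sub_zero] at h2
        exact (hdist.trans h2).trans (Complex.abs_re_le_norm w)
      exact (bounded_of_le hτ h hw0 hτ' h1 hwM).mono (by linarith)
    · have h1 := norm_one_add_le_of_gt hτ h hz hw0
      exact ⟨by linarith, by linarith, by linarith, by linarith⟩
  have hK1 := B.one_le
  have hsupp : ∀ x ∈ Icc (w.re - ρ) (w.re + ρ), x ∉ supp1 σ z := by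
    intro x hx hxs
    have h2 := Metric.infDist_le_dist_of_mem (x := w.re) hxs
    rw [Real.dist_eq] at h2
    have h3 : |w.re - x| ≤ ρ := by
      rw [abs_le]
      constructor <;> linarith [hx.1, hx.2]
    linarith
  have hden := den_inv_im_le hτ h hw0 hρ0 hsupp
  have hm1 : (m1c σ z w).im ≤ 2 / ρ ^ 2 * w.im := by
    calc (m1c σ z w).im = avg (fun i => σ i * (den σ z w i)⁻¹.im) := m1c_im_eq hτ h hw0
      _ ≤ avg (fun i => σ i * (2 * w.im / ρ ^ 2)) := by
          apply avg_mono
          intro i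
          have := (p.sigma_pos i).le
          have := hden i
          gcongr
      _ = 2 / ρ ^ 2 * w.im := by
          rw [avg_mul_right, p.mean]
          ring
  have h7 := B.m1c_im_ge hτ h hw0
  have h8 := B.m2c_im_ge hτ h hw0
  rw [show (6 * K ^ 4) ^ 2 = 36 * K ^ 8 by ring, div_eq_inv_mul] at h7
  rw [show (6 * K ^ 3) ^ 2 = 36 * K ^ 6 by ring, div_eq_inv_mul] at h8
  have h9 : (36 * K ^ 8)⁻¹ * w.im ≤ (36 * K ^ 6)⁻¹ * w.im := by
    gcongr
    · norm_num
  have hm2 : (m2c σ z w).im ≤ U * w.im := by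
    refine (B.m2c_im_le hτ h hw0).trans ?_
    calc K ^ 4 * (3 * K * w.im + 9 * K * (m1c σ z w).im)
        ≤ K ^ 4 * (3 * K * w.im + 9 * K * (2 / ρ ^ 2 * w.im)) := by gcongr
      _ = _ := by
        rw [hU]
        ring
  obtain ⟨h1, h2⟩ := B.comparable_norm hτ h hw0 (by linarith : 36 * K ^ 8 ≤ C)
  refine ⟨comparable_of (l := (36 * K ^ 8)⁻¹) (u := 2 / ρ ^ 2) (by positivity)
    (by rw [inv_inv]; linarith) (by linarith) hw0.le h7 hm1,
    comparable_of (l := (36 * K ^ 8)⁻¹) (u := U) (by positivity) (by rw [inv_inv]; linarith)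
    (by linarith) hw0.le (h9.trans h8) hm2, h1, h2, fun i => ?_⟩
  -- Im w / |den|² ≤ Im (1 / den) ≤ 2 Im w / ρ²; cancelling Im w bounds |den| from below
  -- independently of ζ.
  have h3 := (den_inv_im_ge hτ h hw0 i).trans (hden i)
  have h4 : 0 < ‖den σ z w i‖ := norm_pos_iff.2 (den_ne hτ h hw0 i)
  have h5 : ρ / 2 ≤ ‖den σ z w i‖ := by
    apply le_of_sq_le_sq _ h4.le
    rw [div_le_div_iff₀ (by positivity) (by positivity)] at h3
    have : w.im * ρ ^ 2 ≤ w.im * (2 * ‖den σ z w i‖ ^ 2) := by linarith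
    have := le_of_mul_le_mul_left this hw0
    nlinarith
  rw [norm_denom_eq hτ h hw0]
  have h6 := half_le_norm_one_add hτ h hw0
  calc τ' / 8 = 1 / 2 * (ρ / 2) := by
        rw [hρ]
        ring
    _ ≤ _ := by gcongr

lemma Bounded.m2c_im_ge_of_im {K e y : ℝ} (b : Bounded τ σ z w K) (hτ : 0 < τ)
    (h : Admissible τ σ z) (hw : 0 < w.im) (he : 0 < e) (hy : 0 < y) (hwe : e ≤ w.re)
    (hwy : y ≤ (m1c σ z w).im) : e * y / (3 * K * (6 * K ^ 3) ^ 2) ≤ (m2c σ z w).im := by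
  have hK1 := b.one_le
  rw [div_le_iff₀' (by positivity)]
  refine le_trans ?_ (b.re_mul_m1c_im_le hτ h hw)
  have : 0 ≤ w.re := he.le.trans hwe
  gcongr

/-- A lower bound on `Im m₁` away from zero bounds the denominators from below. -/
lemma Bounded.norm_denom_ge_of_im {K e y : ℝ} (b : Bounded τ σ z w K) (hτ : 0 < τ)
    (h : Admissible τ σ z) (hw : 0 < w.im) (he : 0 < e) (hy : 0 < y) (hwe : e ≤ w.re)
    (hwy : y ≤ (m1c σ z w).im) (i : Fin N) :
    min (τ / 4) (4 * K ^ 2)⁻¹ * (e * (e * y / (3 * K * (6 * K ^ 3) ^ 2)))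
      ≤ ‖denom σ z (σ i) w‖ := by
  have p := h.params hτ
  have hK1 := b.one_le
  obtain ⟨Y, hY⟩ : ∃ Y, Y = e * y / (3 * K * (6 * K ^ 3) ^ 2) := ⟨_, rfl⟩
  rw [← hY]
  have hY0 : 0 < Y := by
    rw [hY]
    positivity
  have h1 : Y ≤ (m2c σ z w).im := by
    rw [hY]
    exact b.m2c_im_ge_of_im hτ h hw he hy hwe hwy
  -- If Im w is not small the trivial bound suffices. Otherwise Re w Im m₂ dominates Im (w m₂),
  -- which enters -Im den with weight σ i ≥ τ.
  by_cases hη : e * Y / (2 * K ^ 2) ≤ w.im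
  · refine le_trans ?_ (half_im_le_norm_denom hτ h hw i)
    calc min (τ / 4) (4 * K ^ 2)⁻¹ * (e * Y) ≤ (4 * K ^ 2)⁻¹ * (e * Y) := by
          gcongr
          exact min_le_right _ _
      _ = e * Y / (2 * K ^ 2) / 2 := by
          field_simp
          norm_num
      _ ≤ _ := by gcongr
  · push Not at hη
    rw [lt_div_iff₀ (by positivity)] at hη
    have h2 : e * Y / 2 ≤ (w * m2c σ z w).im := by
      rw [Complex.mul_im]
      have h3 : e * Y ≤ w.re * (m2c σ z w).im := by
        gcongr
        linarith
      have h4 := (abs_le.1 ((Complex.abs_re_le_norm _).trans (b.norm_m2c_le hτ h hw))).1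
      have h5 : w.im * -K ^ 2 ≤ w.im * (m2c σ z w).re := by gcongr
      linarith
    have h3 : τ * (e * Y / 2) ≤ ‖den σ z w i‖ := by
      have h4 : -‖den σ z w i‖ ≤ (den σ z w i).im :=
        (abs_le.1 (Complex.abs_im_le_norm (den σ z w i))).1
      have h5 : (den σ z w i).im = _ := den_im i
      have h6 : 0 ≤ ‖z‖ ^ 2 * (m1c σ z w).im / ‖1 + m1c σ z w‖ ^ 2 := by
        have := (m1c_spec hτ h).im_pos w hw
        positivity
      have h7 : τ * (e * Y / 2) ≤ σ i * (w * m2c σ z w).im := by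
        have := p.lower i
        have := p.sigma_pos i
        gcongr
      linarith
    rw [norm_denom_eq hτ h hw]
    have h6 := half_le_norm_one_add hτ h hw
    calc min (τ / 4) (4 * K ^ 2)⁻¹ * (e * Y) ≤ τ / 4 * (e * Y) := by
          gcongr
          exact min_le_left _ _
      _ = 1 / 2 * (τ * (e * Y / 2)) := by ring
      _ ≤ _ := by gcongr

/-- Regular bulk components. -/
theorem bulk (hτ : 0 < τ) (τ' : ℝ) (hτ' : 0 < τ') (g : ℝ → ℝ) (hg : ∀ δ : ℝ, 0 < δ → 0 < g δ) :
    ∃ c : ℝ, 0 < c ∧ ∀ ζ : ℝ, 0 < ζ → ∃ C : ℝ, 0 < C ∧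
      ∀ (N : ℕ) (σ : Fin N → ℝ) (z : ℂ), Admissible τ σ z →
      ∀ a b : ℝ, IsBulkComponent σ z a b → IsRegularBulk g σ z a b →
      ∀ w ∈ domBulk ζ τ' σ z a b,
        Comparable C ‖1 + m1c σ z w‖ 1 ∧ Comparable C (m1c σ z w).im 1 ∧
        Comparable C ‖m2c σ z w‖ 1 ∧ Comparable C (m2c σ z w).im 1 ∧
        ∀ i, c ≤ ‖denom σ z (σ i) w‖ := by
  obtain ⟨ρ, hρ⟩ : ∃ ρ, ρ = τ' / 2 := ⟨_, rfl⟩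
  have hρ0 : 0 < ρ := by
    rw [hρ]
    positivity
  obtain ⟨y₀, hy₀⟩ : ∃ y, y = Real.pi * g ρ / 4 := ⟨_, rfl⟩
  have hy0 : 0 < y₀ := by
    have := Real.pi_pos
    have := hg ρ hρ0
    rw [hy₀]
    positivity
  obtain ⟨κ, hκ⟩ : ∃ κ : ℝ → ℝ, κ = fun M => 1 + τ⁻¹ + M + 4 / τ ^ 2 * (1 + (√τ')⁻¹) := ⟨_, rfl⟩
  have hκ0 : ∀ M, 0 ≤ M → 0 < κ M := by
    intro M hM
    rw [hκ]
    positivity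
  obtain ⟨K₀, hK₀⟩ : ∃ K, K = κ (16 / τ) := ⟨_, rfl⟩
  have hK₀0 : 0 < K₀ := hK₀ ▸ hκ0 _ (by positivity)
  -- a lower bound on `Im m₁` in a strip above the component
  have hlow : ∀ (N : ℕ) (σ : Fin N → ℝ) (z : ℂ), Admissible τ σ z →
      ∀ a b : ℝ, IsBulkComponent σ z a b → IsRegularBulk g σ z a b →
      ∀ w : ℂ, 0 < w.im → w.re ∈ Icc (a + τ') (b - τ') →
        τ' ≤ w.re ∧ (w.im ≤ ρ / 2 → y₀ ≤ (m1c σ z w).im) := by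
    intro N σ z h a b hab hreg w hw hwab
    have ha0 : 0 ≤ a := supp1_subset hτ h hab.1
    refine ⟨by linarith [hwab.1], fun hη => ?_⟩
    have hpi := Real.pi_pos
    rw [hy₀]
    refine le_im_of_boundary (m1c_differentiableOn hτ h) hρ0 ?_ ?_ ?_ hw rfl hη
    · have := hg ρ hρ0
      positivity
    · exact fun v hv => ((m1c_spec hτ h).im_pos v hv).le
    · intro x hx ε hε
      have hx1 : a + ρ ≤ x := by linarith [hx.1, hwab.1]
      have hx2 : x ≤ b - ρ := by linarith [hx.2, hwab.2]
      have hx0 : 0 < x := by linarith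
      have h1 := hreg ρ hρ0 x ⟨hx1, hx2⟩
      rw [rho1c_eq hτ h hx0] at h1
      have h2 : Real.pi * g ρ ≤ (m1Real σ z x).im := by
        calc Real.pi * g ρ ≤ Real.pi * (Real.pi⁻¹ * (m1Real σ z x).im) := by gcongr
          _ = _ := by field_simp
      exact (tendsto_m1c_im hτ h hx0).eventually (eventually_ge_nhds (by linarith))
  obtain ⟨c₁, hc₁⟩ : ∃ c, c = min (τ / 4) (4 * K₀ ^ 2)⁻¹
    * (τ' * (τ' * y₀ / (3 * K₀ * (6 * K₀ ^ 3) ^ 2))) := ⟨_, rfl⟩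
  have hc₁0 : 0 < c₁ := by
    rw [hc₁]
    positivity
  -- Three regimes keep c independent of ζ: η ≥ ρ/2, then |w| ≥ 16/τ, and the remaining bounded
  -- region, where the constant K₀ does not involve ζ.
  refine ⟨min c₁ (min (ρ / 4) (4 / τ)), by positivity, fun ζ hζ => ?_⟩
  obtain ⟨K, hK⟩ : ∃ K, K = κ (2 * ζ⁻¹) := ⟨_, rfl⟩
  have hK0 : 0 < K := hK ▸ hκ0 _ (by positivity)
  obtain ⟨Y, hY⟩ : ∃ Y, Y = τ' * y₀ / (3 * K * (6 * K ^ 3) ^ 2) := ⟨_, rfl⟩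
  have hY0 : 0 < Y := by
    rw [hY]
    positivity
  obtain ⟨C, hC⟩ : ∃ C, C = 36 * K ^ 8 * (1 + (ρ / 2)⁻¹) + y₀⁻¹ + Y⁻¹ := ⟨_, rfl⟩
  have hc2 : 0 ≤ 36 * K ^ 8 * (ρ / 2)⁻¹ := by positivity
  have hc3 : 0 < y₀⁻¹ := by positivity
  have hc4 : 0 < Y⁻¹ := by positivity
  have hc5 : 0 < 36 * K ^ 8 := by positivity
  refine ⟨C, by linarith, fun N σ z h a b hab hreg w hw => ?_⟩
  obtain ⟨⟨hw0, hre0, hre, -, him⟩, hwab⟩ := hw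
  obtain ⟨hre', hl⟩ := hlow N σ z h a b hab hreg w hw0 hwab
  have hwM : ‖w‖ ≤ 2 * ζ⁻¹ := by
    refine (Complex.norm_le_abs_re_add_abs_im w).trans ?_
    rw [abs_of_nonneg hre0, abs_of_pos hw0]
    linarith
  have hwτ : τ' ≤ ‖w‖ := hre'.trans (Complex.re_le_norm w)
  have B : Bounded τ σ z w K := by
    rw [hK, hκ]
    exact bounded_of_le hτ h hw0 hτ' hwτ hwM
  have hK1 := B.one_le
  obtain ⟨h1, h2⟩ := B.comparable_norm hτ h hw0 (by linarith : 36 * K ^ 8 ≤ C)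
  have h3 : Comparable C (m1c σ z w).im 1 ∧ Comparable C (m2c σ z w).im 1 := by
    by_cases hη : ρ / 2 ≤ w.im
    · exact B.comparable_im hτ h hw0 (by positivity) hη (by linarith)
    · push Not at hη
      have hy := hl hη.le
      have hk1 : K ≤ K ^ 8 := le_self_pow₀ hK1 (by norm_num)
      have hk2 : K ^ 2 ≤ K ^ 8 := pow_le_pow_right₀ hK1 (by norm_num)
      have h4 := B.m1c_im_le
      have h5 := B.m2c_im_le' hτ h hw0
      have h6 : Y ≤ (m2c σ z w).im := by
        rw [hY]
        exact B.m2c_im_ge_of_im hτ h hw0 hτ' hy0 hre' hy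
      exact ⟨comparable_of (u := 36 * K ^ 8) hy0 (by linarith) (by linarith) zero_le_one
        (by linarith) (by linarith), comparable_of (u := 36 * K ^ 8) hY0 (by linarith)
        (by linarith) zero_le_one (by linarith) (by linarith)⟩
  refine ⟨h1, h3.1, h2, h3.2, fun i => ?_⟩
  by_cases hη : ρ / 2 ≤ w.im
  · refine (min_le_right _ _).trans ((min_le_left _ _).trans ?_)
    exact le_trans (by linarith) (half_im_le_norm_denom hτ h hw0 i)
  push Not at hη
  by_cases hW : 16 / τ ≤ ‖w‖
  · refine (min_le_right _ _).trans ((min_le_right _ _).trans ?_)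
    refine le_trans ?_ ((large_bounds hτ h hw0 hW).2 i).1
    have : 4 / τ = 16 / τ / 4 := by ring
    rw [this]
    gcongr
  · push Not at hW
    have B₀ : Bounded τ σ z w K₀ := by
      rw [hK₀, hκ]
      exact bounded_of_le hτ h hw0 hτ' hwτ hW.le
    refine (min_le_left _ _).trans ?_
    rw [hc₁]
    exact B₀.norm_denom_ge_of_im hτ h hw0 hτ' hy0 hre' (hl hη.le) i

end CircularLaw

/-! ### Taylor estimates and the square root dichotomy -/

namespace CircularLaw

/-- A second order Taylor estimate for differences of values of an analytic function. -/
theorem norm_taylor_sub_le {φ : ℂ → ℂ} {m₀ : ℂ} {R M : ℝ} (hR : 0 < R)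
    (hφ : DifferentiableOn ℂ φ (Metric.ball m₀ R)) (hM : ∀ m ∈ Metric.ball m₀ R, ‖φ m‖ ≤ M)
    {ρ : ℝ} (hρ : ρ < R / 2) {m m' : ℂ} (hm : ‖m - m₀‖ ≤ ρ) (hm' : ‖m' - m₀‖ ≤ ρ) :
    ‖φ m - φ m' - (m - m') * (deriv φ m₀ + iteratedDeriv 2 φ m₀ * ((m + m') / 2 - m₀))‖
      ≤ 6 * M / (R / 4) ^ 3 * ρ ^ 2 * ‖m - m'‖ := by
  set L := 6 * M / (R / 4) ^ 3 with hL
  have hρ0 : 0 ≤ ρ := (norm_nonneg _).trans hm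
  have hM0 : 0 ≤ M := (norm_nonneg _).trans (hM m₀ (Metric.mem_ball_self hR))
  have hL0 : 0 ≤ L := by positivity
  set S := Metric.closedBall m₀ ρ with hS
  have hconv : Convex ℝ S := convex_closedBall _ _
  have hSR : S ⊆ Metric.ball m₀ R := Metric.closedBall_subset_ball (by linarith)
  have hm₀ : m₀ ∈ S := Metric.mem_closedBall_self hρ0
  have hSn : ∀ u ∈ S, ‖u - m₀‖ ≤ ρ := fun u hu => by rwa [← dist_eq_norm]
  have hopen : IsOpen (Metric.ball m₀ R) := Metric.isOpen_ball
  have hd1 : DifferentiableOn ℂ (deriv φ) (Metric.ball m₀ R) := hφ.deriv hopen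
  have hd2 : DifferentiableOn ℂ (deriv (deriv φ)) (Metric.ball m₀ R) := hd1.deriv hopen
  have hat : ∀ {g : ℂ → ℂ}, DifferentiableOn ℂ g (Metric.ball m₀ R) → ∀ u ∈ S,
      DifferentiableAt ℂ g u := fun hg u hu => hg.differentiableAt (hopen.mem_nhds (hSR hu))
  have e2 : iteratedDeriv 2 φ = deriv (deriv φ) := by
    rw [iteratedDeriv_succ, iteratedDeriv_one]
  have e3 : iteratedDeriv 3 φ = deriv (deriv (deriv φ)) := by
    rw [iteratedDeriv_succ, e2]
  rw [e2]
  set k := deriv (deriv φ) m₀ with hk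
  -- third derivative
  have b3 : ∀ u ∈ S, ‖deriv (deriv (deriv φ)) u‖ ≤ L := by
    intro u hu
    rw [← e3]
    have hsub : Metric.closedBall u (R / 4) ⊆ Metric.ball m₀ R := by
      apply Metric.closedBall_subset_ball'
      have : dist u m₀ ≤ ρ := hu
      linarith
    have h1 := Complex.norm_iteratedDeriv_le_of_forall_mem_sphere_norm_le 3
      (by positivity : 0 < R / 4) ((hφ.mono hsub).diffContOnCl_ball subset_rfl)
      (fun v hv => hM v (hsub (Metric.sphere_subset_closedBall hv)))
    have e : ((3 : ℕ).factorial : ℝ) = 6 := by norm_num [Nat.factorial]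
    rwa [e] at h1
  have b2 : ∀ u ∈ S, ‖deriv (deriv φ) u - k‖ ≤ L * ρ := by
    intro u hu
    refine (hconv.norm_image_sub_le_of_norm_deriv_le (hat hd2) b3 hm₀ hu).trans ?_
    gcongr
    exact hSn u hu
  have b1 : ∀ u ∈ S, ‖deriv φ u - deriv φ m₀ - k * (u - m₀)‖ ≤ L * ρ * ρ := by
    intro u hu
    have hder : ∀ v ∈ S, HasDerivAt (fun v => deriv φ v - k * v) (deriv (deriv φ) v - k) v := by
      intro v hv
      simpa using (hat hd1 v hv).hasDerivAt.fun_sub ((hasDerivAt_id v).const_mul k)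
    have h1 := hconv.norm_image_sub_le_of_norm_deriv_le
      (fun v hv => (hder v hv).differentiableAt)
      (fun v hv => by rw [(hder v hv).deriv]; exact b2 v hv) hm₀ hu
    have e : deriv φ u - deriv φ m₀ - k * (u - m₀)
        = deriv φ u - k * u - (deriv φ m₀ - k * m₀) := by ring
    rw [e]
    refine h1.trans ?_
    gcongr
    exact hSn u hu
  -- The function minus its quadratic Taylor part has derivative O(ρ²), so its increment gains the
  -- factor |m - m'|. For m' the conjugate of m this factor is 2 |Im m|.
  have hder : ∀ v ∈ S, HasDerivAt (fun v => φ v - deriv φ m₀ * v - k / 2 * (v - m₀) ^ 2)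
      (deriv φ v - deriv φ m₀ - k * (v - m₀)) v := by
    intro v hv
    have h1 := (((hasDerivAt_id v).sub_const m₀).fun_pow 2).const_mul (k / 2)
    have h2 := ((hat hφ v hv).hasDerivAt.fun_sub
      ((hasDerivAt_id v).const_mul (deriv φ m₀))).fun_sub h1
    refine h2.congr_deriv ?_
    norm_num
    ring
  have hmS : m ∈ S := by rwa [hS, Metric.mem_closedBall, dist_eq_norm]
  have hmS' : m' ∈ S := by rwa [hS, Metric.mem_closedBall, dist_eq_norm]
  have h1 := hconv.norm_image_sub_le_of_norm_deriv_le
    (fun v hv => (hder v hv).differentiableAt)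
    (fun v hv => by rw [(hder v hv).deriv]; exact b1 v hv) hmS' hmS
  have e : φ m - φ m' - (m - m') * (deriv φ m₀ + k * ((m + m') / 2 - m₀))
      = φ m - deriv φ m₀ * m - k / 2 * (m - m₀) ^ 2
        - (φ m' - deriv φ m₀ * m' - k / 2 * (m' - m₀) ^ 2) := by ring
  rw [e]
  refine h1.trans (le_of_eq ?_)
  ring

lemma norm_iteratedDeriv_two_le {φ : ℂ → ℂ} {m₀ : ℂ} {R M : ℝ} (hR : 0 < R)
    (hφ : DifferentiableOn ℂ φ (Metric.ball m₀ R)) (hM : ∀ m ∈ Metric.ball m₀ R, ‖φ m‖ ≤ M) :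
    ‖iteratedDeriv 2 φ m₀‖ ≤ 2 * M / (R / 2) ^ 2 := by
  have hsub : Metric.closedBall m₀ (R / 2) ⊆ Metric.ball m₀ R :=
    Metric.closedBall_subset_ball (by linarith)
  have h1 := Complex.norm_iteratedDeriv_le_of_forall_mem_sphere_norm_le 2
    (by positivity : 0 < R / 2) ((hφ.mono hsub).diffContOnCl_ball subset_rfl)
    (fun v hv => hM v (hsub (Metric.sphere_subset_closedBall hv)))
  simpa using h1

/-- T has size η and is approximated by q v with |q| of size s, so v has size η / s. The smallness
of s makes each error at most half of the term it competes with. -/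
lemma im_bounds_of_error {L s y η v q T : ℝ} (hL : 1 ≤ L) (hs0 : 0 < s)
    (hsL : 100 * L ^ 5 * s ≤ 1) (hy0 : 0 ≤ y) (hyup : y ≤ 2 * L * s) (hη : 0 < η) (hv : 0 < v)
    (hq : (2 * L ^ 2)⁻¹ * s ≤ |q|) (hq' : |q| ≤ 2 * L ^ 2 * s) (hT : L⁻¹ * η ≤ T)
    (hT' : T ≤ L * η) (h : |T - q * v| ≤ L * (s ^ 2 + y ^ 2) * v + L * s ^ 2 * η) :
    (6 * L ^ 3)⁻¹ * (η / s) ≤ v ∧ v ≤ 8 * L ^ 3 * (η / s) := by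
  have hL0 : 0 < L := by linarith
  have hp : ∀ n : ℕ, 1 ≤ L ^ n := fun n => one_le_pow₀ hL
  have h5 : L * (s ^ 2 + y ^ 2) ≤ (4 * L ^ 2)⁻¹ * s := by
    calc L * (s ^ 2 + y ^ 2) ≤ L * (s ^ 2 + (2 * L * s) ^ 2) := by gcongr
      _ = (L + 4 * L ^ 3) * s ^ 2 := by ring
      _ ≤ (L ^ 3 + 4 * L ^ 3) * s ^ 2 := by
        gcongr
        exact le_self_pow₀ hL (by norm_num)
      _ = (4 * L ^ 2)⁻¹ * s * (20 * L ^ 5 * s) := by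
        field_simp
        ring
      _ ≤ (4 * L ^ 2)⁻¹ * s * 1 := by
        gcongr
        have : 0 ≤ 80 * L ^ 5 * s := by positivity
        linarith
      _ = _ := by ring
  have h6 : L * s ^ 2 ≤ L⁻¹ / 2 := by
    have h7 : L ^ 2 * s * s ≤ L ^ 5 * s * 1 := by
      have : s ≤ 1 := by nlinarith [hp 5]
      have : L ^ 2 ≤ L ^ 5 := pow_le_pow_right₀ hL (by norm_num)
      gcongr
    calc L * s ^ 2 = L⁻¹ * (L ^ 2 * s * s) := by field_simp
      _ ≤ L⁻¹ * (1 / 2) := by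
        gcongr
        linarith
      _ = _ := by ring
  have he1 : L * (s ^ 2 + y ^ 2) * v ≤ (4 * L ^ 2)⁻¹ * s * v := by gcongr
  have he2 : L * s ^ 2 * η ≤ L⁻¹ / 2 * η := by gcongr
  have hT0 : 0 < T := lt_of_lt_of_le (by positivity) hT
  have habs : |q * v| = |q| * v := by rw [abs_mul, abs_of_pos hv]
  have hA : |q| * v ≤ T + ((4 * L ^ 2)⁻¹ * s * v + L⁻¹ / 2 * η) := by
    have := abs_sub_abs_le_abs_sub (q * v) T
    rw [abs_sub_comm, habs, abs_of_pos hT0] at this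
    linarith
  have hB : T ≤ |q| * v + ((4 * L ^ 2)⁻¹ * s * v + L⁻¹ / 2 * η) := by
    have := abs_sub_abs_le_abs_sub T (q * v)
    rw [habs, abs_of_pos hT0] at this
    linarith
  have hLi : L⁻¹ ≤ L := (inv_le_one_of_one_le₀ hL).trans hL
  have hLD : L⁻¹ * η ≤ L * η := by gcongr
  have hsv : 0 < s * v := by positivity
  constructor
  · have h4 : |q| * v ≤ 2 * L ^ 2 * s * v := by gcongr
    have h7 : (4 * L ^ 2)⁻¹ * (s * v) ≤ L ^ 2 * (s * v) := by
      have : (4 * L ^ 2)⁻¹ ≤ L ^ 2 := by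
        apply (inv_le_one_of_one_le₀ _).trans (hp 2)
        linarith [hp 2]
      gcongr
    have h8 : L⁻¹ * η / 2 ≤ 3 * L ^ 2 * s * v := by linarith
    have h9 : (6 * L ^ 3)⁻¹ * (η / s) = (3 * L ^ 2 * s)⁻¹ * (L⁻¹ * η / 2) := by
      field_simp
      norm_num
    rw [h9, inv_mul_le_iff₀ (by positivity)]
    exact h8
  · have h4 : (2 * L ^ 2)⁻¹ * s * v ≤ |q| * v := by gcongr
    have h7 : (2 * L ^ 2)⁻¹ * s * v = 2 * ((4 * L ^ 2)⁻¹ * s * v) := by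
      field_simp
      norm_num
    have h8 : (4 * L ^ 2)⁻¹ * s * v ≤ 2 * L * η := by
      have : 0 ≤ L * η := by positivity
      linarith
    have h9 : 8 * L ^ 3 * (η / s) = ((4 * L ^ 2)⁻¹ * s)⁻¹ * (2 * L * η) := by
      field_simp
      norm_num
    rw [h9, le_inv_mul_iff₀ (by positivity)]
    exact h8

/-- Once y = O(s), all the error terms are of third order in s and so are small against the main
term of order s². -/
lemma sqrt_error_le {L s y : ℝ} (hL : 1 ≤ L) (hs0 : 0 < s) (hsL : 100 * L ^ 5 * s ≤ 1)
    (hy0 : 0 ≤ y) (hyup : y ≤ 2 * L * s) :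
    L * (y ^ 3 + s ^ 2 * (s ^ 2 + y)) ≤ L⁻¹ * s ^ 2 / 4 := by
  have hp : ∀ n : ℕ, 1 ≤ L ^ n := fun n => one_le_pow₀ hL
  have hs1 : s ≤ 1 := by nlinarith [hp 5]
  have h3 : y ^ 3 ≤ (2 * L * s) ^ 3 := by gcongr
  have h4 : s ^ 2 * (s ^ 2 + y) ≤ s ^ 2 * (s + 2 * L * s) := by
    gcongr
    nlinarith
  have h5 : L * (y ^ 3 + s ^ 2 * (s ^ 2 + y)) ≤ 11 * L ^ 4 * s ^ 3 := by
    calc _ ≤ L * ((2 * L * s) ^ 3 + s ^ 2 * (s + 2 * L * s)) := by gcongr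
      _ = (8 * L ^ 4 + L + 2 * L ^ 2) * s ^ 3 := by ring
      _ ≤ (8 * L ^ 4 + L ^ 4 + 2 * L ^ 4) * s ^ 3 := by
        gcongr
        · exact le_self_pow₀ hL (by norm_num)
        · norm_num
      _ = _ := by ring
  refine h5.trans ?_
  calc 11 * L ^ 4 * s ^ 3 = L⁻¹ * s ^ 2 * (11 * L ^ 5 * s) := by field_simp
    _ ≤ L⁻¹ * s ^ 2 * (1 / 4) := by
      gcongr
      linarith
    _ = _ := by ring

/-- Square root behaviour: an approximate solution of `Y² = β D` in the upper half plane, together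
with a relation for its imaginary part. -/
theorem sqrt_dichotomy {L : ℝ} (hL : 1 ≤ L) {Y D : ℂ} {β k T : ℝ} (hβ : L⁻¹ ≤ |β|) (hβ' : |β| ≤ L)
    (hk : L⁻¹ ≤ |k|) (hk' : |k| ≤ L) (hD : 0 < D.im) (hY : 0 < Y.im)
    (h1 : ‖Y ^ 2 - β * D‖ ≤ L * (‖Y‖ ^ 3 + ‖D‖ * (‖D‖ + ‖Y‖)))
    (h2 : |T - Y.im * (k * Y.re)| ≤ L * (‖D‖ + ‖Y‖ ^ 2) * Y.im + L * ‖D‖ * D.im)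
    (hT : L⁻¹ * D.im ≤ T) (hT' : T ≤ L * D.im)
    (hDs : √‖D‖ ≤ (100 * L ^ 5)⁻¹) (hYs : ‖Y‖ ≤ (4 * L)⁻¹) :
    ‖Y‖ ≤ 2 * L * √‖D‖ ∧ (β * D.re ≤ 0 → (2 * L)⁻¹ * √‖D‖ ≤ Y.im) ∧
      (0 ≤ β * D.re → (6 * L ^ 3)⁻¹ * (D.im / √‖D‖) ≤ Y.im ∧
        Y.im ≤ 8 * L ^ 3 * (D.im / √‖D‖)) := by
  have hL0 : 0 < L := by linarith
  have hDpos : 0 < ‖D‖ := hD.trans_le (Complex.im_le_norm D)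
  obtain ⟨s, hs⟩ : ∃ s, s = √‖D‖ := ⟨_, rfl⟩
  have hs0 : 0 < s := hs ▸ Real.sqrt_pos.2 hDpos
  have hsD : ‖D‖ = s ^ 2 := by rw [hs, Real.sq_sqrt hDpos.le]
  rw [← hs] at hDs ⊢
  rw [hsD] at h1 h2
  obtain ⟨y, hy⟩ : ∃ y, y = ‖Y‖ := ⟨_, rfl⟩
  have hy0 : 0 ≤ y := hy ▸ norm_nonneg Y
  rw [← hy] at h1 h2 hYs ⊢
  have hsL : 100 * L ^ 5 * s ≤ 1 := by
    calc 100 * L ^ 5 * s ≤ 100 * L ^ 5 * (100 * L ^ 5)⁻¹ := by gcongr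
      _ = 1 := by field_simp
  have hyL : 4 * L * y ≤ 1 := by
    calc 4 * L * y ≤ 4 * L * (4 * L)⁻¹ := by gcongr
      _ = 1 := by field_simp
  have hp : ∀ n : ℕ, 1 ≤ L ^ n := fun n => one_le_pow₀ hL
  have hs1 : s ≤ 1 := by nlinarith [hp 5]
  have hy1 : y ≤ 1 := by nlinarith
  have hYsq : ‖Y ^ 2‖ = y ^ 2 := by rw [norm_pow, hy]
  have hβD : ‖(β : ℂ) * D‖ = |β| * s ^ 2 := by
    rw [norm_mul, Complex.norm_real, Real.norm_eq_abs, hsD]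
  -- the upper bound on `Y`
  have hyup : y ≤ 2 * L * s := by
    have h3 : y ^ 2 ≤ |β| * s ^ 2 + L * (y ^ 3 + s ^ 2 * (s ^ 2 + y)) := by
      have := norm_sub_norm_le (Y ^ 2) (β * D)
      rw [hYsq, hβD] at this
      linarith
    have h4 : L * y ^ 3 ≤ y ^ 2 / 4 := by
      have : 4 * L * y * y ^ 2 ≤ 1 * y ^ 2 := by gcongr
      linarith [show 4 * L * y * y ^ 2 = 4 * (L * y ^ 3) by ring]
    have h5 : L * (s ^ 2 * (s ^ 2 + y)) ≤ L * (s ^ 2 * (1 / 100 + 1 / 4)) := by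
      have h6 : s ^ 2 ≤ 1 / 100 := by nlinarith [hp 5]
      have h7 : y ≤ 1 / 4 := by nlinarith
      gcongr
    have h6 : |β| * s ^ 2 ≤ L * s ^ 2 := by gcongr
    apply le_of_sq_le_sq _ (by positivity)
    have h7 : L * s ^ 2 ≤ L ^ 2 * s ^ 2 := by
      gcongr
      nlinarith
    nlinarith
  have herr := sqrt_error_le hL hs0 hsL hy0 hyup
  have h3 : ‖Y ^ 2 - β * D‖ ≤ L⁻¹ * s ^ 2 / 4 := h1.trans herr
  have hylow : 3 / 4 * (L⁻¹ * s ^ 2) ≤ y ^ 2 := by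
    have := norm_sub_norm_le ((β : ℂ) * D) (Y ^ 2)
    rw [norm_sub_rev, hYsq, hβD] at this
    have : L⁻¹ * s ^ 2 ≤ |β| * s ^ 2 := by gcongr
    linarith
  have hyri : y ^ 2 = Y.re ^ 2 + Y.im ^ 2 := by
    rw [hy, Complex.sq_norm, Complex.normSq_apply]
    ring
  have hre := abs_le.1 ((Complex.abs_re_le_norm _).trans h3)
  have ere : (Y ^ 2 - β * D).re = Y.re ^ 2 - Y.im ^ 2 - β * D.re := by
    rw [Complex.sub_re, Complex.re_ofReal_mul, sq, Complex.mul_re]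
    ring
  rw [ere] at hre
  have hq : ((2 * L)⁻¹ * s) ^ 2 ≤ L⁻¹ * s ^ 2 / 4 := by
    have : ((2 * L)⁻¹ * s) ^ 2 = L⁻¹ * (L⁻¹ * s ^ 2) / 4 := by
      rw [mul_inv]
      ring
    rw [this]
    have h4 : L⁻¹ ≤ 1 := inv_le_one_of_one_le₀ hL
    have h5 : L⁻¹ * (L⁻¹ * s ^ 2) ≤ 1 * (L⁻¹ * s ^ 2) := by gcongr
    linarith
  refine ⟨hyup, fun hneg => ?_, fun hpos => ?_⟩
  -- (Re Y)² - (Im Y)² equals β Re D ≤ 0 up to a small error, so Im Y carries a fixed fraction of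
  -- |Y|.
  · apply le_of_sq_le_sq _ hY.le
    linarith [hre.2]
  -- Now Re Y dominates, and the approximate equation says little about Im Y. The second relation, T
  -- ≈ k Re Y Im Y with T of size Im D, determines it.
  · have hYre : (2 * L)⁻¹ * s ≤ |Y.re| := by
      apply le_of_sq_le_sq _ (abs_nonneg _)
      rw [sq_abs]
      linarith [hre.1]
    have hi : (2 * L ^ 2)⁻¹ * s = L⁻¹ * ((2 * L)⁻¹ * s) := by
      field_simp
    have hkY : (2 * L ^ 2)⁻¹ * s ≤ |k * Y.re| := by
      rw [abs_mul, hi]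
      gcongr
    have hYre' : |Y.re| ≤ 2 * L * s := (hy ▸ Complex.abs_re_le_norm Y : |Y.re| ≤ y).trans hyup
    have hkY' : |k * Y.re| ≤ 2 * L ^ 2 * s := by
      rw [abs_mul, show 2 * L ^ 2 * s = L * (2 * L * s) by ring]
      gcongr
    rw [mul_comm Y.im] at h2
    exact im_bounds_of_error hL hs0 hsL hy0 hyup hD hY hkY hkY' hT hT' h2

end CircularLaw

/-! ### Local analysis of f near a real zero -/

namespace CircularLaw

open scoped ComplexConjugate

/-- The summand `m (m² - |z|²) / p(r, m)` of `f`. -/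
noncomputable def frac (s : ℝ) (z r m : ℂ) : ℂ := m * (m ^ 2 - (‖z‖ : ℂ) ^ 2) / cubic s z r m

/-- The difference quotient of `f` in the variable `r`, up to sign. -/
noncomputable def slopeR {N : ℕ} (σ : Fin N → ℝ) (z r r' m : ℂ) : ℂ :=
  1 + avg (fun i => (σ i : ℂ) * (frac (σ i) z r m * frac (σ i) z r' m))

variable {N : ℕ} {σ : Fin N → ℝ} {z : ℂ}

lemma fFun_eq_frac (r m : ℂ) :
    fFun σ z r m = -r + m + avg (fun i => (σ i : ℂ) * frac (σ i) z r m) := fFun_eq r m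

/-- The cubic is affine in r with slope equal to the numerator of `frac`, so the difference quotient
of `frac` is minus the product of its two values. -/
lemma fFun_sub (r r' m : ℂ) (h : ∀ i, cubic (σ i) z r m ≠ 0) (h' : ∀ i, cubic (σ i) z r' m ≠ 0) :
    fFun σ z r m - fFun σ z r' m = -(r - r') * slopeR σ z r r' m := by
  have e : avg (fun i => (σ i : ℂ) * frac (σ i) z r m) - avg (fun i => (σ i : ℂ) * frac (σ i) z r' m)
      = -(r - r') * avg (fun i => (σ i : ℂ) * (frac (σ i) z r m * frac (σ i) z r' m)) := by
    rw [← avg_sub, ← avg_mul_left]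
    congr 1
    ext i
    have h1 := h i
    have h2 := h' i
    have e1 : cubic (σ i) z r m - cubic (σ i) z r' m
        = (r - r') * (m * (m ^ 2 - (‖z‖ : ℂ) ^ 2)) := by
      simp only [cubic]
      ring
    simp only [frac]
    field_simp
    linear_combination (-(σ i : ℂ)) * m * (m ^ 2 - (‖z‖ : ℂ) ^ 2) * e1
  rw [fFun_eq_frac, fFun_eq_frac, slopeR]
  linear_combination e

lemma cubic_conj (s : ℝ) (z r m : ℂ) : cubic s z (conj r) (conj m) = conj (cubic s z r m) := by
  simp [cubic]

lemma frac_conj (s : ℝ) (z r m : ℂ) : frac s z (conj r) (conj m) = conj (frac s z r m) := by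
  simp [frac, cubic_conj]

lemma fFun_conj (r m : ℂ) : fFun σ z (conj r) (conj m) = conj (fFun σ z r m) := by
  rw [fFun_eq_frac, fFun_eq_frac, map_add, map_add, map_neg, conj_avg]
  simp [frac_conj]

lemma slopeR_conj (r r' m : ℂ) :
    slopeR σ z (conj r) (conj r') (conj m) = conj (slopeR σ z r r' m) := by
  rw [slopeR, slopeR, map_add, map_one, conj_avg]
  simp [frac_conj]

lemma deriv_conj_of_symm {φ : ℂ → ℂ} (h : ∀ m, φ (conj m) = conj (φ m)) (m : ℂ) :
    deriv φ (conj m) = conj (deriv φ m) := by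
  have e : conj ∘ φ ∘ conj = φ := by
    ext m
    simp [h]
  have h1 := congrFun (deriv_conj_conj (f := φ)) (conj m)
  rw [e] at h1
  simpa using h1

/-- Bounds at a point `(r₀, m₀)` where `f` vanishes and no denominator does. -/
structure LocalData {N : ℕ} (σ : Fin N → ℝ) (z : ℂ) (B q r₀ m₀ : ℝ) : Prop where
  card_pos : 0 < N
  one_le : 1 ≤ B
  q_pos : 0 < q
  sigma_nonneg : ∀ i, 0 ≤ σ i
  sigma_le : ∀ i, σ i ≤ B
  Z_le : ‖z‖ ^ 2 ≤ B
  r_le : |r₀| + 1 ≤ B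
  m_le : |m₀| + 1 ≤ B
  cubic_ge : ∀ i, q ≤ ‖cubic (σ i) z r₀ m₀‖
  zero : fFun σ z r₀ m₀ = 0

lemma norm_cubic_sub_le {s B : ℝ} {r m r' m' : ℂ} (hB : 1 ≤ B) (hs : 0 ≤ s) (hsB : s ≤ B)
    (hZ : ‖z‖ ^ 2 ≤ B) (hm : ‖m‖ ≤ B) (hr' : ‖r'‖ ≤ B) (hm' : ‖m'‖ ≤ B) :
    ‖cubic s z r m - cubic s z r' m'‖ ≤ 8 * B ^ 3 * (‖r - r'‖ + ‖m - m'‖) := by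
  have hB0 : 0 ≤ B := by linarith
  have hp1 : B ≤ B ^ 3 := le_self_pow₀ hB (by norm_num)
  have hp2 : B ^ 2 ≤ B ^ 3 := pow_le_pow_right₀ hB (by norm_num)
  have e : cubic s z r m - cubic s z r' m' = (r - r') * (m ^ 3 - (‖z‖ : ℂ) ^ 2 * m)
      + (m - m') * (r' * (m ^ 2 + m * m' + m' ^ 2) - ((s : ℂ) + (‖z‖ : ℂ) ^ 2) * (m + m')
        - r' * (‖z‖ : ℂ) ^ 2) := by
    simp only [cubic]
    ring
  have h1 : ‖m ^ 3 - (‖z‖ : ℂ) ^ 2 * m‖ ≤ 8 * B ^ 3 := by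
    refine (norm_sub_le _ _).trans ?_
    rw [norm_pow, norm_mul, norm_Z]
    have h2 : ‖m‖ ^ 3 ≤ B ^ 3 := by gcongr
    have h3 : ‖z‖ ^ 2 * ‖m‖ ≤ B * B := by gcongr
    have h4 : B * B = B ^ 2 := by ring
    have h5 : 0 ≤ B ^ 3 := by positivity
    linarith
  have h2 : ‖r' * (m ^ 2 + m * m' + m' ^ 2) - ((s : ℂ) + (‖z‖ : ℂ) ^ 2) * (m + m')
      - r' * (‖z‖ : ℂ) ^ 2‖ ≤ 8 * B ^ 3 := by
    have h3 : ‖r' * (m ^ 2 + m * m' + m' ^ 2)‖ ≤ B * (B ^ 2 + B * B + B ^ 2) := by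
      rw [norm_mul]
      gcongr
      refine (norm_add₃_le).trans ?_
      rw [norm_pow, norm_mul, norm_pow]
      gcongr
    have h4 : ‖((s : ℂ) + (‖z‖ : ℂ) ^ 2) * (m + m')‖ ≤ (B + B) * (B + B) := by
      rw [norm_mul]
      gcongr
      · refine (norm_add_le _ _).trans ?_
        rw [norm_Z, Complex.norm_real, Real.norm_of_nonneg hs]
        gcongr
      · exact (norm_add_le _ _).trans (by gcongr)
    have h5 : ‖r' * (‖z‖ : ℂ) ^ 2‖ ≤ B * B := by
      rw [norm_mul, norm_Z]
      gcongr
    have h6 := norm_sub_le (r' * (m ^ 2 + m * m' + m' ^ 2)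
      - ((s : ℂ) + (‖z‖ : ℂ) ^ 2) * (m + m')) (r' * (‖z‖ : ℂ) ^ 2)
    have h7 := norm_sub_le (r' * (m ^ 2 + m * m' + m' ^ 2))
      (((s : ℂ) + (‖z‖ : ℂ) ^ 2) * (m + m'))
    have h8 : B * (B ^ 2 + B * B + B ^ 2) = 3 * B ^ 3 := by ring
    have h9 : (B + B) * (B + B) = 4 * B ^ 2 := by ring
    have h10 : B * B = B ^ 2 := by ring
    linarith
  rw [e]
  refine (norm_add_le _ _).trans ?_
  rw [norm_mul, norm_mul]
  calc ‖r - r'‖ * _ + ‖m - m'‖ * _ ≤ ‖r - r'‖ * (8 * B ^ 3) + ‖m - m'‖ * (8 * B ^ 3) := by gcongr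
    _ = _ := by ring

/-- A radius on which the bounds of `LocalData` persist. -/
noncomputable def localRadius (B q : ℝ) : ℝ := min 1 (q / (32 * B ^ 3))

namespace LocalData

variable {B q r₀ m₀ : ℝ} {r m r' m' : ℂ}

lemma radius_pos (d : LocalData σ z B q r₀ m₀) : 0 < localRadius B q := by
  have := d.one_le
  have := d.q_pos
  exact lt_min one_pos (by positivity)

lemma norm_m_le (d : LocalData σ z B q r₀ m₀) (hm : ‖m - m₀‖ ≤ localRadius B q) : ‖m‖ ≤ B := by
  have h1 := norm_sub_norm_le m m₀
  rw [Complex.norm_real, Real.norm_eq_abs] at h1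
  have h2 : localRadius B q ≤ 1 := min_le_left _ _
  linarith [d.m_le]

lemma norm_r_le (d : LocalData σ z B q r₀ m₀) (hr : ‖r - r₀‖ ≤ localRadius B q) : ‖r‖ ≤ B := by
  have h1 := norm_sub_norm_le r r₀
  rw [Complex.norm_real, Real.norm_eq_abs] at h1
  have h2 : localRadius B q ≤ 1 := min_le_left _ _
  linarith [d.r_le]

lemma half_le_norm_cubic (d : LocalData σ z B q r₀ m₀) (hr : ‖r - r₀‖ ≤ localRadius B q)
    (hm : ‖m - m₀‖ ≤ localRadius B q) (i : Fin N) : q / 2 ≤ ‖cubic (σ i) z r m‖ := by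
  have hB := d.one_le
  have hr0 : ‖(r₀ : ℂ)‖ ≤ B := by
    rw [Complex.norm_real, Real.norm_eq_abs]
    linarith [d.r_le]
  have hm0 : ‖(m₀ : ℂ)‖ ≤ B := by
    rw [Complex.norm_real, Real.norm_eq_abs]
    linarith [d.m_le]
  have h1 := norm_cubic_sub_le (r := r) hB (d.sigma_nonneg i) (d.sigma_le i) d.Z_le
    (d.norm_m_le hm) hr0 hm0
  have h2 := norm_sub_norm_le (cubic (σ i) z r₀ m₀) (cubic (σ i) z r m)
  rw [norm_sub_rev] at h2
  have h3 : localRadius B q ≤ q / (32 * B ^ 3) := min_le_right _ _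
  have h4 : 8 * B ^ 3 * (‖r - r₀‖ + ‖m - m₀‖) ≤ q / 2 := by
    calc 8 * B ^ 3 * (‖r - r₀‖ + ‖m - m₀‖)
        ≤ 8 * B ^ 3 * (q / (32 * B ^ 3) + q / (32 * B ^ 3)) := by
          gcongr <;> linarith
      _ = q / 2 := by
        field_simp
        ring
  linarith [d.cubic_ge i]

lemma cubic_ne (d : LocalData σ z B q r₀ m₀) (hr : ‖r - r₀‖ ≤ localRadius B q)
    (hm : ‖m - m₀‖ ≤ localRadius B q) (i : Fin N) : cubic (σ i) z r m ≠ 0 := by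
  have h1 := d.half_le_norm_cubic hr hm i
  have := d.q_pos
  exact norm_pos_iff.1 (by linarith)

lemma norm_num_le (d : LocalData σ z B q r₀ m₀) (hm : ‖m - m₀‖ ≤ localRadius B q) :
    ‖m * (m ^ 2 - (‖z‖ : ℂ) ^ 2)‖ ≤ 2 * B ^ 3 := by
  have hB := d.one_le
  have h1 := d.norm_m_le hm
  have h2 := d.Z_le
  rw [norm_mul]
  have h3 : ‖m ^ 2 - (‖z‖ : ℂ) ^ 2‖ ≤ B ^ 2 + B := by
    refine (norm_sub_le _ _).trans ?_
    rw [norm_pow, norm_Z]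
    gcongr
  calc ‖m‖ * ‖m ^ 2 - (‖z‖ : ℂ) ^ 2‖ ≤ B * (B ^ 2 + B) := by gcongr
    _ = B ^ 3 + B ^ 2 := by ring
    _ ≤ B ^ 3 + B ^ 3 := by
      gcongr
      norm_num
    _ = _ := by ring

lemma norm_frac_le (d : LocalData σ z B q r₀ m₀) (hr : ‖r - r₀‖ ≤ localRadius B q)
    (hm : ‖m - m₀‖ ≤ localRadius B q) (i : Fin N) : ‖frac (σ i) z r m‖ ≤ 4 * B ^ 3 / q := by
  have hB := d.one_le
  have hq := d.q_pos
  have h1 := d.half_le_norm_cubic hr hm i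
  have h2 := d.norm_num_le hm
  rw [frac, norm_div]
  calc _ ≤ 2 * B ^ 3 / (q / 2) := by gcongr
    _ = _ := by
      field_simp
      norm_num

lemma norm_frac_sub_le (d : LocalData σ z B q r₀ m₀) (hr : ‖r - r₀‖ ≤ localRadius B q)
    (hm : ‖m - m₀‖ ≤ localRadius B q) (hr' : ‖r' - r₀‖ ≤ localRadius B q)
    (hm' : ‖m' - m₀‖ ≤ localRadius B q) (i : Fin N) :
    ‖frac (σ i) z r m - frac (σ i) z r' m'‖
      ≤ (8 * B ^ 2 / q + 64 * B ^ 6 / q ^ 2) * (‖r - r'‖ + ‖m - m'‖) := by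
  have hB := d.one_le
  have hq := d.q_pos
  have h1 := d.half_le_norm_cubic hr hm i
  have h1' := d.half_le_norm_cubic hr' hm' i
  have h2 := d.norm_num_le hm'
  have hne := d.cubic_ne hr hm i
  have hne' := d.cubic_ne hr' hm' i
  have h3 := norm_cubic_sub_le (r := r') (r' := r) (m' := m) hB (d.sigma_nonneg i) (d.sigma_le i)
    d.Z_le (d.norm_m_le hm') (d.norm_r_le hr) (d.norm_m_le hm)
  rw [norm_sub_rev r', norm_sub_rev m'] at h3
  have e : frac (σ i) z r m - frac (σ i) z r' m'
      = (m - m') * (m ^ 2 + m * m' + m' ^ 2 - (‖z‖ : ℂ) ^ 2) / cubic (σ i) z r m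
        + m' * (m' ^ 2 - (‖z‖ : ℂ) ^ 2) * (cubic (σ i) z r' m' - cubic (σ i) z r m)
          / (cubic (σ i) z r m * cubic (σ i) z r' m') := by
    simp only [frac]
    field_simp
    ring
  have h4 : ‖m ^ 2 + m * m' + m' ^ 2 - (‖z‖ : ℂ) ^ 2‖ ≤ 4 * B ^ 2 := by
    refine (norm_sub_le _ _).trans ?_
    have h5 : ‖m ^ 2 + m * m' + m' ^ 2‖ ≤ B ^ 2 + B * B + B ^ 2 := by
      refine norm_add₃_le.trans ?_
      rw [norm_pow, norm_mul, norm_pow]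
      have := d.norm_m_le hm
      have := d.norm_m_le hm'
      gcongr
    rw [norm_Z]
    nlinarith [d.Z_le]
  have h5 : ‖m - m'‖ ≤ ‖r - r'‖ + ‖m - m'‖ := by linarith [norm_nonneg (r - r')]
  rw [e]
  refine (norm_add_le _ _).trans ?_
  rw [norm_div, norm_div, norm_mul, norm_mul (m' * _), norm_mul (cubic _ _ _ _), add_mul]
  gcongr ?_ + ?_
  · calc ‖m - m'‖ * ‖m ^ 2 + m * m' + m' ^ 2 - (‖z‖ : ℂ) ^ 2‖ / ‖cubic (σ i) z r m‖
        ≤ (‖r - r'‖ + ‖m - m'‖) * (4 * B ^ 2) / (q / 2) := by gcongr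
      _ = _ := by
        field_simp
        ring
  · calc _ ≤ 2 * B ^ 3 * (8 * B ^ 3 * (‖r - r'‖ + ‖m - m'‖)) / (q / 2 * (q / 2)) := by gcongr
      _ = _ := by
        field_simp
        ring

/-- A Lipschitz constant for `slopeR`. -/
noncomputable def slopeLip (B q : ℝ) : ℝ :=
  2 * (B * (4 * B ^ 3 / q * (8 * B ^ 2 / q + 64 * B ^ 6 / q ^ 2)))

lemma norm_slopeR_sub_le (d : LocalData σ z B q r₀ m₀) {r₁ r₂ r₁' r₂' : ℂ}
    (h1 : ‖r₁ - r₀‖ ≤ localRadius B q) (h2 : ‖r₂ - r₀‖ ≤ localRadius B q)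
    (h1' : ‖r₁' - r₀‖ ≤ localRadius B q) (h2' : ‖r₂' - r₀‖ ≤ localRadius B q)
    (hm : ‖m - m₀‖ ≤ localRadius B q) (hm' : ‖m' - m₀‖ ≤ localRadius B q) :
    ‖slopeR σ z r₁ r₂ m - slopeR σ z r₁' r₂' m'‖
      ≤ slopeLip B q * (‖r₁ - r₁'‖ + ‖r₂ - r₂'‖ + ‖m - m'‖) := by
  have hB := d.one_le
  have hq := d.q_pos
  obtain ⟨L₁, hL₁⟩ : ∃ L, L = 8 * B ^ 2 / q + 64 * B ^ 6 / q ^ 2 := ⟨_, rfl⟩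
  have hL₁0 : 0 ≤ L₁ := by
    rw [hL₁]
    positivity
  have e : slopeR σ z r₁ r₂ m - slopeR σ z r₁' r₂' m'
      = avg (fun i => (σ i : ℂ) * (frac (σ i) z r₁ m * (frac (σ i) z r₂ m - frac (σ i) z r₂' m')
        + (frac (σ i) z r₁ m - frac (σ i) z r₁' m') * frac (σ i) z r₂' m')) := by
    rw [slopeR, slopeR, add_sub_add_left_eq_sub, ← avg_sub]
    congr 1
    ext i
    ring
  rw [e]
  refine (norm_avg_le _).trans (avg_le_of_le d.card_pos fun i => ?_)
  rw [norm_mul, Complex.norm_real, Real.norm_of_nonneg (d.sigma_nonneg i)]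
  have h3 := d.norm_frac_le h1 hm i
  have h4 := d.norm_frac_le h2' hm' i
  have h5 := d.norm_frac_sub_le h1 hm h1' hm' i
  have h6 := d.norm_frac_sub_le h2 hm h2' hm' i
  rw [← hL₁] at h5 h6
  have h7 : ‖frac (σ i) z r₁ m * (frac (σ i) z r₂ m - frac (σ i) z r₂' m')
        + (frac (σ i) z r₁ m - frac (σ i) z r₁' m') * frac (σ i) z r₂' m'‖
      ≤ 4 * B ^ 3 / q * (L₁ * (‖r₂ - r₂'‖ + ‖m - m'‖))
        + L₁ * (‖r₁ - r₁'‖ + ‖m - m'‖) * (4 * B ^ 3 / q) := by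
    refine (norm_add_le _ _).trans ?_
    rw [norm_mul, norm_mul]
    gcongr
  have h8 := d.sigma_le i
  calc σ i * _ ≤ B * (4 * B ^ 3 / q * (L₁ * (‖r₂ - r₂'‖ + ‖m - m'‖))
        + L₁ * (‖r₁ - r₁'‖ + ‖m - m'‖) * (4 * B ^ 3 / q)) := by gcongr
    _ = B * (4 * B ^ 3 / q * L₁) * (‖r₁ - r₁'‖ + ‖r₂ - r₂'‖ + 2 * ‖m - m'‖) := by ring
    _ ≤ B * (4 * B ^ 3 / q * L₁) * (2 * (‖r₁ - r₁'‖ + ‖r₂ - r₂'‖ + ‖m - m'‖)) := by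
      gcongr
      linarith [norm_nonneg (r₁ - r₁'), norm_nonneg (r₂ - r₂')]
    _ = _ := by
      rw [slopeLip, hL₁]
      ring

/-- At a real point the summands σ `frac`² are nonnegative, so J = -∂_r f is at least 1:
nondegeneracy in r holds without any assumption. -/
lemma slopeR_real (d : LocalData σ z B q r₀ m₀) :
    ∃ J : ℝ, slopeR σ z r₀ r₀ m₀ = J ∧ 1 ≤ J ∧ J ≤ 1 + B * (4 * B ^ 3 / q) ^ 2 := by
  have hB := d.one_le
  have hq := d.q_pos
  have h0 : ∀ x : ℝ, ‖(x : ℂ) - x‖ ≤ localRadius B q := by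
    intro x
    rw [sub_self, norm_zero]
    exact d.radius_pos.le
  have hreal : ∀ i, frac (σ i) z r₀ m₀ = ((frac (σ i) z r₀ m₀).re : ℂ) := by
    intro i
    have := frac_conj (σ i) z r₀ m₀
    rw [Complex.conj_ofReal, Complex.conj_ofReal] at this
    exact (Complex.conj_eq_iff_re.1 this.symm).symm
  refine ⟨1 + avg (fun i => σ i * (frac (σ i) z r₀ m₀).re ^ 2), ?_, ?_, ?_⟩
  · rw [slopeR]
    push_cast
    rw [ofReal_avg]
    congr 2
    ext i
    rw [hreal i]
    push_cast
    simp only [Complex.ofReal_re]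
    ring
  · have : 0 ≤ avg (fun i => σ i * (frac (σ i) z r₀ m₀).re ^ 2) := by
      apply avg_nonneg
      intro i
      have := d.sigma_nonneg i
      positivity
    linarith
  · gcongr
    apply avg_le_of_le d.card_pos
    intro i
    have h1 := d.sigma_le i
    have h2 := d.sigma_nonneg i
    have h3 := d.norm_frac_le (h0 r₀) (h0 m₀) i
    have h4 : (frac (σ i) z r₀ m₀).re ^ 2 ≤ (4 * B ^ 3 / q) ^ 2 := by
      rw [← sq_abs]
      have := Complex.abs_re_le_norm (frac (σ i) z r₀ m₀)
      gcongr
      linarith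
    gcongr

/-- A bound for `f(r₀, ·)` near `m₀`. -/
lemma norm_fFun_le (d : LocalData σ z B q r₀ m₀) (hm : ‖m - m₀‖ ≤ localRadius B q) :
    ‖fFun σ z r₀ m‖ ≤ 2 * B + B * (4 * B ^ 3 / q) := by
  have hB := d.one_le
  have hq := d.q_pos
  have h0 : ‖(r₀ : ℂ) - r₀‖ ≤ localRadius B q := by
    rw [sub_self, norm_zero]
    exact d.radius_pos.le
  rw [fFun_eq_frac]
  have h1 : ‖avg (fun i => (σ i : ℂ) * frac (σ i) z r₀ m)‖ ≤ B * (4 * B ^ 3 / q) := by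
    refine (norm_avg_le _).trans (avg_le_of_le d.card_pos fun i => ?_)
    rw [norm_mul, Complex.norm_real, Real.norm_of_nonneg (d.sigma_nonneg i)]
    have := d.sigma_le i
    have := d.norm_frac_le h0 hm i
    gcongr
  have h2 : ‖-(r₀ : ℂ) + m‖ ≤ B + B := by
    refine (norm_add_le _ _).trans ?_
    rw [norm_neg]
    exact add_le_add (d.norm_r_le h0) (d.norm_m_le hm)
  refine (norm_add_le _ _).trans ?_
  linarith

lemma fFun_differentiableOn (d : LocalData σ z B q r₀ m₀) :
    DifferentiableOn ℂ (fFun σ z r₀) (Metric.ball (m₀ : ℂ) (localRadius B q)) := by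
  have h0 : ‖(r₀ : ℂ) - r₀‖ ≤ localRadius B q := by
    rw [sub_self, norm_zero]
    exact d.radius_pos.le
  have e : fFun σ z r₀ = fun m => -(r₀ : ℂ) + m + (1 / (N : ℂ)) * ∑ i, (σ i : ℂ) *
      (m * (m ^ 2 - (‖z‖ : ℂ) ^ 2) / cubic (σ i) z r₀ m) := rfl
  rw [e]
  refine DifferentiableOn.add (by fun_prop) (DifferentiableOn.const_mul ?_ _)
  refine DifferentiableOn.fun_sum fun i _ => DifferentiableOn.const_mul ?_ _
  refine DifferentiableOn.div (by fun_prop) (by unfold cubic; fun_prop) fun m hm => ?_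
  rw [Metric.mem_ball, dist_eq_norm] at hm
  exact d.cubic_ne h0 hm.le i

/-- For real r₀ the function f(r₀, ·) commutes with conjugation, hence so do its derivatives. -/
lemma exists_real_derivs (σ : Fin N → ℝ) (z : ℂ) (r₀ m₀ : ℝ) :
    ∃ k₁ k : ℝ, deriv (fFun σ z r₀) m₀ = k₁ ∧ iteratedDeriv 2 (fFun σ z r₀) m₀ = k := by
  have h0 : ∀ m, fFun σ z r₀ (conj m) = conj (fFun σ z r₀ m) := by
    intro m
    have := fFun_conj (σ := σ) (z := z) r₀ m
    rwa [Complex.conj_ofReal] at this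
  have h1 := deriv_conj_of_symm h0
  have h2 := deriv_conj_of_symm h1
  have e1 := h1 m₀
  have e2 := h2 m₀
  rw [Complex.conj_ofReal] at e1 e2
  refine ⟨(deriv (fFun σ z r₀) m₀).re, (deriv (deriv (fFun σ z r₀)) m₀).re,
    (Complex.conj_eq_iff_re.1 e1.symm).symm, ?_⟩
  rw [iteratedDeriv_succ, iteratedDeriv_one]
  exact (Complex.conj_eq_iff_re.1 e2.symm).symm

end LocalData

/-- The two relations between `r - √e` and `m - m₀` near a point where `f` vanishes. -/
theorem local_relations {B q : ℝ} (hB : 1 ≤ B) (hq : 0 < q) :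
    ∃ δ L : ℝ, 0 < δ ∧ 1 ≤ L ∧ ∀ (N : ℕ) (σ : Fin N → ℝ) (z : ℂ) (r₀ m₀ : ℝ),
      LocalData σ z B q r₀ m₀ → ∃ k₁ k J : ℝ, iteratedDeriv 2 (fFun σ z r₀) m₀ = k ∧ |k| ≤ L ∧
        1 ≤ J ∧ J ≤ L ∧ ∀ r m : ℂ, 0 < r.im → 0 < m.im → ‖r - r₀‖ ≤ δ → ‖m - m₀‖ ≤ δ →
          fFun σ z r m = 0 →
          (∀ i, q / 2 ≤ ‖cubic (σ i) z r m‖) ∧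
          ‖(m - m₀) * (k₁ + k * ((m - m₀) / 2)) - (r - r₀) * J‖
            ≤ L * (‖m - m₀‖ ^ 3 + ‖r - r₀‖ * (‖r - r₀‖ + ‖m - m₀‖)) ∧
          ∃ T : ℝ, |T - J * r.im| ≤ L * (‖r - r₀‖ + ‖m - m₀‖) * r.im ∧
            |T - m.im * (k₁ + k * (m.re - m₀))|
              ≤ L * ‖m - m₀‖ ^ 2 * m.im + L * ‖r - r₀‖ * (r.im + m.im) := by
  obtain ⟨R, hR⟩ : ∃ R, R = localRadius B q := ⟨_, rfl⟩
  have hR0 : 0 < R := hR ▸ lt_min one_pos (by positivity)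
  obtain ⟨M, hM⟩ : ∃ M, M = 2 * B + B * (4 * B ^ 3 / q) := ⟨_, rfl⟩
  have hM0 : 0 ≤ M := by
    rw [hM]
    positivity
  obtain ⟨S, hS⟩ : ∃ S, S = LocalData.slopeLip B q := ⟨_, rfl⟩
  have hS0 : 0 ≤ S := by
    rw [hS]
    unfold LocalData.slopeLip
    positivity
  obtain ⟨Q, hQ⟩ : ∃ Q, Q = 6 * M / (R / 4) ^ 3 := ⟨_, rfl⟩
  have hQ0 : 0 ≤ Q := by
    rw [hQ]
    positivity
  obtain ⟨L, hL⟩ : ∃ L, L = 1 + B * (4 * B ^ 3 / q) ^ 2 + 2 * M / (R / 2) ^ 2 + Q + S := ⟨_, rfl⟩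
  have hL1 : 0 ≤ B * (4 * B ^ 3 / q) ^ 2 := by positivity
  have hL2 : 0 ≤ 2 * M / (R / 2) ^ 2 := by positivity
  refine ⟨R / 4, L, by positivity, by linarith, fun N σ z r₀ m₀ d => ?_⟩
  obtain ⟨k₁, k, hk₁, hk⟩ := LocalData.exists_real_derivs σ z r₀ m₀
  obtain ⟨J, hJ, hJ1, hJ2⟩ := d.slopeR_real
  have hball : ∀ m ∈ Metric.ball (m₀ : ℂ) R, ‖fFun σ z r₀ m‖ ≤ M := by
    intro m hm
    rw [Metric.mem_ball, dist_eq_norm, hR] at hm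
    rw [hM]
    exact d.norm_fFun_le hm.le
  have hdiff : DifferentiableOn ℂ (fFun σ z r₀) (Metric.ball (m₀ : ℂ) R) := by
    rw [hR]
    exact d.fFun_differentiableOn
  have hkL : |k| ≤ L := by
    have h1 := norm_iteratedDeriv_two_le hR0 hdiff hball
    rw [hk, Complex.norm_real, Real.norm_eq_abs] at h1
    linarith
  refine ⟨k₁, k, J, hk, hkL, hJ1, by linarith, fun r m hri hmi hr hm hf => ?_⟩
  have htaylor : ∀ m m' : ℂ, ∀ ρ : ℝ, ρ ≤ R / 4 → ‖m - m₀‖ ≤ ρ → ‖m' - m₀‖ ≤ ρ →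
      ‖fFun σ z r₀ m - fFun σ z r₀ m' - (m - m') * (k₁ + k * ((m + m') / 2 - m₀))‖
        ≤ Q * ρ ^ 2 * ‖m - m'‖ := by
    intro m m' ρ hρ hm hm'
    have := norm_taylor_sub_le hR0 hdiff hball (ρ := ρ) (by linarith) hm hm'
    rwa [hk₁, hk, ← hQ] at this
  have hrR : ‖r - r₀‖ ≤ localRadius B q := by
    rw [← hR]
    linarith
  have hmR : ‖m - m₀‖ ≤ localRadius B q := by
    rw [← hR]
    linarith
  have h00 : ∀ x : ℝ, ‖(x : ℂ) - x‖ ≤ localRadius B q := by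
    intro x
    rw [sub_self, norm_zero]
    exact d.radius_pos.le
  have hconj : ∀ (u : ℂ) (x : ℝ), ‖conj u - x‖ = ‖u - x‖ := by
    intro u x
    rw [← Complex.norm_conj, map_sub, Complex.conj_conj, Complex.conj_ofReal]
  have hrR' : ‖conj r - r₀‖ ≤ localRadius B q := by rwa [hconj]
  have hmR' : ‖conj m - m₀‖ ≤ localRadius B q := by rwa [hconj]
  -- the value of `f(r₀, m)`
  have hφ : fFun σ z r₀ m = (r - r₀) * slopeR σ z r r₀ m := by
    have := fFun_sub (σ := σ) (z := z) r r₀ m (d.cubic_ne hrR hmR) (d.cubic_ne (h00 r₀) hmR)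
    rw [hf] at this
    linear_combination -this
  have hφ' : fFun σ z r₀ (conj m) = conj (fFun σ z r₀ m) := by
    have := fFun_conj (σ := σ) (z := z) r₀ m
    rwa [Complex.conj_ofReal] at this
  obtain ⟨J₁, hJ₁⟩ : ∃ J, J = slopeR σ z r r₀ m := ⟨_, rfl⟩
  rw [← hJ₁] at hφ
  have hJd : ‖J₁ - J‖ ≤ S * (‖r - r₀‖ + ‖m - m₀‖) := by
    have := d.norm_slopeR_sub_le hrR (h00 r₀) (h00 r₀) (h00 r₀) hmR (h00 m₀)
    rw [hJ, ← hJ₁, ← hS, sub_self, norm_zero, add_zero] at this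
    exact this
  have h2im : ∀ u : ℂ, ‖u - conj u‖ = 2 * |u.im| := by
    intro u
    rw [Complex.sub_conj, norm_mul, Complex.norm_I, mul_one, Complex.norm_real, Real.norm_eq_abs,
      abs_mul, abs_two]
  -- Comparing the slope with its value at the conjugate point measures Im J₁ by imaginary parts
  -- instead of distances.
  have hJi : |J₁.im| ≤ S * (r.im + m.im) := by
    have := d.norm_slopeR_sub_le hrR (h00 r₀) hrR' (h00 r₀) hmR hmR'
    have e : slopeR σ z (conj r) r₀ (conj m) = conj J₁ := by
      have := slopeR_conj (σ := σ) (z := z) r r₀ m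
      rwa [Complex.conj_ofReal, ← hJ₁] at this
    rw [← hJ₁, e, ← hS, h2im, h2im, h2im, sub_self, norm_zero, add_zero, abs_of_pos hri,
      abs_of_pos hmi] at this
    linarith
  -- T is Im r Re J₁, the part of Im ((r - r₀) J₁) proportional to Im r; the rest goes into the
  -- error.
  refine ⟨d.half_le_norm_cubic hrR hmR, ?_, ((r - r₀) * J₁).im - (r.re - r₀) * J₁.im, ?_, ?_⟩
  · have h1 := htaylor m m₀ ‖m - m₀‖ hm le_rfl (by rw [sub_self, norm_zero]; exact norm_nonneg _)
    rw [d.zero, sub_zero, hφ] at h1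
    have e : (m - m₀) * (k₁ + k * ((m - m₀) / 2)) - (r - r₀) * J
        = (r - r₀) * (J₁ - J) - ((r - r₀) * J₁ - (m - m₀) * (k₁ + k * ((m + m₀) / 2 - m₀))) := by
      ring
    rw [e]
    refine (norm_sub_le _ _).trans ?_
    rw [norm_mul]
    calc ‖r - r₀‖ * ‖J₁ - J‖ + _
        ≤ ‖r - r₀‖ * (S * (‖r - r₀‖ + ‖m - m₀‖)) + Q * ‖m - m₀‖ ^ 2 * ‖m - m₀‖ := by gcongr
      _ = S * (‖r - r₀‖ * (‖r - r₀‖ + ‖m - m₀‖)) + Q * ‖m - m₀‖ ^ 3 := by ring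
      _ ≤ L * (‖r - r₀‖ * (‖r - r₀‖ + ‖m - m₀‖)) + L * ‖m - m₀‖ ^ 3 := by
        gcongr <;> linarith
      _ = _ := by ring
  · have e : ((r - r₀) * J₁).im - (r.re - r₀) * J₁.im - J * r.im = r.im * (J₁ - J).re := by
      rw [Complex.mul_im]
      simp
      ring
    rw [e, abs_mul, abs_of_pos hri]
    have h1 := (Complex.abs_re_le_norm _).trans hJd
    calc r.im * |(J₁ - J).re| ≤ r.im * (L * (‖r - r₀‖ + ‖m - m₀‖)) := by
          gcongr
          refine h1.trans ?_
          gcongr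
          linarith
      _ = _ := by ring
  -- Expanding between m and its conjugate, rather than between m and m₀, gives an error that
  -- carries the factor Im m.
  · have h1 := htaylor m (conj m) ‖m - m₀‖ hm le_rfl (hconj m m₀).le
    rw [hφ', h2im, abs_of_pos hmi, Complex.sub_conj, Complex.sub_conj, hφ] at h1
    have e : (((2 * ((r - r₀) * J₁).im : ℝ) : ℂ) * Complex.I
        - ((2 * m.im : ℝ) : ℂ) * Complex.I * (k₁ + k * ((m + conj m) / 2 - m₀)))
        = ((2 * (((r - r₀) * J₁).im - m.im * (k₁ + k * (m.re - m₀))) : ℝ) : ℂ) * Complex.I := by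
      rw [Complex.add_conj]
      push_cast
      ring
    rw [e, norm_mul, Complex.norm_I, mul_one, Complex.norm_real, Real.norm_eq_abs, abs_mul,
      abs_two] at h1
    have h2 : |((r - r₀) * J₁).im - m.im * (k₁ + k * (m.re - m₀))| ≤ L * ‖m - m₀‖ ^ 2 * m.im := by
      have : Q * ‖m - m₀‖ ^ 2 * m.im ≤ L * ‖m - m₀‖ ^ 2 * m.im := by
        gcongr
        linarith
      linarith
    have h3 : |(r.re - r₀) * J₁.im| ≤ L * ‖r - r₀‖ * (r.im + m.im) := by
      have h4 : |r.re - r₀| ≤ ‖r - r₀‖ := by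
        have := Complex.abs_re_le_norm (r - r₀)
        rwa [Complex.sub_re, Complex.ofReal_re] at this
      rw [abs_mul]
      calc |r.re - r₀| * |J₁.im| ≤ ‖r - r₀‖ * (S * (r.im + m.im)) := by gcongr
        _ = S * ‖r - r₀‖ * (r.im + m.im) := by ring
        _ ≤ _ := by
          gcongr
          linarith
    have e2 : ((r - r₀) * J₁).im - (r.re - r₀) * J₁.im - m.im * (k₁ + k * (m.re - m₀))
        = (((r - r₀) * J₁).im - m.im * (k₁ + k * (m.re - m₀))) - (r.re - r₀) * J₁.im := by ring
    rw [e2]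
    exact (abs_sub _ _).trans (add_le_add h2 h3)

end CircularLaw

/-! ### Data at a regular edge -/

namespace CircularLaw

-- The cubic is r times the product of m - x over its three complex roots. This converts the
-- regularity condition into a lower bound on the denominators of f.
open Polynomial in
lemma mul_pow_le_norm_cubic {s ε : ℝ} {z r m : ℂ} (hr : r ≠ 0) (hε : 0 ≤ ε)
    (H : ∀ x, cubic s z r x = 0 → ε ≤ ‖m - x‖) : ‖r‖ * ε ^ 3 ≤ ‖cubic s z r m‖ := by
  have hdeg : (cubicPoly s z r).natDegree = 3 := by
    unfold cubicPoly
    compute_degree!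
  have hlead : (cubicPoly s z r).leadingCoeff = r := by
    rw [leadingCoeff, hdeg]
    simp only [cubicPoly, coeff_add, coeff_sub, coeff_C_mul, coeff_X_pow, coeff_X, coeff_C]
    norm_num
  have hs : (cubicPoly s z r).Splits := IsAlgClosed.splits _
  have hcard : (cubicPoly s z r).roots.card = 3 := by rw [← hs.natDegree_eq_card_roots, hdeg]
  have hmem : ∀ x ∈ (cubicPoly s z r).roots, ε ≤ ‖m - x‖ := by
    intro x hx
    apply H
    rw [← eval_cubicPoly]
    exact isRoot_of_mem_roots hx
  rw [← eval_cubicPoly, hs.eval_eq_prod_roots, hlead, norm_mul]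
  obtain ⟨a, b, c, habc⟩ := Multiset.card_eq_three.1 hcard
  rw [habc] at hmem ⊢
  have ha := hmem a (by simp)
  have hb := hmem b (by simp)
  have hc := hmem c (by simp)
  gcongr
  simp only [Multiset.insert_eq_cons, Multiset.map_cons, Multiset.map_singleton,
    Multiset.prod_cons, Multiset.prod_singleton, norm_mul]
  calc ε ^ 3 = ε * (ε * ε) := by ring
    _ ≤ _ := by gcongr

variable {τ : ℝ} {N : ℕ} {σ : Fin N → ℝ} {z w : ℂ}

/-- The equation f(√w, A) = 0 passes to the boundary where the limiting denominators do not vanish,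
as regularity guarantees at an edge. -/
lemma fFun_limit_eq_zero (hτ : 0 < τ) (h : Admissible τ σ z) {x : ℝ} (hx : 0 < x) {m₀ : ℂ}
    (hm : Tendsto (rootA σ z) (𝓝[upperHalf] (x : ℂ)) (𝓝 m₀))
    (hne : ∀ i, cubic (σ i) z ((√x : ℝ) : ℂ) m₀ ≠ 0) : fFun σ z ((√x : ℝ) : ℂ) m₀ = 0 := by
  have hr := tendsto_csqrt hx
  have hcub : ∀ i, Tendsto (fun w => cubic (σ i) z (csqrt w) (rootA σ z w)) (𝓝[upperHalf] (x : ℂ))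
      (𝓝 (cubic (σ i) z ((√x : ℝ) : ℂ) m₀)) := by
    intro i
    exact (((hr.mul (hm.pow 3)).sub ((hm.pow 2).const_mul _)).sub
      ((hr.mul_const _).mul hm)).add_const _
  have h1 : Tendsto (fun w => fFun σ z (csqrt w) (rootA σ z w)) (𝓝[upperHalf] (x : ℂ))
      (𝓝 (fFun σ z ((√x : ℝ) : ℂ) m₀)) := by
    refine (hr.neg.add hm).add (Tendsto.const_mul _ (tendsto_finsetSum _ fun i _ => ?_))
    exact ((hm.mul ((hm.pow 2).sub_const _)).div (hcub i) (hne i)).const_mul _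
  have h2 : Tendsto (fun w => fFun σ z (csqrt w) (rootA σ z w)) (𝓝[upperHalf] (x : ℂ)) (𝓝 0) := by
    refine tendsto_const_nhds.congr' ?_
    filter_upwards [self_mem_nhdsWithin] with w hw
    exact (fFun_root hτ h hw).symm
  exact tendsto_nhds_unique h1 h2

/-- At a regular edge all the quantities in the local expansion are controlled. -/
lemma exists_localData {ε : ℝ} (hτ : 0 < τ) (hε : 0 < ε) :
    ∃ a B q : ℝ, 0 < a ∧ 1 ≤ B ∧ 0 < q ∧ ∀ (N : ℕ) (σ : Fin N → ℝ) (z : ℂ), Admissible τ σ z →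
      ∀ e : ℝ, IsRegularEdge ε σ z e → a ≤ e ∧ e ≤ 200 / τ ∧ ∃ m₀ : ℝ, mcReal σ z e = m₀ ∧
        Tendsto (rootA σ z) (𝓝[upperHalf] (e : ℂ)) (𝓝 (m₀ : ℂ)) ∧ LocalData σ z B q (√e) m₀ := by
  obtain ⟨a, ha, Ha⟩ := edges_lower_bound hτ
  obtain ⟨M, hM⟩ : ∃ M, M = 200 / τ + 1 := ⟨_, rfl⟩
  have hτ' : 0 < 200 / τ := by positivity
  have hτ'' : 0 < τ⁻¹ := by positivity
  obtain ⟨K, hK⟩ : ∃ K, K = 1 + τ⁻¹ + M + 4 / τ ^ 2 * (1 + (√(a / 2))⁻¹) := ⟨_, rfl⟩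
  have hK0 : 1 ≤ K := by
    have : 0 ≤ 4 / τ ^ 2 * (1 + (√(a / 2))⁻¹) := by positivity
    linarith
  refine ⟨a, 2 + τ⁻¹ + M + M * K, √a * ε ^ 3, ha, by nlinarith, by positivity,
    fun N σ z h e he => ?_⟩
  have hae := Ha N σ z h e he.edge he.ne_zero
  have heM := (edges_subset hτ h he.edge).2
  have he0 : 0 < e := ha.trans_le hae
  have hMK : 0 ≤ M * K := by nlinarith
  refine ⟨hae, heM, (mcReal σ z e).re, ?_⟩
  have him := m1Real_im_eq_zero_of_edge hτ h he0 he.edge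
  have hreal : mcReal σ z e = ((mcReal σ z e).re : ℂ) := by
    apply Complex.ext
    · simp
    · rw [mcReal_eq hτ h he0, Complex.im_ofReal_mul]
      simp [him]
  have hlim : Tendsto (rootA σ z) (𝓝[upperHalf] (e : ℂ)) (𝓝 (mcReal σ z e)) := by
    rw [mcReal_eq hτ h he0]
    exact tendsto_rootA hτ h he0
  have hse : √a ≤ √e := Real.sqrt_le_sqrt hae
  have hse0 : 0 < √e := Real.sqrt_pos.2 he0
  have hcub : ∀ i, √a * ε ^ 3 ≤ ‖cubic (σ i) z ((√e : ℝ) : ℂ) (mcReal σ z e)‖ := by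
    intro i
    refine le_trans ?_ (mul_pow_le_norm_cubic (Complex.ofReal_ne_zero.2 hse0.ne') hε.le
      (he.roots i))
    rw [Complex.norm_real, Real.norm_of_nonneg hse0.le]
    gcongr
  have hqpos : 0 < √a * ε ^ 3 := by positivity
  have hzero := fFun_limit_eq_zero hτ h he0 hlim fun i => norm_pos_iff.1 (hqpos.trans_le (hcub i))
  have hsq : ∀ y, 0 ≤ y → y ^ 2 ≤ M → y ≤ M := by
    intro y hy hyM
    by_contra hcon
    push Not at hcon
    nlinarith
  have hm : ‖mcReal σ z e‖ ≤ M * K := by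
    refine le_of_tendsto hlim.norm ?_
    have hn := tendsto_norm_upperHalf e
    rw [abs_of_pos he0] at hn
    filter_upwards [self_mem_nhdsWithin, hn.eventually (eventually_ge_nhds (b := a / 2)
      (by linarith)), hn.eventually (eventually_le_nhds (b := M) (by linarith))] with w hw h1 h2
    have hb := bounded_of_le hτ h hw (c := a / 2) (by positivity) h1 h2
    rw [← hK] at hb
    rw [rootA, norm_mul]
    have h3 : ‖csqrt w‖ ≤ M := hsq _ (norm_nonneg _) (by rwa [norm_sq_csqrt])
    have := hb.norm_one_add_le
    have : 0 ≤ M := by linarith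
    gcongr
  rw [hreal] at hcub hzero hm
  refine ⟨hreal, by rwa [← hreal], ?_⟩
  have hp := h.params hτ
  have hzup := (abs_le.1 h.z_upper).2
  exact
    { card_pos := hp.card_pos
      one_le := by linarith
      q_pos := by positivity
      sigma_nonneg := fun i => hτ.le.trans (h.lower i)
      sigma_le := fun i => by linarith [h.upper i]
      Z_le := by linarith
      r_le := by
        rw [abs_of_pos hse0]
        linarith [hsq (√e) hse0.le (by rw [Real.sq_sqrt he0.le]; linarith)]
      m_le := by
        rw [Complex.norm_real, Real.norm_eq_abs] at hm
        linarith
      cubic_ge := hcub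
      zero := hzero }

/-- If `Im √w (1 + m₁)` is small near a positive real number then the density vanishes there. -/
lemma eventually_rho1c_eq_zero (hτ : 0 < τ) (h : Admissible τ σ z) {x C : ℝ} (hx : 0 < x)
    (H : ∀ᶠ w in 𝓝[upperHalf] (x : ℂ), (rootA σ z w).im ≤ C * (csqrt w).im) :
    ∀ᶠ y in 𝓝 x, rho1c σ z y = 0 := by
  have h1 : ∀ᶠ u in 𝓝 (x : ℂ), ∀ᶠ w in 𝓝[upperHalf] u, (rootA σ z w).im ≤ C * (csqrt w).im := by
    rw [eventually_nhdsWithin_iff] at H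
    filter_upwards [eventually_eventually_nhds.2 H] with u hu
    exact eventually_nhdsWithin_iff.2 hu
  filter_upwards [Complex.continuous_ofReal.continuousAt.eventually h1, Ioi_mem_nhds hx] with y hy hy0
  have hy0' : (0 : ℝ) < y := hy0
  have h2 := (Complex.continuous_im.tendsto _).comp (tendsto_rootA hτ h hy0')
  have h3 := ((Complex.continuous_im.tendsto _).comp (tendsto_csqrt hy0')).const_mul C
  have h4 := le_of_tendsto_of_tendsto h2 h3 hy
  rw [Complex.ofReal_im, mul_zero, Complex.im_ofReal_mul, Complex.add_im, Complex.one_im,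
    zero_add] at h4
  have h5 : (m1Real σ z y).im = 0 := by
    refine le_antisymm ?_ (m1Real_im_nonneg hτ h hy0')
    exact nonpos_of_mul_nonpos_right h4 (Real.sqrt_pos.2 hy0')
  rw [rho1c_eq hτ h hy0', h5, mul_zero]

/-- The hypotheses of `sqrt_dichotomy` in terms of the local relations. -/
lemma dichotomy_hypotheses {H r₀ k J T : ℝ} {r Y : ℂ} (hH : 1 ≤ H) (hr₀ : H⁻¹ ≤ r₀) (hre : H⁻¹ ≤ r.re)
    (hr₀' : r₀ ≤ H) (hre' : r.re ≤ H) (hri : 0 < r.im) (hYi : 0 < Y.im) (hk : H⁻¹ ≤ |k|) (hk' : |k| ≤ H)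
    (hJ : 1 ≤ J) (hJ' : J ≤ H) (hX : ‖r - r₀‖ ≤ (4 * H)⁻¹) (hY : ‖Y‖ ≤ (4 * H)⁻¹)
    (h1 : ‖Y * (k * (Y / 2)) - (r - r₀) * J‖ ≤ H * (‖Y‖ ^ 3 + ‖r - r₀‖ * (‖r - r₀‖ + ‖Y‖)))
    (h2 : |T - J * r.im| ≤ H * (‖r - r₀‖ + ‖Y‖) * r.im)
    (h3 : |T - Y.im * (k * Y.re)| ≤ H * ‖Y‖ ^ 2 * Y.im + H * ‖r - r₀‖ * (r.im + Y.im)) :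
    let D : ℂ := r ^ 2 - r₀ ^ 2
    let L := 4 * H ^ 5
    0 < D.im ∧ ‖r - r₀‖ ≤ H * ‖D‖ ∧ L⁻¹ ≤ |J / (k * r₀)| ∧ |J / (k * r₀)| ≤ L ∧ L⁻¹ ≤ |k| ∧ |k| ≤ L ∧
    ‖Y ^ 2 - (J / (k * r₀) : ℝ) * D‖ ≤ L * (‖Y‖ ^ 3 + ‖D‖ * (‖D‖ + ‖Y‖)) ∧
    |T - Y.im * (k * Y.re)| ≤ L * (‖D‖ + ‖Y‖ ^ 2) * Y.im + L * ‖D‖ * D.im ∧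
    L⁻¹ * D.im ≤ T ∧ T ≤ L * D.im := by
  intro D L
  have hH0 : 0 < H := by linarith
  have hHi : 0 < H⁻¹ := by positivity
  have hrpos : 0 < r.re := hHi.trans_le hre
  have hr₀pos : 0 < r₀ := hHi.trans_le hr₀
  have hkpos : 0 < |k| := hHi.trans_le hk
  have hkne : k ≠ 0 := abs_pos.1 hkpos
  have hp : ∀ n, n ≤ 5 → H ^ n ≤ H ^ 5 := fun n hn => pow_le_pow_right₀ hH hn
  have hDim : D.im = 2 * (r.re * r.im) := by
    simp only [D, sq]
    simp
    ring
  have hDpos : 0 < D.im := by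
    rw [hDim]
    positivity
  have hDe : D = (r - r₀) * (r + r₀) := by
    simp only [D]
    ring
  obtain ⟨X, hXe⟩ : ∃ X, X = r - r₀ := ⟨_, rfl⟩
  rw [← hXe] at hX h1 h2 h3 hDe ⊢
  have hXD : ‖X‖ ≤ H * ‖D‖ := by
    have h4 : H⁻¹ ≤ ‖r + r₀‖ := by
      have := Complex.re_le_norm (r + r₀)
      rw [Complex.add_re, Complex.ofReal_re] at this
      linarith
    rw [hDe, norm_mul]
    calc ‖X‖ = H * (‖X‖ * H⁻¹) := by field_simp
      _ ≤ _ := by gcongr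
  have hβe : |J / (k * r₀)| = J * (|k|⁻¹ * r₀⁻¹) := by
    rw [abs_div, abs_mul, abs_of_pos hr₀pos, abs_of_pos (by linarith : 0 < J), div_eq_mul_inv,
      mul_inv]
  have hki : |k|⁻¹ ≤ H := by rwa [inv_le_comm₀ hkpos hH0]
  have hri' : r₀⁻¹ ≤ H := by rwa [inv_le_comm₀ hr₀pos hH0]
  have hki' : H⁻¹ ≤ |k|⁻¹ := by gcongr
  have hri'' : H⁻¹ ≤ r₀⁻¹ := by gcongr
  have hβ2 : |J / (k * r₀)| ≤ H ^ 3 := by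
    rw [hβe]
    calc J * (|k|⁻¹ * r₀⁻¹) ≤ H * (H * H) := by gcongr
      _ = _ := by ring
  have hβ1 : (H ^ 2)⁻¹ ≤ |J / (k * r₀)| := by
    rw [hβe]
    calc (H ^ 2)⁻¹ = 1 * (H⁻¹ * H⁻¹) := by
          field_simp
      _ ≤ _ := by gcongr
  have hH5 : 0 < H ^ 5 := by positivity
  have hL3 : H ^ 3 ≤ L := by linarith [hp 3 (by norm_num)]
  have hL2 : H ^ 2 ≤ L := by linarith [hp 2 (by norm_num)]
  have hL4 : 4 * H ≤ L := by linarith [hp 1 (by norm_num), pow_one H]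
  have hL1 : H ≤ L := by linarith
  have hL0 : 0 < L := by linarith
  have hriD : r.im ≤ H * D.im := by
    rw [hDim]
    calc r.im = H * (H⁻¹ * r.im) := by field_simp
      _ ≤ H * (r.re * r.im) := by gcongr
      _ ≤ H * (2 * (r.re * r.im)) := by
        have : 0 < r.re * r.im := by positivity
        exact mul_le_mul_of_nonneg_left (by linarith) hH0.le
  have hDri : D.im ≤ 2 * H * r.im := by
    rw [hDim]
    nlinarith
  refine ⟨hDpos, hXD, ?_, hβ2.trans hL3, ?_, hk'.trans hL1, ?_, ?_, ?_, ?_⟩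
  · exact le_trans (by gcongr) hβ1
  · exact le_trans (by gcongr) hk
  -- With X = r - r₀ one has D = X (X + 2 r₀), so multiplying by J / (k r₀) gives 2 J X / k plus a
  -- multiple of X². This trades r - r₀ for w - e at the cost of a quadratic error.
  · have e : Y ^ 2 - (J / (k * r₀) : ℝ) * D
        = (2 / k) * (Y * (k * (Y / 2)) - X * J) - (J / (k * r₀) : ℝ) * X ^ 2 := by
      have h4 : (k : ℂ) ≠ 0 := Complex.ofReal_ne_zero.2 hkne
      have h5 : (r₀ : ℂ) ≠ 0 := Complex.ofReal_ne_zero.2 hr₀pos.ne'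
      have h6 : r = X + r₀ := by rw [hXe]; ring
      rw [hDe, h6]
      push_cast
      field_simp
      ring
    rw [e]
    refine (norm_sub_le _ _).trans ?_
    rw [norm_mul, norm_mul, norm_div, Complex.norm_real, Complex.norm_real, Real.norm_eq_abs,
      Real.norm_eq_abs, norm_pow, Complex.norm_two, div_eq_mul_inv]
    calc 2 * |k|⁻¹ * ‖Y * (k * (Y / 2)) - X * J‖ + |J / (k * r₀)| * ‖X‖ ^ 2
        ≤ 2 * H * (H * (‖Y‖ ^ 3 + (H * ‖D‖) * (H * ‖D‖ + H * ‖Y‖))) + H ^ 3 * (H * ‖D‖) ^ 2 := by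
          have : ‖Y‖ ≤ H * ‖Y‖ := le_mul_of_one_le_left (norm_nonneg _) hH
          gcongr
          refine h1.trans ?_
          gcongr
      _ = 2 * H ^ 2 * ‖Y‖ ^ 3 + 2 * H ^ 4 * (‖D‖ * (‖D‖ + ‖Y‖)) + H ^ 5 * (‖D‖ * ‖D‖) := by ring
      _ ≤ 2 * H ^ 5 * ‖Y‖ ^ 3 + 2 * H ^ 5 * (‖D‖ * (‖D‖ + ‖Y‖)) + H ^ 5 * (‖D‖ * (‖D‖ + ‖Y‖)) := by
        have := hp 2 (by norm_num)
        have := hp 4 (by norm_num)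
        gcongr
        linarith [norm_nonneg Y]
      _ ≤ L * (‖Y‖ ^ 3 + ‖D‖ * (‖D‖ + ‖Y‖)) := by
        have h7 : 0 ≤ H ^ 5 * ‖Y‖ ^ 3 := by positivity
        have h8 : 0 ≤ H ^ 5 * (‖D‖ * (‖D‖ + ‖Y‖)) := by positivity
        linarith
  · refine h3.trans ?_
    calc H * ‖Y‖ ^ 2 * Y.im + H * ‖X‖ * (r.im + Y.im)
        ≤ H * ‖Y‖ ^ 2 * Y.im + H * (H * ‖D‖) * (H * D.im + Y.im) := by gcongr
      _ = H * ‖Y‖ ^ 2 * Y.im + H ^ 3 * ‖D‖ * D.im + H ^ 2 * ‖D‖ * Y.im := by ring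
      _ ≤ L * ‖Y‖ ^ 2 * Y.im + L * ‖D‖ * D.im + L * ‖D‖ * Y.im := by gcongr
      _ = _ := by ring
  all_goals
    have h4 : H * (‖X‖ + ‖Y‖) * r.im ≤ r.im / 2 := by
      calc H * (‖X‖ + ‖Y‖) * r.im ≤ H * ((4 * H)⁻¹ + (4 * H)⁻¹) * r.im := by gcongr
        _ = r.im / 2 := by
          field_simp
          norm_num
    obtain ⟨h5, h6⟩ := abs_le.1 (h2.trans h4)
    have h7 : r.im ≤ J * r.im := le_mul_of_one_le_left hri.le hJ
  · rw [inv_mul_le_iff₀ hL0]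
    calc D.im ≤ 2 * H * r.im := hDri
      _ = 4 * H * (r.im / 2) := by ring
      _ ≤ L * T := by
        gcongr
        linarith
  · have h8 : J * r.im ≤ H * r.im := by gcongr
    calc T ≤ 2 * H * r.im := by nlinarith
      _ ≤ 2 * H * (H * D.im) := by gcongr
      _ = 2 * H ^ 2 * D.im := by ring
      _ ≤ L * D.im := by
        gcongr
        linarith [hp 2 (by norm_num)]

end CircularLaw

/-! ### Square root behaviour at a regular edge -/

namespace CircularLaw

variable {τ : ℝ} {N : ℕ} {σ : Fin N → ℝ} {z w : ℂ}

/-- The continuity method: by hypothesis g never takes the value d, and on a connected set it cannot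
pass that value. -/
lemma lt_of_bootstrap {S : Set ℂ} (hS : IsPreconnected S) {g : ℂ → ℝ} (hg : ContinuousOn g S) {d : ℝ}
    (h0 : ∃ w ∈ S, g w < d) (h : ∀ w ∈ S, g w ≤ d → g w < d) : ∀ w ∈ S, g w < d := by
  intro w hw
  by_contra hcon
  push Not at hcon
  obtain ⟨w₀, hw₀, hlt⟩ := h0
  obtain ⟨v, hv, hvd⟩ := hS.intermediate_value hw₀ hw hg ⟨hlt.le, hcon⟩
  exact (h v hv hvd.le).ne hvd

lemma norm_csqrt_sub_le {x : ℝ} (hx : 0 < x) (hw : 0 < w.im) :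
    ‖csqrt w - (√x : ℝ)‖ * √x ≤ ‖w - x‖ := by
  have h1 : √x ≤ ‖csqrt w + (√x : ℝ)‖ := by
    have := Complex.re_le_norm (csqrt w + (√x : ℝ))
    rw [Complex.add_re, Complex.ofReal_re] at this
    linarith [(csqrt_mem_quadrant hw).1]
  have e : w - x = (csqrt w - (√x : ℝ)) * (csqrt w + (√x : ℝ)) := by
    have h2 : (((√x : ℝ) : ℂ)) ^ 2 = x := by
      rw [← Complex.ofReal_pow, Real.sq_sqrt hx.le]
    linear_combination -csqrt_sq w + h2
  rw [e, norm_mul]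
  gcongr

lemma sqrt_le_csqrt_re {b : ℝ} (hb : b ≤ w.re) (hw : 0 < w.im) : √b ≤ (csqrt w).re := by
  have h1 := csqrt_mem_quadrant hw
  refine Real.sqrt_le_iff.2 ⟨h1.1.le, hb.trans ?_⟩
  have := congrArg Complex.re (csqrt_sq w)
  rw [sq, Complex.mul_re] at this
  nlinarith [h1.2]

lemma csqrt_re_mul_im (w : ℂ) : 2 * ((csqrt w).re * (csqrt w).im) = w.im := by
  have := congrArg Complex.im (csqrt_sq w)
  rw [sq, Complex.mul_im] at this
  linarith

/-- With a nonzero slope k₁ of f in m the second local relation reads k₁ Im m ≈ T ≈ J Im r. Then Im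
A = O(Im √w) and the density vanishes nearby, which is impossible at an edge. -/
lemma im_le_of_slope_ne_zero {L k₁ k J T ri Yi Yr x y ρ : ℝ} (hL : 1 ≤ L) (hk₁ : 0 < |k₁|)
    (hri : 0 < ri) (hYi : 0 < Yi) (hy0 : 0 ≤ y) (hx : x ≤ ρ) (hy : y ≤ ρ) (hρ : ρ ≤ 1)
    (hρ' : ρ * (|k| + 2 * L) ≤ |k₁| / 2) (hYr : |Yr| ≤ y)
    (h1 : |T - J * ri| ≤ L * (x + y) * ri)
    (h2 : |T - Yi * (k₁ + k * Yr)| ≤ L * y ^ 2 * Yi + L * x * (ri + Yi)) :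
    Yi ≤ 2 / |k₁| * (|J| + 3 * L) * ri := by
  have h3 : |T| ≤ (|J| + 2 * L) * ri := by
    have e : T = (T - J * ri) + J * ri := by ring
    have h4 := abs_add_le (T - J * ri) (J * ri)
    rw [← e, abs_mul, abs_of_pos hri] at h4
    have h5 : L * (x + y) * ri ≤ L * 2 * ri := by
      gcongr
      linarith
    linarith
  have h4 : |k₁| * Yi ≤ |T| + |k| * ρ * Yi + (L * ρ * Yi + L * 1 * ri + L * ρ * Yi) := by
    have e : k₁ * Yi = T - k * Yr * Yi - (T - Yi * (k₁ + k * Yr)) := by ring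
    have h5 : |k₁ * Yi| ≤ |T| + |k * Yr * Yi| + |T - Yi * (k₁ + k * Yr)| := by
      conv_lhs => rw [e]
      exact (abs_sub _ _).trans (add_le_add (abs_sub _ _) le_rfl)
    rw [abs_mul, abs_mul, abs_mul, abs_of_pos hYi] at h5
    have h6 : |k| * |Yr| * Yi ≤ |k| * ρ * Yi := by
      gcongr
      linarith
    have h7 : L * y ^ 2 * Yi ≤ L * ρ * Yi := by
      gcongr
      nlinarith
    have h8 : L * x * (ri + Yi) ≤ L * 1 * ri + L * ρ * Yi := by
      rw [mul_add]
      gcongr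
      linarith
    linarith
  have h5 : ρ * (|k| + 2 * L) * Yi ≤ |k₁| / 2 * Yi := by gcongr
  have h6 : |k₁| / 2 * Yi ≤ (|J| + 3 * L) * ri := by linarith
  calc Yi = 2 / |k₁| * (|k₁| / 2 * Yi) := by field_simp
    _ ≤ 2 / |k₁| * ((|J| + 3 * L) * ri) := by gcongr
    _ = _ := by ring

/-- At an edge the derivative of `f` in `m` vanishes. -/
lemma slope_eq_zero_of_edge (hτ : 0 < τ) (h : Admissible τ σ z) {x m₀ δ L k₁ k J : ℝ} (hx : 0 < x)
    (hedge : x ∈ edges σ z) (hlim : Tendsto (rootA σ z) (𝓝[upperHalf] (x : ℂ)) (𝓝 (m₀ : ℂ)))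
    (hδ : 0 < δ) (hL : 1 ≤ L)
    (hrel : ∀ r m : ℂ, 0 < r.im → 0 < m.im → ‖r - (√x : ℝ)‖ ≤ δ → ‖m - m₀‖ ≤ δ →
      fFun σ z r m = 0 → ∃ T : ℝ, |T - J * r.im| ≤ L * (‖r - (√x : ℝ)‖ + ‖m - m₀‖) * r.im ∧
        |T - m.im * (k₁ + k * (m.re - m₀))|
          ≤ L * ‖m - m₀‖ ^ 2 * m.im + L * ‖r - (√x : ℝ)‖ * (r.im + m.im)) : k₁ = 0 := by
  by_contra hne
  have hk₁ : 0 < |k₁| := abs_pos.2 hne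
  have hpos : 0 < |k| + 2 * L := by positivity
  obtain ⟨ρ, hρ⟩ : ∃ ρ, ρ = min δ (min 1 (|k₁| / 2 / (|k| + 2 * L))) := ⟨_, rfl⟩
  have hρ0 : 0 < ρ := hρ ▸ lt_min hδ (lt_min one_pos (by positivity))
  have hρδ : ρ ≤ δ := hρ ▸ min_le_left _ _
  have hρ1 : ρ ≤ 1 := hρ ▸ (min_le_right _ _).trans (min_le_left _ _)
  have hρk : ρ * (|k| + 2 * L) ≤ |k₁| / 2 := by
    rw [← le_div_iff₀ hpos, hρ]
    exact (min_le_right _ _).trans (min_le_right _ _)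
  refine notMem_edges_of_zero (eventually_rho1c_eq_zero hτ h (C := 2 / |k₁| * (|J| + 3 * L)) hx ?_)
    hedge
  have hclose : ∀ {g : ℂ → ℂ} {a : ℂ}, Tendsto g (𝓝[upperHalf] (x : ℂ)) (𝓝 a) →
      ∀ᶠ w in 𝓝[upperHalf] (x : ℂ), ‖g w - a‖ ≤ ρ := by
    intro g a hg
    filter_upwards [hg.eventually (Metric.ball_mem_nhds a hρ0)] with w hw
    rw [dist_eq_norm] at hw
    exact hw.le
  filter_upwards [self_mem_nhdsWithin, hclose hlim, hclose (tendsto_csqrt hx)] with w hw hm hr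
  have S := isSol hτ h hw
  have hA : 0 < (rootA σ z w).im := S.im_pos.trans S.A_im
  obtain ⟨T, h1, h2⟩ := hrel _ _ S.im_pos hA (hr.trans hρδ) (hm.trans hρδ) (fFun_root hτ h hw)
  refine im_le_of_slope_ne_zero hL hk₁ S.im_pos hA (norm_nonneg _) hr hm hρ1 hρk ?_
    h1 h2
  have := Complex.abs_re_le_norm (rootA σ z w - m₀)
  rwa [Complex.sub_re, Complex.ofReal_re] at this

/-- The dichotomy at a single point where `√w (1 + m₁)` is close to its value at the edge. -/
lemma edge_pointwise (hτ : 0 < τ) (h : Admissible τ σ z) {e H L δ δ' q m₀ k J : ℝ} (he : 0 < e)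
    (hH : 1 ≤ H) (hLH : L ≤ H) (he1 : H⁻¹ ≤ √e) (he2 : √e + 1 ≤ H)
    (hk : H⁻¹ ≤ |k|) (hk' : |k| ≤ H) (hJ : 1 ≤ J) (hJ' : J ≤ H)
    (hrel : ∀ r m : ℂ, 0 < r.im → 0 < m.im → ‖r - (√e : ℝ)‖ ≤ δ → ‖m - m₀‖ ≤ δ →
      fFun σ z r m = 0 → (∀ i, q / 2 ≤ ‖cubic (σ i) z r m‖) ∧
      ‖(m - m₀) * ((0 : ℝ) + k * ((m - m₀) / 2)) - (r - (√e : ℝ)) * J‖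
        ≤ L * (‖m - m₀‖ ^ 3 + ‖r - (√e : ℝ)‖ * (‖r - (√e : ℝ)‖ + ‖m - m₀‖)) ∧
      ∃ T : ℝ, |T - J * r.im| ≤ L * (‖r - (√e : ℝ)‖ + ‖m - m₀‖) * r.im ∧
        |T - m.im * (0 + k * (m.re - m₀))|
          ≤ L * ‖m - m₀‖ ^ 2 * m.im + L * ‖r - (√e : ℝ)‖ * (r.im + m.im))
    (hδ' : δ' ≤ δ) (hδ'' : δ' ≤ (4 * (4 * H ^ 5))⁻¹) (hw : 0 < w.im) (hre : H⁻¹ ≤ (csqrt w).re)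
    (hD : H * ‖w - e‖ ≤ δ') (hDs : √‖w - e‖ ≤ (100 * (4 * H ^ 5) ^ 5)⁻¹)
    (hY : ‖rootA σ z w - m₀‖ ≤ δ') :
    (∀ i, q / 2 ≤ ‖cubic (σ i) z (csqrt w) (rootA σ z w)‖) ∧
    ‖rootA σ z w - m₀‖ ≤ 2 * (4 * H ^ 5) * √‖w - e‖ ∧
    (J / (k * √e) * (w.re - e) ≤ 0 → (2 * (4 * H ^ 5))⁻¹ * √‖w - e‖ ≤ (rootA σ z w).im) ∧
    (0 ≤ J / (k * √e) * (w.re - e) →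
      (6 * (4 * H ^ 5) ^ 3)⁻¹ * (w.im / √‖w - e‖) ≤ (rootA σ z w).im ∧
      (rootA σ z w).im ≤ 8 * (4 * H ^ 5) ^ 3 * (w.im / √‖w - e‖)) := by
  have hH0 : 0 < H := by linarith
  have S := isSol hτ h hw
  have hA : 0 < (rootA σ z w).im := S.im_pos.trans S.A_im
  have hX : ‖csqrt w - (√e : ℝ)‖ ≤ δ' := by
    have h1 := norm_csqrt_sub_le he hw
    have h2 : ‖csqrt w - (√e : ℝ)‖ * H⁻¹ ≤ ‖w - e‖ := le_trans (by gcongr) h1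
    rw [← div_eq_mul_inv, div_le_iff₀ hH0] at h2
    linarith
  have hHp : H ≤ H ^ 5 := le_self_pow₀ hH (by norm_num)
  have hδH : δ' ≤ (4 * H)⁻¹ := hδ''.trans (by gcongr; linarith)
  have hδ1 : δ' ≤ 1 := hδH.trans (inv_le_one_of_one_le₀ (by linarith))
  have hre2 : (csqrt w).re ≤ H := by
    have h1 := Complex.re_le_norm (csqrt w - (√e : ℝ))
    rw [Complex.sub_re, Complex.ofReal_re] at h1
    linarith
  obtain ⟨h1, h2, T, h3, h4⟩ := hrel _ _ S.im_pos hA (hX.trans hδ') (hY.trans hδ') (fFun_root hτ h hw)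
  have hYim : (rootA σ z w - m₀).im = (rootA σ z w).im := by simp
  have hYre : (rootA σ z w - m₀).re = (rootA σ z w).re - m₀ := by simp
  obtain ⟨Y, hYe⟩ : ∃ Y, Y = rootA σ z w - m₀ := ⟨_, rfl⟩
  rw [← hYe] at hY h2 h3 h4 hYim hYre ⊢
  rw [← hYre, ← hYim] at h4
  rw [Complex.ofReal_zero, zero_add] at h2
  rw [zero_add] at h4
  rw [← hYim] at hA ⊢
  have hri := S.im_pos
  have key := dichotomy_hypotheses hH he1 hre (by linarith) hre2 hri hA hk hk' hJ hJ'
    (hX.trans hδH) (hY.trans hδH) (h2.trans (by gcongr)) (h3.trans (by gcongr))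
    (h4.trans (by gcongr))
  have hDe : csqrt w ^ 2 - ((√e : ℝ) : ℂ) ^ 2 = w - e := by
    rw [csqrt_sq, ← Complex.ofReal_pow, Real.sq_sqrt he.le]
  have hDim : (w - e).im = w.im := by simp
  have hDre : (w - e).re = w.re - e := by simp
  simp only [hDe, hDim] at key
  obtain ⟨-, -, k1, k2, k3, k4, k5, k6, k7, k8⟩ := key
  have hL1 : 1 ≤ 4 * H ^ 5 := by linarith
  rw [← hDim] at k6 k7 k8
  have := sqrt_dichotomy hL1 k1 k2 k3 k4 (by rw [hDim]; exact hw) hA k5 k6 k7 k8 hDs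
    (hY.trans hδ'')
  rw [hDim, hDre] at this
  exact ⟨h1, this⟩

/-- Square root behaviour of `√w (1 + m₁)` near a regular edge. -/
theorem edge_expansion {ε : ℝ} (hτ : 0 < τ) (hε : 0 < ε) :
    ∃ a δ L : ℝ, 0 < a ∧ 0 < δ ∧ δ ≤ a / 2 ∧ 1 ≤ L ∧ ∀ (N : ℕ) (σ : Fin N → ℝ) (z : ℂ),
      Admissible τ σ z → ∀ e : ℝ, IsRegularEdge ε σ z e → a ≤ e ∧ e ≤ 200 / τ ∧
      ∃ β : ℝ, β ≠ 0 ∧ ∀ w : ℂ, 0 < w.im → ‖w - e‖ < δ →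
        (∀ i, L⁻¹ ≤ ‖cubic (σ i) z (csqrt w) (rootA σ z w)‖) ∧
        (β * (w.re - e) ≤ 0 →
          L⁻¹ * √‖w - e‖ ≤ (rootA σ z w).im ∧ (rootA σ z w).im ≤ L * √‖w - e‖) ∧
        (0 ≤ β * (w.re - e) →
          L⁻¹ * (w.im / √‖w - e‖) ≤ (rootA σ z w).im ∧
          (rootA σ z w).im ≤ L * (w.im / √‖w - e‖)) := by
  obtain ⟨a, B, q, ha, hB, hq, Hdata⟩ := exists_localData hτ hε
  obtain ⟨δ₁, L₁, hδ₁, hL₁, Hrel⟩ := local_relations hB hq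
  have hsa : 0 < √(a / 2) := by positivity
  obtain ⟨H, hHd⟩ : ∃ H, H = B + L₁ + ε⁻¹ + (√(a / 2))⁻¹ := ⟨_, rfl⟩
  have hε' : 0 < ε⁻¹ := by positivity
  have hsa' : 0 < (√(a / 2))⁻¹ := by positivity
  have hH : 1 ≤ H := by linarith
  have hH0 : 0 < H := by linarith
  have hHε : H⁻¹ ≤ ε := by
    rw [inv_le_comm₀ hH0 hε]
    linarith
  have hHa : H⁻¹ ≤ √(a / 2) := by
    rw [inv_le_comm₀ hH0 hsa]
    linarith
  obtain ⟨P, hP⟩ : ∃ P, P = 4 * H ^ 5 := ⟨_, rfl⟩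
  have hP1 : 1 ≤ P := by
    have := one_le_pow₀ hH (n := 5)
    linarith
  have hP0 : 0 < P := by linarith
  obtain ⟨δ', hδ'⟩ : ∃ d, d = min δ₁ (4 * P)⁻¹ := ⟨_, rfl⟩
  have hδ'0 : 0 < δ' := hδ' ▸ lt_min hδ₁ (by positivity)
  have hδ'1 : δ' ≤ δ₁ := hδ' ▸ min_le_left _ _
  have hδ'2 : δ' ≤ (4 * P)⁻¹ := hδ' ▸ min_le_right _ _
  obtain ⟨t, ht⟩ : ∃ t, t = min (100 * P ^ 5)⁻¹ (δ' / (4 * P)) := ⟨_, rfl⟩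
  have ht0 : 0 < t := ht ▸ lt_min (by positivity) (by positivity)
  -- The three constraints keep w away from 0, keep √w near √e, and make √|w - e| small enough for
  -- both the dichotomy and the continuity argument. All depend on τ and ε only.
  obtain ⟨δ, hδ⟩ : ∃ d, d = min (a / 2) (min (δ' / H) (t ^ 2)) := ⟨_, rfl⟩
  have hδ0 : 0 < δ := hδ ▸ lt_min (by positivity) (lt_min (by positivity) (by positivity))
  have hδa : δ ≤ a / 2 := hδ ▸ min_le_left _ _
  have hδH : δ ≤ δ' / H := hδ ▸ (min_le_right _ _).trans (min_le_left _ _)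
  have hδt : δ ≤ t ^ 2 := hδ ▸ (min_le_right _ _).trans (min_le_right _ _)
  have hPp : P ≤ P ^ 3 := le_self_pow₀ hP1 (by norm_num)
  have hq' : 0 < (q / 2)⁻¹ := by positivity
  have hLq : (8 * P ^ 3 + (q / 2)⁻¹)⁻¹ ≤ q / 2 := by
    rw [inv_le_comm₀ (by positivity) (by positivity)]
    linarith
  have hL2P : (8 * P ^ 3 + (q / 2)⁻¹)⁻¹ ≤ (2 * P)⁻¹ := by
    gcongr
    linarith
  have hL6P : (8 * P ^ 3 + (q / 2)⁻¹)⁻¹ ≤ (6 * P ^ 3)⁻¹ := by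
    gcongr
    linarith
  refine ⟨a, δ, 8 * P ^ 3 + (q / 2)⁻¹, ha, hδ0, hδa, by linarith, fun N σ z h e he => ?_⟩
  obtain ⟨hae, heM, m₀, hm₀, hlim, d⟩ := Hdata N σ z h e he
  obtain ⟨k₁, k, J, hk, hkL, hJ1, hJL, hrel⟩ := Hrel N σ z _ m₀ d
  have he0 : 0 < e := ha.trans_le hae
  have hk₁ : k₁ = 0 := slope_eq_zero_of_edge hτ h he0 he.edge hlim hδ₁ hL₁
    fun r m hr hm hrd hmd hf => (hrel r m hr hm hrd hmd hf).2.2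
  subst hk₁
  have hkε : ε ≤ |k| := by
    have := he.second_deriv
    rwa [hm₀, hk, Complex.norm_real, Real.norm_eq_abs] at this
  have hse : √(a / 2) ≤ √e := Real.sqrt_le_sqrt (by linarith)
  have hse0 : 0 < √e := by linarith
  have hr₀ := d.r_le
  rw [abs_of_pos hse0] at hr₀
  have hpt : ∀ w : ℂ, 0 < w.im → ‖w - e‖ < δ → ‖rootA σ z w - m₀‖ ≤ δ' → _ :=
    fun w hw hwe hY => edge_pointwise (w := w) hτ h he0 hH (by linarith : L₁ ≤ H)
      (hHa.trans hse) (by linarith : √e + 1 ≤ H) (hHε.trans hkε) (by linarith : |k| ≤ H) hJ1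
      (by linarith : J ≤ H) hrel hδ'1 (by rw [← hP]; exact hδ'2) hw (hHa.trans
        (sqrt_le_csqrt_re (by
          have h1 := (abs_le.1 ((Complex.abs_re_le_norm (w - e)).trans hwe.le)).1
          rw [Complex.sub_re, Complex.ofReal_re] at h1
          linarith) hw))
      (by
        rw [le_div_iff₀ hH0] at hδH
        nlinarith)
      (by
        rw [← hP]
        refine Real.sqrt_le_iff.2 ⟨by positivity, hwe.le.trans (hδt.trans ?_)⟩
        gcongr
        rw [ht]
        exact min_le_left _ _) hY
  have hsmall : ∀ w : ℂ, ‖w - e‖ < δ → 2 * P * √‖w - e‖ < δ' := by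
    intro w hwe
    have h1 : √‖w - e‖ ≤ t := Real.sqrt_le_iff.2 ⟨ht0.le, hwe.le.trans hδt⟩
    have h2 : t ≤ δ' / (4 * P) := ht ▸ min_le_right _ _
    calc 2 * P * √‖w - e‖ ≤ 2 * P * (δ' / (4 * P)) := by
          gcongr
          linarith
      _ = δ' / 2 := by
        field_simp
        norm_num
      _ < δ' := by linarith
  -- The boundary limit gives closeness only very near e, with no uniformity. Wherever |A - m₀| ≤
  -- δ', the dichotomy improves this to 2 P √|w - e| < δ', so closeness persists on the whole half
  -- ball of uniform radius.
  have hall : ∀ w ∈ Metric.ball (e : ℂ) δ ∩ upperHalf, ‖rootA σ z w - m₀‖ < δ' := by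
    refine lt_of_bootstrap ((convex_ball _ _).inter convex_upperHalf).isPreconnected
      (((rootA_continuousOn hτ h).mono inter_subset_right).sub continuousOn_const).norm ?_ ?_
    · have h1 : ∀ᶠ w in 𝓝[upperHalf] (e : ℂ), ‖rootA σ z w - m₀‖ < δ' := by
        filter_upwards [hlim.eventually (Metric.ball_mem_nhds (m₀ : ℂ) hδ'0)] with w hw
        rwa [dist_eq_norm] at hw
      have h2 : ∀ᶠ w in 𝓝[upperHalf] (e : ℂ), w ∈ Metric.ball (e : ℂ) δ ∩ upperHalf :=
        inter_mem (mem_nhdsWithin_of_mem_nhds (Metric.ball_mem_nhds _ hδ0)) self_mem_nhdsWithin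
      obtain ⟨w, hw1, hw2⟩ := (h1.and h2).exists
      exact ⟨w, hw2, hw1⟩
    · rintro w ⟨hwe, hw⟩ hY
      rw [mem_ball_iff_norm] at hwe
      have h1 := (hpt w hw hwe hY).2.1
      rw [← hP] at h1
      exact h1.trans_lt (hsmall w hwe)
  refine ⟨hae, heM, J / (k * √e), ?_, fun w hw hwe => ?_⟩
  · have hkne : k ≠ 0 := abs_pos.1 (hε.trans_le hkε)
    have : J ≠ 0 := by linarith
    positivity
  · have hY := hall w ⟨by rwa [mem_ball_iff_norm], hw⟩
    obtain ⟨h1, h2, h3, h4⟩ := hpt w hw hwe hY.le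
    rw [← hP] at h2 h3 h4
    have hs : 0 ≤ √‖w - e‖ := Real.sqrt_nonneg _
    refine ⟨fun i => hLq.trans (h1 i), fun hb => ⟨?_, ?_⟩, fun hb => ⟨?_, ?_⟩⟩
    · exact le_trans (by gcongr) (h3 hb)
    · have h5 := Complex.im_le_norm (rootA σ z w - m₀)
      rw [Complex.sub_im, Complex.ofReal_im, sub_zero] at h5
      refine h5.trans (h2.trans ?_)
      gcongr
      linarith
    · exact le_trans (by gcongr) (h4 hb).1
    · refine (h4 hb).2.trans ?_
      gcongr
      linarith

end CircularLaw

/-! ### The support near a regular edge, comparison of imaginary parts -/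

namespace CircularLaw

variable {τ : ℝ} {N : ℕ} {σ : Fin N → ℝ} {z w : ℂ}

section Support

variable {e δ L β : ℝ}

lemma tendsto_norm_sub_upperHalf (x e : ℝ) :
    Tendsto (fun w : ℂ => ‖w - e‖) (𝓝[upperHalf] (x : ℂ)) (𝓝 |x - e|) := by
  have h1 : Continuous fun w : ℂ => ‖w - e‖ := by fun_prop
  have := h1.tendsto (x : ℂ)
  rw [← Complex.ofReal_sub, Complex.norm_real, Real.norm_eq_abs] at this
  exact this.mono_left nhdsWithin_le_nhds

lemma tendsto_mul_re_sub_upperHalf (β x e : ℝ) :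
    Tendsto (fun w : ℂ => β * (w.re - e)) (𝓝[upperHalf] (x : ℂ)) (𝓝 (β * (x - e))) := by
  have h1 : Continuous fun w : ℂ => β * (w.re - e) := by fun_prop
  have := h1.tendsto (x : ℂ)
  rw [Complex.ofReal_re] at this
  exact this.mono_left nhdsWithin_le_nhds

lemma tendsto_rootA_im (hτ : 0 < τ) (h : Admissible τ σ z) {x : ℝ} (hx : 0 < x) :
    Tendsto (fun w => (rootA σ z w).im) (𝓝[upperHalf] (x : ℂ)) (𝓝 (√x * (m1Real σ z x).im)) := by
  have h1 := (Complex.continuous_im.tendsto _).comp (tendsto_rootA hτ h hx)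
  rwa [Complex.im_ofReal_mul, Complex.add_im, Complex.one_im, zero_add] at h1

/-- Letting w tend to a real point x ≠ e turns the dichotomy into a statement on the density: it is
positive where β (x - e) < 0, and by `rho1c_eq_zero_of_le_div` zero where β (x - e) > 0. -/
lemma rho1c_ne_zero_of_sqrt_le (hτ : 0 < τ) (h : Admissible τ σ z) (hL : 0 < L)
    (H : ∀ w : ℂ, 0 < w.im → ‖w - e‖ < δ → β * (w.re - e) ≤ 0 →
      L⁻¹ * √‖w - e‖ ≤ (rootA σ z w).im) {x : ℝ} (hx : 0 < x) (hxe : |x - e| < δ)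
    (hneg : β * (x - e) < 0) : rho1c σ z x ≠ 0 := by
  have hne : 0 < |x - e| := abs_pos.2 fun h0 => by simp [h0] at hneg
  have h1 : L⁻¹ * √|x - e| ≤ √x * (m1Real σ z x).im := by
    refine le_of_tendsto_of_tendsto ((tendsto_norm_sub_upperHalf x e).sqrt.const_mul _)
      (tendsto_rootA_im hτ h hx) ?_
    filter_upwards [self_mem_nhdsWithin, (tendsto_norm_sub_upperHalf x e).eventually_lt_const hxe,
      (tendsto_mul_re_sub_upperHalf β x e).eventually_lt_const hneg] with w hw h2 h3
    exact H w hw h2 h3.le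
  have h2 : 0 < L⁻¹ * √|x - e| := by positivity
  rw [rho1c_eq hτ h hx]
  intro h0
  rcases mul_eq_zero.1 h0 with h3 | h3
  · exact inv_ne_zero Real.pi_pos.ne' h3
  · rw [h3, mul_zero] at h1
    linarith

lemma rho1c_eq_zero_of_le_div (hτ : 0 < τ) (h : Admissible τ σ z)
    (H : ∀ w : ℂ, 0 < w.im → ‖w - e‖ < δ → 0 ≤ β * (w.re - e) →
      (rootA σ z w).im ≤ L * (w.im / √‖w - e‖)) {x : ℝ} (hx : 0 < x) (hxe : |x - e| < δ)
    (hpos : 0 < β * (x - e)) : rho1c σ z x = 0 := by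
  have hne : 0 < |x - e| := abs_pos.2 fun h0 => by simp [h0] at hpos
  have h1 : √x * (m1Real σ z x).im ≤ L * (0 / √|x - e|) := by
    refine le_of_tendsto_of_tendsto (tendsto_rootA_im hτ h hx)
      (((tendsto_im_upperHalf x).div (tendsto_norm_sub_upperHalf x e).sqrt
        (Real.sqrt_pos.2 hne).ne').const_mul _) ?_
    filter_upwards [self_mem_nhdsWithin, (tendsto_norm_sub_upperHalf x e).eventually_lt_const hxe,
      (tendsto_mul_re_sub_upperHalf β x e).eventually_const_lt hpos] with w hw h2 h3
    exact H w hw h2 h3.le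
  rw [zero_div, mul_zero] at h1
  have h2 : (m1Real σ z x).im = 0 :=
    le_antisymm (nonpos_of_mul_nonpos_right h1 (Real.sqrt_pos.2 hx)) (m1Real_im_nonneg hτ h hx)
  rw [rho1c_eq hτ h hx, h2, mul_zero]

/-- The support and the distance to the edges, near an edge where the density is positive on one
side and vanishes on the other. -/
lemma support_near_edge (hβ : β ≠ 0) (he : e ∈ edges σ z) (hδe : δ ≤ e)
    (Hne : ∀ x : ℝ, |x - e| < δ → β * (x - e) < 0 → rho1c σ z x ≠ 0)
    (Hz : ∀ x : ℝ, |x - e| < δ → 0 < β * (x - e) → rho1c σ z x = 0) {x : ℝ} (hx : |x - e| ≤ δ / 2)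
    (hδ : 0 < δ) : (x ∈ supp1 σ z ↔ β * (x - e) ≤ 0) ∧ kappa σ z x = |x - e| := by
  have hnear : ∀ y : ℝ, |y - e| < δ → ∀ᶠ u in 𝓝 y, |u - e| < δ := by
    intro y hy
    have : Continuous fun u : ℝ => |u - e| := by fun_prop
    exact this.continuousAt.eventually_lt_const hy
  have hcont : ∀ y : ℝ, Tendsto (fun u => β * (u - e)) (𝓝 y) (𝓝 (β * (y - e))) := by
    intro y
    have : Continuous fun u : ℝ => β * (u - e) := by fun_prop
    exact this.tendsto y
  have hpos : ∀ y : ℝ, |y - e| < δ → 0 < β * (y - e) → ∀ᶠ u in 𝓝 y, rho1c σ z u = 0 := by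
    intro y hy hb
    filter_upwards [hnear y hy, (hcont y).eventually_const_lt hb] with u h1 h2
    exact Hz u h1 h2
  have hneg : ∀ y : ℝ, |y - e| < δ → β * (y - e) < 0 → ∀ᶠ u in 𝓝 y, rho1c σ z u ≠ 0 := by
    intro y hy hb
    filter_upwards [hnear y hy, (hcont y).eventually_lt_const hb] with u h1 h2
    exact Hne u h1 h2
  have hxδ : |x - e| < δ := by linarith
  constructor
  · constructor
    · intro hmem
      by_contra hcon
      push Not at hcon
      exact mem_closure_iff_frequently.1 hmem
        ((hpos x hxδ hcon).mono fun y hy => by simpa using hy)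
    · intro hb
      rcases hb.lt_or_eq with h1 | h1
      · exact subset_closure (Hne x hxδ h1)
      · have : x = e := by
          rcases mul_eq_zero.1 h1 with h2 | h2
          · exact absurd h2 hβ
          · linarith
        rw [this]
        exact isClosed_closure.frontier_subset he
  · have hmem : e ∈ {e : ℝ | e ∈ edges σ z ∧ 0 < e} := ⟨he, by linarith⟩
    refine le_antisymm (Metric.infDist_le_dist_of_mem hmem)
      ((Metric.le_infDist ⟨e, hmem⟩).2 fun y hy => ?_)
    by_cases hye : y = e
    · rw [hye, Real.dist_eq]
    -- No other edge lies within δ of e; as |x - e| ≤ δ/2, the nearest positive edge to x is e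
    -- itself.
    · have h1 : δ ≤ |y - e| := by
        by_contra hcon
        push Not at hcon
        rcases lt_trichotomy (β * (y - e)) 0 with h2 | h2 | h2
        · exact notMem_edges_of_pos (hneg y hcon h2) hy.1
        · exact (mul_ne_zero hβ (sub_ne_zero.2 hye)) h2
        · exact notMem_edges_of_zero (hpos y hcon h2) hy.1
      have h2 := abs_sub_le y x e
      rw [Real.dist_eq, abs_sub_comm x y]
      linarith

end Support

/-- Away from the imaginary axis `Im m₁`, `Im m₂` and `Im √w (1 + m₁)` are comparable. -/
lemma im_le_im_rootA (hτ : 0 < τ) {a K : ℝ} (ha : 0 < a) (hK : 1 ≤ K) :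
    ∃ C : ℝ, 1 ≤ C ∧ ∀ (N : ℕ) (σ : Fin N → ℝ) (z w : ℂ), Admissible τ σ z → 0 < w.im → a ≤ w.re →
      Bounded τ σ z w K → (m1c σ z w).im ≤ C * (rootA σ z w).im ∧
        (rootA σ z w).im ≤ C * (m1c σ z w).im ∧ (m2c σ z w).im ≤ C * (m1c σ z w).im ∧
        (m1c σ z w).im ≤ C * (m2c σ z w).im := by
  have hK0 : 0 < K := by linarith
  have hsa : 0 < √a := Real.sqrt_pos.2 ha
  obtain ⟨C₁, hC₁⟩ : ∃ C, C = a⁻¹ * (K + K ^ 2) := ⟨_, rfl⟩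
  obtain ⟨C₂, hC₂⟩ : ∃ C, C = (√a)⁻¹ * (K ^ 2 + K ^ 2 * ((√a)⁻¹ * (6 * K ^ 4) ^ 2)) := ⟨_, rfl⟩
  obtain ⟨C₃, hC₃⟩ : ∃ C, C = K ^ 4 * (3 * K * (6 * K ^ 4) ^ 2 + 9 * K) := ⟨_, rfl⟩
  obtain ⟨C₄, hC₄⟩ : ∃ C, C = a⁻¹ * (3 * K * (6 * K ^ 3) ^ 2) := ⟨_, rfl⟩
  have h1 : 0 < C₁ := by rw [hC₁]; positivity
  have h2 : 0 < C₂ := by rw [hC₂]; positivity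
  have h3 : 0 < C₃ := by rw [hC₃]; positivity
  have h4 : 0 < C₄ := by rw [hC₄]; positivity
  refine ⟨1 + C₁ + C₂ + C₃ + C₄, by linarith, fun N σ z w h hw haw b => ?_⟩
  have S := isSol hτ h hw
  have hri := S.im_pos
  have hrr := S.re_pos
  have hA : 0 < (rootA σ z w).im := hri.trans S.A_im
  have hm1 := (m1c_spec hτ h).im_pos w hw
  have hm2 := m2c_im_pos hτ h hw
  have hη : w.im ≤ (6 * K ^ 4) ^ 2 * (m1c σ z w).im := by
    have := b.m1c_im_ge hτ h hw
    rwa [div_le_iff₀ (by positivity), mul_comm] at this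
  have hr1 : √a ≤ (csqrt w).re := sqrt_le_csqrt_re haw hw
  have hwK : ‖csqrt w‖ ≤ K := by
    have h5 := norm_sq_csqrt w
    have h6 := b.norm_le
    by_contra hcon
    push Not at hcon
    nlinarith
  have hr2 : (csqrt w).re ≤ K := (Complex.re_le_norm _).trans hwK
  have hri2 : (csqrt w).im ≤ (√a)⁻¹ * w.im := by
    have h5 := csqrt_re_mul_im w
    calc (csqrt w).im = (√a)⁻¹ * (√a * (csqrt w).im) := by field_simp
      _ ≤ (√a)⁻¹ * w.im := by
        gcongr
        nlinarith
  have hAn : ‖rootA σ z w‖ ≤ K ^ 2 := by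
    rw [rootA, norm_mul, sq]
    have := b.norm_one_add_le
    gcongr
  have hAre := (Complex.abs_re_le_norm (rootA σ z w)).trans hAn
  -- `|w| Im m₁ = Re √w Im A - Re A Im √w`
  have key : ‖w‖ * (m1c σ z w).im
      = (csqrt w).re * (rootA σ z w).im - (rootA σ z w).re * (csqrt w).im := by
    rw [← norm_sq_csqrt w, Complex.sq_norm, Complex.normSq_apply, rootA]
    simp only [Complex.mul_im, Complex.mul_re, Complex.add_im, Complex.add_re, Complex.one_im,
      Complex.one_re]
    ring
  have hmul : |(rootA σ z w).re * (csqrt w).im| ≤ K ^ 2 * (csqrt w).im := by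
    rw [abs_mul, abs_of_pos hri]
    gcongr
  obtain ⟨hmul1, hmul2⟩ := abs_le.1 hmul
  have hwa : a ≤ ‖w‖ := haw.trans (Complex.re_le_norm w)
  have hbig : ∀ {C y : ℝ}, 0 < y → C ≤ 1 + C₁ + C₂ + C₃ + C₄ → C * y ≤ (1 + C₁ + C₂ + C₃ + C₄) * y :=
    fun hy hC => mul_le_mul_of_nonneg_right hC hy.le
  refine ⟨le_trans ?_ (hbig hA (by linarith : C₁ ≤ _)), le_trans ?_ (hbig hm1 (by linarith : C₂ ≤ _)),
    le_trans ?_ (hbig hm1 (by linarith : C₃ ≤ _)), le_trans ?_ (hbig hm2 (by linarith : C₄ ≤ _))⟩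
  · have h5 : a * (m1c σ z w).im ≤ (K + K ^ 2) * (rootA σ z w).im := by
      calc a * (m1c σ z w).im ≤ ‖w‖ * (m1c σ z w).im := by gcongr
        _ ≤ (csqrt w).re * (rootA σ z w).im + K ^ 2 * (csqrt w).im := by linarith
        _ ≤ K * (rootA σ z w).im + K ^ 2 * (rootA σ z w).im := by
          gcongr
          exact S.A_im.le
        _ = _ := by ring
    calc (m1c σ z w).im = a⁻¹ * (a * (m1c σ z w).im) := by field_simp
      _ ≤ a⁻¹ * ((K + K ^ 2) * (rootA σ z w).im) := by gcongr
      _ = _ := by rw [hC₁]; ring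
  · have hKK : K ≤ K ^ 2 := le_self_pow₀ hK (by norm_num)
    have h5 : √a * (rootA σ z w).im
        ≤ K ^ 2 * (m1c σ z w).im + K ^ 2 * ((√a)⁻¹ * ((6 * K ^ 4) ^ 2 * (m1c σ z w).im)) := by
      calc √a * (rootA σ z w).im ≤ (csqrt w).re * (rootA σ z w).im := by gcongr
        _ ≤ ‖w‖ * (m1c σ z w).im + K ^ 2 * (csqrt w).im := by linarith
        _ ≤ K ^ 2 * (m1c σ z w).im + K ^ 2 * ((√a)⁻¹ * ((6 * K ^ 4) ^ 2 * (m1c σ z w).im)) := by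
          gcongr
          · exact b.norm_le.trans hKK
          · refine hri2.trans ?_
            gcongr
    calc (rootA σ z w).im = (√a)⁻¹ * (√a * (rootA σ z w).im) := by field_simp
      _ ≤ (√a)⁻¹ * (K ^ 2 * (m1c σ z w).im
          + K ^ 2 * ((√a)⁻¹ * ((6 * K ^ 4) ^ 2 * (m1c σ z w).im))) := by gcongr
      _ = _ := by rw [hC₂]; ring
  · calc (m2c σ z w).im ≤ K ^ 4 * (3 * K * w.im + 9 * K * (m1c σ z w).im) := b.m2c_im_le hτ h hw
      _ ≤ K ^ 4 * (3 * K * ((6 * K ^ 4) ^ 2 * (m1c σ z w).im) + 9 * K * (m1c σ z w).im) := by gcongr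
      _ = _ := by rw [hC₃]; ring
  · calc (m1c σ z w).im = a⁻¹ * (a * (m1c σ z w).im) := by field_simp
      _ ≤ a⁻¹ * (w.re * (m1c σ z w).im) := by gcongr
      _ ≤ a⁻¹ * (3 * K * (6 * K ^ 3) ^ 2 * (m2c σ z w).im) := by
        exact mul_le_mul_of_nonneg_left (b.re_mul_m1c_im_le hτ h hw) (by positivity)
      _ = _ := by rw [hC₄]; ring

/-- The cubic at A is (Z - A²) times the denominator up to sign, and |Z - A²| ≤ 3 K³. -/
lemma div_le_norm_denom (hτ : 0 < τ) (h : Admissible τ σ z) (hw : 0 < w.im) {K q : ℝ}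
    (b : Bounded τ σ z w K) {s : ℝ} (hq : q ≤ ‖cubic s z (csqrt w) (rootA σ z w)‖) :
    q / (3 * K ^ 3) ≤ ‖denom σ z s w‖ := by
  have hK := b.one_le
  rw [div_le_iff₀ (by positivity), norm_denom, mul_comm]
  refine hq.trans ?_
  rw [cubic_root_eq hτ h hw, norm_mul]
  gcongr
  have hKK : K ≤ K ^ 3 := le_self_pow₀ hK (by norm_num)
  have h1 := b.Z_le hτ h
  have h2 : ‖rootA σ z w ^ 2‖ ≤ K ^ 3 := by
    have h3 : rootA σ z w ^ 2 = w * (1 + m1c σ z w) ^ 2 := by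
      rw [rootA, mul_pow, csqrt_sq]
    rw [h3, norm_mul, norm_pow]
    calc _ ≤ K * K ^ 2 := by
          have := b.norm_le
          have := b.norm_one_add_le
          gcongr
      _ = _ := by ring
  refine (norm_sub_le _ _).trans ?_
  rw [Complex.norm_real, Real.norm_of_nonneg (by positivity)]
  linarith

lemma sqrt_norm_bounds {e : ℝ} (hw : 0 < w.im) :
    √‖w - e‖ ≤ √(|w.re - e| + w.im) ∧ √(|w.re - e| + w.im) ≤ 2 * √‖w - e‖ ∧ 0 < √‖w - e‖ := by
  have hre : (w - e).re = w.re - e := by simp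
  have him : (w - e).im = w.im := by simp
  have h1 := Complex.abs_re_le_norm (w - e)
  have h2 := Complex.im_le_norm (w - e)
  have h3 := Complex.norm_le_abs_re_add_abs_im (w - e)
  rw [hre] at h1 h3
  rw [him] at h2 h3
  rw [abs_of_pos hw] at h3
  have h4 : 0 < ‖w - e‖ := hw.trans_le h2
  refine ⟨Real.sqrt_le_sqrt h3, ?_, Real.sqrt_pos.2 h4⟩
  apply Real.sqrt_le_iff.2 ⟨by positivity, ?_⟩
  rw [mul_pow, Real.sq_sqrt h4.le]
  linarith

end CircularLaw

/-! ### Conclusion at regular edges -/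

namespace CircularLaw

variable {τ : ℝ} {N : ℕ} {σ : Fin N → ℝ} {z w : ℂ}

lemma sqrt_mem_of_mem {V v : ℝ} (hV : 1 ≤ V) (h1 : V⁻¹ ≤ v) (h2 : v ≤ V) : V⁻¹ ≤ √v ∧ √v ≤ V := by
  have hV0 : 0 < V := by linarith
  have hv : 0 < v := (inv_pos.2 hV0).trans_le h1
  have hi : V⁻¹ ≤ 1 := inv_le_one_of_one_le₀ hV
  constructor
  · apply Real.le_sqrt_of_sq_le
    have : 0 < V⁻¹ := by positivity
    nlinarith
  · exact Real.sqrt_le_iff.2 ⟨hV0.le, by nlinarith⟩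

lemma Comparable.of_one {C D V x u : ℝ} (hC : 0 < C) (hV : 0 < V) (h : Comparable C x 1) (h1 : V⁻¹ ≤ u)
    (h2 : u ≤ V) (hD : C * V ≤ D) : Comparable D x u := by
  obtain ⟨h3, h4⟩ := h
  rw [mul_one] at h3 h4
  have hu : 0 < u := (inv_pos.2 hV).trans_le h1
  refine comparable_of (l := C⁻¹ * V⁻¹) (u := C * V) (by positivity) ?_ hD hu.le ?_ ?_
  · rwa [mul_inv, inv_inv, inv_inv]
  · calc C⁻¹ * V⁻¹ * u ≤ C⁻¹ * V⁻¹ * V := by gcongr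
      _ = C⁻¹ := by field_simp
      _ ≤ x := h3
  · calc x ≤ C := h4
      _ = C * V * V⁻¹ := by field_simp
      _ ≤ C * V * u := by gcongr

/-- The comparison function for `Im m` near an edge: `√(κ + η)` inside the support and
`η / √(κ + η)` outside. -/
lemma comparable_near_edge {L C₀ C b η d x₁ x₂ v u β t : ℝ} (hL : 1 ≤ L) (hC₀ : 1 ≤ C₀)
    (hC : 2 * L * C₀ ^ 2 ≤ C) (hη : 0 < η) (hd : 0 < d) (hdv : d ≤ v) (hvd : v ≤ 2 * d)
    (hin : β * t ≤ 0 → L⁻¹ * d ≤ b ∧ b ≤ L * d)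
    (hout : 0 ≤ β * t → L⁻¹ * (η / d) ≤ b ∧ b ≤ L * (η / d))
    (h1 : x₁ ≤ C₀ * b) (h2 : b ≤ C₀ * x₁) (h3 : x₂ ≤ C₀ * x₁) (h4 : x₁ ≤ C₀ * x₂)
    (hu : (β * t ≤ 0 ∧ u = v) ∨ (0 ≤ β * t ∧ u = η / v)) :
    Comparable C x₁ u ∧ Comparable C x₂ u := by
  have hL0 : 0 < L := by linarith
  have hC0 : 0 < C₀ := by linarith
  have hv : 0 < v := hd.trans_le hdv
  have key : 0 < u ∧ (2 * L)⁻¹ * u ≤ b ∧ b ≤ 2 * L * u := by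
    rcases hu with ⟨hs, rfl⟩ | ⟨hs, rfl⟩
    · obtain ⟨h5, h6⟩ := hin hs
      refine ⟨hv, le_trans ?_ h5, h6.trans ?_⟩
      · calc (2 * L)⁻¹ * u ≤ (2 * L)⁻¹ * (2 * d) := by gcongr
          _ = L⁻¹ * d := by field_simp
      · calc L * d ≤ L * u := by gcongr
          _ ≤ 2 * L * u := by nlinarith
    · obtain ⟨h5, h6⟩ := hout hs
      have h7 : 0 < η / v := by positivity
      refine ⟨h7, le_trans ?_ h5, h6.trans ?_⟩
      · have h8 : η / v ≤ η / d := by gcongr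
        gcongr
        linarith
      · calc L * (η / d) = 2 * L * (η / (2 * d)) := by field_simp
          _ ≤ 2 * L * (η / v) := by gcongr
  obtain ⟨hu0, h5, h6⟩ := key
  have hCC : C₀ ≤ C₀ ^ 2 := le_self_pow₀ hC₀ (by norm_num)
  have hb1 : C₀⁻¹ * b ≤ x₁ := by
    rw [inv_mul_le_iff₀ hC0]
    exact h2
  have hb2 : C₀⁻¹ * x₁ ≤ x₂ := by
    rw [inv_mul_le_iff₀ hC0]
    exact h4
  have hLC : 2 * L * C₀ ≤ 2 * L * C₀ ^ 2 := by gcongr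
  constructor
  · refine comparable_of (l := (2 * L * C₀)⁻¹) (u := 2 * L * C₀) (by positivity)
      (by rw [inv_inv]; exact hLC.trans hC) (hLC.trans hC) hu0.le ?_ ?_
    · calc (2 * L * C₀)⁻¹ * u = C₀⁻¹ * ((2 * L)⁻¹ * u) := by rw [mul_inv]; ring
        _ ≤ C₀⁻¹ * b := by gcongr
        _ ≤ x₁ := hb1
    · calc x₁ ≤ C₀ * b := h1
        _ ≤ C₀ * (2 * L * u) := by gcongr
        _ = _ := by ring
  · refine comparable_of (l := (2 * L * C₀ ^ 2)⁻¹) (u := 2 * L * C₀ ^ 2) (by positivity)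
      (by rwa [inv_inv]) hC hu0.le ?_ ?_
    · calc (2 * L * C₀ ^ 2)⁻¹ * u = C₀⁻¹ * (C₀⁻¹ * ((2 * L)⁻¹ * u)) := by
            field_simp
        _ ≤ C₀⁻¹ * (C₀⁻¹ * b) := by gcongr
        _ ≤ C₀⁻¹ * x₁ := by gcongr
        _ ≤ x₂ := hb2
    · calc x₂ ≤ C₀ * x₁ := h3
        _ ≤ C₀ * (C₀ * b) := by gcongr
        _ ≤ C₀ * (C₀ * (2 * L * u)) := by gcongr
        _ = _ := by ring

/-- Regular edges. -/
theorem regular_edge {τ : ℝ} (hτ : 0 < τ) (ε : ℝ) (hε : 0 < ε) :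
    ∃ τ₀ : ℝ, 0 < τ₀ ∧ ∀ τ' : ℝ, 0 < τ' → τ' ≤ τ₀ →
      ∃ c : ℝ, 0 < c ∧ ∀ ζ : ℝ, 0 < ζ → ∃ C : ℝ, 0 < C ∧
        ∀ (N : ℕ) (σ : Fin N → ℝ) (z : ℂ), Admissible τ σ z →
        ∀ e : ℝ, IsRegularEdge ε σ z e →
        ∀ w ∈ domEdge ζ τ' σ z e,
          (w.re ∈ supp1 σ z →
            Comparable C (m1c σ z w).im (Real.sqrt (kappa σ z w.re + w.im))) ∧
          (w.re ∉ supp1 σ z →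
            Comparable C (m1c σ z w).im (w.im / Real.sqrt (kappa σ z w.re + w.im))) ∧
          (w.re ∈ supp2 σ z →
            Comparable C (m2c σ z w).im (Real.sqrt (kappa σ z w.re + w.im))) ∧
          (w.re ∉ supp2 σ z →
            Comparable C (m2c σ z w).im (w.im / Real.sqrt (kappa σ z w.re + w.im))) ∧
          Comparable C ‖1 + m1c σ z w‖ 1 ∧ Comparable C ‖m2c σ z w‖ 1 ∧
          ∀ i, c ≤ ‖denom σ z (σ i) w‖ := by
  obtain ⟨a, δ, L, ha, hδ, hδa, hL, Hexp⟩ := edge_expansion hτ hε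
  have hL0 : 0 < L := by linarith
  have hτ' : 0 < τ⁻¹ := by positivity
  have hτ2 : 0 < 200 / τ := by positivity
  -- K₁ bounds the data within distance δ of any regular edge without reference to ζ, so c may
  -- depend on it; the constant K below involves ζ and enters only C.
  obtain ⟨K₁, hK₁⟩ : ∃ K, K = 1 + τ⁻¹ + (200 / τ + δ) + 4 / τ ^ 2 * (1 + (√(a / 2))⁻¹) := ⟨_, rfl⟩
  have hK₁0 : 0 < K₁ := by
    have : 0 ≤ 4 / τ ^ 2 * (1 + (√(a / 2))⁻¹) := by positivity
    linarith
  refine ⟨δ / 2, by positivity, fun τ' _ hτδ => ⟨min (L⁻¹ / (3 * K₁ ^ 3)) (δ / 4),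
    lt_min (by positivity) (by positivity), fun ζ hζ => ?_⟩⟩
  obtain ⟨K, hK⟩ : ∃ K, K = 1 + τ⁻¹ + 2 * ζ⁻¹ + 4 / τ ^ 2 * (1 + (√(a / 2))⁻¹) := ⟨_, rfl⟩
  have hζ' : 0 < ζ⁻¹ := by positivity
  have hK1 : 1 ≤ K := by
    have : 0 ≤ 4 / τ ^ 2 * (1 + (√(a / 2))⁻¹) := by positivity
    linarith
  obtain ⟨C₀, hC₀, Him⟩ := im_le_im_rootA hτ (a := a / 2) (by positivity) hK1
  obtain ⟨V, hV⟩ : ∃ V, V = 1 + (δ / 2)⁻¹ + δ / 2 + ζ⁻¹ := ⟨_, rfl⟩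
  have hδ2 : 0 < (δ / 2)⁻¹ := by positivity
  have hV1 : 1 ≤ V := by linarith
  obtain ⟨C₁, hC₁⟩ : ∃ C, C = 36 * K ^ 8 * (1 + (δ / 2)⁻¹) := ⟨_, rfl⟩
  have hC₁0 : 0 < C₁ := by rw [hC₁]; positivity
  have hK8 : 0 < 36 * K ^ 8 := by positivity
  have hp1 : 0 < C₁ * V ^ 2 := by positivity
  have hp2 : 0 < 2 * L * C₀ ^ 2 := by positivity
  obtain ⟨C, hC⟩ : ∃ C, C = 36 * K ^ 8 + C₁ * V ^ 2 + 2 * L * C₀ ^ 2 := ⟨_, rfl⟩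
  refine ⟨C, by linarith, fun N σ z h e he w ⟨⟨hw, _, hreζ, _, himζ⟩, hwe⟩ => ?_⟩
  obtain ⟨hae, heM, β, hβ, hexp⟩ := Hexp N σ z h e he
  have hwe' : |w.re - e| ≤ δ / 2 := hwe.trans hτδ
  have hwre : a / 2 ≤ w.re := by linarith [(abs_le.1 hwe').1]
  have hwre0 : 0 < w.re := by linarith
  have hwn : a / 2 ≤ ‖w‖ := hwre.trans (Complex.re_le_norm w)
  have hwn' : ‖w‖ ≤ 2 * ζ⁻¹ := by
    have := Complex.norm_le_abs_re_add_abs_im w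
    rw [abs_of_pos hwre0, abs_of_pos hw] at this
    linarith
  have b := bounded_of_le hτ h hw (c := a / 2) (by positivity) hwn hwn'
  rw [← hK] at b
  have hxpos : ∀ x : ℝ, |x - e| < δ → 0 < x := by
    intro x hx
    linarith [(abs_lt.1 hx).1]
  obtain ⟨hsupp, hkappa⟩ := support_near_edge hβ he.edge (by linarith)
    (fun x hx hneg => rho1c_ne_zero_of_sqrt_le hτ h hL0
      (fun v hv hve hb => ((hexp v hv hve).2.1 hb).1) (hxpos x hx) hx hneg)
    (fun x hx hpos => rho1c_eq_zero_of_le_div hτ h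
      (fun v hv hve hb => ((hexp v hv hve).2.2 hb).2) (hxpos x hx) hx hpos) hwe' hδ
  rw [mem_supp2_iff hτ h hwre0, hsupp, hkappa]
  obtain ⟨hn1, hn2⟩ := b.comparable_norm hτ h hw (by linarith : 36 * K ^ 8 ≤ C)
  have hfar : δ ≤ ‖w - e‖ → δ / 2 ≤ w.im := by
    intro hd
    have := Complex.norm_le_abs_re_add_abs_im (w - e)
    rw [Complex.sub_re, Complex.sub_im, Complex.ofReal_re, Complex.ofReal_im, sub_zero,
      abs_of_pos hw] at this
    linarith
  have hmain : ∀ u : ℝ, ((β * (w.re - e) ≤ 0 ∧ u = √(|w.re - e| + w.im)) ∨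
      (0 ≤ β * (w.re - e) ∧ u = w.im / √(|w.re - e| + w.im))) →
      Comparable C (m1c σ z w).im u ∧ Comparable C (m2c σ z w).im u := by
    intro u hu
    -- Within distance δ of e the expansion applies. Beyond it η ≥ δ/2, and all the compared
    -- quantities are of order one.
    rcases lt_or_ge ‖w - e‖ δ with hd | hd
    · obtain ⟨-, h1, h2⟩ := hexp w hw hd
      obtain ⟨h3, h4, h5, h6⟩ := Him N σ z w h hw hwre b
      obtain ⟨h7, h8, h9⟩ := sqrt_norm_bounds (e := e) hw
      exact comparable_near_edge hL hC₀ (by linarith) hw h9 h7 h8 h1 h2 h3 h4 h5 h6 hu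
    · have hη := hfar hd
      obtain ⟨h1, h2⟩ := b.comparable_im hτ h hw (by positivity) hη hC₁.ge
      have hV0 : 0 < V := by linarith
      have hVδ : V⁻¹ ≤ δ / 2 := by
        rw [inv_le_comm₀ hV0 (by positivity)]
        linarith
      obtain ⟨h3, h4⟩ := sqrt_mem_of_mem (v := |w.re - e| + w.im) hV1
        (by linarith [abs_nonneg (w.re - e)]) (by linarith)
      have hs0 : 0 < √(|w.re - e| + w.im) := (inv_pos.2 hV0).trans_le h3
      have hVV : V ≤ V ^ 2 := le_self_pow₀ hV1 (by norm_num)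
      have hu' : (V ^ 2)⁻¹ ≤ u ∧ u ≤ V ^ 2 := by
        rcases hu with ⟨-, rfl⟩ | ⟨-, rfl⟩
        · exact ⟨le_trans (by gcongr) h3, h4.trans hVV⟩
        · constructor
          · rw [le_div_iff₀ hs0]
            calc (V ^ 2)⁻¹ * √(|w.re - e| + w.im) ≤ (V ^ 2)⁻¹ * V := by gcongr
              _ = V⁻¹ := by field_simp
              _ ≤ w.im := hVδ.trans hη
          · rw [div_le_iff₀ hs0]
            calc w.im ≤ V := by linarith
              _ = V ^ 2 * V⁻¹ := by field_simp
              _ ≤ V ^ 2 * √(|w.re - e| + w.im) := by gcongr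
      have hV20 : 0 < V ^ 2 := by positivity
      exact ⟨h1.of_one hC₁0 hV20 hu'.1 hu'.2 (by linarith),
        h2.of_one hC₁0 hV20 hu'.1 hu'.2 (by linarith)⟩
  refine ⟨fun hs => (hmain _ (Or.inl ⟨hs, rfl⟩)).1,
    fun hs => (hmain _ (Or.inr ⟨(not_le.1 hs).le, rfl⟩)).1,
    fun hs => (hmain _ (Or.inl ⟨hs, rfl⟩)).2,
    fun hs => (hmain _ (Or.inr ⟨(not_le.1 hs).le, rfl⟩)).2, hn1, hn2, fun i => ?_⟩
  rcases lt_or_ge ‖w - e‖ δ with hd | hd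
  · have hwM : ‖w‖ ≤ 200 / τ + δ := by
      have h1 := norm_sub_norm_le w e
      rw [Complex.norm_real, Real.norm_of_nonneg (by linarith)] at h1
      linarith
    have b₁ := bounded_of_le hτ h hw (c := a / 2) (by positivity) hwn hwM
    rw [← hK₁] at b₁
    exact (min_le_left _ _).trans (div_le_norm_denom hτ h hw b₁ ((hexp w hw hd).1 i))
  · refine (min_le_right _ _).trans (le_trans ?_ (half_im_le_norm_denom hτ h hw i))
    linarith [hfar hd]

end CircularLaw

open CircularLaw
theorem lemma3p5 (τ : ℝ) (hτ : 0 < τ) :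
    -- Case 1: regular bulk component
    (∀ τ' : ℝ, 0 < τ' → ∀ g : ℝ → ℝ, (∀ δ : ℝ, 0 < δ → 0 < g δ) →
      ∃ c : ℝ, 0 < c ∧ ∀ ζ : ℝ, 0 < ζ → ∃ C : ℝ, 0 < C ∧
        ∀ (N : ℕ) (σ : Fin N → ℝ) (z : ℂ), Admissible τ σ z →
        ∀ a b : ℝ, IsBulkComponent σ z a b → IsRegularBulk g σ z a b →
        ∀ w ∈ domBulk ζ τ' σ z a b,
          Comparable C ‖1 + m1c σ z w‖ 1 ∧ Comparable C (m1c σ z w).im 1 ∧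
          Comparable C ‖m2c σ z w‖ 1 ∧ Comparable C (m2c σ z w).im 1 ∧
          ∀ i, c ≤ ‖denom σ z (σ i) w‖) ∧
    -- Case 2: outside the support
    (∀ τ' : ℝ, 0 < τ' →
      ∃ c : ℝ, 0 < c ∧ ∀ ζ : ℝ, 0 < ζ → ∃ C : ℝ, 0 < C ∧
        ∀ (N : ℕ) (σ : Fin N → ℝ) (z : ℂ), Admissible τ σ z →
        ∀ w ∈ domOut ζ τ' σ z,
          Comparable C (m1c σ z w).im w.im ∧ Comparable C (m2c σ z w).im w.im ∧
          Comparable C ‖1 + m1c σ z w‖ 1 ∧ Comparable C ‖m2c σ z w‖ 1 ∧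
          ∀ i, c ≤ ‖denom σ z (σ i) w‖) ∧
    -- Case 3: near a nonzero regular edge
    (∀ ε : ℝ, 0 < ε → ∃ τ₀ : ℝ, 0 < τ₀ ∧ ∀ τ' : ℝ, 0 < τ' → τ' ≤ τ₀ →
      ∃ c : ℝ, 0 < c ∧ ∀ ζ : ℝ, 0 < ζ → ∃ C : ℝ, 0 < C ∧
        ∀ (N : ℕ) (σ : Fin N → ℝ) (z : ℂ), Admissible τ σ z →
        ∀ e : ℝ, IsRegularEdge ε σ z e →
        ∀ w ∈ domEdge ζ τ' σ z e,
          (w.re ∈ supp1 σ z →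
            Comparable C (m1c σ z w).im (Real.sqrt (kappa σ z w.re + w.im))) ∧
          (w.re ∉ supp1 σ z →
            Comparable C (m1c σ z w).im (w.im / Real.sqrt (kappa σ z w.re + w.im))) ∧
          (w.re ∈ supp2 σ z →
            Comparable C (m2c σ z w).im (Real.sqrt (kappa σ z w.re + w.im))) ∧
          (w.re ∉ supp2 σ z →
            Comparable C (m2c σ z w).im (w.im / Real.sqrt (kappa σ z w.re + w.im))) ∧
          Comparable C ‖1 + m1c σ z w‖ 1 ∧ Comparable C ‖m2c σ z w‖ 1 ∧
          ∀ i, c ≤ ‖denom σ z (σ i) w‖) ∧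
    -- Case 4: near the edge at zero, for `|z|² ≤ 1 - τ`
    (∃ τ₀ : ℝ, 0 < τ₀ ∧ ∀ τ' : ℝ, 0 < τ' → τ' ≤ τ₀ →
      ∃ c : ℝ, 0 < c ∧ ∀ ζ : ℝ, 0 < ζ → ∃ C : ℝ, 0 < C ∧
        ∀ (N : ℕ) (σ : Fin N → ℝ) (z : ℂ), Admissible τ σ z → ‖z‖ ^ 2 ≤ 1 - τ →
        ∃ t : ℝ, 0 < t ∧ Comparable C t 1 ∧
        ∀ w ∈ domEdge ζ τ' σ z 0,
          (τ' ≤ w.im →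
            Comparable C ‖1 + m1c σ z w‖ 1 ∧ Comparable C (m1c σ z w).im 1 ∧
            Comparable C ‖m2c σ z w‖ 1 ∧ Comparable C (m2c σ z w).im 1) ∧
          (‖w‖ ≤ 2 * τ' →
            ‖m1c σ z w - Complex.I * (Real.sqrt t : ℂ) / csqrt w‖ ≤ C ∧
            ‖m2c σ z w -
              Complex.I * (Real.sqrt t : ℂ) / (csqrt w * ((t : ℂ) + (‖z‖ : ℂ) ^ 2))‖ ≤ C ∧
            Comparable C (m1c σ z w).im (‖w‖ ^ (-(1 / 2 : ℝ))) ∧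
            Comparable C (m2c σ z w).im (‖w‖ ^ (-(1 / 2 : ℝ)))) ∧
          ∀ i, c ≤ ‖denom σ z (σ i) w‖) ∧
    -- Case 5: large `η`
    (∀ ζ : ℝ, 0 < ζ → ∃ C : ℝ, 0 < C ∧
        ∀ (N : ℕ) (σ : Fin N → ℝ) (z : ℂ), Admissible τ σ z →
        ∀ w ∈ domLarge ζ,
          Comparable C ‖m1c σ z w‖ (1 / w.im) ∧ Comparable C (m1c σ z w).im (1 / w.im) ∧
          Comparable C ‖m2c σ z w‖ (1 / w.im) ∧ Comparable C (m2c σ z w).im (1 / w.im)) ∧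
    (∃ ζ₀ : ℝ, 0 < ζ₀ ∧ ∀ ζ : ℝ, 0 < ζ → ζ ≤ ζ₀ →
        ∀ (N : ℕ) (σ : Fin N → ℝ) (z : ℂ), Admissible τ σ z →
        ∀ w ∈ domLarge ζ, ∀ i, w.im ≤ ‖denom σ z (σ i) w‖) := by
  exact ⟨bulk hτ, outside hτ, regular_edge hτ, zero_edge hτ, large_eta hτ, large_eta_denom hτ⟩
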